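/- Throughout, manifolds and submanifolds are smooth and need not be connected. An asymptotically cylindrical manifold is a complete Riemannian manifold $(M,g)$ together with a compact set $K\subseteq M$, a closed Riemannian manifold $(N,h)$ (the cross-section) and a diffeomorphism $\Psi\colon(0,\infty)\times N\to M\setminus K$ such that $\Psi^*g-(dt^2+h)$ and all its covariant derivatives are $O(e^{-\delta t})$ for some $\delta>0$; a differential form on $M$ is asymptotically cylindrical if its pullback by $\Psi$ converges in the same sense to a translation-invariant form. A submanifold $X\subseteq M$ is asymptotically cylindrical with asymptotic limit $(0,\infty)\times Z$, where $Z\subseteq N$ is a closed submanifold, if it is complete and its end (the complement of a compact subset of $X$; also the part of the end with bounded $t$ is to be relatively compact in $X$) is parametrised by $(t,y)\mapsto\Psi(t,w_t(y))$ on $(R,\infty)\times Z$ for some $R\ge 0$, where $w_t\colon Z\to N$ converges to the inclusion with all derivatives at an exponential rate. For $\varepsilon>0$, an ($\varepsilon$-small) asymptotically cylindrical local deformation $Y$ of $X$ with the same asymptotic limit is an asymptotically cylindrical submanifold $Y=f(X)$, with the same $Z$, where $f\colon X\to M$ is an embedding that is joined to the inclusion by a smooth family $(F_\tau)_{\tau\in[0,1]}$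 of maps $X\to M$ whose velocity field has $C^1$-norm at most $\varepsilon$ and decays in $C^1$ at an exponential rate along the end (for example $F_\tau=\exp(\tau s)$, where $s$ is a $C^1$-small, exponentially decaying section of the normal bundle of $X$). The moduli space of $\varepsilon$-small local deformations of $X$ of a given kind is the set of all such submanifolds $Y$ of that kind. A submanifold $X$ is said to be calibrated by a form $\varphi$ if $\varphi|_X=\mathrm{vol}_X$ for some orientation of $X$. Let $M$ be an asymptotically cylindrical Calabi--Yau $4$-fold with asymptotically cylindrical Kähler form $\omega$ and holomorphic volume form $\Omega$, normalised by $\omega^4=\frac32\,\Omega\wedge\bar\Omega$, and let $\Phi=-\frac12\omega\wedge\omega+\operatorname{Re}\Omega$ be the induced $\mathrm{Spin}(7)$-structure. A $4$-dimensional submanifold of $M$ is Cayley if it is calibrated by $\Phi$, and special Lagrangian if it is calibrated by $\operatorname{Re}\Omega$. Let $\tilde M$ be an asymptotically cylindrical $7$-manifold with an asymptotically cylindrical torsion-free $G_2$-structure $\tilde\varphi$ with Hodge dual $\tilde\psi$. A submanifold of $\tilde M$ is associative (of dimension $3$) if it is calibrated by $\tilde\varphi$, and coassociative (of dimension $4$)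 if it is calibrated by $\tilde\psi$; a $4$-dimensional submanifold of $S^1\times\tilde M$ is Cayley if it is calibrated by $\Phi=d\theta\wedge\tilde\varphi+\tilde\psi$, with respect to the product metric. Proposition. (1) Let $X$ be an asymptotically cylindrical special Lagrangian submanifold of $M$. Then there is $\varepsilon_0>0$ such that for every $0<\varepsilon\le\varepsilon_0$, every $\varepsilon$-small asymptotically cylindrical local deformation of $X$ with the same asymptotic limit which is Cayley is special Lagrangian, and the moduli space of all $\varepsilon$-small local deformations of $X$ as an asymptotically cylindrical Cayley submanifold with the same asymptotic limit is equal to the moduli space of all $\varepsilon$-small local deformations of $X$ as an asymptotically cylindrical special Lagrangian submanifold with the same asymptotic limit. (2) The same holds with "special Lagrangian submanifold" replaced by "complex surface". (3) Let $\tilde X$ be an asymptotically cylindrical coassociative submanifold of $\tilde M$ without closed (that is, compact) connected components, and let $X=\{1\}\times\tilde X\subseteq S^1\times\tilde M$. Then there is $\varepsilon_0>0$ such that for every $0<\varepsilon\le\varepsilon_0$, every $\varepsilon$-small asymptotically cylindrical local deformation of $X$ with the same asymptotic limit which is Cayley is of the form $\{1\}\times\tilde Y$ for some asymptotically cylindrical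 coassociative submanifold $\tilde Y$ of $\tilde M$; and $\tilde Y\mapsto\{1\}\times\tilde Y$ identifies the moduli space of all $\varepsilon$-small local deformations of $\tilde X$ as an asymptotically cylindrical coassociative submanifold of $\tilde M$ with the same asymptotic limit with the moduli space of all $\varepsilon$-small local deformations of $X$ as an asymptotically cylindrical Cayley submanifold of $S^1\times\tilde M$ with the same asymptotic limit. (4) Let $\tilde X$ be an asymptotically cylindrical associative submanifold of $\tilde M$, and let $X=S^1\times\tilde X\subseteq S^1\times\tilde M$. Then there is $\varepsilon_0>0$ such that for every $0<\varepsilon\le\varepsilon_0$, every $\varepsilon$-small asymptotically cylindrical local deformation of $X$ with the same asymptotic limit which is Cayley is of the form $S^1\times\tilde Y$ for some asymptotically cylindrical associative submanifold $\tilde Y$ of $\tilde M$; and $\tilde Y\mapsto S^1\times\tilde Y$ identifies the moduli space of all $\varepsilon$-small local deformations of $\tilde X$ as an asymptotically cylindrical associative submanifold of $\tilde M$ with the same asymptotic limit with the moduli space of all $\varepsilon$-small local deformations of $X$ as an asymptotically cylindrical Cayley submanifold of $S^1\times\tilde M$ with the same asymptotic limit. -/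

import Mathlib

open Set Filter Topology Asymptotics
open scoped Manifold ContDiff

noncomputable section

namespace ACyl

/-! ### Riemannian metrics and differential forms on manifolds -/

section Basic

variable {E : Type*} [NormedAddCommGroup E] [NormedSpace ℝ E]
  {H : Type*} [TopologicalSpace H] (I : ModelWithCorners ℝ E H)
  (M : Type*) [TopologicalSpace M] [ChartedSpace H M]

/-- Smooth Riemannian metrics on `M`. -/
abbrev SmoothMetric [IsManifold I ∞ M] : Type _ :=
  Bundle.ContMDiffRiemannianMetric I ∞ E (fun x : M => TangentSpace I x)

/-- A field of real-valued functions of two tangent vectors (used for metrics). -/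
abbrev MetricField : Type _ := ∀ x : M, TangentSpace I x → TangentSpace I x → ℝ

/-- A field of `F`-valued functions of `k` tangent vectors (used for the values of covariant
tensors and of differential forms). -/
abbrev TensorField (k : ℕ) (F : Type*) : Type _ := ∀ x : M, (Fin k → TangentSpace I x) → F

/-- `F`-valued differential `k`-forms on `M` (not necessarily smooth). -/
abbrev DForm (k : ℕ) (F : Type*) [NormedAddCommGroup F] [NormedSpace ℝ F] : Type _ :=
  ∀ x : M, TangentSpace I x [⋀^Fin k]→L[ℝ] F

variable {I M}

/-- The scalar product of a smooth Riemannian metric. -/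
def SmoothMetric.field [IsManifold I ∞ M] (g : SmoothMetric I M) : MetricField I M :=
  fun x u v => g.inner x u v

/-- A metric, seen as a covariant 2-tensor. -/
def MetricField.toTensor (g : MetricField I M) : TensorField I M 2 ℝ := fun x u => g x (u 0) (u 1)

/-- The values of a differential form. -/
def DForm.field {k : ℕ} {F : Type*} [NormedAddCommGroup F] [NormedSpace ℝ F]
    (φ : DForm I M k F) : TensorField I M k F := fun x u => φ x u

/-- The expression of a differential form in the preferred chart around `p`. -/
def DForm.inChart {k : ℕ} {F : Type*} [NormedAddCommGroup F] [NormedSpace ℝ F]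
    (φ : DForm I M k F) (p : M) : E → E [⋀^Fin k]→L[ℝ] F := fun z =>
  (φ ((extChartAt I p).symm z)).compContinuousLinearMap
    (mfderiv 𝓘(ℝ, E) I (extChartAt I p).symm z)

/-- A smooth differential form. -/
def DForm.IsSmooth {k : ℕ} {F : Type*} [NormedAddCommGroup F] [NormedSpace ℝ F]
    (φ : DForm I M k F) : Prop :=
  ∀ p : M, ContDiffOn ℝ ∞ (φ.inChart p) (extChartAt I p).target

/-- A closed differential form: the exterior derivative vanishes in all charts. -/
def DForm.IsClosed {k : ℕ} {F : Type*} [NormedAddCommGroup F] [NormedSpace ℝ F]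
    (φ : DForm I M k F) : Prop :=
  ∀ p : M, ∀ z ∈ (extChartAt I p).target, extDeriv (φ.inChart p) z = 0

end Basic

/-! ### Maps between manifolds -/

section Maps

variable {E : Type*} [NormedAddCommGroup E] [NormedSpace ℝ E]
  {H : Type*} [TopologicalSpace H] (I : ModelWithCorners ℝ E H)
  {M : Type*} [TopologicalSpace M] [ChartedSpace H M]
  {E' : Type*} [NormedAddCommGroup E'] [NormedSpace ℝ E']
  {H' : Type*} [TopologicalSpace H'] (I' : ModelWithCorners ℝ E' H')
  {X : Type*} [TopologicalSpace X] [ChartedSpace H' X]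

/-- Smooth embeddings `X → M` of finite-dimensional manifolds: smooth immersions which are
homeomorphisms onto their image. Submanifolds of `M` are the images of smooth embeddings. -/
structure IsSmoothEmb (f : X → M) : Prop where
  smooth : ContMDiff I' I ∞ f
  immersion : ∀ x : X, Function.Injective (mfderiv I' I f x)
  embedding : IsEmbedding f

/-- `α` restricts to a diffeomorphism of the open set `S` onto the open set `T`: it is smooth and
bijective, and its differential is invertible at all points of `S`. -/
def IsDiffeoOn (α : X → M) (S : Set X) (T : Set M) : Prop :=
  ContMDiffOn I' I ∞ α S ∧ BijOn α S T ∧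
    ∀ x ∈ S, Function.Bijective (mfderiv I' I α x)

variable {I I'}

/-- The metric `f^* g` is complete on `X`: sequences in `X` that are Cauchy for the distance given
by the infimum of the `g`-lengths of the images of `C^1` curves in `X` converge in `X`. -/
def IsCompleteAlong (I' : ModelWithCorners ℝ E' H') (g : MetricField I M) (f : X → M) : Prop :=
  ∀ u : ℕ → X,
    (∀ ε : ℝ, 0 < ε → ∃ n₀ : ℕ, ∀ m n : ℕ, n₀ ≤ m → n₀ ≤ n →
      ∃ γ : ℝ → X, ContMDiff 𝓘(ℝ, ℝ) I' 1 γ ∧ γ 0 = u m ∧ γ 1 = u n ∧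
        (∫ s in (0 : ℝ)..1, √(g (f (γ s))
          (mfderiv I' I f (γ s) (mfderiv 𝓘(ℝ, ℝ) I' γ s (1 : ℝ)))
          (mfderiv I' I f (γ s) (mfderiv 𝓘(ℝ, ℝ) I' γ s (1 : ℝ))))) < ε) →
    ∃ x : X, Tendsto u atTop (𝓝 x)

/-- The submanifold `f : X → M`, of dimension `k`, is calibrated by the `k`-form `φ` on `(M, g)`,
that is, `φ|_X = vol_X` for some orientation of `X`. The Riemannian volume forms of `(X, f^* g)`
for the various orientations are exactly the continuous `k`-forms `ν` on `X` such that
`ν(u₁, …, u_k)^2` is the Gram determinant of `u₁, …, u_k` for all tangent vectors `u₁, …, u_k`;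
this is the condition imposed on `f^* φ`. -/
def IsCalibratedBy (I' : ModelWithCorners ℝ E' H') (g : MetricField I M) {k : ℕ}
    (φ : TensorField I M k ℝ) (f : X → M) : Prop :=
  ∀ (x : X) (u : Fin k → TangentSpace I' x),
    φ (f x) (fun i => mfderiv I' I f x (u i)) ^ 2 =
      Matrix.det (Matrix.of fun i j : Fin k =>
        g (f x) (mfderiv I' I f x (u i)) (mfderiv I' I f x (u j)))

/-- The Gram function of the metric `g` in the preferred chart around `p`. -/
def MetricField.inChart (g : MetricField I M) (p : M) (z a b : E) : ℝ :=
  g ((extChartAt I p).symm z)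
    (mfderiv 𝓘(ℝ, E) I (extChartAt I p).symm z a)
    (mfderiv 𝓘(ℝ, E) I (extChartAt I p).symm z b)

/-- For a smooth family of maps `F τ : X → M` with velocity field `V = ∂F/∂τ` along `F τ`, the
condition `|V| ≤ r` and `|∇_u V| ≤ r |u|` for all `u ∈ T_x X`, at the time `τ` and the point `x`.
Here `∇` is the Levi-Civita connection of `g`, and `|u|` is measured with respect to `ι^* g`.

In the chart around `F τ x`, the letters `a`, `b`, `c` stand for `V`, `dF(u)`, and the derivative
of (the chart expression of) `V` in direction `u`, so that `g(∇_u V, w)` is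
`g(c, w) + ½ ((D_b g)(a, w) + (D_a g)(b, w) - (D_w g)(a, b))`. -/
def VelocityC1Le (I' : ModelWithCorners ℝ E' H') (g : MetricField I M) (ι : X → M)
    (F : ℝ → X → M) (τ : ℝ) (x : X) (r : ℝ) : Prop :=
  let p : M := F τ x
  let e := extChartAt I p
  let G : E → E → E → ℝ := g.inChart p
  let a : E := deriv (fun σ => e (F σ x)) τ
  G (e p) a a ≤ r ^ 2 ∧
  ∀ (u : TangentSpace I' x) (w : E),
    let b : E := mfderiv I' 𝓘(ℝ, E) (fun y => e (F τ y)) x u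
    let c : E := mfderiv I' 𝓘(ℝ, E) (fun y => deriv (fun σ => e (F σ y)) τ) x u
    |G (e p) c w + (1 / 2) * (fderiv ℝ (fun z => G z a w) (e p) b
        + fderiv ℝ (fun z => G z b w) (e p) a - fderiv ℝ (fun z => G z a b) (e p) w)| ≤
      r * √(g (ι x) (mfderiv I' I ι x u) (mfderiv I' I ι x u)) * √(G (e p) w w)

end Maps

/-! ### Asymptotically cylindrical manifolds and submanifolds -/

section Cylinders

variable {E : Type*} [NormedAddCommGroup E] [NormedSpace ℝ E]
  {H : Type*} [TopologicalSpace H] {I : ModelWithCorners ℝ E H}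
  {M : Type*} [TopologicalSpace M] [ChartedSpace H M]
  {EN : Type*} [NormedAddCommGroup EN] [NormedSpace ℝ EN]
  {HN : Type*} [TopologicalSpace HN] {J : ModelWithCorners ℝ EN HN}
  {N : Type*} [TopologicalSpace N] [ChartedSpace HN N]
  {EX : Type*} [NormedAddCommGroup EX] [NormedSpace ℝ EX]
  {HX : Type*} [TopologicalSpace HX] {IX : ModelWithCorners ℝ EX HX}
  {X : Type*} [TopologicalSpace X] [ChartedSpace HX X]
  {EZ : Type*} [NormedAddCommGroup EZ] [NormedSpace ℝ EZ]
  {HZ : Type*} [TopologicalSpace HZ] {IZ : ModelWithCorners ℝ EZ HZ}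
  {Z : Type*} [TopologicalSpace Z] [ChartedSpace HZ Z]

/-- `D` and all its derivatives are `O(exp (-δ t))` as `t → ∞`, uniformly for `y ∈ C`. -/
def ExpDecayOn {EZ : Type*} [NormedAddCommGroup EZ] [NormedSpace ℝ EZ]
    {F : Type*} [NormedAddCommGroup F] [NormedSpace ℝ F]
    (D : ℝ × EZ → F) (C : Set EZ) (δ : ℝ) : Prop :=
  ∀ k : ℕ, (fun z : ℝ × EZ => iteratedFDeriv ℝ k D z) =O[atTop ×ˢ 𝓟 C]
    fun z : ℝ × EZ => Real.exp (-δ * z.1)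

/-- A translation-invariant covariant `k`-tensor on the cylinder `ℝ × N`, given at the points
`(t, y)` independently of `t`. -/
abbrev CylTensor (J : ModelWithCorners ℝ EN HN) (N : Type*) [TopologicalSpace N]
    [ChartedSpace HN N] (k : ℕ) (F : Type*) : Type _ :=
  ∀ y : N, (Fin k → ℝ × TangentSpace J y) → F

/-- The components of a translation-invariant tensor on `ℝ × N` in the preferred chart around
`q`. -/
def CylTensor.comp {k : ℕ} {F : Type*} (S : CylTensor J N k F) (q : N) (u : Fin k → ℝ × EN)
    (z : EN) : F :=
  S ((extChartAt J q).symm z)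
    (fun i => ((u i).1, mfderiv 𝓘(ℝ, EN) J (extChartAt J q).symm z (u i).2))

/-- The map `Ψ`, defined on the cylinder over `N`, in the preferred chart of `N` around `q`. -/
def endInChart (J : ModelWithCorners ℝ EN HN) (Ψ : ℝ × N → M) (q : N) : ℝ × EN → M :=
  fun z => Ψ (z.1, (extChartAt J q).symm z.2)

/-- The components of the pullback `Ψ^* T` in the preferred chart of `N` around `q`. -/
def pullbackComp (J : ModelWithCorners ℝ EN HN) (Ψ : ℝ × N → M) {k : ℕ} {F : Type*}
    (T : TensorField I M k F) (q : N) (u : Fin k → ℝ × EN) (z : ℝ × EN) : F :=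
  T (endInChart J Ψ q z) (fun i => mfderiv 𝓘(ℝ, ℝ × EN) I (endInChart J Ψ q) z (u i))

/-- `Ψ^* T - S` and all its derivatives are `O(exp (-δ t))` for some `δ > 0`. As `N` is compact,
this may be expressed by the components with respect to charts of `N` over compact subsets. -/
def IsAsymptoticTo (Ψ : ℝ × N → M) {k : ℕ} {F : Type*} [NormedAddCommGroup F] [NormedSpace ℝ F]
    (T : TensorField I M k F) (S : CylTensor J N k F) : Prop :=
  ∃ δ : ℝ, 0 < δ ∧ ∀ (q : N) (C : Set EN), IsCompact C → C ⊆ (extChartAt J q).target →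
    ∀ u : Fin k → ℝ × EN,
      ExpDecayOn (fun z => pullbackComp J Ψ T q u z - S.comp q u z.2) C δ

/-- The product metric `dt^2 + h` on the cylinder over `(N, h)`. -/
def cylMetric (h : MetricField J N) : CylTensor J N 2 ℝ :=
  fun y u => (u 0).1 * (u 1).1 + h y (u 0).2 (u 1).2

/-- `(M, g)` is a complete Riemannian manifold which is asymptotically cylindrical with
cross-section `(N, h)` (a closed Riemannian manifold): outside of a compact subset it is identified
with `(0, ∞) × N` by `Ψ`, and `Ψ^* g` converges to `dt^2 + h` with all derivatives at an
exponential rate. Only the values of `Ψ` on `(0, ∞) × N` matter. -/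
structure IsACylManifold [IsManifold I ∞ M] [IsManifold J ∞ N]
    (g : SmoothMetric I M) (h : SmoothMetric J N) (Ψ : ℝ × N → M) : Prop where
  complete : IsCompleteAlong I g.field (id : M → M)
  diffeo : ∃ K : Set M, IsCompact K ∧
    IsDiffeoOn I (𝓘(ℝ, ℝ).prod J) Ψ (Ioi (0 : ℝ) ×ˢ univ) Kᶜ
  metric : IsAsymptoticTo Ψ g.field.toTensor (cylMetric h.field)

/-- The differential form `φ` is asymptotically cylindrical: it converges, with all derivatives
and at an exponential rate, to a smooth translation-invariant form on the cylinder. -/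
def IsACylForm (J : ModelWithCorners ℝ EN HN) (Ψ : ℝ × N → M) {k : ℕ} {F : Type*}
    [NormedAddCommGroup F] [NormedSpace ℝ F] (φ : DForm I M k F) : Prop :=
  ∃ φ' : ∀ y : N, (ℝ × TangentSpace J y) [⋀^Fin k]→L[ℝ] F,
    (∀ (q : N) (u : Fin k → ℝ × EN),
      ContDiffOn ℝ ∞ (CylTensor.comp (J := J) (fun y v => φ' y v) q u) (extChartAt J q).target) ∧
    IsAsymptoticTo (J := J) Ψ φ.field (fun y v => φ' y v)

/-- The maps `w t : Z → N` converge to `j : Z → N` as `t → ∞`, with all derivatives and at an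
exponential rate. As `Z` is compact, this may be expressed in charts over compact subsets. -/
def ExpConverges (J : ModelWithCorners ℝ EN HN) (IZ : ModelWithCorners ℝ EZ HZ)
    (w : ℝ × Z → N) (j : Z → N) : Prop :=
  ∃ δ : ℝ, 0 < δ ∧ ∀ (z₀ : Z) (q : N) (C : Set EZ), IsCompact C →
    C ⊆ (extChartAt IZ z₀).target →
    (∀ y ∈ C, j ((extChartAt IZ z₀).symm y) ∈ (extChartAt J q).source) →
      (∀ᶠ z in atTop ×ˢ 𝓟 C, w (z.1, (extChartAt IZ z₀).symm z.2) ∈ (extChartAt J q).source) ∧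
      ExpDecayOn (fun z : ℝ × EZ =>
        extChartAt J q (w (z.1, (extChartAt IZ z₀).symm z.2)) -
          extChartAt J q (j ((extChartAt IZ z₀).symm z.2))) C δ

/-- The submanifold `f : X → M` of the asymptotically cylindrical manifold `(M, g)` with end
`Ψ : (0, ∞) × N → M` is asymptotically cylindrical, with cross-section the closed submanifold
`j : Z → N` of `N` (so the asymptotic limit of `X` is `(0, ∞) × Z`): it is complete, and outside of
a compact subset it is parametrised by maps `(t, y) ↦ Ψ (t, w (t, y))` of `(R, ∞) × Z`, where
`w (t, ·)` converges to `j` with all derivatives at an exponential rate. (By the tubular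
neighbourhood theorem, one may take `w (t, y) = exp (v (t, y))` for sections `v` of the normal
bundle of `Z` in `N` that decay with all derivatives at an exponential rate, after changing the
parametrisation; conversely such maps `w` are of this type.) Only the values of `α` and `w` on
`(R, ∞) × Z` matter. -/
structure IsACylSubmanifold (IX : ModelWithCorners ℝ EX HX) (IZ : ModelWithCorners ℝ EZ HZ)
    (J : ModelWithCorners ℝ EN HN)
    (g : MetricField I M) (Ψ : ℝ × N → M) (j : Z → N) (f : X → M) : Prop where
  embedding : IsSmoothEmb I IX f
  cross_section : IsSmoothEmb J IZ j
  complete : IsCompleteAlong IX g f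
  end_param : ∃ (R : ℝ) (α : ℝ × Z → X) (w : ℝ × Z → N), 0 ≤ R ∧
    IsDiffeoOn IX (𝓘(ℝ, ℝ).prod IZ) α (Ioi R ×ˢ univ) (α '' (Ioi R ×ˢ univ)) ∧
    (∀ T : ℝ, R ≤ T → IsCompact (α '' (Ioi T ×ˢ univ))ᶜ) ∧
    ContMDiffOn (𝓘(ℝ, ℝ).prod IZ) J ∞ w (Ioi R ×ˢ univ) ∧
    (∀ (t : ℝ) (y : Z), R < t → f (α (t, y)) = Ψ (t, w (t, y))) ∧
    ExpConverges J IZ w j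

/-- The submanifold `f : X → M` is an asymptotically cylindrical local deformation of size at most
`ε` of the asymptotically cylindrical submanifold `ι : X → M`, with the same asymptotic limit
`(0, ∞) × Z`, `j : Z → N`: it is asymptotically cylindrical with this limit, and there is a smooth
family of maps from `ι` to `f` whose velocity field has `C^1`-norm at most `ε` everywhere and
decays at an exponential rate in `C^1` along the end. (For `f = exp s`, with `s` a `C^1`-small
exponentially decaying section of the normal bundle of `X`, the family is `exp (τ s)`.) -/
structure IsLocalDeformation (IX : ModelWithCorners ℝ EX HX) (IZ : ModelWithCorners ℝ EZ HZ)
    (J : ModelWithCorners ℝ EN HN)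
    (g : MetricField I M) (Ψ : ℝ × N → M) (j : Z → N) (ι : X → M) (ε : ℝ) (f : X → M) :
    Prop where
  acyl : IsACylSubmanifold IX IZ J g Ψ j f
  family : ∃ F : ℝ → X → M,
    ContMDiff (𝓘(ℝ, ℝ).prod IX) I ∞ (fun z : ℝ × X => F z.1 z.2) ∧
    F 0 = ι ∧ F 1 = f ∧
    (∀ τ ∈ Icc (0 : ℝ) 1, ∀ x : X, VelocityC1Le IX g ι F τ x ε) ∧
    ∃ lam A : ℝ, 0 < lam ∧ 0 ≤ A ∧ ∀ τ ∈ Icc (0 : ℝ) 1, ∀ (x : X) (t : ℝ) (y : N),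
      0 < t → ι x = Ψ (t, y) → VelocityC1Le IX g ι F τ x (A * Real.exp (-lam * t))

/-- The moduli space of all asymptotically cylindrical local deformations `Y = f(X)` (of size at
most `ε`, with the same asymptotic limit) of `ι : X → M` that have the property `P`, as a set of
subsets of `M`. -/
def moduliSpace (IX : ModelWithCorners ℝ EX HX) (IZ : ModelWithCorners ℝ EZ HZ)
    (J : ModelWithCorners ℝ EN HN)
    (g : MetricField I M) (Ψ : ℝ × N → M) (j : Z → N) (ι : X → M) (ε : ℝ)
    (P : (X → M) → Prop) : Set (Set M) :=
  {Y | ∃ f : X → M, IsLocalDeformation IX IZ J g Ψ j ι ε f ∧ P f ∧ Y = range f}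

end Cylinders

/-! ### Calabi–Yau 4-folds -/

section CalabiYau

/-- A Calabi–Yau 4-fold with its Kähler form `ω = kahler` and normalised holomorphic volume form
`Ω = hvol` (`ω^4 = (3/2) Ω ∧ Ω̄`), as a torsion-free `SU(4)`-structure on an 8-manifold: at every
point, the tangent space may be identified with `ℂ^4` such that the metric, the complex structure, `ω`,
and `Ω` are the standard ones (so `Ω = dz₁ ∧ dz₂ ∧ dz₃ ∧ dz₄`), and `ω`, `Ω` are closed. (The
almost complex structure is then integrable since `Ω` is closed, and `Ω` is holomorphic.) -/
structure CalabiYau4 (M : Type*) [TopologicalSpace M] [ChartedSpace (EuclideanSpace ℝ (Fin 8)) M]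
    [IsManifold (𝓡 8) ∞ M] where
  g : SmoothMetric (𝓡 8) M
  J : ∀ x : M, TangentSpace (𝓡 8) x → TangentSpace (𝓡 8) x
  kahler : DForm (𝓡 8) M 2 ℝ
  hvol : DForm (𝓡 8) M 4 ℂ
  frame : ∀ x : M, ∃ L : TangentSpace (𝓡 8) x ≃ₗ[ℝ] (Fin 4 → ℂ),
    (∀ u v, g.inner x u v = ∑ k, (starRingEnd ℂ (L u k) * L v k).re) ∧
    (∀ u, L (J x u) = Complex.I • L u) ∧
    (∀ u : Fin 2 → TangentSpace (𝓡 8) x,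
      kahler x u = ∑ k, (starRingEnd ℂ (L (u 0) k) * L (u 1) k).im) ∧
    (∀ u : Fin 4 → TangentSpace (𝓡 8) x,
      hvol x u = Matrix.det (Matrix.of fun i k => L (u i) k))
  smooth_kahler : kahler.IsSmooth
  smooth_hvol : hvol.IsSmooth
  closed_kahler : kahler.IsClosed
  closed_hvol : hvol.IsClosed

variable {M : Type*} [TopologicalSpace M] [ChartedSpace (EuclideanSpace ℝ (Fin 8)) M]
  [IsManifold (𝓡 8) ∞ M]
  {EX : Type*} [NormedAddCommGroup EX] [NormedSpace ℝ EX]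
  {HX : Type*} [TopologicalSpace HX]
  {X : Type*} [TopologicalSpace X] [ChartedSpace HX X]

/-- The Calabi–Yau 4-fold `M` is asymptotically cylindrical, with end `Ψ : (0, ∞) × N → M`: the
metric is asymptotic to `dt^2 + h`, and `ω` and `Ω` are asymptotically cylindrical. -/
structure CalabiYau4.IsACyl {N : Type*} [TopologicalSpace N]
    [ChartedSpace (EuclideanSpace ℝ (Fin 7)) N] [IsManifold (𝓡 7) ∞ N]
    (S : CalabiYau4 M) (h : SmoothMetric (𝓡 7) N) (Ψ : ℝ × N → M) : Prop where
  manifold : IsACylManifold S.g h Ψ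
  form_kahler : IsACylForm (𝓡 7) Ψ S.kahler
  form_hvol : IsACylForm (𝓡 7) Ψ S.hvol

/-- The form `Φ = -½ ω ∧ ω + Re Ω` of the induced `Spin(7)`-structure, whose metric is `g`. -/
def CalabiYau4.cayleyForm (S : CalabiYau4 M) : TensorField (𝓡 8) M 4 ℝ := fun x u =>
  -(S.kahler x ![u 0, u 1] * S.kahler x ![u 2, u 3]
    - S.kahler x ![u 0, u 2] * S.kahler x ![u 1, u 3]
    + S.kahler x ![u 0, u 3] * S.kahler x ![u 1, u 2]) + (S.hvol x u).re

/-- The 4-dimensional submanifold `f : X → M` is Cayley: `Φ|_X = vol_X` for some orientation. -/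
def CalabiYau4.IsCayley (S : CalabiYau4 M) (IX : ModelWithCorners ℝ EX HX) (f : X → M) : Prop :=
  IsCalibratedBy IX S.g.field S.cayleyForm f

/-- The 4-dimensional submanifold `f : X → M` is special Lagrangian: `(Re Ω)|_X = vol_X` for some
orientation. -/
def CalabiYau4.IsSpecialLagrangian (S : CalabiYau4 M) (IX : ModelWithCorners ℝ EX HX)
    (f : X → M) : Prop :=
  IsCalibratedBy IX S.g.field (fun x (u : Fin 4 → TangentSpace (𝓡 8) x) => (S.hvol x u).re) f

/-- The submanifold `f : X → M` is a complex submanifold: its tangent spaces are invariant under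
the complex structure. -/
def CalabiYau4.IsComplex (S : CalabiYau4 M) (IX : ModelWithCorners ℝ EX HX) (f : X → M) : Prop :=
  ∀ (x : X) (u : TangentSpace IX x), ∃ v : TangentSpace IX x,
    mfderiv IX (𝓡 8) f x v = S.J (f x) (mfderiv IX (𝓡 8) f x u)

end CalabiYau

/-! ### `G₂`-structures and products with a circle -/

section G2

/-- The elementary form `dx_{s 0} ∧ … ∧ dx_{s (k-1)}` on `ℝ^7`. -/
def dx {k : ℕ} (s : Fin k → Fin 7) (u : Fin k → Fin 7 → ℝ) : ℝ :=
  Matrix.det (Matrix.of fun a b => u a (s b))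

/-- The standard `G₂`-form on `ℝ^7`. -/
def phi0 (u : Fin 3 → Fin 7 → ℝ) : ℝ :=
  dx ![0, 1, 2] u + dx ![0, 3, 4] u - dx ![0, 5, 6] u + dx ![1, 3, 5] u + dx ![1, 4, 6] u
    + dx ![2, 3, 6] u - dx ![2, 4, 5] u

/-- The Hodge-dual of `phi0` with respect to the standard metric and orientation of `ℝ^7`. With an
additional coordinate `θ` in front, `dθ ∧ phi0 + psi0` is the standard Cayley form on `ℝ^8`. -/
def psi0 (u : Fin 4 → Fin 7 → ℝ) : ℝ :=
  dx ![3, 4, 5, 6] u - dx ![1, 2, 3, 4] u + dx ![1, 2, 5, 6] u + dx ![0, 2, 3, 5] u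
    + dx ![0, 2, 4, 6] u - dx ![0, 1, 3, 6] u + dx ![0, 1, 4, 5] u

/-- A torsion-free `G₂`-structure `φ` on a 7-manifold `M`, with the induced metric `g` and the
Hodge-dual `ψ` of `φ`: at every point, the tangent space may be identified with `ℝ^7` such that
`φ`, `g`, `ψ` are the standard ones, and `φ`, `ψ` are closed. -/
structure TorsionFreeG2 (M : Type*) [TopologicalSpace M]
    [ChartedSpace (EuclideanSpace ℝ (Fin 7)) M] [IsManifold (𝓡 7) ∞ M] where
  g : SmoothMetric (𝓡 7) M
  φ : DForm (𝓡 7) M 3 ℝ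
  ψ : DForm (𝓡 7) M 4 ℝ
  frame : ∀ x : M, ∃ L : TangentSpace (𝓡 7) x ≃ₗ[ℝ] (Fin 7 → ℝ),
    (∀ u v, g.inner x u v = ∑ k, L u k * L v k) ∧
    (∀ u : Fin 3 → TangentSpace (𝓡 7) x, φ x u = phi0 (fun i => L (u i))) ∧
    (∀ u : Fin 4 → TangentSpace (𝓡 7) x, ψ x u = psi0 (fun i => L (u i)))
  smooth_φ : φ.IsSmooth
  smooth_ψ : ψ.IsSmooth
  closed_φ : φ.IsClosed
  closed_ψ : ψ.IsClosed

/-- The form `dθ` on the unit circle, where `θ` is the angular coordinate: for a tangent vector `u`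
at `p = exp (i θ)`, seen in `ℂ`, `u = i p dθ(u)`. -/
def dtheta (p : Circle) (u : TangentSpace (𝓡 1) p) : ℝ :=
  let v : ℂ := mfderiv (𝓡 1) 𝓘(ℝ, ℂ) (fun z : Circle => (z : ℂ)) p u
  (starRingEnd ℂ (p : ℂ) * v).im

variable {M : Type*} [TopologicalSpace M] [ChartedSpace (EuclideanSpace ℝ (Fin 7)) M]
  [IsManifold (𝓡 7) ∞ M]
  {EX : Type*} [NormedAddCommGroup EX] [NormedSpace ℝ EX]
  {HX : Type*} [TopologicalSpace HX]
  {X : Type*} [TopologicalSpace X] [ChartedSpace HX X]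

/-- The `G₂`-structure `φ` is asymptotically cylindrical, with end `Ψ : (0, ∞) × N → M`. -/
structure TorsionFreeG2.IsACyl {N : Type*} [TopologicalSpace N]
    [ChartedSpace (EuclideanSpace ℝ (Fin 6)) N] [IsManifold (𝓡 6) ∞ N]
    (S : TorsionFreeG2 M) (h : SmoothMetric (𝓡 6) N) (Ψ : ℝ × N → M) : Prop where
  manifold : IsACylManifold S.g h Ψ
  form_φ : IsACylForm (𝓡 6) Ψ S.φ

/-- The 4-dimensional submanifold `f : X → M` is coassociative: `ψ|_X = vol_X` for some
orientation. -/
def TorsionFreeG2.IsCoassociative (S : TorsionFreeG2 M) (IX : ModelWithCorners ℝ EX HX)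
    (f : X → M) : Prop :=
  IsCalibratedBy IX S.g.field S.ψ.field f

/-- The 3-dimensional submanifold `f : X → M` is associative: `φ|_X = vol_X` for some
orientation. -/
def TorsionFreeG2.IsAssociative (S : TorsionFreeG2 M) (IX : ModelWithCorners ℝ EX HX)
    (f : X → M) : Prop :=
  IsCalibratedBy IX S.g.field S.φ.field f

/-- The `S^1`-component of a tangent vector of `S^1 × M`, measured by `dθ`. -/
def circlePart (z : Circle × M) (u : TangentSpace ((𝓡 1).prod (𝓡 7)) z) : ℝ :=
  dtheta z.1 (mfderiv ((𝓡 1).prod (𝓡 7)) (𝓡 1) (Prod.fst : Circle × M → Circle) z u)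

/-- The `M`-component of a tangent vector of `S^1 × M`. -/
def basePart (z : Circle × M) (u : TangentSpace ((𝓡 1).prod (𝓡 7)) z) :
    TangentSpace (𝓡 7) z.2 :=
  mfderiv ((𝓡 1).prod (𝓡 7)) (𝓡 7) (Prod.snd : Circle × M → M) z u

/-- The product metric `dθ^2 + g` on `S^1 × M`. -/
def TorsionFreeG2.prodMetric (S : TorsionFreeG2 M) :
    MetricField ((𝓡 1).prod (𝓡 7)) (Circle × M) := fun z u v =>
  circlePart z u * circlePart z v + S.g.inner z.2 (basePart z u) (basePart z v)

/-- The form `Φ = dθ ∧ φ + ψ` of the induced `Spin(7)`-structure on `S^1 × M`, whose metric is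
`dθ^2 + g`. -/
def TorsionFreeG2.cayleyForm (S : TorsionFreeG2 M) :
    TensorField ((𝓡 1).prod (𝓡 7)) (Circle × M) 4 ℝ := fun z u =>
  (∑ i : Fin 4, (-1 : ℝ) ^ (i : ℕ) * circlePart z (u i) *
    S.φ z.2 (fun k : Fin 3 => basePart z (u (i.succAbove k))))
    + S.ψ z.2 (fun k => basePart z (u k))

/-- The 4-dimensional submanifold `f : X → S^1 × M` is Cayley: `Φ|_X = vol_X` for some
orientation. -/
def TorsionFreeG2.IsCayley (S : TorsionFreeG2 M) (IX : ModelWithCorners ℝ EX HX)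
    (f : X → Circle × M) : Prop :=
  IsCalibratedBy IX S.prodMetric S.cayleyForm f

/-- The end `(0, ∞) × (S^1 × N) → S^1 × M` of `S^1 × M` induced by an end of `M`. -/
def prodEnd {N : Type*} (Ψ : ℝ × N → M) : ℝ × (Circle × N) → Circle × M :=
  fun z => (z.2.1, Ψ (z.1, z.2.2))

end G2

end ACyl

end

open ACyl

set_option linter.unusedSectionVars false

namespace ACyl

noncomputable section

local notation "ϕ" => extChartAt

local notation "𝔼" n:max => EuclideanSpace ℝ (Fin n)

/-- The model of the product of the circle with a manifold modelled on `I`. -/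
local notation "𝓒(" I ")" => ModelWithCorners.prod (𝓡 1) I

theorem _root_.Eq.app {F A B : Type*} [FunLike F A B] {f g : F} (h : f = g) (a : A) : f a = g a := by rw [h]

section

variable {E E' H H' M M' : Type*} [NormedAddCommGroup E] [NormedSpace ℝ E] [TopologicalSpace H]
  {I : ModelWithCorners ℝ E H} [TopologicalSpace M] [ChartedSpace H M] [NormedAddCommGroup E']
  [NormedSpace ℝ E'] [TopologicalSpace H'] {I' : ModelWithCorners ℝ E' H'} [TopologicalSpace M']
  [ChartedSpace H' M'] {f : M → M'} {F : E → E'} {x : M} {z : E}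
  {n : ℕ∞ω}

theorem _root_.ContMDiffAt.mdiffAt (h : CMDiffAt n f x) (hn : n ≠ 0 := by simp) : MDiffAt f x := h.mdifferentiableAt hn

theorem _root_.ContMDiff.mdiffAt (h : CMDiff n f) (hn : n ≠ 0 := by simp) : MDiffAt f x := h.mdifferentiableAt hn

theorem _root_.ContDiffAt.diffAt (h : ContDiffAt ℝ n F z) (hn : n ≠ 0 := by simp) : DifferentiableAt ℝ F z :=
  h.differentiableAt hn

end

variable {V : Type*} [NormedAddCommGroup V] [NormedSpace ℝ V]

section

variable {E : Type*} [NormedAddCommGroup E] [NormedSpace ℝ E]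
  {H : Type*} [TopologicalSpace H] {I : ModelWithCorners ℝ E H}
  {M : Type*} [TopologicalSpace M] [ChartedSpace H M]
  {F : Type*} [NormedAddCommGroup F] [NormedSpace ℝ F]

/-- The pullbacks of the tensor field `T` by smooth maps from normed spaces are smooth. -/
def SmoothOnMaps {k : ℕ} (T : TensorField I M k F) : Prop :=
  ∀ (V : Type) [NormedAddCommGroup V] [NormedSpace ℝ V] (G : V → M) (z0 : V), CMDiffAt ∞ G z0 → ∀ u : Fin k → V,
      ContDiffAt ℝ ∞ (fun z => T (G z) (fun i => mfderiv% G z (u i))) z0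

/-- The pullbacks of the form `T` by smooth maps from normed spaces are closed. -/
def ClosedOnMaps {k : ℕ} (T : TensorField I M k F) : Prop :=
  ∀ (V : Type) [NormedAddCommGroup V] [NormedSpace ℝ V] (G : V → M) (z0 : V), CMDiffAt ∞ G z0 → ∀ v : Fin (k + 1) → V,
      ∑ i : Fin (k + 1), (-1 : ℝ) ^ (i : ℕ) •
        fderiv ℝ (fun z => T (G z) (fun j => mfderiv% G z (v (i.succAbove j)))) z0 (v i)
      = 0

theorem tensor_congr_point {k : ℕ} {A : Type*} (T : TensorField I M k A) {x y : M} (h : y = x)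
    (w : Fin k → E) : T y (fun i => (w i : E)) = T x (fun i => (w i : E)) := by
  subst h; rfl

variable [IsManifold I ∞ M]

theorem isManifold_one : IsManifold I 1 M := IsManifold.of_le (n := ∞) (by exact_mod_cast le_top)

theorem mfderiv_symm_mfderiv_extChartAt [I.Boundaryless] (p x : M) (hx : x ∈ (ϕ I p).source) (u : TangentSpace I x) :
    (mfderiv% (ϕ I p).symm (ϕ I p x) (mfderiv% (ϕ I p) x u) : E) = u := by
  have := isManifold_one (I := I) (M := M)
  have h := mfderivWithin_extChartAt_symm_comp_mfderiv_extChartAt' hx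
  rw [I.range_eq_univ, mfderivWithin_univ] at h
  exact h.app u

theorem mfderiv_mfderiv_symm_extChartAt [I.Boundaryless] (p : M) (z : E) (hz : z ∈ (ϕ I p).target) (u : E) :
    (mfderiv% (ϕ I p) ((ϕ I p).symm z) (mfderiv% (ϕ I p).symm z u) : E) = u := by
  have := isManifold_one (I := I) (M := M)
  have h := mfderiv_extChartAt_comp_mfderivWithin_extChartAt_symm hz
  rw [I.range_eq_univ, mfderivWithin_univ] at h
  exact h.app u

theorem tensor_eq_chart [I.Boundaryless] {k : ℕ} {A : Type*} (T : TensorField I M k A) (p x : M)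
    (hx : x ∈ (ϕ I p).source) (u : Fin k → TangentSpace I x) :
    T x u = T ((ϕ I p).symm (ϕ I p x)) (fun i =>
      mfderiv% (ϕ I p).symm (ϕ I p x) (mfderiv% (ϕ I p) x (u i))) := by
  rw [← (tensor_congr_point T ((ϕ I p).left_inv hx) (fun i => (u i)))]
  congr 1
  funext i
  exact (mfderiv_symm_mfderiv_extChartAt p x hx (u i)).symm

theorem mfderiv_chart_comp {G : V → M} {z : V} {p : M} (hG : MDiffAt G z) (hz : G z ∈ (ϕ I p).source) (v : V) :
    (fderiv ℝ (fun z => ϕ I p (G z)) z v : E) = mfderiv% (ϕ I p) (G z) (mfderiv% G z v) := by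
  have := isManifold_one (I := I) (M := M)
  rw [extChartAt_source] at hz
  rw [← mfderiv_eq_fderiv]
  exact (mfderiv_comp z (mdifferentiableAt_extChartAt hz) hG).app v

theorem contDiffAt_chart_comp {G : V → M} {z : V} {p : M} {n : ℕ∞} (hG : CMDiffAt n G z) (hz : G z ∈ (ϕ I p).source) :
    ContDiffAt ℝ n (fun z => ϕ I p (G z)) z := by
  rw [← contMDiffAt_iff_contDiffAt]
  rw [extChartAt_source] at hz
  have h : CMDiffAt ∞ (ϕ I p) (G z) := contMDiffAt_extChartAt' hz
  exact (h.of_le (by exact_mod_cast le_top)).comp z hG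

theorem form_eventually_eq [I.Boundaryless] {G : V → M} {z0 : V} {k : ℕ} (φ : DForm I M k F) (hG : CMDiffAt ∞ G z0) :
    ∀ᶠ z in 𝓝 z0, ∀ u : Fin k → V, φ (G z) (fun i => mfderiv% G z (u i)) =
      ((φ.inChart (G z0) (ϕ I (G z0) (G z))).compContinuousLinearMap (fderiv ℝ (fun z => ϕ I (G z0) (G z)) z)) u := by
  have h1 : ∀ᶠ z in 𝓝 z0, CMDiffAt 1 G z := (contMDiffAt_iff_contMDiffAt_nhds (by simp)).1
      (hG.of_le (by exact_mod_cast le_top))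
  have h2 : ∀ᶠ z in 𝓝 z0, G z ∈ (ϕ I (G z0)).source := hG.continuousAt.eventually_mem (extChartAt_source_mem_nhds _)
  filter_upwards [h1, h2] with z h1 h2 u
  have := tensor_eq_chart φ.field (G z0) (G z) h2 (fun i => mfderiv% G z (u i))
  refine Eq.trans this (congrArg (fun w => φ.inChart (G z0)
    (ϕ I (G z0) (G z)) w) (funext fun i => ((fun i => mfderiv_chart_comp h1.mdiffAt h2 (u i)) i).symm))

theorem chart_pullback_contDiffAt [I.Boundaryless] {G : V → M} {z0 : V} {k : ℕ} {φ : DForm I M k F} (hφ : φ.IsSmooth)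
    (hG : CMDiffAt ∞ G z0) :
    DifferentiableAt ℝ (fun z => (φ.inChart (G z0) (ϕ I (G z0) (G z))).compContinuousLinearMap
        (fderiv ℝ (fun z => ϕ I (G z0) (G z)) z)) z0 ∧ ∀ u : Fin k → V,
    ContDiffAt ℝ ∞ (fun z => (φ.inChart (G z0) (ϕ I (G z0) (G z))).compContinuousLinearMap
        (fderiv ℝ (fun z => ϕ I (G z0) (G z)) z) u) z0 := by
  have hc := contDiffAt_chart_comp hG (mem_extChartAt_source _)
  have h2 : ContDiffAt ℝ ∞ (fderiv ℝ _) z0 := hc.fderiv_right (by simp)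
  have h3 := ((hφ (G z0)).contDiffAt (extChartAt_target_mem_nhds (G z0))).comp z0 hc
  constructor
  · have := (ContinuousAlternatingMap.hasStrictFDerivAt_compContinuousLinearMap ((φ.inChart (G z0)) _,
        fderiv ℝ _ z0)).hasFDerivAt.comp z0
        (h3.diffAt.hasFDerivAt.prodMk h2.diffAt.hasFDerivAt)
    exact this.differentiableAt
  · intro u
    have h4 : ContDiffAt ℝ ∞ (fun z => ContinuousMultilinearMap.compContinuousLinearMapContinuousMultilinear ℝ
        (fun _ : Fin k => V) _ F
        (fun _ => fderiv ℝ _ z)) z0 :=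
      (ContinuousMultilinearMap.contDiff _).contDiffAt.comp z0 (contDiffAt_pi.2 fun _ => h2)
    exact (ContinuousMultilinearMap.apply ℝ (fun _ => V) F u).contDiff.contDiffAt.comp z0
      (h4.clm_apply ((ContinuousAlternatingMap.toContinuousMultilinearMapCLM ℝ).contDiff.contDiffAt.comp z0 h3))

theorem DForm.smoothOnMaps [I.Boundaryless] {k : ℕ} {φ : DForm I M k F} (hφ : φ.IsSmooth) : SmoothOnMaps φ.field := by
  refine fun V _ _ G z0 hG u => ((chart_pullback_contDiffAt hφ hG).2 u).congr_of_eventuallyEq ?_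
  filter_upwards [form_eventually_eq φ hG] with z hz
  exact hz u

theorem DForm.closedOnMaps [I.Boundaryless] {k : ℕ} {φ : DForm I M k F} (hφ : φ.IsSmooth)
    (hc : φ.IsClosed) : ClosedOnMaps φ.field := by
  intro V _ _ G z0 hG v
  have h0 := extDeriv_pullback (f := fun z => ϕ I (G z0) (G z)) (x := z0)
    (((hφ (G z0)).contDiffAt (extChartAt_target_mem_nhds (G z0))).diffAt) (contDiffAt_chart_comp hG (mem_extChartAt_source _)) (by
      rw [minSmoothness_of_isRCLikeNormedField]
      exact WithTop.coe_le_coe.2 (le_top (a := 2)))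
  rw [hc (G z0) _ (mem_extChartAt_target _)] at h0
  refine Eq.trans (Finset.sum_congr rfl fun i _ => ?_) (((extDeriv_apply ((chart_pullback_contDiffAt hφ hG).1) v).symm.trans (h0.app v)).trans rfl)
  have e1 : (fun z => φ.field (G z) (fun j => mfderiv% G z (v (i.succAbove j))))
      =ᶠ[𝓝 z0] fun z => (ContinuousAlternatingMap.apply ℝ V F (i.removeNth v))
        ((φ.inChart (G z0) (ϕ I (G z0) (G z))).compContinuousLinearMap
        (fderiv ℝ (fun z => ϕ I (G z0) (G z)) z)) := by
    filter_upwards [form_eventually_eq φ hG] with z hz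
    exact hz _
  rw [e1.fderiv_eq]
  rw [← Int.cast_smul_eq_zsmul ℝ]
  push_cast
  rfl

theorem SmoothMetric.smoothOnMaps (g : SmoothMetric I M) : SmoothOnMaps g.field.toTensor := by
  intro V _ _ G z0 hG u
  have hv : ∀ v, CMDiffAt ∞ (fun z => Bundle.TotalSpace.mk' E (G z) (mfderiv% G z v)) z0 := by
    intro v
    have := isManifold_one (I := I) (M := M)
    rw [Bundle.contMDiffAt_totalSpace]
    refine ⟨hG, contMDiffAt_iff_contDiffAt.2 ?_⟩
    have h2 : ContDiffAt ℝ ∞ (fderiv ℝ _) z0 := (contDiffAt_chart_comp hG (mem_extChartAt_source _)).fderiv_right (by simp)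
    refine (h2.clm_apply (contDiffAt_const (c := v))).congr_of_eventuallyEq ?_
    have h1 : ∀ᶠ z in 𝓝 z0, CMDiffAt 1 G z := (contMDiffAt_iff_contMDiffAt_nhds (by simp)).1
        (hG.of_le (by exact_mod_cast le_top))
    have h2 : ∀ᶠ z in 𝓝 z0, G z ∈ (ϕ I (G z0)).source := hG.continuousAt.eventually_mem (extChartAt_source_mem_nhds _)
    filter_upwards [h1, h2] with z h1 h2
    refine Eq.trans ?_ (mfderiv_chart_comp h1.mdiffAt h2 v).symm
    rw [extChartAt_source] at h2
    rw [← (TangentBundle.continuousLinearMapAt_trivializationAt h2)]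
    exact (Bundle.Trivialization.continuousLinearMapAt_apply_of_mem ℝ _ (by simpa using h2) _).symm
  have h2 : ContMDiffAt 𝓘(ℝ, V) (I.prod 𝓘(ℝ)) ∞ (fun z => Bundle.TotalSpace.mk' ℝ (E := Bundle.Trivial M ℝ) (G z)
        (g.inner (G z) (mfderiv% G z (u 0)) (mfderiv% G z (u 1)))) z0 := by
    apply ContMDiffAt.clm_bundle_apply₂ (F₁ := E) (F₂ := E)
    · exact ContMDiffAt.comp z0 g.contMDiff.contMDiffAt hG
    · exact hv _
    · exact hv _
  exact contMDiffAt_iff_contDiffAt.1 (Bundle.contMDiffAt_totalSpace.1 h2).2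

end

section

variable {W : Type*} [AddCommGroup W] [Module ℝ W]

/-- Half of the square of a 2-form, as a 4-form. -/
def halfSquare (η : W [⋀^Fin 2]→ₗ[ℝ] ℝ) : W [⋀^Fin 4]→ₗ[ℝ] ℝ :=
  have e0 : ∀ a c x : W, Function.update ![a, c] 0 x = ![x, c] := fun a c x => by ext i; fin_cases i <;> rfl
  have e1 : ∀ a c x : W, Function.update ![a, c] 1 x = ![a, x] := fun a c x => by ext i; fin_cases i <;> rfl
  have h1 : ∀ a b c : W, η ![a + b, c] = η ![a, c] + η ![b, c] := fun a b c => by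
    have := η.map_update_add ![a, c] 0 a b
    rwa [e0, e0, e0] at this
  have h2 : ∀ a b c : W, η ![a, b + c] = η ![a, b] + η ![a, c] := fun a b c => by
    have := η.map_update_add ![a, c] 1 b c
    rwa [e1, e1, e1] at this
  have h3 : ∀ (r : ℝ) (a c : W), η ![r • a, c] = r * η ![a, c] := fun r a c => by
    have := η.map_update_smul ![a, c] 0 r a
    rwa [e0, e0] at this
  have h4 : ∀ (r : ℝ) (a c : W), η ![a, r • c] = r * η ![a, c] := fun r a c => by
    have := η.map_update_smul ![a, c] 1 r c
    rwa [e1, e1] at this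
  have h5 : ∀ a : W, η ![a, a] = 0 := fun a => η.map_eq_zero_of_eq ![a, a] (i := 0) (j := 1) rfl (by simp)
  have h6 : ∀ a b : W, η ![b, a] = - η ![a, b] := fun a b => by
    have := h5 (a + b)
    rw [h1, h2, h2, h5, h5] at this
    linarith
  { toFun := fun u => η ![u 0, u 1] * η ![u 2, u 3] - η ![u 0, u 2] * η ![u 1, u 3] + η ![u 0, u 3] * η ![u 1, u 2]
    map_update_add' := by
      intro inst u i x y
      obtain rfl : inst = instDecidableEqFin 4 := Subsingleton.elim _ _
      fin_cases i <;> simp [Function.update, h1, h2] <;> ring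
    map_update_smul' := by
      intro inst u i r x
      obtain rfl : inst = instDecidableEqFin 4 := Subsingleton.elim _ _
      fin_cases i <;> simp [Function.update, h3, h4] <;> ring
    map_eq_zero_of_eq' := by
      intro u i j h hij
      fin_cases i <;> fin_cases j <;> simp at h hij ⊢ <;>
        simp only [h, h5, h6 (u 0) (u 1), h6 (u 0) (u 2), h6 (u 1) (u 2), h6 (u 1) (u 3), h6 (u 2) (u 3)] <;> ring }

theorem halfSquare_apply (η : W [⋀^Fin 2]→ₗ[ℝ] ℝ) (u : Fin 4 → W) :
    halfSquare η u = η ![u 0, u 1] * η ![u 2, u 3] - η ![u 0, u 2] * η ![u 1, u 3] + η ![u 0, u 3] * η ![u 1, u 2] := rfl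

/-- The product of a 1-form with a 3-form. -/
def wedgeOneThree (c : W →ₗ[ℝ] ℝ) (φ : W [⋀^Fin 3]→ₗ[ℝ] ℝ) : W [⋀^Fin 4]→ₗ[ℝ] ℝ :=
  AlternatingMap.alternatizeUncurryFin (c.smulRight φ)

theorem wedgeOneThree_apply (c : W →ₗ[ℝ] ℝ) (φ : W [⋀^Fin 3]→ₗ[ℝ] ℝ) (u : Fin 4 → W) : wedgeOneThree c φ u =
      ∑ i : Fin 4, (-1 : ℝ) ^ (i : ℕ) * c (u i) * φ (fun k => u (i.succAbove k)) := by
  simp only [wedgeOneThree, AlternatingMap.alternatizeUncurryFin_apply]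
  refine Finset.sum_congr rfl fun i _ => ?_
  rw [← Int.cast_smul_eq_zsmul ℝ]
  simp [mul_assoc]
  left; rfl

end

section

variable {W : Type*} [NormedAddCommGroup W] [InnerProductSpace ℝ W]

/-- The Gram determinant. -/
def gram {k : ℕ} (u : Fin k → W) : ℝ := Matrix.det (Matrix.of fun i j => inner ℝ (u i) (u j))

theorem gram_eq_zero_of_not_linearIndependent {k : ℕ} {u : Fin k → W} (h : ¬ LinearIndependent ℝ u) : gram u = 0 := by
  rw [Fintype.linearIndependent_iff] at h
  push Not at h
  obtain ⟨a, ha, i, hi⟩ := h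
  refine Matrix.exists_mulVec_eq_zero_iff.1 ⟨a, fun h0 => hi (congrFun h0 i), ?_⟩
  funext j
  have := congrArg (fun v => inner ℝ (u j) v) ha
  simp only [inner_sum, inner_smul_right, inner_zero_right] at this
  simp only [Matrix.mulVec, dotProduct, Matrix.of_apply, Pi.zero_apply]
  rw [← this]
  exact Finset.sum_congr rfl fun k _ => mul_comm _ _

theorem exists_scale {u : Fin 4 → W} (h : LinearIndependent ℝ u) {S : Submodule ℝ W}
    (hS : ∀ i, u i ∈ S) (b : OrthonormalBasis (Fin 4) ℝ S) :
    ∃ d : ℝ, gram u = d ^ 2 ∧ d ≠ 0 ∧ ∀ T : W [⋀^Fin 4]→ₗ[ℝ] ℝ, T u = d * T (fun i => (b i : W)) := by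
  let u' : Fin 4 → S := fun i => ⟨u i, hS i⟩
  have hg : gram u = (b.toBasis.det u') ^ 2 := by
    rw [Module.Basis.det_apply, sq]
    nth_rewrite 1 [← Matrix.det_transpose]
    rw [← Matrix.det_mul, gram]
    congr 1
    ext i j
    simp only [Matrix.of_apply, Matrix.mul_apply, Matrix.transpose_apply, Module.Basis.toMatrix_apply,
      OrthonormalBasis.coe_toBasis_repr_apply]
    have := b.sum_inner_mul_inner (u' i) (u' j)
    rw [show inner ℝ (u i) (u j) = inner ℝ (u' i) (u' j) from rfl, ← this]
    exact Finset.sum_congr rfl fun k _ => by rw [b.repr_apply_apply, b.repr_apply_apply, real_inner_comm]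
  refine ⟨b.toBasis.det u', hg, ?_, fun T => ?_⟩
  · have hu' : LinearIndependent ℝ u' := LinearIndependent.of_comp S.subtype h
    have := Module.Basis.finiteDimensional_of_finite b.toBasis
    exact ((Module.Basis.is_basis_iff_det b.toBasis).1 ⟨hu', hu'.span_eq_top_of_card_eq_finrank' (Module.finrank_eq_card_basis b.toBasis).symm⟩).ne_zero
  · have h2 := (AlternatingMap.eq_smul_basis_det b.toBasis (T.compLinearMap S.subtype)).app u'
    simp only [AlternatingMap.smul_apply, smul_eq_mul] at h2
    rw [mul_comm]
    simpa [u', Function.comp_def] using h2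

theorem finrank_span_eq_four {u : Fin 4 → W} (h : LinearIndependent ℝ u) :
    Module.finrank ℝ (Submodule.span ℝ (range u)) = 4 := by
  rw [finrank_span_eq_card h]; rfl

theorem exists_orthonormalBasis_span [FiniteDimensional ℝ W] {u : Fin 4 → W} (h : LinearIndependent ℝ u) :
    Nonempty (OrthonormalBasis (Fin 4) ℝ (Submodule.span ℝ (range u))) :=
  ⟨(stdOrthonormalBasis ℝ _).reindex (finCongr (finrank_span_eq_four h))⟩

/-- There are orthonormal bases adapted to a linear functional. -/
theorem exists_orthonormalBasis_adapted [FiniteDimensional ℝ W] {u : Fin 4 → W} (h : LinearIndependent ℝ u) (c : W →ₗ[ℝ] ℝ) :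
    ∃ b : OrthonormalBasis (Fin 4) ℝ (Submodule.span ℝ (range u)), ∀ i, i ≠ 0 → c (b i) = 0 := by
  set S := Submodule.span ℝ (range u)
  let c' : S →L[ℝ] ℝ := LinearMap.toContinuousLinearMap (c.comp S.subtype)
  let r : S := (InnerProductSpace.toDual ℝ S).symm c'
  have hr : ∀ x : S, c x = inner ℝ r x := fun x => by rw [InnerProductSpace.toDual_symm_apply]; rfl
  by_cases h0 : r = 0
  · obtain ⟨b⟩ := exists_orthonormalBasis_span h
    exact ⟨b, fun i _ => by rw [hr, h0, inner_zero_left]⟩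
  · let v : Fin 4 → S := fun _ => (‖r‖⁻¹ : ℝ) • r
    have hv : Orthonormal ℝ (({0} : Set (Fin 4)).domRestrict v) := by
      refine ⟨fun i => ?_, fun i j hij => absurd (Subsingleton.elim i j) hij⟩
      have : ‖(‖r‖⁻¹ : ℝ) • r‖ = 1 := by rw [norm_smul, norm_inv, norm_norm, inv_mul_cancel₀ (norm_ne_zero_iff.2 h0)]
      exact this
    obtain ⟨b, hb⟩ := hv.exists_orthonormalBasis_extension_of_card_eq (by rw [finrank_span_eq_four h]; rfl)
    refine ⟨b, fun i hi => ?_⟩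
    have h1 : inner ℝ (b 0) (b i) = 0 := b.orthonormal.2 (Ne.symm hi)
    rw [hb 0 (by simp), inner_smul_left] at h1
    rw [hr]
    exact (mul_eq_zero.1 h1).resolve_left (by simpa using h0)

end

section

theorem orthonormal_sum_sq {W : Type*} [NormedAddCommGroup W] [InnerProductSpace ℝ W]
    {v : Fin 4 → W} (hv : Orthonormal ℝ v) (x : W) : ∑ j, inner ℝ x (v j) ^ 2 ≤ ‖x‖ ^ 2 := by
  have := hv.sum_inner_products_le x (s := Finset.univ)
  simpa [real_inner_comm, Real.norm_eq_abs, sq_abs] using this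

theorem eq_sum_of_sum_sq_eq {W : Type*} [NormedAddCommGroup W] [InnerProductSpace ℝ W]
    {v : Fin 4 → W} (hv : Orthonormal ℝ v) (x : W) (h : ∑ j, inner ℝ x (v j) ^ 2 = ‖x‖ ^ 2) :
    x = ∑ j, inner ℝ x (v j) • v j := by
  have h1 : ‖x - ∑ j, inner ℝ x (v j) • v j‖ ^ 2 = 0 := by
    rw [norm_sub_sq_real, inner_sum, ← real_inner_self_eq_norm_sq (∑ j, inner ℝ x (v j) • v j), hv.inner_sum]
    simp only [inner_smul_right, ← h]
    simp [sq, two_mul]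
  exact sub_eq_zero.1 (norm_eq_zero.1 (pow_eq_zero_iff two_ne_zero |>.1 h1))

/-- `ℂ^4` as a real inner product space. -/
abbrev C4 : Type := PiLp 2 (fun _ : Fin 4 => ℂ)

theorem C4.inner_eq (x y : C4) : inner ℝ x y = ∑ k, (starRingEnd ℂ (x k) * y k).re := by
  rw [PiLp.inner_apply]
  refine Finset.sum_congr rfl fun k _ => ?_
  simp [Complex.inner]
  ring

theorem C4.inner_I_smul (x y : C4) : inner ℝ (Complex.I • x) y = ∑ k, (starRingEnd ℂ (x k) * y k).im := by
  rw [C4.inner_eq]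
  refine Finset.sum_congr rfl fun k _ => ?_
  simp [Complex.mul_re, Complex.mul_im]
  try ring

/-- The real matrix of the Kähler form on a frame. -/
def C4.om (x y : C4) : ℝ := ∑ k, (starRingEnd ℂ (x k) * y k).im

theorem C4.om_self (x : C4) : C4.om x x = 0 := by
  simp [C4.om, Complex.mul_im]
  simp [mul_comm]

theorem C4.om_swap (x y : C4) : C4.om y x = - C4.om x y := by
  rw [C4.om, C4.om, ← Finset.sum_neg_distrib]
  refine Finset.sum_congr rfl fun k _ => ?_
  simp [Complex.mul_im]; ring

def C4.pf (v : Fin 4 → C4) : ℝ :=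
  C4.om (v 0) (v 1) * C4.om (v 2) (v 3) - C4.om (v 0) (v 2) * C4.om (v 1) (v 3) + C4.om (v 0) (v 3) * C4.om (v 1) (v 2)

theorem C4.row_le {v : Fin 4 → C4} (hv : Orthonormal ℝ v) (i : Fin 4) : ∑ j, C4.om (v i) (v j) ^ 2 ≤ 1 := by
  have h := orthonormal_sum_sq hv (Complex.I • v i)
  simp only [C4.inner_I_smul, norm_smul, Complex.norm_I, hv.1 i] at h
  simpa [C4.om] using h

theorem C4.pf_bounds {v : Fin 4 → C4} (hv : Orthonormal ℝ v) :
    |C4.pf v| ≤ 1 ∧ (C4.pf v ^ 2 = 1 → ∀ i, ∑ j, C4.om (v i) (v j) ^ 2 = 1) ∧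
    ((∀ i, ∑ j, C4.om (v i) (v j) ^ 2 = 1) → C4.pf v ^ 2 = 1) := by
  have r0 := C4.row_le hv 0
  have r1 := C4.row_le hv 1
  have r2 := C4.row_le hv 2
  have r3 := C4.row_le hv 3
  simp only [Fin.sum_univ_four, C4.om_self, C4.om_swap (v 0) (v 1), C4.om_swap (v 0) (v 2),
    C4.om_swap (v 0) (v 3), C4.om_swap (v 1) (v 2), C4.om_swap (v 1) (v 3),
    C4.om_swap (v 2) (v 3)] at r0 r1 r2 r3
  have orth : (∀ i, ∑ j, C4.om (v i) (v j) ^ 2 = 1) → ∀ i j, i ≠ j → ∑ k, C4.om (v i) (v k) * C4.om (v j) (v k) = 0 := by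
    intro h i j hij
    have e : ∀ i, Complex.I • v i = ∑ j, C4.om (v i) (v j) • v j := fun i => by
      have := eq_sum_of_sum_sq_eq hv (Complex.I • v i) (by
        simp only [C4.inner_I_smul, norm_smul, Complex.norm_I, hv.1 i]
        simpa [C4.om] using h i)
      simp only [C4.inner_I_smul] at this
      exact this
    have h1 : inner ℝ (Complex.I • v i) (Complex.I • v j) = inner ℝ (v i) (v j) := by
      rw [C4.inner_eq, C4.inner_eq]
      exact Finset.sum_congr rfl fun k _ => by simp [Complex.mul_re]
    rw [hv.2 hij, e i, e j, hv.inner_sum] at h1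
    simpa using h1
  unfold C4.pf
  refine ⟨abs_le.2 ⟨?_, ?_⟩, fun h => ?_, fun h => ?_⟩
  · nlinarith [sq_nonneg (C4.om (v 0) (v 1) + C4.om (v 2) (v 3)), sq_nonneg (C4.om (v 0) (v 2) - C4.om (v 1) (v 3)),
      sq_nonneg (C4.om (v 0) (v 3) + C4.om (v 1) (v 2))]
  · nlinarith [sq_nonneg (C4.om (v 0) (v 1) - C4.om (v 2) (v 3)), sq_nonneg (C4.om (v 0) (v 2) + C4.om (v 1) (v 3)),
      sq_nonneg (C4.om (v 0) (v 3) - C4.om (v 1) (v 2))]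
  · have key : 2 ≤ C4.om (v 0) (v 1) ^ 2 + C4.om (v 0) (v 2) ^ 2 + C4.om (v 0) (v 3) ^ 2 +
        C4.om (v 1) (v 2) ^ 2 + C4.om (v 1) (v 3) ^ 2 + C4.om (v 2) (v 3) ^ 2 := by
      rcases mul_self_eq_one_iff.1 ((sq _).symm.trans h) with h | h
      · nlinarith [sq_nonneg (C4.om (v 0) (v 1) - C4.om (v 2) (v 3)), sq_nonneg (C4.om (v 0) (v 2) + C4.om (v 1) (v 3)),
          sq_nonneg (C4.om (v 0) (v 3) - C4.om (v 1) (v 2))]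
      · nlinarith [sq_nonneg (C4.om (v 0) (v 1) + C4.om (v 2) (v 3)), sq_nonneg (C4.om (v 0) (v 2) - C4.om (v 1) (v 3)),
          sq_nonneg (C4.om (v 0) (v 3) + C4.om (v 1) (v 2))]
    intro i
    simp only [Fin.sum_univ_four]
    fin_cases i <;> simp only [Fin.zero_eta, Fin.mk_one, Fin.reduceFinMk, C4.om_self,
      C4.om_swap (v 0) (v 1), C4.om_swap (v 0) (v 2),
      C4.om_swap (v 0) (v 3), C4.om_swap (v 1) (v 2), C4.om_swap (v 1) (v 3),
      C4.om_swap (v 2) (v 3)] <;> nlinarith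
  · have o1 := orth h 0 1 (by simp)
    have o2 := orth h 0 2 (by simp)
    have o3 := orth h 0 3 (by simp)
    have h0 := h 0
    have h1 := h 1
    have h2 := h 2
    have h3 := h 3
    simp only [Fin.sum_univ_four, C4.om_self, C4.om_swap (v 0) (v 1), C4.om_swap (v 0) (v 2),
      C4.om_swap (v 0) (v 3), C4.om_swap (v 1) (v 2), C4.om_swap (v 1) (v 3),
      C4.om_swap (v 2) (v 3)] at o1 o2 o3 h0 h1 h2 h3
    generalize C4.om (v 0) (v 1) = a at *
    generalize C4.om (v 0) (v 2) = b at *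
    generalize C4.om (v 0) (v 3) = c at *
    generalize C4.om (v 1) (v 2) = d at *
    generalize C4.om (v 1) (v 3) = e at *
    generalize C4.om (v 2) (v 3) = f at *
    have hA : a ^ 2 + b ^ 2 + c ^ 2 = 1 := by linarith
    have hB : d ^ 2 + e ^ 2 + f ^ 2 = 1 := by linarith
    have e1 : b * d + c * e = 0 := by linarith
    have e2 : -(a * d) + c * f = 0 := by linarith
    have e3 : a * e + b * f = 0 := by linarith
    have : (a * f - b * e + c * d) ^ 2 = (a ^ 2 + b ^ 2 + c ^ 2) * (d ^ 2 + e ^ 2 + f ^ 2)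
        - (b * d + c * e) ^ 2 - (-(a * d) + c * f) ^ 2 - (a * e + b * f) ^ 2 := by ring
    rw [this, hA, hB, e1, e2, e3]; norm_num

theorem det_fin_four {R : Type*} [CommRing R] (A : Matrix (Fin 4) (Fin 4) R) :
    A.det = A 0 0 * (A 1 1 * (A 2 2 * A 3 3 - A 2 3 * A 3 2) - A 1 2 * (A 2 1 * A 3 3 - A 2 3 * A 3 1)
        + A 1 3 * (A 2 1 * A 3 2 - A 2 2 * A 3 1))
      - A 0 1 * (A 1 0 * (A 2 2 * A 3 3 - A 2 3 * A 3 2) - A 1 2 * (A 2 0 * A 3 3 - A 2 3 * A 3 0)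
        + A 1 3 * (A 2 0 * A 3 2 - A 2 2 * A 3 0))
      + A 0 2 * (A 1 0 * (A 2 1 * A 3 3 - A 2 3 * A 3 1) - A 1 1 * (A 2 0 * A 3 3 - A 2 3 * A 3 0)
        + A 1 3 * (A 2 0 * A 3 1 - A 2 1 * A 3 0))
      - A 0 3 * (A 1 0 * (A 2 1 * A 3 2 - A 2 2 * A 3 1) - A 1 1 * (A 2 0 * A 3 2 - A 2 2 * A 3 0)
        + A 1 2 * (A 2 0 * A 3 1 - A 2 1 * A 3 0)) := by
  rw [Matrix.det_succ_row_zero, Fin.sum_univ_four]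
  simp only [Matrix.det_fin_three, Matrix.submatrix_apply, Fin.succ_zero_eq_one, Fin.succ_one_eq_two,
    show (2 : Fin 3).succ = 3 from rfl,
    show (0 : Fin 4).succAbove 0 = 1 from rfl, show (0 : Fin 4).succAbove 1 = 2 from rfl,
    show (0 : Fin 4).succAbove 2 = 3 from rfl, show (1 : Fin 4).succAbove 0 = 0 from rfl,
    show (1 : Fin 4).succAbove 1 = 2 from rfl, show (1 : Fin 4).succAbove 2 = 3 from rfl,
    show (2 : Fin 4).succAbove 0 = 0 from rfl, show (2 : Fin 4).succAbove 1 = 1 from rfl,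
    show (2 : Fin 4).succAbove 2 = 3 from rfl, show (3 : Fin 4).succAbove 0 = 0 from rfl,
    show (3 : Fin 4).succAbove 1 = 1 from rfl, show (3 : Fin 4).succAbove 2 = 2 from rfl,
    show ((0 : Fin 4) : ℕ) = 0 from rfl, show ((1 : Fin 4) : ℕ) = 1 from rfl,
    show ((2 : Fin 4) : ℕ) = 2 from rfl, show ((3 : Fin 4) : ℕ) = 3 from rfl]
  ring

theorem C4.det_sq {v : Fin 4 → C4} (hv : Orthonormal ℝ v) :
    Complex.normSq (Matrix.det (Matrix.of fun i k => v i k)) ≤ (1 - |C4.pf v|) ^ 2 := by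
  set A : Matrix (Fin 4) (Fin 4) ℂ := Matrix.of fun i k => v i k with hA
  have h1 : (Complex.normSq A.det : ℂ) = (A * A.conjTranspose).det := by
    rw [Matrix.det_mul, Matrix.det_conjTranspose, Complex.normSq_eq_conj_mul_self, mul_comm]; rfl
  have h2 : ∀ i j, (A * A.conjTranspose) i j = ((inner ℝ (v i) (v j) : ℝ) : ℂ) - Complex.I * (C4.om (v i) (v j) : ℝ) := by
    intro i j
    rw [C4.inner_eq, C4.om, Matrix.mul_apply]
    push_cast
    rw [Finset.mul_sum, ← Finset.sum_sub_distrib]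
    refine Finset.sum_congr rfl fun k _ => ?_
    simp only [hA, Matrix.of_apply, Matrix.conjTranspose_apply]
    apply Complex.ext
    · simp [Complex.mul_re, Complex.mul_im]
    · simp [Complex.mul_re, Complex.mul_im]; ring
  have h3 : ∀ i, inner ℝ (v i) (v i) = (1 : ℝ) := fun i => by rw [real_inner_self_eq_norm_sq, hv.1 i]; norm_num
  have h4 : ∀ i j, i ≠ j → inner ℝ (v i) (v j) = (0 : ℝ) := fun i j h => hv.2 h
  have h5 : (Complex.normSq A.det : ℂ) = ((1 - (C4.om (v 0) (v 1) ^ 2 + C4.om (v 0) (v 2) ^ 2 +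
      C4.om (v 0) (v 3) ^ 2 + C4.om (v 1) (v 2) ^ 2 + C4.om (v 1) (v 3) ^ 2 +
      C4.om (v 2) (v 3) ^ 2) + C4.pf v ^ 2 : ℝ) : ℂ) := by
    rw [h1, det_fin_four]
    simp only [h2, h3, h4 0 1 (by simp), h4 0 2 (by simp), h4 0 3 (by simp), h4 1 0 (by simp),
      h4 1 2 (by simp), h4 1 3 (by simp), h4 2 0 (by simp), h4 2 1 (by simp), h4 2 3 (by simp),
      h4 3 0 (by simp), h4 3 1 (by simp), h4 3 2 (by simp), C4.om_self,
      C4.om_swap (v 0) (v 1), C4.om_swap (v 0) (v 2), C4.om_swap (v 0) (v 3),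
      C4.om_swap (v 1) (v 2), C4.om_swap (v 1) (v 3), C4.om_swap (v 2) (v 3), C4.pf]
    push_cast
    ring_nf
    simp only [Complex.I_sq, Complex.I_pow_four]
    ring
  rw [Complex.ofReal_injective h5]
  have h7 : 2 * |C4.pf v| ≤ C4.om (v 0) (v 1) ^ 2 + C4.om (v 0) (v 2) ^ 2 +
      C4.om (v 0) (v 3) ^ 2 + C4.om (v 1) (v 2) ^ 2 + C4.om (v 1) (v 3) ^ 2 +
      C4.om (v 2) (v 3) ^ 2 := by
    rcases abs_cases (C4.pf v) with ⟨h, _⟩ | ⟨h, _⟩ <;> rw [h, C4.pf]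
    · nlinarith [sq_nonneg (C4.om (v 0) (v 1) - C4.om (v 2) (v 3)), sq_nonneg (C4.om (v 0) (v 2) + C4.om (v 1) (v 3)),
        sq_nonneg (C4.om (v 0) (v 3) - C4.om (v 1) (v 2))]
    · nlinarith [sq_nonneg (C4.om (v 0) (v 1) + C4.om (v 2) (v 3)), sq_nonneg (C4.om (v 0) (v 2) - C4.om (v 1) (v 3)),
        sq_nonneg (C4.om (v 0) (v 3) + C4.om (v 1) (v 2))]
  have h8 := sq_abs (C4.pf v)
  nlinarith

/-- The real and imaginary parts of the standard forms of `ℂ^4`, compared with the volume. -/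
theorem C4.abs_add_abs_sq_le_gram (P R : C4 [⋀^Fin 4]→ₗ[ℝ] ℝ) (hP : ∀ v, P v = C4.pf v)
    (hR : ∀ v : Fin 4 → C4, R v = (Matrix.det (Matrix.of fun i k => v i k)).re) (u : Fin 4 → C4) :
    (|P u| + |R u|) ^ 2 ≤ gram u := by
  by_cases h : LinearIndependent ℝ u
  · obtain ⟨b⟩ := exists_orthonormalBasis_span h
    obtain ⟨d, hd, -, hT⟩ := exists_scale h (fun i => Submodule.subset_span (mem_range_self i)) b
    have hb : Orthonormal ℝ (fun i => (b i : C4)) := b.orthonormal.comp_linearIsometry (Submodule.subtypeₗᵢ _)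
    have h3 : |R (fun i => (b i : C4))| ≤ 1 - |C4.pf fun i => (b i : C4)| := by
      rw [hR]
      refine abs_le_of_sq_le_sq (le_trans ?_ (C4.det_sq hb)) (by linarith [(C4.pf_bounds hb).1])
      rw [Complex.normSq_apply]
      nlinarith [sq_nonneg (Matrix.det (Matrix.of fun i k => (b i : C4) k)).im]
    rw [hT, hT, hd, abs_mul, abs_mul, ← mul_add, mul_pow, sq_abs, hP]
    have h4 : (|C4.pf fun i => (b i)| + |R fun i => (b i)|) ^ 2 ≤ 1 := by rw [sq_le_one_iff₀ (by positivity)]; linarith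
    nlinarith [sq_nonneg d]
  · rw [P.map_linearDependent u h, R.map_linearDependent u h, gram_eq_zero_of_not_linearIndependent h]
    simp

theorem C4.mem_span_of_pf_sq_eq (P : C4 [⋀^Fin 4]→ₗ[ℝ] ℝ) (hP : ∀ v, P v = C4.pf v)
    {u : Fin 4 → C4} (hu : gram u ≠ 0) (h : P u ^ 2 = gram u) (i : Fin 4) :
    Complex.I • u i ∈ Submodule.span ℝ (range u) := by
  have hl : LinearIndependent ℝ u := by by_contra h; exact hu (gram_eq_zero_of_not_linearIndependent h)
  obtain ⟨b⟩ := exists_orthonormalBasis_span hl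
  obtain ⟨d, hd, hd0, hT⟩ := exists_scale hl (fun i => Submodule.subset_span (mem_range_self i)) b
  have hb := b.orthonormal.comp_linearIsometry (Submodule.subtypeₗᵢ _)
  have h1 : C4.pf (fun i => (b i : C4)) ^ 2 = 1 := by
    rw [hd, hT, hP, mul_pow] at h
    exact mul_left_cancel₀ (pow_ne_zero 2 hd0) (by rw [h, mul_one])
  have h3 : ∀ j, Complex.I • (b j : C4) ∈ Submodule.span ℝ (range u) := fun j => by
    have e := eq_sum_of_sum_sq_eq hb (Complex.I • (b j : C4)) (by
      have hn : ‖(b j : C4)‖ = 1 := hb.1 j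
      simp only [C4.inner_I_smul, norm_smul, Complex.norm_I, hn]
      simpa [C4.om] using ((C4.pf_bounds hb).2.1 h1) j)
    rw [e]
    exact Submodule.sum_mem _ fun k _ => Submodule.smul_mem _ _ (b k).2
  have h4 : u i = ∑ j, b.repr ⟨u i, Submodule.subset_span ⟨i, rfl⟩⟩ j • (b j : C4) := by
    have := congrArg Subtype.val (b.sum_repr ⟨u i, Submodule.subset_span ⟨i, rfl⟩⟩)
    simpa using this.symm
  rw [h4, Finset.smul_sum]
  refine Submodule.sum_mem _ fun k _ => ?_
  rw [smul_comm]
  exact Submodule.smul_mem _ _ (h3 k)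

theorem C4.pf_sq_eq_of_mem_span (P : C4 [⋀^Fin 4]→ₗ[ℝ] ℝ) (hP : ∀ v, P v = C4.pf v)
    {u : Fin 4 → C4} (h : ∀ i, Complex.I • u i ∈ Submodule.span ℝ (range u)) :
    P u ^ 2 = gram u := by
  by_cases hl : LinearIndependent ℝ u
  · obtain ⟨b⟩ := exists_orthonormalBasis_span hl
    obtain ⟨d, hd, hd0, hT⟩ := exists_scale hl (fun i => Submodule.subset_span (mem_range_self i)) b
    have hb := b.orthonormal.comp_linearIsometry (Submodule.subtypeₗᵢ _)
    have h3 : ∀ x ∈ Submodule.span ℝ (range u), Complex.I • x ∈ Submodule.span ℝ (range u) := by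
      intro x hx
      induction hx using Submodule.span_induction with
      | mem x hx => obtain ⟨i, rfl⟩ := hx; exact h i
      | zero => simp
      | add x y _ _ h1 h2 => rw [smul_add]; exact Submodule.add_mem _ h1 h2
      | smul a x _ h1 => rw [smul_comm]; exact Submodule.smul_mem _ _ h1
    have h1 : C4.pf (fun i => (b i)) ^ 2 = 1 := by
      refine (C4.pf_bounds hb).2.2 fun i => ?_
      have e := b.sum_inner_mul_inner ⟨_, h3 _ (b i).2⟩ ⟨_, h3 _ (b i).2⟩
      simp only [Submodule.coe_inner, real_inner_self_eq_norm_sq, norm_smul, Complex.norm_I] at e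
      have hn : ‖(b i : C4)‖ = 1 := hb.1 i
      rw [hn] at e
      norm_num at e
      rw [← e]
      refine Finset.sum_congr rfl fun j _ => ?_
      rw [real_inner_comm _ (b j : C4), C4.inner_I_smul, sq]
      rfl
    rw [hd, hT, hP, mul_pow, h1, mul_one]
  · rw [P.map_linearDependent u hl, gram_eq_zero_of_not_linearIndependent hl]; norm_num

end

section

/-- The form `dx` as an alternating map. -/
def dxAlt {k : ℕ} (s : Fin k → Fin 7) : (Fin 7 → ℝ) [⋀^Fin k]→ₗ[ℝ] ℝ :=
  (Matrix.detRowAlternating).compLinearMap (LinearMap.funLeft ℝ ℝ s)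

def phiAlt : (Fin 7 → ℝ) [⋀^Fin 3]→ₗ[ℝ] ℝ :=
  dxAlt ![0, 1, 2] + dxAlt ![0, 3, 4] - dxAlt ![0, 5, 6] + dxAlt ![1, 3, 5] + dxAlt ![1, 4, 6]
    + dxAlt ![2, 3, 6] - dxAlt ![2, 4, 5]

def psiAlt : (Fin 7 → ℝ) [⋀^Fin 4]→ₗ[ℝ] ℝ :=
  dxAlt ![3, 4, 5, 6] - dxAlt ![1, 2, 3, 4] + dxAlt ![1, 2, 5, 6] + dxAlt ![0, 2, 3, 5]
    + dxAlt ![0, 2, 4, 6] - dxAlt ![0, 1, 3, 6] + dxAlt ![0, 1, 4, 5]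

/-- The cross product of `ℝ^7`. -/
def cross7 (x y : Fin 7 → ℝ) : Fin 7 → ℝ :=
  let m := fun a b : Fin 7 => x a * y b - x b * y a
  ![m 1 2 + m 3 4 - m 5 6, m 2 0 + m 3 5 + m 4 6, m 0 1 + m 3 6 - m 4 5,
    m 4 0 + m 5 1 + m 6 2, m 0 3 + m 6 1 - m 5 2, m 1 3 - m 6 0 - m 2 4, m 1 4 - m 0 5 + m 2 3]

theorem phi0_eq (x y z : Fin 7 → ℝ) : phi0 ![x, y, z] = ∑ k, cross7 x y k * z k := by
  simp [phi0, dx, cross7, Fin.sum_univ_succ, Matrix.det_fin_three]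
  ring

theorem cross7_sq (x y : Fin 7 → ℝ) : ∑ k, cross7 x y k ^ 2 = (∑ k, x k ^ 2) * (∑ k, y k ^ 2) - (∑ k, x k * y k) ^ 2 := by
  simp [cross7, Fin.sum_univ_succ]
  ring

theorem psi0_eq (w x y z : Fin 7 → ℝ) : psi0 ![w, x, y, z] =
    - ∑ k, cross7 x (cross7 y z) k * w k - (∑ k, x k * y k) * (∑ k, w k * z k) + (∑ k, x k * z k) * (∑ k, w k * y k) := by
  simp [psi0, dx, cross7, Fin.sum_univ_succ, det_fin_four]
  ring

theorem phi0_sq_le {x y z : Fin 7 → ℝ} (hx : ∑ k, x k ^ 2 ≤ 1) (hy : ∑ k, y k ^ 2 ≤ 1)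
    (hz : ∑ k, z k ^ 2 ≤ 1) : phi0 ![x, y, z] ^ 2 ≤ 1 := by
  rw [phi0_eq]
  have h1 := Finset.sum_mul_sq_le_sq_mul_sq Finset.univ (cross7 x y) z
  rw [cross7_sq] at h1
  have h2 := mul_le_one₀ hx (by positivity) hy
  nlinarith [sq_nonneg (∑ k, x k * y k), Finset.sum_nonneg fun k (_ : k ∈ Finset.univ) => sq_nonneg (z k)]

theorem psi0_sq_le {w x y z : Fin 7 → ℝ} (hx : ∑ k, x k ^ 2 ≤ 1) (hy : ∑ k, y k ^ 2 ≤ 1)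
    (hz : ∑ k, z k ^ 2 ≤ 1) (hxy : ∑ k, x k * y k = 0) (hxz : ∑ k, x k * z k = 0) :
    psi0 ![w, x, y, z] ^ 2 ≤ ∑ k, w k ^ 2 := by
  rw [psi0_eq, hxy, hxz]
  have h1 := Finset.sum_mul_sq_le_sq_mul_sq Finset.univ (cross7 x (cross7 y z)) w
  rw [cross7_sq, cross7_sq] at h1
  have h2 := mul_le_one₀ hy (by positivity) hz
  have h3 : ∑ k, cross7 y z k ^ 2 ≤ 1 := by rw [cross7_sq]; nlinarith [sq_nonneg (∑ k, y k * z k)]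
  have h4 := mul_le_one₀ hx (by positivity) h3
  rw [cross7_sq] at h4
  nlinarith [sq_nonneg (∑ k, x k * cross7 y z k), Finset.sum_nonneg fun k (_ : k ∈ Finset.univ) => sq_nonneg (w k)]

/-- `ℝ × ℝ^7` as an inner product space. -/
abbrev R8 : Type := WithLp 2 (ℝ × 𝔼 7)

theorem R8.inner_eq (x y : R8) : inner ℝ x y = x.fst * y.fst + ∑ k, x.snd k * y.snd k := by
  rw [WithLp.prod_inner_apply, PiLp.inner_apply]
  simp [mul_comm]

/-- Orthonormal frames adapted to the circle direction. -/
theorem R8.adapted_bounds {v : Fin 4 → R8} (hv : Orthonormal ℝ v)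
    (h0 : ∀ i, i ≠ 0 → (v i).fst = 0) (A B : R8 [⋀^Fin 4]→ₗ[ℝ] ℝ)
    (hA : ∀ u, A u = ∑ i : Fin 4, (-1 : ℝ) ^ (i : ℕ) * (u i).fst * phi0 (fun k => (u (i.succAbove k)).snd))
    (hB : ∀ u, B u = psi0 (fun k => (u k).snd)) :
    A v ^ 2 ≤ (v 0).fst ^ 2 ∧ B v ^ 2 ≤ 1 - (v 0).fst ^ 2 ∧ (v 0).fst ^ 2 ≤ 1 ∧ ((v 0).fst ^ 2 = 1 → (v 0).snd = 0) := by
  have hn : ∀ i, (v i).fst ^ 2 + ∑ k, (v i).snd k ^ 2 = 1 := fun i => by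
    have h := R8.inner_eq (v i) (v i)
    rw [real_inner_self_eq_norm_sq, hv.1 i] at h
    simp only [← sq] at h
    linarith
  have ho : ∀ i j, i ≠ j → i ≠ 0 → ∑ k, (v i).snd k * (v j).snd k = 0 := fun i j hij hi => by
    have h := R8.inner_eq (v i) (v j)
    rw [hv.2 hij, h0 i hi] at h
    linarith
  have h1 : ∀ i, i ≠ 0 → ∑ k, (v i).snd k ^ 2 ≤ 1 := fun i hi => by nlinarith [hn i, sq_nonneg (v i).fst]
  have hs : (v 0).fst ^ 2 ≤ 1 := by
    nlinarith [hn 0, Finset.sum_nonneg fun k (_ : k ∈ Finset.univ) => sq_nonneg ((v 0).snd k)]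
  refine ⟨?_, ?_, hs, fun h => ?_⟩
  · rw [hA, Fin.sum_univ_four, h0 1 (by simp), h0 2 (by simp), h0 3 (by simp)]
    have e : (fun k => (v ((0 : Fin 4).succAbove k)).snd.ofLp) = ![(v 1).snd.ofLp, (v 2).snd.ofLp, (v 3).snd.ofLp] := by
      funext k; fin_cases k <;> rfl
    rw [e]
    have := phi0_sq_le (h1 1 (by simp)) (h1 2 (by simp)) (h1 3 (by simp))
    simp only [Fin.val_zero, pow_zero, one_mul, mul_zero, zero_mul, add_zero, mul_pow]
    exact mul_le_of_le_one_right (sq_nonneg _) this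
  · rw [hB]
    have e : (fun k => (v k).snd.ofLp) = ![(v 0).snd.ofLp, (v 1).snd.ofLp, (v 2).snd.ofLp, (v 3).snd.ofLp] := by
      funext k; fin_cases k <;> rfl
    rw [e]
    refine (psi0_sq_le (h1 1 (by simp)) (h1 2 (by simp)) (h1 3 (by simp)) (ho 1 2 (by simp) (by simp))
      (ho 1 3 (by simp) (by simp))).trans ?_
    linarith [hn 0]
  · have h2 : ∑ k, (v 0).snd k ^ 2 = 0 := by linarith [hn 0]
    rw [Finset.sum_eq_zero_iff_of_nonneg fun k _ => sq_nonneg _] at h2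
    ext k
    simpa using h2 k (Finset.mem_univ k)

def R8.fstL : R8 →ₗ[ℝ] ℝ := (LinearMap.fst ℝ ℝ (𝔼 7)).comp (WithLp.linearEquiv 2 ℝ _).toLinearMap

def R8.sndL : R8 →ₗ[ℝ] (Fin 7 → ℝ) := (WithLp.linearEquiv 2 ℝ _).toLinearMap.comp
  ((LinearMap.snd ℝ ℝ (𝔼 7)).comp (WithLp.linearEquiv 2 ℝ _).toLinearMap)

def R8.thetaPhi : R8 [⋀^Fin 4]→ₗ[ℝ] ℝ := wedgeOneThree R8.fstL (phiAlt.compLinearMap R8.sndL)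

def R8.psi : R8 [⋀^Fin 4]→ₗ[ℝ] ℝ := psiAlt.compLinearMap R8.sndL

theorem R8.thetaPhi_apply (u : Fin 4 → R8) : R8.thetaPhi u = ∑ i : Fin 4, (-1 : ℝ) ^ (i : ℕ) *
    (u i).fst * phi0 (fun k => (u (i.succAbove k)).snd) := by
  rw [R8.thetaPhi, wedgeOneThree_apply]; rfl

theorem R8.psi_apply (u : Fin 4 → R8) : R8.psi u = psi0 (fun k => (u k).snd) := rfl

theorem R8.thetaPhi_sq_add_psi_sq_le (u : Fin 4 → R8) : R8.thetaPhi u ^ 2 + R8.psi u ^ 2 ≤ gram u := by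
  by_cases h : LinearIndependent ℝ u
  · obtain ⟨b, hb⟩ := exists_orthonormalBasis_adapted h R8.fstL
    obtain ⟨d, hd, -, hT⟩ := exists_scale h (fun i => Submodule.subset_span (mem_range_self i)) b
    have ho : Orthonormal ℝ (fun i => (b i : R8)) := b.orthonormal.comp_linearIsometry (Submodule.subtypeₗᵢ _)
    obtain ⟨h1, h2, -, -⟩ := R8.adapted_bounds ho hb R8.thetaPhi R8.psi R8.thetaPhi_apply R8.psi_apply
    rw [hT, hT, hd, mul_pow, mul_pow]
    nlinarith [sq_nonneg d]
  · rw [AlternatingMap.map_linearDependent _ u h, AlternatingMap.map_linearDependent _ u h,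
      gram_eq_zero_of_not_linearIndependent h]
    simp

theorem R8.fst_eq_zero_of_psi_sq_eq {u : Fin 4 → R8} (hu : gram u ≠ 0) (h : R8.psi u ^ 2 = gram u)
    (i : Fin 4) : (u i).fst = 0 := by
  have hl : LinearIndependent ℝ u := by by_contra h; exact hu (gram_eq_zero_of_not_linearIndependent h)
  obtain ⟨b, hb⟩ := exists_orthonormalBasis_adapted hl R8.fstL
  obtain ⟨d, hd, hd0, hT⟩ := exists_scale hl (fun i => Submodule.subset_span (mem_range_self i)) b
  have ho : Orthonormal ℝ (fun i => (b i : R8)) := b.orthonormal.comp_linearIsometry (Submodule.subtypeₗᵢ _)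
  obtain ⟨-, h2, -, -⟩ := R8.adapted_bounds ho hb R8.thetaPhi R8.psi R8.thetaPhi_apply R8.psi_apply
  have h1 : R8.psi (fun i => (b i : R8)) ^ 2 = 1 := by
    rw [hd, hT, mul_pow] at h
    exact mul_left_cancel₀ (pow_ne_zero 2 hd0) (by rw [h, mul_one])
  have h3 : (b 0 : R8).fst = 0 := by
    have : (b 0 : R8).fst ^ 2 = 0 := le_antisymm (by linarith) (sq_nonneg _)
    exact pow_eq_zero_iff two_ne_zero |>.1 this
  have h5 : R8.fstL (u i) = 0 := by
    rw [show u i = _ from (congrArg Subtype.val (b.sum_repr ⟨u i, Submodule.subset_span ⟨i, rfl⟩⟩)).symm]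
    simp only [Submodule.coe_sum, Submodule.coe_smul, map_sum, map_smul]
    refine Finset.sum_eq_zero fun j _ => ?_
    by_cases hj : j = 0
    · rw [hj, show R8.fstL (b 0) = 0 from h3, smul_zero]
    · rw [hb j hj, smul_zero]
  exact h5

theorem R8.mem_span_of_thetaPhi_sq_eq {u : Fin 4 → R8} (hu : gram u ≠ 0) (h : R8.thetaPhi u ^ 2 = gram u) :
    (WithLp.toLp 2 ((1 : ℝ), (0 : 𝔼 7)) : R8) ∈ Submodule.span ℝ (range u) := by
  have hl : LinearIndependent ℝ u := by by_contra h; exact hu (gram_eq_zero_of_not_linearIndependent h)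
  obtain ⟨b, hb⟩ := exists_orthonormalBasis_adapted hl R8.fstL
  obtain ⟨d, hd, hd0, hT⟩ := exists_scale hl (fun i => Submodule.subset_span (mem_range_self i)) b
  have ho : Orthonormal ℝ (fun i => (b i : R8)) := b.orthonormal.comp_linearIsometry (Submodule.subtypeₗᵢ _)
  obtain ⟨h2, -, h3, h4⟩ := R8.adapted_bounds ho hb R8.thetaPhi R8.psi R8.thetaPhi_apply R8.psi_apply
  have h1 : R8.thetaPhi (fun i => (b i : R8)) ^ 2 = 1 := by
    rw [hd, hT, mul_pow] at h
    exact mul_left_cancel₀ (pow_ne_zero 2 hd0) (by rw [h, mul_one])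
  have h5 := le_antisymm h3 (by linarith)
  have h7 : (WithLp.toLp 2 ((1 : ℝ), 0) : R8) = (b 0 : R8).fst • (b 0 : R8) := by
    apply (WithLp.linearEquiv 2 ℝ _).injective
    refine Prod.ext ?_ ?_
    · exact (h5.symm.trans (sq _))
    · change 0 = (b 0 : R8).fst • (b 0 : R8).snd
      rw [h4 h5, smul_zero]
  rw [h7]
  exact Submodule.smul_mem _ _ (b 0).2

end

section

theorem fderiv_mul_apply {f g : V → ℝ} {z : V} (hf : DifferentiableAt ℝ f z) (hg : DifferentiableAt ℝ g z) (x : V) :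
    fderiv ℝ (fun z => f z * g z) z x = fderiv ℝ f z x * g z + f z * fderiv ℝ g z x := by
  rw [fderiv_fun_mul hf hg]
  simp only [add_apply, smul_apply, smul_eq_mul]
  ring

theorem closed_wedgeOneThree_aux (γ : V → V → ℝ) (Φ : V → V → V → V → ℝ) (z0 : V)
    (dγ : ∀ a, DifferentiableAt ℝ (fun z => γ z a) z0)
    (dΦ : ∀ a b c, DifferentiableAt ℝ (fun z => Φ z a b c) z0)
    (hγ : ∀ a b, fderiv ℝ (fun z => γ z b) z0 a - fderiv ℝ (fun z => γ z a) z0 b = 0)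
    (hΦ : ∀ a b c d, fderiv ℝ (fun z => Φ z b c d) z0 a - fderiv ℝ (fun z => Φ z a c d) z0 b
      + fderiv ℝ (fun z => Φ z a b d) z0 c - fderiv ℝ (fun z => Φ z a b c) z0 d = 0)
    (v : Fin 5 → V) :
    ∑ i : Fin 5, (-1 : ℝ) ^ (i : ℕ) * fderiv ℝ (fun z =>
      γ z (v (i.succAbove 0)) * Φ z (v (i.succAbove 1)) (v (i.succAbove 2)) (v (i.succAbove 3))
      - γ z (v (i.succAbove 1)) * Φ z (v (i.succAbove 0)) (v (i.succAbove 2)) (v (i.succAbove 3))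
      + γ z (v (i.succAbove 2)) * Φ z (v (i.succAbove 0)) (v (i.succAbove 1)) (v (i.succAbove 3))
      - γ z (v (i.succAbove 3)) * Φ z (v (i.succAbove 0)) (v (i.succAbove 1)) (v (i.succAbove 2)))
      z0 (v i) = 0 := by
  have key : ∀ a b c d x : V, fderiv ℝ (fun z => γ z a * Φ z b c d - γ z b * Φ z a c d
      + γ z c * Φ z a b d - γ z d * Φ z a b c) z0 x =
      (fderiv ℝ (fun z => γ z a) z0 x * Φ z0 b c d + γ z0 a * fderiv ℝ (fun z => Φ z b c d) z0 x)
      - (fderiv ℝ (fun z => γ z b) z0 x * Φ z0 a c d + γ z0 b * fderiv ℝ (fun z => Φ z a c d) z0 x)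
      + (fderiv ℝ (fun z => γ z c) z0 x * Φ z0 a b d + γ z0 c * fderiv ℝ (fun z => Φ z a b d) z0 x)
      - (fderiv ℝ (fun z => γ z d) z0 x * Φ z0 a b c + γ z0 d * fderiv ℝ (fun z => Φ z a b c) z0 x) := by
    intro a b c d x
    have e1 := (dγ a).fun_mul (dΦ b c d)
    have e2 := (dγ b).fun_mul (dΦ a c d)
    have e3 := (dγ c).fun_mul (dΦ a b d)
    rw [fderiv_fun_sub ((e1.fun_sub e2).fun_add e3) ((dγ d).fun_mul (dΦ a b c)), fderiv_fun_add (e1.fun_sub e2) e3,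
      fderiv_fun_sub e1 e2]
    simp only [add_apply, sub_apply]
    rw [fderiv_mul_apply (dγ a) (dΦ b c d), fderiv_mul_apply (dγ b) (dΦ a c d),
      fderiv_mul_apply (dγ c) (dΦ a b d), fderiv_mul_apply (dγ d) (dΦ a b c)]
  simp only [key, Fin.sum_univ_five, show (0 : Fin 5).succAbove 0 = 1 from rfl,
    show (0 : Fin 5).succAbove 1 = 2 from rfl,
    show (0 : Fin 5).succAbove 2 = 3 from rfl,
    show (0 : Fin 5).succAbove 3 = 4 from rfl,
    show (1 : Fin 5).succAbove 0 = 0 from rfl,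
    show (1 : Fin 5).succAbove 1 = 2 from rfl,
    show (1 : Fin 5).succAbove 2 = 3 from rfl,
    show (1 : Fin 5).succAbove 3 = 4 from rfl,
    show (2 : Fin 5).succAbove 0 = 0 from rfl,
    show (2 : Fin 5).succAbove 1 = 1 from rfl,
    show (2 : Fin 5).succAbove 2 = 3 from rfl,
    show (2 : Fin 5).succAbove 3 = 4 from rfl,
    show (3 : Fin 5).succAbove 0 = 0 from rfl,
    show (3 : Fin 5).succAbove 1 = 1 from rfl,
    show (3 : Fin 5).succAbove 2 = 2 from rfl,
    show (3 : Fin 5).succAbove 3 = 4 from rfl,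
    show (4 : Fin 5).succAbove 0 = 0 from rfl,
    show (4 : Fin 5).succAbove 1 = 1 from rfl,
    show (4 : Fin 5).succAbove 2 = 2 from rfl,
    show (4 : Fin 5).succAbove 3 = 3 from rfl]
  norm_num
  linear_combination hγ (v 0) (v 1) * Φ z0 (v 2) (v 3) (v 4) - hγ (v 0) (v 2) * Φ z0 (v 1) (v 3) (v 4)
      + hγ (v 0) (v 3) * Φ z0 (v 1) (v 2) (v 4)
      - hγ (v 0) (v 4) * Φ z0 (v 1) (v 2) (v 3)
      + hγ (v 1) (v 2) * Φ z0 (v 0) (v 3) (v 4)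
      - hγ (v 1) (v 3) * Φ z0 (v 0) (v 2) (v 4)
      + hγ (v 1) (v 4) * Φ z0 (v 0) (v 2) (v 3)
      + hγ (v 2) (v 3) * Φ z0 (v 0) (v 1) (v 4)
      - hγ (v 2) (v 4) * Φ z0 (v 0) (v 1) (v 3)
      + hγ (v 3) (v 4) * Φ z0 (v 0) (v 1) (v 2)
      - γ z0 (v 0) * hΦ (v 1) (v 2) (v 3) (v 4)
      + γ z0 (v 1) * hΦ (v 0) (v 2) (v 3) (v 4)
      - γ z0 (v 2) * hΦ (v 0) (v 1) (v 3) (v 4)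
      + γ z0 (v 3) * hΦ (v 0) (v 1) (v 2) (v 4)
      - γ z0 (v 4) * hΦ (v 0) (v 1) (v 2) (v 3)

theorem closed_halfSquare_aux (B : V → V → V → ℝ) (z0 : V) (dB : ∀ a b, DifferentiableAt ℝ (fun z => B z a b) z0)
    (hB : ∀ a b c, fderiv ℝ (fun z => B z b c) z0 a - fderiv ℝ (fun z => B z a c) z0 b
      + fderiv ℝ (fun z => B z a b) z0 c = 0)
    (v : Fin 5 → V) :
    ∑ i : Fin 5, (-1 : ℝ) ^ (i : ℕ) * fderiv ℝ (fun z =>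
      B z (v (i.succAbove 0)) (v (i.succAbove 1)) * B z (v (i.succAbove 2)) (v (i.succAbove 3))
      - B z (v (i.succAbove 0)) (v (i.succAbove 2)) * B z (v (i.succAbove 1)) (v (i.succAbove 3))
      + B z (v (i.succAbove 0)) (v (i.succAbove 3)) * B z (v (i.succAbove 1)) (v (i.succAbove 2)))
      z0 (v i) = 0 := by
  have key : ∀ a b c d x : V, fderiv ℝ (fun z => B z a b * B z c d - B z a c * B z b d + B z a d * B z b c) z0 x =
      (fderiv ℝ (fun z => B z a b) z0 x * B z0 c d + B z0 a b * fderiv ℝ (fun z => B z c d) z0 x)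
      - (fderiv ℝ (fun z => B z a c) z0 x * B z0 b d + B z0 a c * fderiv ℝ (fun z => B z b d) z0 x)
      + (fderiv ℝ (fun z => B z a d) z0 x * B z0 b c + B z0 a d * fderiv ℝ (fun z => B z b c) z0 x) := by
    intro a b c d x
    have e1 := (dB a b).fun_mul (dB c d)
    have e2 := (dB a c).fun_mul (dB b d)
    rw [fderiv_fun_add (e1.fun_sub e2) ((dB a d).fun_mul (dB b c)), fderiv_fun_sub e1 e2]
    simp only [add_apply, sub_apply]
    rw [fderiv_mul_apply (dB a b) (dB c d), fderiv_mul_apply (dB a c) (dB b d), fderiv_mul_apply (dB a d) (dB b c)]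
  simp only [key, Fin.sum_univ_five, show (0 : Fin 5).succAbove 0 = 1 from rfl,
    show (0 : Fin 5).succAbove 1 = 2 from rfl,
    show (0 : Fin 5).succAbove 2 = 3 from rfl,
    show (0 : Fin 5).succAbove 3 = 4 from rfl,
    show (1 : Fin 5).succAbove 0 = 0 from rfl,
    show (1 : Fin 5).succAbove 1 = 2 from rfl,
    show (1 : Fin 5).succAbove 2 = 3 from rfl,
    show (1 : Fin 5).succAbove 3 = 4 from rfl,
    show (2 : Fin 5).succAbove 0 = 0 from rfl,
    show (2 : Fin 5).succAbove 1 = 1 from rfl,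
    show (2 : Fin 5).succAbove 2 = 3 from rfl,
    show (2 : Fin 5).succAbove 3 = 4 from rfl,
    show (3 : Fin 5).succAbove 0 = 0 from rfl,
    show (3 : Fin 5).succAbove 1 = 1 from rfl,
    show (3 : Fin 5).succAbove 2 = 2 from rfl,
    show (3 : Fin 5).succAbove 3 = 4 from rfl,
    show (4 : Fin 5).succAbove 0 = 0 from rfl,
    show (4 : Fin 5).succAbove 1 = 1 from rfl,
    show (4 : Fin 5).succAbove 2 = 2 from rfl,
    show (4 : Fin 5).succAbove 3 = 3 from rfl]
  norm_num
  linear_combination B z0 (v 0) (v 1) * hB (v 2) (v 3) (v 4) - B z0 (v 0) (v 2) * hB (v 1) (v 3) (v 4)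
      + B z0 (v 0) (v 3) * hB (v 1) (v 2) (v 4)
      - B z0 (v 0) (v 4) * hB (v 1) (v 2) (v 3)
      + B z0 (v 1) (v 2) * hB (v 0) (v 3) (v 4)
      - B z0 (v 1) (v 3) * hB (v 0) (v 2) (v 4)
      + B z0 (v 1) (v 4) * hB (v 0) (v 2) (v 3)
      + B z0 (v 2) (v 3) * hB (v 0) (v 1) (v 4)
      - B z0 (v 2) (v 4) * hB (v 0) (v 1) (v 3)
      + B z0 (v 3) (v 4) * hB (v 0) (v 1) (v 2)

end

section

variable {E : Type*} [NormedAddCommGroup E] [NormedSpace ℝ E]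
  {H : Type*} [TopologicalSpace H] {I : ModelWithCorners ℝ E H}
  {M : Type*} [TopologicalSpace M] [ChartedSpace H M]

/-- Fields of alternating forms. -/
abbrev AltField (I : ModelWithCorners ℝ E H) (M : Type*) [TopologicalSpace M] [ChartedSpace H M]
    (k : ℕ) : Type _ := ∀ x : M, TangentSpace I x [⋀^Fin k]→ₗ[ℝ] ℝ

/-- The values of a field of alternating forms. -/
def AltField.field {k : ℕ} (T : AltField I M k) : TensorField I M k ℝ := fun x u => T x u

theorem vec_two {A : Type*} (w : Fin 2 → A) : w = ![w 0, w 1] := by funext i; fin_cases i <;> rfl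

theorem vec_three {A : Type*} (w : Fin 3 → A) : w = ![w 0, w 1, w 2] := by funext i; fin_cases i <;> rfl

theorem halfSquare_smoothOnMaps {η : AltField I M 2} (h : SmoothOnMaps η.field) :
    SmoothOnMaps (AltField.field fun x => halfSquare (η x)) := by
  intro V _ _ G z0 hG u
  have h' : ∀ a b : V, ContDiffAt ℝ ∞ (fun z => η (G z) ![mfderiv% G z a, mfderiv% G z b]) z0 := fun a b => by
    have := h V G z0 hG ![a, b]
    refine this.congr_of_eventuallyEq (Eventually.of_forall fun z => ?_)
    exact congrArg (η (G z)) (funext fun i => by fin_cases i <;> rfl)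
  exact (((h' _ _).mul (h' _ _)).sub ((h' _ _).mul (h' _ _))).add ((h' _ _).mul (h' _ _))

theorem halfSquare_closedOnMaps {η : AltField I M 2} (h : SmoothOnMaps η.field)
    (hc : ClosedOnMaps η.field) : ClosedOnMaps (AltField.field fun x => halfSquare (η x)) := by
  refine fun V _ _ G z0 hG v => (closed_halfSquare_aux (fun z a b => η (G z) ![mfderiv% G z a,
      mfderiv% G z b]) z0 (fun a b => ?_) (fun a b c => ?_) v)
  · have := h V G z0 hG ![a, b]
    refine (this.congr_of_eventuallyEq (Eventually.of_forall fun z => ?_)).diffAt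
    exact congrArg (η (G z)) (funext fun i => by fin_cases i <;> rfl)
  · have := hc V G z0 hG ![a, b, c]
    rw [Fin.sum_univ_three] at this
    refine Eq.trans ?_ this
    have e : ∀ i : Fin 3, (fun z => η.field (G z) (fun j => mfderiv% G z ((![a, b, c]) (i.succAbove j)))) =
        fun z => η (G z) ![mfderiv% G z _, mfderiv% G z _] := fun i => by
      funext z
      exact congrArg (η (G z)) (vec_two _)
    rw [e, e, e]
    change _ = (-1) ^ 0 * fderiv ℝ (fun z => η (G z) ![mfderiv% G z b,
      mfderiv% G z c]) z0 a + (-1) ^ 1 * fderiv ℝ (fun z => η (G z)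
      ![mfderiv% G z a, mfderiv% G z c]) z0 b + (-1) ^ 2 * fderiv ℝ (fun z =>
      η (G z) ![mfderiv% G z a, mfderiv% G z b]) z0 c
    ring

theorem wedgeOneThree_eq {W : Type*} [AddCommGroup W] [Module ℝ W] (c : W →ₗ[ℝ] ℝ)
    (φ : W [⋀^Fin 3]→ₗ[ℝ] ℝ) (u : Fin 4 → W) : wedgeOneThree c φ u =
      c (u 0) * φ ![u 1, u 2, u 3] - c (u 1) * φ ![u 0, u 2, u 3] + c (u 2) * φ ![u 0, u 1, u 3]
      - c (u 3) * φ ![u 0, u 1, u 2] := by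
  rw [wedgeOneThree_apply, Fin.sum_univ_four, vec_three fun k => u _, vec_three fun k => u _, vec_three fun k => u _,
    vec_three fun k => u _]
  change (-1 : ℝ) ^ 0 * c (u 0) * φ ![u 1, u 2, u 3] + (-1 : ℝ) ^ 1 * c (u 1) * φ ![u 0, u 2, u 3]
    + (-1) ^ 2 * c (u 2) * φ ![u 0, u 1, u 3] + (-1) ^ 3 * c (u 3) * φ ![u 0, u 1, u 2] = _
  ring

theorem wedgeOneThree_smoothOnMaps {c : ∀ x : M, TangentSpace I x →ₗ[ℝ] ℝ} {φ : AltField I M 3}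
    (hc : SmoothOnMaps (fun x (u : Fin 1 → TangentSpace I x) => c x (u 0)))
    (h : SmoothOnMaps φ.field) :
    SmoothOnMaps (AltField.field fun x => wedgeOneThree (c x) (φ x)) := by
  intro V _ _ G z0 hG u
  have h' : ∀ a b d : V, ContDiffAt ℝ ∞ (fun z => φ (G z) ![mfderiv% G z a,
      mfderiv% G z b, mfderiv% G z d]) z0 := fun a b d => by
    have := h V G z0 hG ![a, b, d]
    refine this.congr_of_eventuallyEq (Eventually.of_forall fun z => ?_)
    exact congrArg (φ (G z)) (funext fun i => by fin_cases i <;> rfl)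
  have hc' := fun a => hc V G z0 hG ![a]
  refine ((((hc' _).mul (h' _ _ _)).sub ((hc' _).mul (h' _ _ _))).add
    ((hc' _).mul (h' _ _ _))).sub ((hc' _).mul (h' _ _ _)) |>.congr_of_eventuallyEq
    (Eventually.of_forall fun z => wedgeOneThree_eq _ _ _)

theorem wedgeOneThree_closedOnMaps {c : ∀ x : M, TangentSpace I x →ₗ[ℝ] ℝ} {φ : AltField I M 3}
    (hc : SmoothOnMaps (fun x (u : Fin 1 → TangentSpace I x) => c x (u 0)))
    (h : SmoothOnMaps φ.field)
    (hcc : ClosedOnMaps (fun x (u : Fin 1 → TangentSpace I x) => c x (u 0)))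
    (hcl : ClosedOnMaps φ.field) :
    ClosedOnMaps (AltField.field fun x => wedgeOneThree (c x) (φ x)) := by
  intro V _ _ G z0 hG v
  have e : ∀ i : Fin 5, (fun z => (AltField.field fun x => wedgeOneThree (c x) (φ x)) (G z)
      (fun j => mfderiv% G z (v (i.succAbove j)))) = _ := fun i =>
    funext fun z => wedgeOneThree_eq (c (G z)) (φ (G z)) _
  simp only [e]
  refine (closed_wedgeOneThree_aux (fun z a => c (G z) _) (fun z a b d => φ (G z) ![mfderiv% G z a,
      mfderiv% G z b, mfderiv% G z d]) z0 (fun a => ?_) (fun a b d => ?_)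
      (fun a b => ?_) (fun a b d f => ?_) v)
  · exact (hc V G z0 hG ![a]).diffAt
  · have := h V G z0 hG ![a, b, d]
    refine (this.congr_of_eventuallyEq (Eventually.of_forall fun z => ?_)).diffAt
    exact congrArg (φ (G z)) (funext fun i => by fin_cases i <;> rfl)
  · have := hcc V G z0 hG ![a, b]
    rw [Fin.sum_univ_two] at this
    refine Eq.trans ?_ this
    change _ = (-1 : ℝ) ^ 0 * fderiv ℝ (fun z => c (G z) (mfderiv% G z b)) z0 a
      + (-1 : ℝ) ^ 1 * fderiv ℝ (fun z => c (G z) (mfderiv% G z a)) z0 b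
    ring
  · have := hcl V G z0 hG ![a, b, d, f]
    rw [Fin.sum_univ_four] at this
    refine Eq.trans ?_ this
    have e : ∀ i : Fin 4, (fun z => φ.field (G z) (fun j => mfderiv% G z ((![a, b, d, f]) (i.succAbove j)))) =
        fun z => φ (G z) ![mfderiv% G z _, mfderiv% G z _, mfderiv% G z _] := fun i => by
      funext z
      exact congrArg (φ (G z)) (vec_three _)
    rw [e, e, e, e]
    change _ = (-1 : ℝ) ^ 0 * fderiv ℝ (fun z => φ (G z) ![mfderiv% G z b,
      mfderiv% G z d, mfderiv% G z f]) z0 a + (-1 : ℝ) ^ 1 * fderiv ℝ (fun z =>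
      φ (G z) ![mfderiv% G z a, mfderiv% G z d, mfderiv% G z f]) z0 b
      + (-1 : ℝ) ^ 2 * fderiv ℝ (fun z => φ (G z) ![mfderiv% G z a,
      mfderiv% G z b, mfderiv% G z f]) z0 d + (-1 : ℝ) ^ 3 * fderiv ℝ (fun z =>
      φ (G z) ![mfderiv% G z a, mfderiv% G z b, mfderiv% G z d]) z0 f
    ring

end

section

theorem finrank_complex_fact : Fact (Module.finrank ℝ ℂ = 1 + 1) := ⟨Complex.finrank_real_complex⟩

attribute [local instance] finrank_complex_fact

theorem contMDiff_circle_coe : ContMDiff (𝓡 1) 𝓘(ℝ, ℂ) ∞ (fun z : Circle => (z : ℂ)) := contMDiff_coe_sphere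

theorem mdifferentiableAt_circle_coe (p : Circle) : MDifferentiableAt (𝓡 1) 𝓘(ℝ, ℂ) (fun z : Circle => (z : ℂ)) p :=
  contMDiff_circle_coe.mdiffAt

/-- The differential of the inclusion of the circle. -/
def circleD (p : Circle) : TangentSpace (𝓡 1) p →L[ℝ] ℂ := mfderiv (𝓡 1) 𝓘(ℝ, ℂ) (fun z : Circle => (z : ℂ)) p

theorem dtheta_eq (p : Circle) (u : TangentSpace (𝓡 1) p) : dtheta p u = (starRingEnd ℂ (p : ℂ) * circleD p u).im := rfl

theorem circleD_re (p : Circle) (u : TangentSpace (𝓡 1) p) : (starRingEnd ℂ (p : ℂ) * circleD p u).re = 0 := by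
  have h := range_mvfderiv_subtypeVal (E := ℂ) (n := 1) p
  have h1 : circleD p u ∈ (ℝ ∙ (p : ℂ))ᗮ := by rw [← h]; exact ⟨u, rfl⟩
  have h2 := Submodule.mem_orthogonal_singleton_iff_inner_right.1 h1
  rw [Complex.inner, mul_comm] at h2
  exact h2

theorem circle_conj_mul (p : Circle) : starRingEnd ℂ (p : ℂ) * (p : ℂ) = 1 := by
  rw [mul_comm, Complex.mul_conj, Circle.normSq_coe]; simp

theorem circleD_eq (p : Circle) (u : TangentSpace (𝓡 1) p) : circleD p u = (dtheta p u : ℂ) * Complex.I * p := by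
  have h1 : starRingEnd ℂ (p : ℂ) * circleD p u = (dtheta p u : ℂ) * Complex.I := by
    apply Complex.ext
    · rw [circleD_re]; simp
    · rw [← dtheta_eq]; simp
  have := congrArg (fun w => (p : ℂ) * w) h1
  simp only [← mul_assoc] at this
  rw [mul_comm (p : ℂ) _, circle_conj_mul, one_mul] at this
  rw [this]; ring

theorem dtheta_eq_zero (p : Circle) {u : TangentSpace (𝓡 1) p} (h : dtheta p u = 0) : u = 0 := by
  have h1 : circleD p u = circleD p 0 := by rw [circleD_eq, h, map_zero]; simp
  exact injective_mvfderiv_subtypeVal_sphere p h1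

/-- The form `dθ` as a linear map. -/
def dthetaL (p : Circle) : TangentSpace (𝓡 1) p →ₗ[ℝ] ℝ where
  toFun := dtheta p
  map_add' u v := by simp only [dtheta_eq, map_add, mul_add, Complex.add_im]
  map_smul' r u := by simp only [dtheta_eq, map_smul, mul_smul_comm, RingHom.id_apply, Complex.smul_im]

variable {EA : Type*} [NormedAddCommGroup EA] [NormedSpace ℝ EA]
  {HA : Type*} [TopologicalSpace HA] {IA : ModelWithCorners ℝ EA HA}
  {A : Type*} [TopologicalSpace A] [ChartedSpace HA A]

theorem circleD_mfderiv {c : A → Circle} {a : A} (hc : MDifferentiableAt IA (𝓡 1) c a)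
    (v : TangentSpace IA a) : circleD (c a) (mfderiv IA (𝓡 1) c a v) =
      mfderiv IA 𝓘(ℝ, ℂ) (fun x => (c x : ℂ)) a v := ((mfderiv_comp a (mdifferentiableAt_circle_coe (c a)) hc).app v).symm

theorem dtheta_mfderiv {c : A → Circle} {a : A} (hc : MDifferentiableAt IA (𝓡 1) c a)
    (v : TangentSpace IA a) : dtheta (c a) (mfderiv IA (𝓡 1) c a v) =
      (starRingEnd ℂ ((c a : Circle) : ℂ) * id (α := ℂ) (mfderiv IA 𝓘(ℝ, ℂ) (fun x => (c x : ℂ)) a v)).im := congrArg (fun w : ℂ => (starRingEnd ℂ _ * w).im) (circleD_mfderiv hc v)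

theorem coe_circle_mfderiv {c : A → Circle} {a : A} (hc : MDifferentiableAt IA (𝓡 1) c a)
    (v : TangentSpace IA a) : (mfderiv IA 𝓘(ℝ, ℂ) (fun x => (c x : ℂ)) a v : ℂ) =
      (dtheta (c a) (mfderiv IA (𝓡 1) c a v) : ℂ) * Complex.I * ((c a : Circle) : ℂ) :=
  (circleD_mfderiv hc v).symm.trans (circleD_eq _ _)

theorem contDiffAt_coe_circle {c : V → Circle} {z : V} {n : ℕ∞} (hc : ContMDiffAt 𝓘(ℝ, V) (𝓡 1) n c z) :
    ContDiffAt ℝ n (fun z => (c z : ℂ)) z :=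
  contMDiffAt_iff_contDiffAt.1 (((contMDiff_circle_coe.of_le (by exact_mod_cast le_top)).contMDiffAt).comp z hc)

theorem eventually_contMDiffAt_one {E : Type*} [NormedAddCommGroup E] [NormedSpace ℝ E]
    {H : Type*} [TopologicalSpace H] {I : ModelWithCorners ℝ E H}
    {M : Type*} [TopologicalSpace M] [ChartedSpace H M] [IsManifold I ∞ M] {G : V → M} {z0 : V}
    (hG : ContMDiffAt 𝓘(ℝ, V) I ∞ G z0) : ∀ᶠ z in 𝓝 z0, MDifferentiableAt 𝓘(ℝ, V) I G z := by
  have := isManifold_one (I := I) (M := M)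
  filter_upwards [(contMDiffAt_iff_contMDiffAt_nhds (by simp)).1 (hG.of_le (m := 1) (by exact_mod_cast le_top))] with z hz
  exact hz.mdiffAt

theorem dtheta_pull_eventually {c : V → Circle} {z0 : V} (hc : ContMDiffAt 𝓘(ℝ, V) (𝓡 1) ∞ c z0) : ∀ᶠ z in 𝓝 z0, ∀ v : V,
      dtheta (c z) (mfderiv 𝓘(ℝ, V) (𝓡 1) c z v) = (starRingEnd ℂ (c z : ℂ) * fderiv ℝ (fun x => (c x : ℂ)) z v).im := by
  have : IsManifold (𝓡 1) ∞ Circle := IsManifold.of_le (n := ω) (by simp)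
  filter_upwards [eventually_contMDiffAt_one hc] with z hz v
  refine (dtheta_mfderiv hz v).trans ?_
  rw [mfderiv_eq_fderiv]
  rfl

theorem dtheta_smooth {c : V → Circle} {z0 : V} (hc : ContMDiffAt 𝓘(ℝ, V) (𝓡 1) ∞ c z0) (v : V) :
    ContDiffAt ℝ ∞ (fun z => dtheta (c z) (mfderiv 𝓘(ℝ, V) (𝓡 1) c z v)) z0 := by
  have h := contDiffAt_coe_circle hc
  have h1 : ContDiffAt ℝ ∞ (fun z => fderiv ℝ _ z v) z0 := (h.fderiv_right (by simp)).clm_apply contDiffAt_const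
  refine (Complex.imCLM.contDiff.contDiffAt.comp z0 ((Complex.conjCLE.contDiff.contDiffAt.comp z0 h).mul h1)).congr_of_eventuallyEq ?_
  filter_upwards [dtheta_pull_eventually hc] with z hz using hz v

theorem dtheta_closed {c : V → Circle} {z0 : V} (hc : ContMDiffAt 𝓘(ℝ, V) (𝓡 1) ∞ c z0) (a b : V) :
    fderiv ℝ (fun z => dtheta (c z) (mfderiv 𝓘(ℝ, V) (𝓡 1) c z b)) z0 a =
    fderiv ℝ (fun z => dtheta (c z) (mfderiv 𝓘(ℝ, V) (𝓡 1) c z a)) z0 b := by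
  have h := contDiffAt_coe_circle hc
  set C : V → ℂ := fun z => (c z : ℂ) with hC
  have key : ∀ a b : V, fderiv ℝ (fun z => dtheta (c z) (mfderiv% c z b)) z0 a =
      (starRingEnd ℂ (fderiv ℝ C z0 a) * fderiv ℝ C z0 b + starRingEnd ℂ (C z0) * fderiv ℝ (fderiv ℝ C) z0 a b).im := by
    intro a b
    have e : (fun z => dtheta (c z) (mfderiv% c z b)) =ᶠ[𝓝 z0]
        fun z => Complex.imCLM (starRingEnd ℂ (C z) * fderiv ℝ C z b) := by
      filter_upwards [dtheta_pull_eventually hc] with z hz using hz b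
    rw [e.fderiv_eq]
    refine (congrArg (fun A => A a)
      (Complex.imCLM.hasFDerivAt.comp z0 ((Complex.conjCLE.hasFDerivAt.comp z0 h.diffAt.hasFDerivAt).mul ((ContinuousLinearMap.apply ℝ ℂ b).hasFDerivAt.comp z0 (((h.fderiv_right (m := ∞) (by simp)).diffAt)).hasFDerivAt))).fderiv).trans ?_
    simp
    ring
  have hs := (h.isSymmSndFDerivAt (by
    rw [minSmoothness_of_isRCLikeNormedField]
    exact WithTop.coe_le_coe.2 (le_top))).eq a b
  have hm := (eventually_contMDiffAt_one (by
    have : IsManifold (𝓡 1) ∞ Circle := IsManifold.of_le (n := ω) (by simp)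
    exact hc)).self_of_nhds
  have hv : ∀ a : V, ∃ t : ℝ, fderiv ℝ C z0 a = (t : ℂ) * Complex.I * C z0 := fun a =>
    ⟨_, (congrArg (fun A : V →L[ℝ] ℂ => A a) (mfderiv_eq_fderiv).symm).trans (coe_circle_mfderiv hm a)⟩
  obtain ⟨s, hs'⟩ := hv a
  obtain ⟨t, ht⟩ := hv b
  rw [key a b, key b a, hs, hs', ht]
  simp [Complex.mul_im, Complex.mul_re]
  ring

end

section

variable {M : Type*} [TopologicalSpace M] [ChartedSpace (𝔼 7) M]

theorem circlePart_eq (z : Circle × M) (u : TangentSpace 𝓒(𝓡 7) z) : circlePart z u = dtheta z.1 (u : 𝔼 1 × 𝔼 7).1 := by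
  rw [circlePart, mfderiv_fst]; rfl

theorem basePart_eq (z : Circle × M) (u : TangentSpace 𝓒(𝓡 7) z) : basePart z u = (u : 𝔼 1 × 𝔼 7).2 := by
  rw [basePart, mfderiv_snd]; rfl

/-- The `S^1`-component as a linear map. -/
def circlePartL (z : Circle × M) : TangentSpace 𝓒(𝓡 7) z →ₗ[ℝ] ℝ :=
  (dthetaL z.1).comp (mfderiv 𝓒(𝓡 7) (𝓡 1) (Prod.fst : Circle × M → Circle) z).toLinearMap

/-- The `M`-component as a linear map. -/
def basePartL (z : Circle × M) : TangentSpace 𝓒(𝓡 7) z →ₗ[ℝ] TangentSpace (𝓡 7) z.2 :=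
  (mfderiv 𝓒(𝓡 7) (𝓡 7) (Prod.snd : Circle × M → M) z).toLinearMap

theorem circlePartL_apply (z : Circle × M) (u : TangentSpace 𝓒(𝓡 7) z) : circlePartL z u = circlePart z u := rfl

theorem basePartL_apply (z : Circle × M) (u : TangentSpace 𝓒(𝓡 7) z) : basePartL z u = basePart z u := rfl

theorem eq_zero_of_parts (z : Circle × M) (u : TangentSpace 𝓒(𝓡 7) z)
    (h1 : circlePart z u = 0) (h2 : basePart z u = 0) : u = 0 := by
  rw [circlePart_eq] at h1
  rw [basePart_eq] at h2
  exact Prod.ext (dtheta_eq_zero _ h1) h2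

variable {EA : Type*} [NormedAddCommGroup EA] [NormedSpace ℝ EA]
  {HA : Type*} [TopologicalSpace HA] {IA : ModelWithCorners ℝ EA HA}
  {A : Type*} [TopologicalSpace A] [ChartedSpace HA A]

theorem circlePart_mfderiv {h : A → Circle × M} {a : A} (hh : MDifferentiableAt IA 𝓒(𝓡 7) h a) (v : TangentSpace IA a) :
    circlePart (h a) (mfderiv IA 𝓒(𝓡 7) h a v) = dtheta (h a).1 (mfderiv IA (𝓡 1) (fun x => (h x).1) a v) := by
  rw [circlePart]
  exact congrArg (fun B : TangentSpace IA a →L[ℝ] TangentSpace (𝓡 1) (h a).1 =>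
    dtheta (h a).1 (B v)) (mfderiv_comp a (mdifferentiableAt_fst) hh).symm

theorem basePart_mfderiv {h : A → Circle × M} {a : A} (hh : MDifferentiableAt IA 𝓒(𝓡 7) h a) (v : TangentSpace IA a) :
    basePart (h a) (mfderiv IA 𝓒(𝓡 7) h a v) =
      mfderiv IA (𝓡 7) (fun x => (h x).2) a v := (mfderiv_comp a (mdifferentiableAt_snd) hh).symm.app v

variable [IsManifold (𝓡 7) ∞ M]

instance : IsManifold (𝓡 1) ∞ Circle := IsManifold.of_le (n := ω) (by simp)

theorem circlePart_smoothOnMaps : SmoothOnMaps (I := 𝓒(𝓡 7)) (M := Circle × M)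
    (fun z (u : Fin 1 → TangentSpace 𝓒(𝓡 7) z) => circlePartL z (u 0)) := by
  refine fun V _ _ G z0 hG u => (dtheta_smooth (contMDiffAt_fst.comp z0 hG) (u 0)).congr_of_eventuallyEq ?_
  filter_upwards [eventually_contMDiffAt_one hG] with z hz
  exact circlePart_mfderiv hz _

theorem circlePart_closedOnMaps : ClosedOnMaps (I := 𝓒(𝓡 7)) (M := Circle × M)
    (fun z (u : Fin 1 → TangentSpace 𝓒(𝓡 7) z) => circlePartL z (u 0)) := by
  intro V _ _ G z0 hG v
  have key : ∀ i : Fin 2, fderiv ℝ _ z0 (v i) = fderiv ℝ (fun z => dtheta (G z).1 _) z0 (v i) := fun i => by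
    have e : (fun z => circlePartL (G z) (mfderiv 𝓘(ℝ, V) 𝓒(𝓡 7) G z
        (v (i.succAbove 0)))) =ᶠ[𝓝 z0] fun z => dtheta (G z).1 (mfderiv% (fun z => (G z).1) z (v (i.succAbove 0))) := by
      filter_upwards [eventually_contMDiffAt_one hG] with z hz
      exact circlePart_mfderiv hz _
    rw [e.fderiv_eq]
  rw [Fin.sum_univ_two, key 0, key 1]
  have := dtheta_closed (c := fun z => (G z).1) (contMDiffAt_fst.comp z0 hG) (v 0) (v 1)
  change (-1 : ℝ) ^ 0 * fderiv ℝ (fun z => dtheta (G z).1 (mfderiv%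
    (fun z => (G z).1) z (v 1))) z0 (v 0) + (-1 : ℝ) ^ 1 * fderiv ℝ (fun z => dtheta (G z).1
    (mfderiv% (fun z => (G z).1) z (v 0))) z0 (v 1) = 0
  rw [this]; ring

/-- The pullback of a form on `M` to `S^1 × M`. -/
def AltField.prodPull {k : ℕ} (T : AltField (𝓡 7) M k) :
    AltField 𝓒(𝓡 7) (Circle × M) k := fun z => (T z.2).compLinearMap (basePartL z)

theorem AltField.prodPull_eventually {k : ℕ} (T : AltField (𝓡 7) M k) {G : V → Circle × M} {z0 : V}
    (hG : ContMDiffAt 𝓘(ℝ, V) 𝓒(𝓡 7) ∞ G z0) (u : Fin k → V) :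
    (fun z => T.prodPull.field (G z) (fun i => mfderiv 𝓘(ℝ, V) 𝓒(𝓡 7) G z (u i))) =ᶠ[𝓝 z0] fun z => T.field (G z).2
        (fun i => mfderiv 𝓘(ℝ, V) (𝓡 7) (fun z => (G z).2) z (u i)) := by
  filter_upwards [eventually_contMDiffAt_one hG] with z hz
  exact congrArg (T (G z).2) (funext fun i => basePart_mfderiv hz _)

theorem AltField.prodPull_smoothOnMaps {k : ℕ} {T : AltField (𝓡 7) M k}
    (hT : SmoothOnMaps T.field) : SmoothOnMaps T.prodPull.field := fun V _ _ G z0 hG u => (hT V _ z0 (contMDiffAt_snd.comp z0 hG) u).congr_of_eventuallyEq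
    (T.prodPull_eventually hG u)

theorem AltField.prodPull_closedOnMaps {k : ℕ} {T : AltField (𝓡 7) M k}
    (hT : ClosedOnMaps T.field) : ClosedOnMaps T.prodPull.field := by
  intro V _ _ G z0 hG v
  rw [← hT V (fun z => (G z).2) z0 (contMDiffAt_snd.comp z0 hG) v]
  exact Finset.sum_congr rfl fun i _ => by rw [(T.prodPull_eventually hG fun j => v _).fderiv_eq]

end

section

variable {E : Type*} [NormedAddCommGroup E] [NormedSpace ℝ E]
  {H : Type*} [TopologicalSpace H] {I : ModelWithCorners ℝ E H}
  {M : Type*} [TopologicalSpace M] [ChartedSpace H M]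

/-- Fields of scalar products that depend smoothly on the point. -/
structure MetricField.IsRiem (g : MetricField I M) : Prop where
  add_left : ∀ x u v w, g x (u + v) w = g x u w + g x v w
  smul_left : ∀ x (r : ℝ) u w, g x (r • u) w = r * g x u w
  symm : ∀ x u v, g x u v = g x v u
  pos : ∀ x u, u ≠ 0 → 0 < g x u u
  smooth : SmoothOnMaps g.toTensor

theorem SmoothMetric.isRiem [IsManifold I ∞ M] (g : SmoothMetric I M) : g.field.IsRiem where
  add_left x u v w := by simp [SmoothMetric.field]
  smul_left x r u w := by simp [SmoothMetric.field]
  symm x u v := g.symm x u v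
  pos x u hu := g.pos x u hu
  smooth := g.smoothOnMaps

theorem TorsionFreeG2.prodMetric_isRiem {M : Type*} [TopologicalSpace M]
    [ChartedSpace (𝔼 7) M] [IsManifold (𝓡 7) ∞ M] (S : TorsionFreeG2 M) :
    S.prodMetric.IsRiem where
  add_left x u v w := by
    simp only [TorsionFreeG2.prodMetric, ← circlePartL_apply, ← basePartL_apply, map_add, add_apply]
    ring
  smul_left x r u w := by
    simp only [TorsionFreeG2.prodMetric, ← circlePartL_apply, ← basePartL_apply, map_smul, smul_apply, smul_eq_mul]
    ring
  symm x u v := by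
    simp only [TorsionFreeG2.prodMetric]
    rw [S.g.symm, mul_comm]
  pos x u hu := by
    simp only [TorsionFreeG2.prodMetric]
    by_cases h : basePart x u = 0
    · have : 0 < circlePart x u * circlePart x u := mul_self_pos.2 (fun h1 => hu (eq_zero_of_parts x u h1 h))
      simpa [h] using this
    · exact add_pos_of_nonneg_of_pos (mul_self_nonneg _) (S.g.pos _ _ h)
  smooth := by
    intro V _ _ G z0 hG u
    have h1 := fun v => circlePart_smoothOnMaps V G z0 hG ![v]
    refine (((h1 (u 0)).mul (h1 (u 1))).add (S.g.smoothOnMaps V _ z0 (contMDiffAt_snd.comp z0 hG) u)).congr_of_eventuallyEq ?_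
    filter_upwards [eventually_contMDiffAt_one hG] with z hz
    exact congrArg₂ (fun a b : TangentSpace (𝓡 7) (G z).2 =>
      circlePart (G z) _ *
      circlePart (G z) _ + S.g.inner (G z).2 a b)
      (basePart_mfderiv hz _) (basePart_mfderiv hz _)

end

theorem gram_le_prod {W : Type*} [NormedAddCommGroup W] [InnerProductSpace ℝ W] (u : Fin 4 → W) :
    gram u ≤ 24 * ∏ i, inner ℝ (u i) (u i) := by
  rw [gram, Matrix.det_apply]
  refine (Finset.sum_le_card_nsmul _ _ (∏ i, inner ℝ (u i) (u i)) fun σ _ => ?_).trans_eq ?_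
  · have h : |∏ i, inner ℝ (u (σ i)) (u i)| ≤ ∏ i, inner ℝ (u i) (u i) := by
      rw [Finset.abs_prod]
      calc ∏ i, |inner ℝ (u (σ i)) (u i)| ≤ ∏ i, (‖u (σ i)‖ * ‖u i‖) :=
            Finset.prod_le_prod (fun _ _ => abs_nonneg _) fun i _ => abs_real_inner_le_norm _ _
        _ = ∏ i, inner ℝ (u i) (u i) := by
            rw [Finset.prod_mul_distrib, Equiv.prod_comp σ fun i => ‖u i‖, ← Finset.prod_mul_distrib]
            simp only [real_inner_self_eq_norm_mul_norm]
    simp only [Matrix.of_apply]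
    rcases Int.units_eq_one_or (Equiv.Perm.sign σ) with h1 | h1 <;> rw [h1]
    · simpa using (le_abs_self _).trans h
    · simpa using (neg_le_abs _).trans h
  · simp [Fintype.card_perm, Nat.factorial]

section

variable {M : Type*} [TopologicalSpace M] [ChartedSpace (𝔼 8) M]
  [IsManifold (𝓡 8) ∞ M] (S : CalabiYau4 M)

/-- The form `½ ω ∧ ω`. -/
def CalabiYau4.halfSq : AltField (𝓡 8) M 4 := fun x => halfSquare (S.kahler x).toAlternatingMap

/-- The form `Re Ω`. -/
def CalabiYau4.reHvol : AltField (𝓡 8) M 4 := fun x => Complex.reLm.compAlternatingMap (S.hvol x).toAlternatingMap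

/-- The Cayley form, as a field of alternating forms. -/
def CalabiYau4.cayley : AltField (𝓡 8) M 4 := fun x => -S.halfSq x + S.reHvol x

theorem CalabiYau4.kahler_smooth : SmoothOnMaps (AltField.field fun x => (S.kahler x).toAlternatingMap) :=
  DForm.smoothOnMaps S.smooth_kahler

theorem CalabiYau4.halfSq_smooth : SmoothOnMaps S.halfSq.field := halfSquare_smoothOnMaps S.kahler_smooth

theorem CalabiYau4.halfSq_closed : ClosedOnMaps S.halfSq.field :=
  halfSquare_closedOnMaps S.kahler_smooth (DForm.closedOnMaps S.smooth_kahler S.closed_kahler)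

theorem CalabiYau4.reHvol_smooth : SmoothOnMaps S.reHvol.field := fun V _ _ G z0 hG u =>
  Complex.reCLM.contDiff.contDiffAt.comp z0 (DForm.smoothOnMaps S.smooth_hvol V G z0 hG u)

theorem CalabiYau4.reHvol_closed : ClosedOnMaps S.reHvol.field := by
  intro V _ _ G z0 hG v
  have h := congrArg Complex.reCLM (DForm.closedOnMaps S.smooth_hvol S.closed_hvol V G z0 hG v)
  rw [map_sum, map_zero] at h
  rw [← h]
  refine Finset.sum_congr rfl fun i _ => ?_
  rw [map_smul]
  exact congrArg (fun A => (-1 : ℝ) ^ (i : ℕ) • A (v i))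
    (Complex.reCLM.hasFDerivAt.comp z0 ((DForm.smoothOnMaps S.smooth_hvol V G z0 hG fun j => v _).diffAt).hasFDerivAt).fderiv

theorem CalabiYau4.cayley_smooth : SmoothOnMaps S.cayley.field := fun V _ _ G z0 hG u =>
  (S.halfSq_smooth V G z0 hG u).neg.add (S.reHvol_smooth V G z0 hG u)

variable {S}

/-- The Gram determinant of tangent vectors. -/
def MetricField.gramAt {E : Type*} [NormedAddCommGroup E] [NormedSpace ℝ E]
    {H : Type*} [TopologicalSpace H] {I : ModelWithCorners ℝ E H} {M : Type*} [TopologicalSpace M]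
    [ChartedSpace H M] (g : MetricField I M) {k : ℕ} (x : M) (u : Fin k → TangentSpace I x) : ℝ :=
  Matrix.det (Matrix.of fun i j => g x (u i) (u j))

theorem CalabiYau4.exists_frame (S : CalabiYau4 M) (x : M) :
    ∃ (L : TangentSpace (𝓡 8) x ≃ₗ[ℝ] C4) (P R : C4 [⋀^Fin 4]→ₗ[ℝ] ℝ),
      (∀ u v, S.g.inner x u v = inner ℝ (L u) (L v)) ∧ (∀ u, L (S.J x u) = Complex.I • L u) ∧
      (∀ v, P v = C4.pf v) ∧
      (∀ v : Fin 4 → C4, R v = (Matrix.det (Matrix.of fun i k => v i k)).re) ∧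
      (∀ u, S.halfSq x u = P (fun i => L (u i))) ∧ (∀ u, S.reHvol x u = R (fun i => L (u i))) := by
  obtain ⟨L, h1, h2, h3, h4⟩ := S.frame x
  let e := L.trans (WithLp.linearEquiv 2 ℝ _).symm
  have h3' : ∀ a b, S.kahler x ![a, b] = C4.om (e a) (e b) := fun a b => h3 ![a, b]
  refine ⟨e, (S.halfSq x).compLinearMap e.symm.toLinearMap,
    (S.reHvol x).compLinearMap e.symm.toLinearMap, fun u v => ?_, fun u => ?_, fun v => ?_,
    fun v => ?_, fun u => ?_, fun u => ?_⟩
  · rw [C4.inner_eq]; exact h1 u v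
  · change (WithLp.linearEquiv 2 ℝ _).symm (L (S.J x u)) = _
    rw [h2]; rfl
  · have := halfSquare_apply (S.kahler x).toAlternatingMap (fun i => e.symm (v i))
    refine Eq.trans this ?_
    change S.kahler x ![_, _] * S.kahler x ![_, _] - S.kahler x ![_, _] * S.kahler x ![_, _] +
      S.kahler x ![_, _] * S.kahler x ![_, _] = _
    simp only [h3', LinearEquiv.apply_symm_apply]
    rfl
  · refine (congrArg Complex.re (h4 fun i => e.symm (v i))).trans ?_
    have : ∀ i, L (e.symm (v i)) = fun k => v i k := fun i => by
      change L (L.symm _) = _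
      rw [LinearEquiv.apply_symm_apply]; rfl
    simp only [this]
  · simp [AlternatingMap.compLinearMap_apply]
  · simp [AlternatingMap.compLinearMap_apply]

theorem CalabiYau4.gramAt_eq {x : M} {L : TangentSpace (𝓡 8) x ≃ₗ[ℝ] C4}
    (h : ∀ u v, S.g.inner x u v = inner ℝ (L u) (L v)) {k : ℕ} (u : Fin k → TangentSpace (𝓡 8) x) :
    S.g.field.gramAt x u = gram fun i => L (u i) := by
  simp only [MetricField.gramAt, gram, SmoothMetric.field, h]

theorem CalabiYau4.comass (S : CalabiYau4 M) (x : M) (u : Fin 4 → TangentSpace (𝓡 8) x) :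
    (|S.halfSq x u| + |S.reHvol x u|) ^ 2 ≤ S.g.field.gramAt x u := by
  obtain ⟨L, P, R, h1, -, h3, h4, h5, h6⟩ := S.exists_frame x
  rw [gramAt_eq h1, h5, h6]
  exact C4.abs_add_abs_sq_le_gram P R h3 h4 _

theorem CalabiYau4.gramAt_le (S : CalabiYau4 M) (x : M) (u : Fin 4 → TangentSpace (𝓡 8) x) :
    S.g.field.gramAt x u ≤ 24 * ∏ i, S.g.field x (u i) (u i) := by
  obtain ⟨L, P, R, h1, -⟩ := S.exists_frame x
  rw [gramAt_eq h1]
  refine (gram_le_prod _).trans_eq ?_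
  simp only [SmoothMetric.field, h1]

theorem CalabiYau4.J_mem_span (S : CalabiYau4 M) {x : M} {u : Fin 4 → TangentSpace (𝓡 8) x}
    (hu : S.g.field.gramAt x u ≠ 0) (h : S.halfSq x u ^ 2 = S.g.field.gramAt x u) (i : Fin 4) :
    S.J x (u i) ∈ Submodule.span ℝ (range u) := by
  obtain ⟨L, P, R, h1, h2, h3, h4, h5, h6⟩ := S.exists_frame x
  rw [gramAt_eq h1, h5] at h
  rw [gramAt_eq h1] at hu
  have := C4.mem_span_of_pf_sq_eq P h3 hu h i
  rw [← h2, show range (fun i => L (u i)) = L '' range u from (range_comp L u), show (L '' range u) = (L.toLinearMap '' range u) from rfl, ← (Submodule.map_span L.toLinearMap (range u))] at this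
  obtain ⟨w, hw, hw'⟩ := this
  rwa [← L.injective hw']

theorem CalabiYau4.halfSq_sq_eq (S : CalabiYau4 M) {x : M} {u : Fin 4 → TangentSpace (𝓡 8) x}
    (h : ∀ i, S.J x (u i) ∈ Submodule.span ℝ (range u)) :
    S.halfSq x u ^ 2 = S.g.field.gramAt x u := by
  obtain ⟨L, P, R, h1, h2, h3, h4, h5, h6⟩ := S.exists_frame x
  rw [gramAt_eq h1, h5]
  refine C4.pf_sq_eq_of_mem_span P h3 fun i => ?_
  rw [← h2, show range (fun i => L (u i)) = L '' range u from (range_comp L u), show (L '' range u) = (L.toLinearMap '' range u) from rfl, ← (Submodule.map_span L.toLinearMap (range u))]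
  exact ⟨_, h i, rfl⟩

end

section

variable {M : Type*} [TopologicalSpace M] [ChartedSpace (𝔼 7) M]
  [IsManifold (𝓡 7) ∞ M] (S : TorsionFreeG2 M)

/-- The form `φ`, as a field of alternating forms. -/
def TorsionFreeG2.phiF : AltField (𝓡 7) M 3 := fun x => (S.φ x).toAlternatingMap

/-- The form `ψ`, as a field of alternating forms. -/
def TorsionFreeG2.psiF : AltField (𝓡 7) M 4 := fun x => (S.ψ x).toAlternatingMap

/-- The form `dθ ∧ φ` on `S^1 × M`. -/
def TorsionFreeG2.thetaPhi : AltField 𝓒(𝓡 7) (Circle × M) 4 := fun z => wedgeOneThree (circlePartL z) (S.phiF.prodPull z)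

/-- The pullback of `ψ` to `S^1 × M`. -/
def TorsionFreeG2.psiP : AltField 𝓒(𝓡 7) (Circle × M) 4 := S.psiF.prodPull

/-- The Cayley form, as a field of alternating forms. -/
def TorsionFreeG2.cayley : AltField 𝓒(𝓡 7) (Circle × M) 4 := fun z => S.thetaPhi z + S.psiP z

theorem TorsionFreeG2.thetaPhi_apply (z : Circle × M) (u : Fin 4 → TangentSpace 𝓒(𝓡 7) z) :
    S.thetaPhi z u = ∑ i : Fin 4, (-1 : ℝ) ^ (i : ℕ) * circlePart z (u i) *
      S.φ z.2 (fun k => basePart z (u (i.succAbove k))) :=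
  wedgeOneThree_apply _ _ _

theorem TorsionFreeG2.psiP_apply (z : Circle × M) (u : Fin 4 → TangentSpace 𝓒(𝓡 7) z) :
    S.psiP z u = S.ψ z.2 (fun k => basePart z (u k)) := rfl

theorem TorsionFreeG2.cayleyForm_eq : S.cayleyForm = S.cayley.field := by
  funext z u
  exact congrArg (· + S.psiP z u) (S.thetaPhi_apply z u).symm

theorem TorsionFreeG2.thetaPhi_smooth : SmoothOnMaps S.thetaPhi.field :=
  wedgeOneThree_smoothOnMaps circlePart_smoothOnMaps (AltField.prodPull_smoothOnMaps (DForm.smoothOnMaps S.smooth_φ))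

theorem TorsionFreeG2.thetaPhi_closed : ClosedOnMaps S.thetaPhi.field :=
  wedgeOneThree_closedOnMaps circlePart_smoothOnMaps (AltField.prodPull_smoothOnMaps (DForm.smoothOnMaps S.smooth_φ))
    circlePart_closedOnMaps
    (AltField.prodPull_closedOnMaps (DForm.closedOnMaps S.smooth_φ S.closed_φ))

theorem TorsionFreeG2.psiP_smooth : SmoothOnMaps S.psiP.field :=
  AltField.prodPull_smoothOnMaps (DForm.smoothOnMaps S.smooth_ψ)

theorem TorsionFreeG2.psiP_closed : ClosedOnMaps S.psiP.field :=
  AltField.prodPull_closedOnMaps (DForm.closedOnMaps S.smooth_ψ S.closed_ψ)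

theorem TorsionFreeG2.cayley_smooth : SmoothOnMaps S.cayley.field := fun V _ _ G z0 hG u =>
  (S.thetaPhi_smooth V G z0 hG u).add (S.psiP_smooth V G z0 hG u)

theorem TorsionFreeG2.exists_frame (z : Circle × M) : ∃ L : TangentSpace 𝓒(𝓡 7) z →ₗ[ℝ] R8, Function.Injective L ∧
      (∀ u, (L u).fst = circlePart z u) ∧ (∀ u, basePart z u = 0 ↔ (L u).snd = 0) ∧
      (∀ u v, S.prodMetric z u v = inner ℝ (L u) (L v)) ∧
      (∀ u, S.thetaPhi z u = R8.thetaPhi (fun i => L (u i))) ∧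
      (∀ u, S.psiP z u = R8.psi (fun i => L (u i))) := by
  obtain ⟨L, h1, h2, h3⟩ := S.frame z.2
  let e : TangentSpace 𝓒(𝓡 7) z →ₗ[ℝ] R8 := (WithLp.linearEquiv 2 ℝ _).symm.toLinearMap.comp
      ((circlePartL z).prod ((WithLp.linearEquiv 2 ℝ _).symm.toLinearMap.comp (L.toLinearMap.comp (basePartL z))))
  have e1 : ∀ u, (e u).fst = circlePart z u := fun u => rfl
  have e2 : ∀ u k, (e u).snd k = L (basePart z u) k := fun u k => rfl
  have e3 : ∀ u, basePart z u = 0 ↔ (e u).snd = 0 := fun u => by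
    constructor
    · intro h
      ext k
      rw [e2, h, map_zero]; rfl
    · intro h
      apply L.injective
      funext k
      rw [← e2, h, map_zero]; rfl
  refine ⟨e, ?_, e1, e3, fun u v => ?_, fun u => ?_, fun u => ?_⟩
  · rw [← LinearMap.ker_eq_bot, LinearMap.ker_eq_bot']
    refine fun u hu => eq_zero_of_parts z u ?_ ((e3 u).2 ?_)
    · rw [← e1, hu]; rfl
    · rw [hu]; rfl
  · rw [R8.inner_eq, TorsionFreeG2.prodMetric, h1]
    simp only [e1, e2]
  · rw [S.thetaPhi_apply, R8.thetaPhi_apply]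
    simp only [e1, h2]
    rfl
  · rw [S.psiP_apply, R8.psi_apply, h3]
    rfl

theorem TorsionFreeG2.gramAt_eq {S : TorsionFreeG2 M} {z : Circle × M} {L : TangentSpace 𝓒(𝓡 7) z →ₗ[ℝ] R8}
    (h : ∀ u v, S.prodMetric z u v = inner ℝ (L u) (L v)) {k : ℕ}
    (u : Fin k → TangentSpace 𝓒(𝓡 7) z) :
    S.prodMetric.gramAt z u = gram fun i => L (u i) := by
  simp only [MetricField.gramAt, gram, h]

theorem TorsionFreeG2.comass (z : Circle × M) (u : Fin 4 → TangentSpace 𝓒(𝓡 7) z) :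
    S.thetaPhi z u ^ 2 + S.psiP z u ^ 2 ≤ S.prodMetric.gramAt z u := by
  obtain ⟨L, -, -, -, h1, h2, h3⟩ := S.exists_frame z
  rw [gramAt_eq h1, h2, h3]
  exact R8.thetaPhi_sq_add_psi_sq_le _

theorem TorsionFreeG2.gramAt_le (z : Circle × M) (u : Fin 4 → TangentSpace 𝓒(𝓡 7) z) :
    S.prodMetric.gramAt z u ≤ 24 * ∏ i, S.prodMetric z (u i) (u i) := by
  obtain ⟨L, -, -, -, h1, h2, h3⟩ := S.exists_frame z
  rw [gramAt_eq h1]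
  refine (gram_le_prod _).trans_eq ?_
  simp only [h1]

theorem TorsionFreeG2.circlePart_eq_zero {z : Circle × M}
    {u : Fin 4 → TangentSpace 𝓒(𝓡 7) z} (hu : S.prodMetric.gramAt z u ≠ 0)
    (h : S.psiP z u ^ 2 = S.prodMetric.gramAt z u) (i : Fin 4) : circlePart z (u i) = 0 := by
  obtain ⟨L, -, h0, -, h1, h2, h3⟩ := S.exists_frame z
  rw [gramAt_eq h1, h3] at h
  rw [gramAt_eq h1] at hu
  rw [← h0]
  exact R8.fst_eq_zero_of_psi_sq_eq hu h i

theorem TorsionFreeG2.exists_theta_mem_span {z : Circle × M}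
    {u : Fin 4 → TangentSpace 𝓒(𝓡 7) z} (hu : S.prodMetric.gramAt z u ≠ 0)
    (h : S.thetaPhi z u ^ 2 = S.prodMetric.gramAt z u) :
    ∃ w ∈ Submodule.span ℝ (range u), circlePart z w = 1 ∧ basePart z w = 0 := by
  obtain ⟨L, hL, h0, h0', h1, h2, h3⟩ := S.exists_frame z
  rw [gramAt_eq h1, h2] at h
  rw [gramAt_eq h1] at hu
  have := R8.mem_span_of_thetaPhi_sq_eq hu h
  rw [show range (fun i => L (u i)) = L '' range u from (range_comp L u), ← Submodule.map_span] at this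
  obtain ⟨w, hw, hw'⟩ := this
  refine ⟨w, hw, ?_, ?_⟩
  · rw [← h0, hw']; rfl
  · rw [h0', hw']; rfl

end

section Manifolds

variable {E : Type} [NormedAddCommGroup E] [NormedSpace ℝ E] [FiniteDimensional ℝ E] {H : Type*}
  [TopologicalSpace H] {I : ModelWithCorners ℝ E H} [I.Boundaryless] {M : Type*} [TopologicalSpace M]
  [ChartedSpace H M] [IsManifold I ∞ M] {EN : Type} [NormedAddCommGroup EN] [NormedSpace ℝ EN]
  [FiniteDimensional ℝ EN] {HN : Type*} [TopologicalSpace HN] {J : ModelWithCorners ℝ EN HN} [J.Boundaryless]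
  {N : Type*} [TopologicalSpace N] [ChartedSpace HN N] [IsManifold J ∞ N] {E' : Type} [NormedAddCommGroup E']
  [NormedSpace ℝ E'] [FiniteDimensional ℝ E'] {H' : Type*} [TopologicalSpace H']
  {I' : ModelWithCorners ℝ E' H'} [I'.Boundaryless] {X : Type*} [TopologicalSpace X] [ChartedSpace H' X]
  [IsManifold I' ∞ X] {EZ : Type} [NormedAddCommGroup EZ] [NormedSpace ℝ EZ] [FiniteDimensional ℝ EZ]
  {HZ : Type*} [TopologicalSpace HZ] {IZ : ModelWithCorners ℝ EZ HZ} [IZ.Boundaryless] {Z : Type*}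
  [TopologicalSpace Z] [ChartedSpace HZ Z] [IsManifold IZ ∞ Z]

section

theorem abs_sqrt_sub_le {n n' : ℝ → ℝ} {r A : ℝ} (hA : 0 ≤ A) (hr : 0 ≤ r) (hn : ∀ τ ∈ Icc (0 : ℝ) 1, 0 ≤ n τ)
    (hd : ∀ τ ∈ Icc (0 : ℝ) 1, HasDerivAt n (n' τ) τ)
    (hb : ∀ τ ∈ Icc (0 : ℝ) 1, |n' τ| ≤ 2 * (r * A) * √(n τ)) {τ : ℝ} (hτ : τ ∈ Icc (0 : ℝ) 1) :
    |√(n τ) - √(n 0)| ≤ r * A := by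
  have key : ∀ δ, 0 < δ → |√(n τ + δ) - √(n 0 + δ)| ≤ r * A := by
    intro δ hδ
    have h1 : ∀ s ∈ Icc (0 : ℝ) 1, HasDerivWithinAt _ (n' s / (2 * √(n s + δ))) (Icc 0 1) s := fun s hs =>
      (((hd s hs).add_const δ).sqrt (by have := hn s hs; positivity)).hasDerivWithinAt
    have h2 : ∀ s ∈ Ico (0 : ℝ) 1, ‖n' s / (2 * √(n s + δ))‖ ≤ r * A := fun s hs => by
      have hs' := Ico_subset_Icc_self hs
      have h0 := hn s hs'
      have hp : 0 < √(n s + δ) := Real.sqrt_pos.2 (by positivity)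
      rw [norm_div, Real.norm_eq_abs, Real.norm_of_nonneg (by positivity), div_le_iff₀ (by positivity)]
      refine (hb s hs').trans ?_
      have : √(n s) ≤ √(n s + δ) := Real.sqrt_le_sqrt (by linarith)
      nlinarith [mul_nonneg hr hA]
    refine (norm_image_sub_le_of_norm_deriv_le_segment' h1 h2 τ hτ).trans ?_
    rw [sub_zero]
    exact mul_le_of_le_one_right (mul_nonneg hr hA) hτ.2
  have hl : Tendsto (fun δ => |√(n τ + δ) - √(n 0 + δ)|) (𝓝[>] 0) (𝓝 |√(n τ) - √(n 0)|) := by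
    have : Continuous fun δ => |√(n τ + δ) - √(n 0 + δ)| := by fun_prop
    have h := this.tendsto 0
    simp only [add_zero] at h
    exact h.mono_left nhdsWithin_le_nhds
  exact le_of_tendsto hl (by filter_upwards [self_mem_nhdsWithin] with δ hδ using key δ hδ)

end

theorem contMDiffAt_extChartAt_symm {E : Type*} [NormedAddCommGroup E] [NormedSpace ℝ E]
    {H : Type*} [TopologicalSpace H] {I : ModelWithCorners ℝ E H} [I.Boundaryless]
    {M : Type*} [TopologicalSpace M] [ChartedSpace H M] [IsManifold I ∞ M] (p : M) {z : E}
    (hz : z ∈ (ϕ I p).target) : CMDiffAt ∞ (ϕ I p).symm z :=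
  (contMDiffOn_extChartAt_symm p).contMDiffAt ((isOpen_extChartAt_target p).mem_nhds hz)

section

variable {g : MetricField I M}

theorem MetricField.IsRiem.inChart_contDiffAt (hg : g.IsRiem) (p : M) (v w : E) {z : E}
    (hz : z ∈ (ϕ I p).target) : ContDiffAt ℝ ∞ (fun z => g.inChart p z v w) z :=
  hg.smooth E (ϕ I p).symm _ (contMDiffAt_extChartAt_symm p hz) ![v, w]

theorem MetricField.IsRiem.add_right (hg : g.IsRiem) (x : M) (u v w : TangentSpace I x) :
    g x u (v + w) = g x u v + g x u w := by
  rw [hg.symm, hg.add_left, hg.symm x v, hg.symm x w]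

theorem MetricField.IsRiem.smul_right (hg : g.IsRiem) (x : M) (r : ℝ) (u w : TangentSpace I x) :
    g x u (r • w) = r * g x u w := by
  rw [hg.symm, hg.smul_left, hg.symm x w]

theorem MetricField.IsRiem.nonneg (hg : g.IsRiem) (x : M) (u : TangentSpace I x) : 0 ≤ g x u u := by
  by_cases h : u = 0
  · have := hg.smul_left x 0 u u
    rw [zero_smul, zero_mul] at this
    rw [h]; rw [h] at this; exact this.ge
  · exact (hg.pos x u h).le

/-- The metric in a chart, as a bilinear map. -/
def MetricField.IsRiem.chartL (hg : g.IsRiem) (p : M) (z : E) : E →L[ℝ] E →L[ℝ] ℝ :=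
  LinearMap.toContinuousLinearMap ((LinearMap.toContinuousLinearMap :
      (E →ₗ[ℝ] ℝ) ≃ₗ[ℝ] E →L[ℝ] ℝ).toLinearMap.comp (LinearMap.mk₂ ℝ (g.inChart p z)
    (fun a b c => by
      simp only [MetricField.inChart]
      exact (congrArg (fun v => g _ v _) (map_add _ _ _)).trans (hg.add_left _ _ _ _))
    (fun r a c => by
      simp only [MetricField.inChart]
      exact (congrArg (fun v => g _ v _) (map_smul _ _ _)).trans (hg.smul_left _ _ _ _))
    (fun a b c => by
      simp only [MetricField.inChart]
      exact (congrArg (fun v => g _ _ v) (map_add _ _ _)).trans (hg.add_right _ _ _ _))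
    (fun r a c => by
      simp only [MetricField.inChart]
      exact (congrArg (fun v => g _ _ v) (map_smul _ _ _)).trans (hg.smul_right _ _ _ _))))

theorem MetricField.IsRiem.chartL_apply (hg : g.IsRiem) (p : M) (z a b : E) : hg.chartL p z a b = g.inChart p z a b := rfl

theorem MetricField.IsRiem.chartL_hasFDerivAt (hg : g.IsRiem) (p : M) : DifferentiableAt ℝ (hg.chartL p) (ϕ I p p) := by
  have h : ContDiffOn ℝ ∞ (hg.chartL p) (ϕ I p).target := by
    rw [contDiffOn_clm_apply]
    intro v
    rw [contDiffOn_clm_apply]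
    exact fun w z hz => (hg.inChart_contDiffAt p v w hz).contDiffWithinAt
  exact (h.contDiffAt (extChartAt_target_mem_nhds p)).diffAt

theorem metric_eq_chart (x p : M) (hx : x ∈ (ϕ I p).source) (u v : TangentSpace I x) :
    g x u v = g.inChart p (ϕ I p x) (mfderiv% (ϕ I p) x u) (mfderiv% (ϕ I p) x v) :=
  tensor_eq_chart g.toTensor p x hx ![u, v]

variable {F : ℝ → X → M}

theorem family_contMDiff_snd (hF : CMDiff ∞ (fun z : ℝ × X => F z.1 z.2)) (τ : ℝ) : CMDiff ∞ (F τ) :=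
  hF.comp (contMDiff_const.prodMk contMDiff_id)

theorem family_contMDiff_fst (hF : CMDiff ∞ (fun z : ℝ × X => F z.1 z.2)) (x : X) : CMDiff ∞ (fun τ => F τ x) :=
  hF.comp (contMDiff_id.prodMk contMDiff_const)

/-- A smooth curve with given velocity. -/
theorem exists_curve (x : X) (u : TangentSpace I' x) : ∃ γ : ℝ → X, CMDiffAt ∞ γ 0 ∧ γ 0 = x ∧
      (mfderiv% γ 0 (1 : ℝ) : E') = u := by
  let u' : E' := mfderiv% (ϕ I' x) x u
  let l : ℝ → E' := fun s => ϕ I' x x + s • u'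
  have hl : ContDiff ℝ ∞ l := by fun_prop
  have hl0 : l 0 = ϕ I' x x := by simp [l]
  have hmem : l 0 ∈ (ϕ I' x).target := by rw [hl0]; exact mem_extChartAt_target x
  have hlm : CMDiffAt ∞ l 0 := hl.contMDiff.contMDiffAt
  refine ⟨fun s => (ϕ I' x).symm (l s), ContMDiffAt.comp 0 (contMDiffAt_extChartAt_symm x hmem) hlm, ?_, ?_⟩
  · simp only [hl0]; exact extChartAt_to_inv x
  have e2 : (mfderiv% (fun s => (ϕ I' x).symm (l s)) 0 (1 : ℝ) : E') =
      mfderiv% (ϕ I' x).symm (l 0) (fderiv ℝ l 0 (1 : ℝ)) := by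
    rw [← mfderiv_eq_fderiv]
    exact (mfderiv_comp (0 : ℝ) ((contMDiffAt_extChartAt_symm x hmem).mdiffAt) hlm.mdiffAt).app 1
  have e3 : fderiv ℝ l 0 (1 : ℝ) = u' := ((((hasDerivAt_id 0).smul_const u').const_add (ϕ I' x x)).congr_deriv (one_smul _ _)).deriv
  rw [e2, e3]
  have e4 := mfderiv_symm_mfderiv_extChartAt x x (mem_extChartAt_source _) u
  rw [← hl0] at e4
  exact e4

theorem mfderiv_along_curve {EA : Type*} [NormedAddCommGroup EA] [NormedSpace ℝ EA]
    {HA : Type*} [TopologicalSpace HA] {IA : ModelWithCorners ℝ EA HA}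
    {A : Type*} [TopologicalSpace A] [ChartedSpace HA A] {f : X → A} {γ : ℝ → X} {x : X}
    {u : TangentSpace I' x} {s : ℝ} (hγ : MDiffAt γ s) (h0 : γ s = x)
    (hu : (mfderiv% γ s (1 : ℝ) : E') = u) (hf : MDiffAt f x) :
    (mfderiv% (fun s => f (γ s)) s (1 : ℝ) : EA) = mfderiv% f x u := by
  subst h0
  exact ((mfderiv_comp s hf hγ).app 1).trans (congrArg _ hu)

theorem family_chart_contDiffAt (hF : CMDiff ∞ (fun z : ℝ × X => F z.1 z.2)) {τ : ℝ} {γ : V → X} {v : V}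
    (hγ : CMDiffAt ∞ γ v) :
    ContDiffAt ℝ ∞ (fun q => ϕ I (F τ (γ v)) (F q.1 (γ q.2))) (τ, v) := by
  have hH := (hF (τ, γ v)).comp (τ, v) (ContMDiffAt.prodMk contDiff_fst.contMDiff.contMDiffAt (ContMDiffAt.comp (τ, v) hγ contDiff_snd.contMDiff.contMDiffAt))
  exact contDiffAt_chart_comp hH (mem_extChartAt_source _)

theorem ContDiffAt.eventually_differentiableAt {V W : Type*} [NormedAddCommGroup V]
    [NormedSpace ℝ V] [NormedAddCommGroup W] [NormedSpace ℝ W] {f : V → W} {z : V}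
    (h : ContDiffAt ℝ ∞ f z) : ∀ᶠ y in 𝓝 z, DifferentiableAt ℝ f y := by
  filter_upwards [eventually_contMDiffAt_one (contMDiffAt_iff_contDiffAt.2 h)] with q hq
  exact hq.differentiableAt

theorem deriv_fst_slice {V W : Type*} [NormedAddCommGroup V] [NormedSpace ℝ V]
    [NormedAddCommGroup W] [NormedSpace ℝ W] {K : ℝ × V → W} {τ : ℝ} {v : V}
    (h : DifferentiableAt ℝ K (τ, v)) : HasDerivAt (fun σ => K (σ, v)) (fderiv ℝ K (τ, v) (1, 0)) τ :=
  h.hasFDerivAt.comp_hasDerivAt τ ((hasDerivAt_id τ).prodMk (hasDerivAt_const τ v))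

theorem deriv_snd_slice {W : Type*} [NormedAddCommGroup W] [NormedSpace ℝ W] {K : ℝ × ℝ → W}
    {τ s : ℝ} (h : DifferentiableAt ℝ K (τ, s)) :
    HasDerivAt (fun s => K (τ, s)) (fderiv ℝ K (τ, s) (0, 1)) s :=
  h.hasFDerivAt.comp_hasDerivAt s ((hasDerivAt_const s τ).prodMk (hasDerivAt_id s))

theorem velocity_mdifferentiableAt (hF : CMDiff ∞ (fun z : ℝ × X => F z.1 z.2)) (τ : ℝ) (x : X) : MDiffAt
      (fun y => deriv (fun σ => ϕ I (F τ x) (F σ y)) τ) x := by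
  have m1' := isManifold_one (I := I') (M := X)
  let K : ℝ × E' → E := fun q => ϕ I (F τ x) (F q.1 ((ϕ I' x).symm q.2))
  have h1 : ContDiffAt ℝ ∞ K (τ, ϕ I' x x) := by
    have := family_chart_contDiffAt hF (τ := τ) (contMDiffAt_extChartAt_symm x (mem_extChartAt_target x))
    rwa [extChartAt_to_inv] at this
  have h2 : ContDiffAt ℝ ∞ (fun z => fderiv ℝ K (τ, z) (1, 0)) (ϕ I' x x) := ContDiffAt.clm_apply ((h1.fderiv_right (by simp)).comp (ϕ I' x x) (by fun_prop)) contDiffAt_const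
  have h3 : MDiffAt (fun y => fderiv ℝ K (τ, ϕ I' x y) (1, 0)) x := h2.diffAt.mdifferentiableAt.comp x
      (mdifferentiableAt_extChartAt (mem_chart_source _ _))
  refine h3.congr_of_eventuallyEq ?_
  filter_upwards [(continuousAt_const.prodMk (continuousAt_extChartAt x)).eventually (ContDiffAt.eventually_differentiableAt h1),
    extChartAt_source_mem_nhds (I := I') x] with y h6 h7
  rw [← (deriv_fst_slice h6).deriv]
  simp only [K, (ϕ I' x).left_inv h7]

theorem chart_velocity (hF : CMDiff ∞ (fun z : ℝ × X => F z.1 z.2)) (τ : ℝ) (x : X) : (mfderiv% (ϕ I (F τ x)) (F τ x)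
        (mfderiv% (fun σ => F σ x) τ (1 : ℝ)) : E) =
      deriv (fun σ => ϕ I (F τ x) (F σ x)) τ :=
  (mfderiv_chart_comp (((family_contMDiff_fst hF x) τ).mdiffAt) (mem_extChartAt_source _) 1).symm

theorem VelocityC1Le.velocity_le (hF : CMDiff ∞ (fun z : ℝ × X => F z.1 z.2))
    {ι : X → M} {τ r : ℝ} {x : X} (h : VelocityC1Le I' g ι F τ x r) :
    g (F τ x) (mfderiv% (fun σ => F σ x) τ (1 : ℝ)) (mfderiv% (fun σ => F σ x) τ (1 : ℝ)) ≤ r ^ 2 :=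
  (metric_eq_chart (F τ x) (F τ x) (mem_extChartAt_source _) _ _).trans_le ((congrArg (fun w => g.inChart (F τ x) _ w w)
      (chart_velocity hF τ x)).trans_le h.1)

/-- The chart expression of `F_*(u)`, and its derivative along the family. -/
theorem exists_chart_derivative (hF : CMDiff ∞ (fun z : ℝ × X => F z.1 z.2)) (τ : ℝ) (x : X)
    (u : TangentSpace I' x) : ∃ B : ℝ → E, (∀ᶠ σ in 𝓝 τ, F σ x ∈ (ϕ I (F τ x)).source ∧
        (mfderiv% (ϕ I (F τ x)) (F σ x) (mfderiv% (F σ) x u) : E) = B σ) ∧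
      HasDerivAt B (mfderiv% (fun y => deriv (fun σ => ϕ I (F τ x) (F σ y)) τ) x u : E) τ := by
  obtain ⟨γ, hγ, hγ0, hdγ⟩ := exists_curve x u
  have hγd := hγ.mdiffAt
  let K : ℝ × ℝ → E := fun q => ϕ I (F τ x) (F q.1 (γ q.2))
  have hK : ContDiffAt ℝ ∞ K (τ, 0) := by
    have := family_chart_contDiffAt hF (τ := τ) hγ
    rwa [hγ0] at this
  have hK1 := (hK.fderiv_right (m := ∞) (by simp)).diffAt
  have hKd := ContDiffAt.eventually_differentiableAt hK
  have hsrc : ∀ᶠ σ in 𝓝 τ, F σ x ∈ (ϕ I (F τ x)).source :=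
    (family_contMDiff_fst hF x).continuous.continuousAt.eventually_mem (extChartAt_source_mem_nhds _)
  refine ⟨fun σ => fderiv ℝ K (σ, 0) (0, 1), ?_, ?_⟩
  · filter_upwards [hsrc, (Continuous.tendsto' (f := fun σ => (σ, 0)) (by fun_prop) τ (τ, 0) rfl).eventually hKd] with σ h1 h2
    refine ⟨h1, ?_⟩
    have hFσ : MDiffAt (F σ) x := (family_contMDiff_snd hF σ _).mdiffAt
    have m1 := isManifold_one (I := I) (M := M)
    have hc : MDiffAt (ϕ I (F τ x)) (F σ x) := mdifferentiableAt_extChartAt (by rwa [extChartAt_source] at h1)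
    refine ((mfderiv_comp x hc hFσ).app u).symm.trans ((mfderiv_along_curve hγd hγ0 hdγ (hc.comp x hFσ)).symm.trans ?_)
    rw [mfderiv_eq_fderiv]
    exact (deriv_snd_slice h2).deriv
  · refine ((ContinuousLinearMap.apply ℝ E ((0, 1))).hasFDerivAt.comp_hasDerivAt τ (deriv_fst_slice hK1)).congr_deriv ?_
    refine Eq.trans ?_ (mfderiv_along_curve hγd hγ0 hdγ (velocity_mdifferentiableAt hF τ x))
    rw [mfderiv_eq_fderiv]
    have e3 : (fun s => deriv (fun σ => ϕ I (F τ x) (F σ (γ s))) τ) =ᶠ[𝓝 0] fun s => fderiv ℝ K (τ, s) (1, 0) := by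
      filter_upwards [(Continuous.tendsto' (by fun_prop) 0 (τ, 0) rfl).eventually hKd] with s hs
      exact (deriv_fst_slice hs).deriv
    have hs := (hK.isSymmSndFDerivAt (by
      rw [minSmoothness_of_isRCLikeNormedField]
      exact WithTop.coe_le_coe.2 (le_top))).eq (1, 0) (0, 1)
    refine hs.trans ((((ContinuousLinearMap.apply ℝ E ((1, 0))).hasFDerivAt.comp_hasDerivAt 0 (deriv_snd_slice hK1)).deriv).symm.trans ?_)
    exact (e3.fderiv_eq.app 1).symm

theorem abs_speed_aux {q c d w s : ℝ} (h : |q + 1 / 2 * (c + d - c)| ≤ w * s) : |d + q + q| ≤ 2 * w * s := by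
  have : d + q + q = 2 * (q + 1 / 2 * (c + d - c)) := by ring
  rw [this, abs_mul, abs_two]; linarith

theorem VelocityC1Le.second {ι : X → M} {τ r : ℝ} {x : X} (h : VelocityC1Le I' g ι F τ x r)
    (u : TangentSpace I' x) (a b c w : E)
    (ha : a = deriv (fun σ => ϕ I (F τ x) (F σ x)) τ)
    (hb : b = mfderiv% (fun y => ϕ I (F τ x) (F τ y)) x u)
    (hc : c = mfderiv% (fun y => deriv (fun σ => ϕ I (F τ x) (F σ y)) τ) x u) :
    |g.inChart (F τ x) (ϕ I (F τ x) (F τ x)) c w +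
    (1 / 2) * (fderiv ℝ (fun z => g.inChart (F τ x) z a w) (ϕ I (F τ x) (F τ x)) b
      + fderiv ℝ (fun z => g.inChart (F τ x) z b w) (ϕ I (F τ x) (F τ x)) a
      - fderiv ℝ (fun z => g.inChart (F τ x) z a b) (ϕ I (F τ x) (F τ x)) w)| ≤
      r * √(g (ι x) (mfderiv% ι x u) (mfderiv% ι x u)) * √(g.inChart (F τ x) (ϕ I (F τ x) (F τ x)) w w) := by
  subst ha hb hc
  exact h.2 u w

theorem hasDerivAt_bilinear {L : E → E →L[ℝ] E →L[ℝ] ℝ} {z B : ℝ → E} {a c : E} {τ : ℝ}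
    (hL : DifferentiableAt ℝ L (z τ)) (hs : ∀ v w, L (z τ) v w = L (z τ) w v)
    (hz : HasDerivAt z a τ) (hB : HasDerivAt B c τ) :
    HasDerivAt (fun σ => L (z σ) (B σ) (B σ))
      (fderiv ℝ (fun y => L y (B τ) (B τ)) (z τ) a + L (z τ) c (B τ) + L (z τ) c (B τ)) τ := by
  refine (((HasFDerivAt.comp_hasDerivAt (l := L) (l' := fderiv ℝ L (z τ)) τ hL.hasFDerivAt hz).clm_apply hB).clm_apply hB).congr_deriv ?_
  rw [((hL.hasFDerivAt.clm_apply (hasFDerivAt_const (B τ) (z τ))).clm_apply (hasFDerivAt_const (B τ) (z τ))).fderiv]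
  simp [hs (B τ) c]

theorem MetricField.IsRiem.hasDerivAt_inChart (hg : g.IsRiem) (p : M) {z B : ℝ → E} {a c : E}
    {τ : ℝ} (hz0 : z τ = ϕ I p p) (hz : HasDerivAt z a τ) (hB : HasDerivAt B c τ) :
    HasDerivAt (fun σ => g.inChart p (z σ) (B σ) (B σ)) (fderiv ℝ (fun y => g.inChart p y (B τ) (B τ)) (ϕ I p p) a +
        g.inChart p (ϕ I p p) c (B τ) + g.inChart p (ϕ I p p) c (B τ)) τ := by
  have hL := hg.chartL_hasFDerivAt p
  rw [← hz0] at hL ⊢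
  exact hasDerivAt_bilinear hL (fun v w => hg.symm _ _ _) hz hB

/-- The derivative of the length of `F_*(u)` is bounded in terms of the velocity bound. -/
theorem VelocityC1Le.speed_le (hg : g.IsRiem) (hF : CMDiff ∞ (fun z : ℝ × X => F z.1 z.2))
    {ι : X → M} {τ r : ℝ} {x : X} (h : VelocityC1Le I' g ι F τ x r) (u : TangentSpace I' x) :
    ∃ n' : ℝ, HasDerivAt (fun σ => g (F σ x) (mfderiv% (F σ) x u) (mfderiv% (F σ) x u)) n' τ ∧
      |n'| ≤ 2 * (r * √(g (ι x) (mfderiv% ι x u) (mfderiv% ι x u))) *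
        √(g (F τ x) (mfderiv% (F τ) x u) (mfderiv% (F τ) x u)) := by
  have m1 := isManifold_one (I := I) (M := M)
  obtain ⟨B, hB, hBd⟩ := exists_chart_derivative hF τ x u
  have hz : HasDerivAt (fun σ => ϕ I (F τ x) (F σ x)) (deriv (fun σ => ϕ I (F τ x) (F σ x)) τ) τ := by
    have := contDiffAt_chart_comp ((family_contMDiff_fst hF x) τ) (mem_extChartAt_source _)
    exact this.diffAt.hasDerivAt
  have hb1 : B τ = (mfderiv% (fun y => ϕ I (F τ x) (F τ y)) x u : E) := by
    rw [← hB.self_of_nhds.2]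
    exact ((mfderiv_comp x (mdifferentiableAt_extChartAt (mem_chart_source _ _)) ((family_contMDiff_snd hF τ x).mdiffAt)).app u).symm
  have hn : (fun σ => g (F σ x) (mfderiv% (F σ) x u) (mfderiv% (F σ) x u)) =ᶠ[𝓝 τ]
      fun σ => g.inChart (F τ x) (ϕ I (F τ x) (F σ x)) (B σ) (B σ) := by
    filter_upwards [hB] with σ hσ
    exact (metric_eq_chart (F σ x) (F τ x) hσ.1 _ _).trans (congrArg (fun w => g.inChart (F τ x) _ w w) hσ.2)
  refine ⟨_, (hg.hasDerivAt_inChart (F τ x) rfl hz hBd).congr_of_eventuallyEq hn, ?_⟩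
  have hnτ : g (F τ x) _ _ = g.inChart (F τ x) _ (B τ) (B τ) := hn.self_of_nhds
  rw [hnτ]
  exact abs_speed_aux (h.second u _ (B τ) _ (B τ) rfl hb1 rfl)

/-- Along the family, lengths of tangent vectors change by a factor between `1 - r` and `1 + r`. -/
theorem abs_sqrt_length_sub_le (hg : g.IsRiem) (hF : CMDiff ∞ (fun z : ℝ × X => F z.1 z.2))
    {r : ℝ} (hr : 0 ≤ r) {x : X} (h : ∀ τ ∈ Icc (0 : ℝ) 1, VelocityC1Le I' g (F 0) F τ x r)
    (u : TangentSpace I' x) {τ : ℝ} (hτ : τ ∈ Icc (0 : ℝ) 1) :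
    |√(g (F τ x) (mfderiv% (F τ) x u) (mfderiv% (F τ) x u)) - √(g (F 0 x) (mfderiv% (F 0) x u) (mfderiv% (F 0) x u))| ≤
    r * √(g (F 0 x) (mfderiv% (F 0) x u) (mfderiv% (F 0) x u)) := by
  have hb : ∀ τ : ℝ, ∃ n' : ℝ, τ ∈ Icc (0 : ℝ) 1 → HasDerivAt _ n' τ ∧ |n'| ≤ 2 * (r * √(g (F 0 x) _ _)) *
        √(g (F τ x) _ _) := fun τ => by
    by_cases hτ : τ ∈ Icc (0 : ℝ) 1
    · obtain ⟨n', h1⟩ := (h τ hτ).speed_le hg hF u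
      exact ⟨n', fun _ => h1⟩
    · exact ⟨0, fun h => absurd h hτ⟩
  choose n' hn' using hb
  exact abs_sqrt_sub_le (Real.sqrt_nonneg _) hr (fun τ _ => hg.nonneg _ _)
    (fun τ hτ => (hn' τ hτ).1) (fun τ hτ => (hn' τ hτ).2) hτ

end

section

theorem exists_left_inverse_normed {f : E' → E} {z : E'} (hf : ContDiffAt ℝ ∞ f z) (hi : Function.Injective (fderiv ℝ f z)) :
    ∃ h : E → E', ContDiffAt ℝ ∞ h (f z) ∧ h (f z) = z ∧ (∀ᶠ y in 𝓝 z, h (f y) = y) ∧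
      (Function.Surjective (fderiv ℝ f z) → ∀ᶠ w in 𝓝 (f z), f (h w) = w) := by
  obtain ⟨l, hl⟩ := (fderiv ℝ f z).toLinearMap.exists_leftInverse_of_injective (LinearMap.ker_eq_bot.2 hi)
  let L : E →L[ℝ] E' := LinearMap.toContinuousLinearMap l
  have hL : ∀ v, L (fderiv ℝ f z v) = v := fun v => hl.app v
  have hk := L.contDiff.contDiffAt.comp z hf
  have hd : HasFDerivAt (fun y => L (f y)) ((ContinuousLinearEquiv.refl ℝ E') : E' →L[ℝ] E') z := by
    refine (L.hasFDerivAt.comp z hf.diffAt.hasFDerivAt).congr_fderiv ?_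
    ext v
    exact hL v
  let e := hk.toOpenPartialHomeomorph _ hd (by simp)
  have hz := hk.mem_toOpenPartialHomeomorph_source hd (by simp)
  have hez : ∀ y, e y = L (f y) := fun y => rfl
  refine ⟨fun w => e.symm (L w), ?_, ?_, ?_, fun hs => ?_⟩
  · exact (hk.to_localInverse hd (by simp)).comp (f z) L.contDiff.contDiffAt
  · exact e.left_inv hz
  · filter_upwards [e.open_source.mem_nhds hz] with y hy using e.left_inv hy
  · have hinj : Function.Injective L := by
      intro a b hab
      obtain ⟨a, rfl⟩ := hs a
      obtain ⟨b, rfl⟩ := hs b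
      rw [hL, hL] at hab
      rw [hab]
    filter_upwards [L.continuous.continuousAt.eventually_mem (e.open_target.mem_nhds (e.map_source hz))] with w hw
    exact hinj (e.right_inv hw)

/-- An immersion has smooth local left inverses, which are inverses if the dimensions agree. -/
theorem exists_left_inverse {f : X → M} {x : X} (hf : CMDiffAt ∞ f x) (hi : Function.Injective (mfderiv% f x)) :
    ∃ h : M → X, CMDiffAt ∞ h (f x) ∧ h (f x) = x ∧ (∀ᶠ y in 𝓝 x, h (f y) = y) ∧
      (Function.Surjective (mfderiv% f x) → ∀ᶠ w in 𝓝 (f x), f (h w) = w) := by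
  have m1 := isManifold_one (I := I) (M := M)
  have m1' := isManifold_one (I := I') (M := X)
  let z : E' := ϕ I' x x
  let k : E' → E := fun y => ϕ I (f x) (f ((ϕ I' x).symm y))
  have hx : (ϕ I' x).symm z = x := extChartAt_to_inv x
  have hsym : CMDiffAt ∞ (ϕ I' x).symm z := contMDiffAt_extChartAt_symm x (mem_extChartAt_target x)
  have hf' : CMDiffAt ∞ f ((ϕ I' x).symm z) := by rw [hx]; exact hf
  have hk : ContDiffAt ℝ ∞ k z := contDiffAt_chart_comp (hf'.comp z hsym) (by simp only [hx]; exact mem_extChartAt_source _)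
  have hkz : k z = ϕ I (f x) (f x) := by simp only [k, hx]
  -- derivative in the chart
  have hder : ∀ u, (fderiv ℝ k z (mfderiv% (ϕ I' x) x u)) = mfderiv% (ϕ I (f x)) (f x) (mfderiv% f x u) := by
    intro u
    have e3 : (k ∘ ϕ I' x) =ᶠ[𝓝 x] (ϕ I (f x) ∘ f) := by
      filter_upwards [extChartAt_source_mem_nhds (I := I') x] with y hy
      simp only [k, Function.comp, (ϕ I' x).left_inv hy]
    rw [← mfderiv_eq_fderiv]
    exact (((mfderiv_comp x (hk.diffAt.mdifferentiableAt) (mdifferentiableAt_extChartAt (mem_chart_source _ _))).app u).symm).trans (((e3.mfderiv_eq (I' := 𝓘(ℝ, E))).app u).trans ((mfderiv_comp x (mdifferentiableAt_extChartAt (mem_chart_source _ _)) hf.mdiffAt).app u))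
  have hsurj' : ∀ v, ∃ u, (mfderiv% (ϕ I' x) x u) = v := by
    intro v
    have := mfderiv_mfderiv_symm_extChartAt x z (mem_extChartAt_target x) v
    rw [hx] at this
    exact ⟨_, this⟩
  have hki : Function.Injective (fderiv ℝ k z) := by
    intro a b hab
    obtain ⟨a, rfl⟩ := hsurj' a
    obtain ⟨b, rfl⟩ := hsurj' b
    have h3 := (mfderiv_symm_mfderiv_extChartAt (f x) (f x) (mem_extChartAt_source _)
      (mfderiv% f x a)).symm.trans ((congrArg _ ((hder a).symm.trans (hab.trans (hder b)))).trans (mfderiv_symm_mfderiv_extChartAt (f x)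
        (f x) (mem_extChartAt_source _) _))
    rw [hi h3]
  obtain ⟨h, hh1, hh2, hh3, hh4⟩ := exists_left_inverse_normed hk hki
  rw [hkz] at hh1 hh2 hh4
  have hh5 := (contMDiffAt_iff_contDiffAt.2 hh1).comp (f x) contMDiffAt_extChartAt
  refine ⟨fun w => (ϕ I' x).symm (h (ϕ I (f x) w)), ?_, ?_, ?_, fun hs => ?_⟩
  · refine ContMDiffAt.comp (f x) ?_ hh5
    rw [hh2]; exact hsym
  · simp only [hh2]; exact hx
  · filter_upwards [(continuousAt_extChartAt x).eventually hh3, extChartAt_source_mem_nhds (I := I') x] with y hy hy'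
    have e : k (ϕ I' x y) = ϕ I (f x) (f y) := by simp only [k, (ϕ I' x).left_inv hy']
    rw [e] at hy
    rw [hy, (ϕ I' x).left_inv hy']
  · have hks : Function.Surjective (fderiv ℝ k z) := by
      intro v
      have e1 := mfderiv_mfderiv_symm_extChartAt (f x) (ϕ I (f x) (f x)) (mem_extChartAt_target _) v
      rw [extChartAt_to_inv] at e1
      obtain ⟨u, hu⟩ := hs _
      exact ⟨_, (hder u).trans ((congrArg _ hu).trans e1)⟩
    have hmem : ∀ᶠ w in 𝓝 (f x), f ((ϕ I' x).symm (h (ϕ I (f x) w))) ∈ (ϕ I (f x)).source := by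
      have hcc : ContinuousAt (fun w => f ((ϕ I' x).symm (h (ϕ I (f x) w)))) (f x) := by
        have hw : (ϕ I' x).symm (h (ϕ I (f x) (f x))) = x := by rw [hh2]; exact hx
        refine ContinuousAt.comp (by rw [hw]; exact hf.continuousAt) (ContinuousAt.comp ?_ hh5.continuousAt)
        rw [hh2]; exact hsym.continuousAt
      refine hcc.eventually_mem ?_
      rw [hh2, hx]
      exact extChartAt_source_mem_nhds _
    filter_upwards [(continuousAt_extChartAt (f x)).eventually (hh4 hks), extChartAt_source_mem_nhds (I := I) (f x), hmem]
      with w hw hw' hw''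
    exact (ϕ I (f x)).injOn hw'' hw' hw

theorem map_nhds_eq_of_bijective {f : X → M} {x : X} (hf : CMDiffAt ∞ f x)
    (hi : Function.Bijective (mfderiv% f x)) : map f (𝓝 x) = 𝓝 (f x) := by
  obtain ⟨h, h1, h2, h3, h4⟩ := exists_left_inverse hf hi.1
  refine le_antisymm hf.continuousAt ?_
  have h5 : Tendsto h (𝓝 (f x)) (𝓝 x) := by
    have := h1.continuousAt
    rwa [ContinuousAt, h2] at this
  calc 𝓝 (f x) = map (f ∘ h) (𝓝 (f x)) := by rw [map_congr (show f ∘ h =ᶠ[𝓝 (f x)] id from h4 hi.2), map_id]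
    _ = map f _ := by rw [map_map]
    _ ≤ map f (𝓝 x) := map_mono h5

theorem IsDiffeoOn.isOpen_image {f : X → M} {S : Set X} {T : Set M} (hS : IsOpen S)
    (h : IsDiffeoOn I I' f S T) {O : Set X} (hO : IsOpen O) (hOS : O ⊆ S) : IsOpen (f '' O) := by
  rw [isOpen_iff_mem_nhds]
  rintro _ ⟨x, hx, rfl⟩
  rw [← map_nhds_eq_of_bijective ((h.1 x (hOS hx)).contMDiffAt (hS.mem_nhds (hOS hx))) (h.2.2 x (hOS hx))]
  exact image_mem_map (hO.mem_nhds hx)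

/-- A diffeomorphism of open sets has a smooth inverse. -/
theorem IsDiffeoOn.exists_inverse [Nonempty X] {f : X → M} {S : Set X} {T : Set M} (hS : IsOpen S)
    (h : IsDiffeoOn I I' f S T) : ∃ k : M → X, (∀ x ∈ S, k (f x) = x) ∧ MapsTo k T S ∧
      (∀ y ∈ T, f (k y) = y) ∧ ContMDiffOn I I' ∞ k T := by
  have hinv := h.2.1.invOn_invFunOn
  have hmaps := h.2.1.surjOn.mapsTo_invFunOn
  refine ⟨Function.invFunOn f S, hinv.1, hmaps, hinv.2, fun y hy => ?_⟩
  set x := Function.invFunOn f S y with hxdef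
  have hx := hmaps hy
  obtain ⟨k, h1, h2, h3, h4⟩ := exists_left_inverse ((h.1 x hx).contMDiffAt (hS.mem_nhds hx)) (h.2.2 x hx).1
  rw [hinv.2 hy] at h1 h2 h4
  refine (h1.congr_of_eventuallyEq ?_).contMDiffWithinAt
  have hk : ∀ᶠ w in 𝓝 y, k w ∈ S := by
    have := h1.continuousAt
    rw [ContinuousAt, h2] at this
    exact this.eventually_mem (hS.mem_nhds hx)
  filter_upwards [h4 (h.2.2 x hx).2, hk] with w hw hw'
  conv_lhs => rw [← hw]
  exact hinv.1 hw'

end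

section

variable {V : Type*} [NormedAddCommGroup V] [NormedSpace ℝ V] [FiniteDimensional ℝ V] {W : Type*}
  [NormedAddCommGroup W] [NormedSpace ℝ W]

theorem continuousOn_integral_zero_one {A : Type*} [TopologicalSpace A] {γ : ℝ × A → W} {U : Set A}
    (hγ : ContinuousOn γ (univ ×ˢ U)) : ContinuousOn (fun z => ∫ τ in (0 : ℝ)..1, γ (τ, z)) U := by
  rw [continuousOn_iff_continuous_domRestrict]
  refine intervalIntegral.continuous_parametric_intervalIntegral_of_continuous' ?_ 0 1
  exact hγ.comp_continuous (by fun_prop) (fun q => ⟨mem_univ _, q.1.2⟩)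

theorem hasFDerivAt_integral_zero_one {β : ℝ × V → ℝ} {U : Set V} (hU : IsOpen U)
    (hβ : ContDiffOn ℝ ∞ β (univ ×ˢ U)) {z : V} (hz : z ∈ U) :
    HasFDerivAt (fun z => ∫ τ in (0 : ℝ)..1, β (τ, z))
      (∫ τ in (0 : ℝ)..1, (fderiv ℝ β (τ, z)).comp (ContinuousLinearMap.inr ℝ ℝ V)) z := by
  have hopen : IsOpen ((univ : Set ℝ) ×ˢ U) := isOpen_univ.prod hU
  have hc : ContinuousOn (fun q => (fderiv ℝ β q).comp (ContinuousLinearMap.inr ℝ ℝ V)) (univ ×ˢ U) :=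
    (hβ.continuousOn_fderiv_of_isOpen hopen (by simp)).clm_comp continuousOn_const
  obtain ⟨r, hr, hrU⟩ := Metric.isOpen_iff.1 hU z hz
  have hsub : Metric.closedBall z (r / 2) ⊆ U := (Metric.closedBall_subset_ball (by linarith)).trans hrU
  obtain ⟨C, hC⟩ := (isCompact_Icc.prod (isCompact_closedBall z (r / 2))).exists_bound_of_continuousOn
    (hc.mono (prod_mono (subset_univ _) hsub))
  have hslice : ∀ y ∈ U, Continuous fun τ => β (τ, y) := fun y hy =>
    hβ.continuousOn.comp_continuous (by fun_prop) fun τ => ⟨mem_univ _, hy⟩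
  refine intervalIntegral.hasFDerivAt_integral_of_dominated_of_fderiv_le
    (F' := fun z τ => (fderiv ℝ β (τ, z)).comp _) (bound := fun _ => C)
    (Metric.closedBall_mem_nhds z (half_pos hr)) ?_ ?_ ?_ ?_ ?_ ?_
  · filter_upwards [hU.mem_nhds hz] with y hy
    exact (hslice y hy).aestronglyMeasurable
  · exact (hslice z hz).intervalIntegrable _ _
  · exact (hc.comp_continuous (by fun_prop) fun τ => ⟨mem_univ _, hz⟩).aestronglyMeasurable
  · refine Eventually.of_forall fun τ hτ y hy => hC (τ, y) ⟨?_, hy⟩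
    rw [uIoc_of_le zero_le_one] at hτ
    exact Ioc_subset_Icc_self hτ
  · simp
  · exact Eventually.of_forall fun τ _ y hy => ((hβ.contDiffAt (hopen.mem_nhds ⟨mem_univ _, hsub hy⟩)).diffAt).hasFDerivAt.comp y (hasFDerivAt_prodMk_right τ y)

theorem contDiffOn_integral_zero_one {β : ℝ × V → ℝ} {U : Set V} (hU : IsOpen U) (hβ : ContDiffOn ℝ ∞ β (univ ×ˢ U)) :
    ContDiffOn ℝ 1 (fun z => ∫ τ in (0 : ℝ)..1, β (τ, z)) U := by
  have hc := continuousOn_integral_zero_one (γ := fun q => (fderiv ℝ β q).comp (ContinuousLinearMap.inr ℝ ℝ V))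
      ((hβ.continuousOn_fderiv_of_isOpen (isOpen_univ.prod hU) (by simp)).clm_comp continuousOn_const)
  have hd : DifferentiableOn ℝ _ U := fun z hz =>
    (hasFDerivAt_integral_zero_one hU hβ hz).differentiableAt.differentiableWithinAt
  exact (contDiffOn_succ_iff_fderiv_of_isOpen hU).2 ⟨hd, by simp, contDiffOn_zero.2 (hc.congr fun z hz => (hasFDerivAt_integral_zero_one hU hβ hz).fderiv)⟩

theorem fderiv_integral_zero_one {β : ℝ × V → ℝ} {U : Set V} (hU : IsOpen U)
    (hβ : ContDiffOn ℝ ∞ β (univ ×ˢ U)) {z : V} (hz : z ∈ U) (v : V) :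
    fderiv ℝ (fun z => ∫ τ in (0 : ℝ)..1, β (τ, z)) z v = ∫ τ in (0 : ℝ)..1, fderiv ℝ β (τ, z) (0, v) ∧
    Continuous fun τ => fderiv ℝ β (τ, z) (0, v) := by
  have hc : Continuous fun τ => (fderiv ℝ β (τ, z)).comp (ContinuousLinearMap.inr ℝ ℝ V) :=
    ((hβ.continuousOn_fderiv_of_isOpen (isOpen_univ.prod hU) (by simp)).clm_comp continuousOn_const).comp_continuous
      (by fun_prop) fun τ => ⟨mem_univ _, hz⟩
  constructor
  · rw [(hasFDerivAt_integral_zero_one hU hβ hz).fderiv,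
      ContinuousLinearMap.intervalIntegral_apply (hc.intervalIntegrable _ _)]
    rfl
  · exact hc.clm_apply continuous_const

end

section

variable {k : ℕ} {T : AltField I M (k + 1)} {F : ℝ → X → M}

/-- The pullback of a form. -/
def AltField.pull {k : ℕ} (T : AltField I M k) (f : X → M) : AltField I' X k :=
  fun x => (T (f x)).compLinearMap (mfderiv% f x).toLinearMap

/-- The contraction of a form along a homotopy with the velocity of the homotopy. -/
def AltField.velPull (I' : ModelWithCorners ℝ E' H') [IsManifold I' ∞ X] (T : AltField I M (k + 1)) (F : ℝ → X → M) (τ : ℝ) :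
    AltField I' X k := fun x =>
  ((T (F τ x)).curryLeft (mfderiv% (fun σ => F σ x) τ (1 : ℝ))).compLinearMap (mfderiv% (F τ) x).toLinearMap

theorem AltField.velPull_apply (τ : ℝ) (x : X) (w : Fin k → TangentSpace I' x) :
    AltField.velPull I' T F τ x w = T (F τ x) (Fin.cons (mfderiv% (fun σ => F σ x) τ (1 : ℝ))
      (fun i => mfderiv% (F τ) x (w i))) := rfl

variable {V : Type} [NormedAddCommGroup V] [NormedSpace ℝ V] [FiniteDimensional ℝ V]

theorem family_comp_contMDiffAt (hF : CMDiff ∞ (fun z : ℝ × X => F z.1 z.2)) {ψ : V → X} {z : V}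
    (hψ : CMDiffAt ∞ ψ z) (τ : ℝ) :
    ContMDiffAt 𝓘(ℝ, ℝ × V) I ∞ (fun q => F q.1 (ψ q.2)) (τ, z) := (hF (τ, ψ z)).comp (τ, z) (ContMDiffAt.prodMk contDiff_fst.contMDiff.contMDiffAt (ContMDiffAt.comp (τ, z) hψ contDiff_snd.contMDiff.contMDiffAt))

theorem family_comp_mfderiv (hF : CMDiff ∞ (fun z : ℝ × X => F z.1 z.2)) {ψ : V → X} {z : V} (hψ : CMDiffAt ∞ ψ z) (τ : ℝ) :
    (mfderiv 𝓘(ℝ, ℝ × V) I (fun q => F q.1 (ψ q.2)) (τ, z) ((1 : ℝ), (0 : V)) : E) =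
      mfderiv 𝓘(ℝ) I (fun σ => F σ (ψ z)) τ (1 : ℝ) ∧
    ∀ v : V, (mfderiv 𝓘(ℝ, ℝ × V) I (fun q : ℝ × V => F q.1 (ψ q.2)) (τ, z) ((0 : ℝ), v) : E) =
      mfderiv I' I (F τ) (ψ z) (mfderiv 𝓘(ℝ, V) I' ψ z v) := by
  have hG := (family_comp_contMDiffAt hF hψ τ).mdiffAt
  constructor
  · have hj : MDifferentiableAt 𝓘(ℝ) 𝓘(ℝ, ℝ × V) _ τ :=
      (differentiableAt_id.prodMk (differentiableAt_const z)).mdifferentiableAt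
    have e := mfderiv_comp τ hG hj
    rw [mfderiv_eq_fderiv] at e
    exact (congrArg _
      (congrArg (fun A : ℝ →L[ℝ] ℝ × V => A 1) (hasFDerivAt_prodMk_left τ z).fderiv)).symm.trans ((e.app 1)).symm
  · intro v
    have e := mfderiv_comp z hG (((differentiableAt_const τ).prodMk differentiableAt_id).mdifferentiableAt)
    rw [mfderiv_eq_fderiv] at e
    exact (congrArg _
      (congrArg (fun A : V →L[ℝ] ℝ × V => A v) (hasFDerivAt_prodMk_right τ z).fderiv)).symm.trans (((e.app v)).symm.trans (((mfderiv_comp z ((family_contMDiff_snd hF τ _).mdiffAt) hψ.mdiffAt).app v)))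

theorem velPull_eq (hF : ContMDiff (𝓘(ℝ).prod I') I ∞ (fun z : ℝ × X => F z.1 z.2)) {ψ : V → X}
    {z : V} (hψ : ContMDiffAt 𝓘(ℝ, V) I' ∞ ψ z) (τ : ℝ) (w : Fin k → V) :
    AltField.velPull I' T F τ (ψ z) (fun i => mfderiv 𝓘(ℝ, V) I' ψ z (w i)) =
      T.field (F τ (ψ z)) (fun i => mfderiv 𝓘(ℝ, ℝ × V) I (fun q : ℝ × V => F q.1 (ψ q.2)) (τ, z)
        ((Fin.cons ((1 : ℝ), (0 : V)) (fun i => ((0 : ℝ), w i)) : Fin (k + 1) → ℝ × V) i)) := by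
  have h := family_comp_mfderiv hF hψ τ
  refine congrArg _ (funext fun i => Fin.cases ?_ (fun i => ?_) i)
  · exact h.1.symm
  · exact (h.2 (w i)).symm

theorem velPull_contDiffOn (hT : SmoothOnMaps T.field)
    (hF : ContMDiff (𝓘(ℝ).prod I') I ∞ (fun z : ℝ × X => F z.1 z.2)) {ψ : V → X} {U : Set V}
    (hU : IsOpen U) (hψ : ContMDiffOn 𝓘(ℝ, V) I' ∞ ψ U) (w : Fin k → V) :
    ContDiffOn ℝ ∞ (fun q : ℝ × V => AltField.velPull I' T F q.1 (ψ q.2)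
      (fun i => mfderiv 𝓘(ℝ, V) I' ψ q.2 (w i))) (univ ×ˢ U) := by
  rintro ⟨τ, z⟩ ⟨-, hz⟩
  refine ((hT (ℝ × V) _ (τ, z) (family_comp_contMDiffAt hF (hψ.contMDiffAt (hU.mem_nhds hz)) τ) (Fin.cons (1, 0) (fun i => (0, w i)))).congr_of_eventuallyEq ?_).contDiffWithinAt
  filter_upwards [(isOpen_univ.prod hU).mem_nhds (show (τ, z) ∈ univ ×ˢ U from ⟨mem_univ _, hz⟩)] with q hq
  exact velPull_eq hF (hψ.contMDiffAt (hU.mem_nhds hq.2)) q.1 w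

theorem velPull_continuous (hT : SmoothOnMaps T.field) (hF : CMDiff ∞ (fun z : ℝ × X => F z.1 z.2)) (x : X)
    (w : Fin k → TangentSpace I' x) : Continuous fun τ => AltField.velPull I' T F τ x w := by
  exact ((velPull_contDiffOn hT hF (isOpen_extChartAt_target x) (contMDiffOn_extChartAt_symm x) (fun i => (mfderiv% (ϕ I' x) x (w i)))).continuousOn.comp_continuous (f := fun τ => (τ, ϕ I' x x)) (by fun_prop) fun τ => ⟨mem_univ _, mem_extChartAt_target x⟩).congr fun τ => (tensor_eq_chart (AltField.velPull I' T F τ).field x x (mem_extChartAt_source x) w).symm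

theorem velPull_intervalIntegrable (hT : SmoothOnMaps T.field) (hF : CMDiff ∞ (fun z : ℝ × X => F z.1 z.2)) (x : X)
    (w : Fin k → TangentSpace I' x) :
    IntervalIntegrable (fun τ => AltField.velPull I' T F τ x w) MeasureTheory.volume 0 1 :=
  (velPull_continuous hT hF x w).intervalIntegrable _ _

/-- The primitive of `F_1^* T - F_0^* T` given by the homotopy formula. -/
def homotopyForm (hT : SmoothOnMaps T.field) (hF : CMDiff ∞ (fun z : ℝ × X => F z.1 z.2)) : AltField I' X k := fun x =>
  { toFun := fun w => ∫ τ in (0 : ℝ)..1, AltField.velPull I' T F τ x w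
    map_update_add' := fun w i a b => by
      simp only [AlternatingMap.map_update_add]
      exact intervalIntegral.integral_add (velPull_intervalIntegrable hT hF x _) (velPull_intervalIntegrable hT hF x _)
    map_update_smul' := fun w i r a => by
      simp only [AlternatingMap.map_update_smul]
      exact intervalIntegral.integral_smul _ _
    map_eq_zero_of_eq' := fun w i j h hij => by
      simp only [AlternatingMap.map_eq_zero_of_eq _ w h hij]
      exact intervalIntegral.integral_zero }

theorem homotopyForm_apply (hT : SmoothOnMaps T.field) (hF : CMDiff ∞ (fun z : ℝ × X => F z.1 z.2)) (x : X)
    (w : Fin k → TangentSpace I' x) :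
    homotopyForm hT hF x w = ∫ τ in (0 : ℝ)..1, AltField.velPull I' T F τ x w := rfl

theorem homotopyForm_contDiffOn (hT : SmoothOnMaps T.field)
    (hF : CMDiff ∞ (fun z : ℝ × X => F z.1 z.2)) {ψ : V → X} {U : Set V}
    (hU : IsOpen U) (hψ : ContMDiffOn 𝓘(ℝ, V) I' ∞ ψ U) (w : Fin k → V) :
    ContDiffOn ℝ 1 (fun z => homotopyForm hT hF (ψ z) (fun i => mfderiv% ψ z (w i))) U :=
  contDiffOn_integral_zero_one hU (velPull_contDiffOn hT hF hU hψ w)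

/-- The homotopy formula `F_1^* T - F_0^* T = dB` for closed forms `T`. -/
theorem homotopy_formula (hT : SmoothOnMaps T.field) (hTc : ClosedOnMaps T.field)
    (hF : CMDiff ∞ (fun z : ℝ × X => F z.1 z.2)) {ψ : V → X} {U : Set V}
    (hU : IsOpen U) (hψ : ContMDiffOn 𝓘(ℝ, V) I' ∞ ψ U) {z : V} (hz : z ∈ U) (v : Fin (k + 1) → V) :
    (T.pull (F 1)) (ψ z) (fun i => mfderiv% ψ z (v i)) - (T.pull (F 0)) (ψ z) (fun i => mfderiv% ψ z (v i)) =
    ∑ i : Fin (k + 1), (-1 : ℝ) ^ (i : ℕ) * fderiv ℝ (fun z => homotopyForm hT hF (ψ z)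
      (fun j => mfderiv% ψ z (v (i.succAbove j)))) z (v i) := by
  have hψz : ∀ y ∈ U, CMDiffAt ∞ ψ y := fun y hy => hψ.contMDiffAt (hU.mem_nhds hy)
  let β : Fin (k + 1) → ℝ × V → ℝ := fun i q => AltField.velPull I' T F q.1 (ψ q.2)
      (fun j => mfderiv% ψ q.2 (v (i.succAbove j)))
  have hβ : ∀ i, ContDiffOn ℝ ∞ (β i) (univ ×ˢ U) := fun i => velPull_contDiffOn hT hF hU hψ fun j => v _
  let G : ℝ × V → M := fun q => F q.1 (ψ q.2)
  have hG := fun τ y hy => family_comp_contMDiffAt hF (hψz y hy) τ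
  let t : ℝ × V → ℝ := fun q => T.field (G q) (fun i => mfderiv 𝓘(ℝ, ℝ × V) I G q ((0 : ℝ), v i))
  have ht' : ∀ τ, t (τ, z) = (T.pull (F τ)) (ψ z) _ := fun τ =>
    congrArg _ (funext fun i => (family_comp_mfderiv hF (hψz z hz) τ).2 (v i))
  have hcl : ∀ τ, fderiv ℝ t (τ, z) (1, 0) = ∑ i : Fin (k + 1), (-1 : ℝ) ^ (i : ℕ) * fderiv ℝ (β i) (τ, z) (0, v i) := by
    intro τ
    have h := hTc (ℝ × V) G (τ, z) (hG τ z hz) (Fin.cons ((1 : ℝ), (0 : V)) (fun i => ((0 : ℝ), v i)))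
    rw [Fin.sum_univ_succ] at h
    have e : ∀ i, (fun q => T.field (G q) (fun j => mfderiv 𝓘(ℝ, ℝ × V) I G q
        ((Fin.cons ((1 : ℝ), (0 : V)) (fun i => ((0 : ℝ), v i)) : Fin (k + 2) → ℝ × V)
          (i.succ.succAbove j)))) =ᶠ[𝓝 (τ, z)] β i := by
      intro i
      filter_upwards [(isOpen_univ.prod hU).mem_nhds (show (τ, z) ∈ univ ×ˢ U from ⟨mem_univ _, hz⟩)] with q hq
      refine Eq.trans (congrArg (T (G q)) (funext fun j => Fin.cases ?_ (fun j => ?_) j)) (velPull_eq hF (hψz q.2 hq.2) q.1 fun j => v _).symm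
      · rw [Fin.succ_succAbove_zero]; rfl
      · rw [Fin.succ_succAbove_succ]; rfl
    have h2 : ∀ i : Fin (k + 1), (-1 : ℝ) ^ (i.succ : ℕ) • fderiv ℝ (fun q =>
        T.field (G q) (fun j => mfderiv 𝓘(ℝ, ℝ × V) I G q
        ((Fin.cons ((1 : ℝ), (0 : V)) (fun i => ((0 : ℝ), v i)) : Fin (k + 2) → ℝ × V) (i.succ.succAbove j)))) (τ, z)
          ((Fin.cons ((1 : ℝ), (0 : V)) (fun i => ((0 : ℝ), v i)) : Fin (k + 2) → ℝ × V) i.succ) =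
        -((-1 : ℝ) ^ (i : ℕ) * fderiv ℝ (β i) (τ, z) (0, v i)) := by
      intro i
      rw [(e i).fderiv_eq, Fin.cons_succ, Fin.val_succ, pow_succ, smul_eq_mul]
      ring
    rw [Finset.sum_congr rfl fun i _ => h2 i, Finset.sum_neg_distrib] at h
    have h3 : (-1 : ℝ) ^ ((0 : Fin (k + 2)) : ℕ) • fderiv ℝ (fun q =>
        T.field (G q) (fun j => mfderiv 𝓘(ℝ, ℝ × V) I G q
        ((Fin.cons ((1 : ℝ), (0 : V)) (fun i => ((0 : ℝ), v i)) : Fin (k + 2) → ℝ × V)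
          ((0 : Fin (k + 2)).succAbove j)))) (τ, z)
          ((Fin.cons ((1 : ℝ), (0 : V)) (fun i => ((0 : ℝ), v i)) : Fin (k + 2) → ℝ × V) 0) =
        fderiv ℝ t (τ, z) (1, 0) := by
      rw [Fin.val_zero, pow_zero, one_smul]
      rfl
    rw [h3] at h
    linarith
  have hd := fun τ => deriv_fst_slice (((fun τ => hT (ℝ × V) G (τ, z) (hG τ z hz) fun i => (0, v i)) τ).diffAt)
  have hci := fun i => (fderiv_integral_zero_one hU (hβ i) hz (v i)).2
  have hcont : Continuous fun τ => fderiv ℝ t (τ, z) (1, 0) := by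
    rw [funext hcl]
    exact continuous_finsetSum _ fun i _ => continuous_const.mul (hci i)
  rw [← ht' 1, ← ht' 0, ← (intervalIntegral.integral_eq_sub_of_hasDerivAt (fun τ _ => hd τ) (hcont.intervalIntegrable 0 1)), funext hcl]
  exact (intervalIntegral.integral_finsetSum fun i _ =>
    (continuous_const.mul (hci i)).intervalIntegrable _ _).trans (Finset.sum_congr rfl fun i _ => (intervalIntegral.integral_const_mul _ _).trans (congrArg _ (fderiv_integral_zero_one hU (hβ i) hz (v i)).1.symm))

end

open MeasureTheory

section

variable (I')

/-- Smooth parametrisations of open subsets of `X`. -/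
structure IsParam (ψ : E' → X) (U : Set E') : Prop where
  isOpen : IsOpen U
  smooth : ContMDiffOn 𝓘(ℝ, E') I' ∞ ψ U
  inj : InjOn ψ U
  imm : ∀ z ∈ U, Function.Injective (mfderiv% ψ z)

variable {I'} {ψ : E' → X} {U : Set E'}

theorem IsParam.contMDiffAt (h : IsParam I' ψ U) {z : E'} (hz : z ∈ U) :
    CMDiffAt ∞ ψ z := h.smooth.contMDiffAt (h.isOpen.mem_nhds hz)

theorem IsParam.map_nhds (h : IsParam I' ψ U) {z : E'} (hz : z ∈ U) : map ψ (𝓝 z) = 𝓝 (ψ z) := map_nhds_eq_of_bijective (h.contMDiffAt hz) ⟨h.imm z hz, (LinearMap.injective_iff_surjective (K := ℝ) (V := E') ).1 (h.imm z hz)⟩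

theorem IsParam.isOpen_image (h : IsParam I' ψ U) {O : Set E'} (hO : IsOpen O) (hOU : O ⊆ U) : IsOpen (ψ '' O) := by
  rw [isOpen_iff_mem_nhds]
  rintro _ ⟨z, hz, rfl⟩
  rw [← h.map_nhds (hOU hz)]
  exact image_mem_map (hO.mem_nhds hz)

theorem IsParam.mono (h : IsParam I' ψ U) {O : Set E'} (hO : IsOpen O) (hOU : O ⊆ U) : IsParam I' ψ O :=
  ⟨hO, h.smooth.mono hOU, h.inj.mono hOU, fun z hz => h.imm z (hOU hz)⟩

theorem IsParam.continuousOn_image (h : IsParam I' ψ U) {A : Type*} [TopologicalSpace A] {k : X → A}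
    (hk : ContinuousOn (fun z => k (ψ z)) U) : ContinuousOn k (ψ '' U) := by
  rintro _ ⟨z, hz, rfl⟩
  refine ContinuousAt.continuousWithinAt ?_
  rw [ContinuousAt, ← h.map_nhds hz, tendsto_map'_iff]
  exact hk.continuousAt (h.isOpen.mem_nhds hz)

theorem isParam_chart (p : X) : IsParam I' (ϕ I' p).symm (ϕ I' p).target where
  isOpen := isOpen_extChartAt_target p
  smooth := contMDiffOn_extChartAt_symm p
  inj := (ϕ I' p).symm.injOn
  imm z hz u v huv := by
    have := congrArg (fun w => (mfderiv% (ϕ I' p) _ w)) huv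
    exact (mfderiv_mfderiv_symm_extChartAt p z hz u).symm.trans (this.trans (mfderiv_mfderiv_symm_extChartAt p z hz v))

variable {k : ℕ} (P : AltField I' X k) (b : Module.Basis (Fin k) ℝ E')

/-- The value of a form on the coordinate frame. -/
def coordDensity (ψ : E' → X) (z : E') : ℝ := P (ψ z) (fun i => mfderiv% ψ z (b i))

theorem alternating_comp_basis {W : Type*} [AddCommGroup W] [Module ℝ W]
    (b : Module.Basis (Fin k) ℝ W) (c : W [⋀^Fin k]→ₗ[ℝ] ℝ) (A : W →ₗ[ℝ] W) :
    c (fun i => A (b i)) = LinearMap.det A * c b := by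
  have h2 := congrArg (fun η => η (fun i => A (b i))) (AlternatingMap.eq_smul_basis_det b c)
  simp only [AlternatingMap.smul_apply, smul_eq_mul] at h2
  have h3 := Module.Basis.det_comp b A b
  rw [Module.Basis.det_self, mul_one] at h3
  rw [h2, show (fun i => A (b i)) = A ∘ b from rfl, h3, mul_comm]

/-- The change of coordinates for the density of a form. -/
theorem coordDensity_eq {p : X} {z : E'} (hψ : CMDiffAt ∞ ψ z) (hz : ψ z ∈ (ϕ I' p).source) :
    coordDensity P b ψ z = (fderiv ℝ (fun z => ϕ I' p (ψ z)) z).det * coordDensity P b (ϕ I' p).symm (ϕ I' p (ψ z)) := by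
  let c : E' [⋀^Fin k]→ₗ[ℝ] ℝ := (P ((ϕ I' p).symm (ϕ I' p (ψ z)))).compLinearMap
      (mfderiv% (ϕ I' p).symm (ϕ I' p (ψ z))).toLinearMap
  have h2 := fun i => mfderiv_chart_comp hψ.mdiffAt hz (b i)
  exact ((tensor_eq_chart P.field p (ψ z) hz (fun i => mfderiv% ψ z (b i))).trans (congrArg c (funext fun i => (h2 i).symm))).trans (alternating_comp_basis b c
    (fderiv ℝ (fun z => ϕ I' p (ψ z)) z).toLinearMap)

variable [MeasurableSpace E'] [BorelSpace E'] (ν : Measure E') [ν.IsAddHaarMeasure] [MeasurableSpace X]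
  [BorelSpace X]

/-- The measure on `E'` with the coordinate density of the form `P`, on `U`. -/
def densityMeasure (ψ : E' → X) (U : Set E') : Measure E' :=
  (ν.restrict U).withDensity fun z => ENNReal.ofReal |coordDensity P b ψ z|

theorem IsParam.measurableSet_preimage (h : IsParam I' ψ U) {A : Set X} (hA : MeasurableSet A) :
    MeasurableSet (U ∩ ψ ⁻¹' A) := by
  convert (h.isOpen.measurableSet.subtype_image (((continuousOn_iff_continuous_domRestrict.1 h.smooth.continuousOn).measurable) hA)) using 1
  ext z
  simp [and_comm]

theorem IsParam.aemeasurable (h : IsParam I' ψ U) : AEMeasurable ψ (densityMeasure P b ν ψ U) :=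
  (h.smooth.continuousOn.aemeasurable h.isOpen.measurableSet).mono_ac (withDensity_absolutelyContinuous _ _)

theorem IsParam.map_apply (h : IsParam I' ψ U) {A : Set X} (hA : MeasurableSet A) : (densityMeasure P b ν ψ U).map ψ A =
      ∫⁻ z in U ∩ ψ ⁻¹' A, ENNReal.ofReal |coordDensity P b ψ z| ∂ν := by
  rw [Measure.map_apply_of_aemeasurable (h.aemeasurable P b ν) hA, densityMeasure,
    withDensity_apply', Measure.restrict_restrict' h.isOpen.measurableSet, inter_comm]

theorem IsParam.chart_apply (h : IsParam I' ψ U) (p : X) {A : Set X} (hA : MeasurableSet A) (hAp : A ⊆ (ϕ I' p).source) :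
    ∫⁻ z in (ϕ I' p).target ∩ (ϕ I' p).symm ⁻¹' (A ∩ ψ '' U), ENNReal.ofReal |coordDensity P b (ϕ I' p).symm z| ∂ν =
    ∫⁻ z in U ∩ ψ ⁻¹' A, ENNReal.ofReal |coordDensity P b ψ z| ∂ν := by
  have hS := h.measurableSet_preimage hA
  have himg : (ϕ I' p).target ∩ (ϕ I' p).symm ⁻¹' (A ∩ ψ '' U) = (fun z => ϕ I' p (ψ z)) '' (U ∩ ψ ⁻¹' A) := by
    ext w
    constructor
    · rintro ⟨hw, hwA, z, hz, hzw⟩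
      refine ⟨z, ⟨hz, ?_⟩, ?_⟩
      · rw [mem_preimage, hzw]; exact hwA
      · simp only [hzw, (ϕ I' p).right_inv hw]
    · rintro ⟨z, ⟨hz, hzA⟩, rfl⟩
      have hs := hAp hzA
      refine ⟨(ϕ I' p).map_source hs, ?_, ?_⟩
      · rw [(ϕ I' p).left_inv hs]; exact hzA
      · rw [(ϕ I' p).left_inv hs]; exact ⟨z, hz, rfl⟩
  have hinj : InjOn _ (U ∩ ψ ⁻¹' A) := fun z hz w hw hzw => h.inj hz.1 hw.1 ((ϕ I' p).injOn (hAp hz.2) (hAp hw.2) hzw)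
  have hd : ∀ z ∈ U ∩ ψ ⁻¹' A, HasFDerivWithinAt _ _ (U ∩ ψ ⁻¹' A) z := fun z hz =>
    ((contDiffAt_chart_comp (h.contMDiffAt hz.1) (hAp hz.2)).diffAt).hasFDerivAt.hasFDerivWithinAt
  rw [himg, lintegral_image_eq_lintegral_abs_det_fderiv_mul ν hS hd hinj]
  refine setLIntegral_congr_fun hS fun z hz => ?_
  rw [coordDensity_eq P b (h.contMDiffAt hz.1) (hAp hz.2), abs_mul, ENNReal.ofReal_mul (abs_nonneg _)]

/-- The measure on `X` given by the absolute value of a top-degree form. -/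
theorem exists_form_measure [SigmaCompactSpace X] [Nonempty X] :
    ∃ μ : Measure X, ∀ (ψ : E' → X) (U : Set E'), IsParam I' ψ U →
      μ.restrict (ψ '' U) = (densityMeasure P b ν ψ U).map ψ := by
  obtain ⟨s, hs, hcov⟩ := countable_cover_nhds_of_sigmaCompact (fun x : X => extChartAt_source_mem_nhds (I := I') x)
  have hne : s.Nonempty := by
    by_contra h
    rw [not_nonempty_iff_eq_empty] at h
    obtain ⟨x⟩ := ‹Nonempty X›
    have : x ∈ ⋃ y ∈ s, (ϕ I' y).source := by rw [hcov]; trivial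
    simp [h] at this
  obtain ⟨c, rfl⟩ := hs.exists_eq_range hne
  let W : ℕ → Set X := disjointed fun n => (ϕ I' (c n)).source
  have hWm : ∀ n, MeasurableSet (W n) := fun n =>
    MeasurableSet.disjointed (fun n => (isOpen_extChartAt_source (c n)).measurableSet) n
  have hWU : ⋃ n, W n = univ := by
    rw [iUnion_disjointed]
    simpa using hcov
  refine ⟨Measure.sum fun n => ((densityMeasure P b ν (ϕ I' (c n)).symm
    (ϕ I' (c n)).target).map (ϕ I' (c n)).symm).restrict (W n), fun ψ U h => ?_⟩
  ext A hA
  have hψU := (h.isOpen_image h.isOpen subset_rfl).measurableSet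
  rw [Measure.restrict_apply hA, Measure.sum_apply _ (hA.inter hψU), h.map_apply P b ν hA]
  have h1 : U ∩ ψ ⁻¹' A = ⋃ n, U ∩ ψ ⁻¹' (A ∩ W n) := by
    rw [← inter_iUnion, ← preimage_iUnion, ← inter_iUnion, hWU, inter_univ]
  rw [h1, lintegral_iUnion (fun n => h.measurableSet_preimage (hA.inter (hWm n)))]
  · refine tsum_congr fun n => ?_
    rw [Measure.restrict_apply (hA.inter hψU), (isParam_chart (c n)).map_apply P b ν
      ((hA.inter hψU).inter (hWm n)), inter_right_comm]
    exact h.chart_apply P b ν (c n) (hA.inter (hWm n)) (inter_subset_right.trans ((fun n => disjointed_subset _ n) n))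
  · exact fun m n hmn => Disjoint.mono (inter_subset_right.trans (preimage_mono inter_subset_right))
      (inter_subset_right.trans (preimage_mono inter_subset_right)) (((disjoint_disjointed _) hmn).preimage ψ)

end

section

variable {k : ℕ} {P : AltField I' X k} {b : Module.Basis (Fin k) ℝ E'} [MeasurableSpace E'] [BorelSpace E']
  {ν : Measure E'} [ν.IsAddHaarMeasure] [MeasurableSpace X] [BorelSpace X] {ψ : E' → X} {U : Set E'}

/-- The measures that are given by the absolute value of the form `P`. -/
def IsFormMeasure (P : AltField I' X k) (b : Module.Basis (Fin k) ℝ E') (ν : Measure E') (μ : Measure X) : Prop :=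
  ∀ (ψ : E' → X) (U : Set E'), IsParam I' ψ U → μ.restrict (ψ '' U) = (densityMeasure P b ν ψ U).map ψ

/-- The form `P` has continuous coefficients. -/
def ContinuousOnParams (P : AltField I' X k) (b : Module.Basis (Fin k) ℝ E') : Prop :=
  ∀ (ψ : E' → X) (U : Set E'), IsParam I' ψ U → ContinuousOn (coordDensity P b ψ) U

variable {μ : Measure X}

theorem IsFormMeasure.apply (hμ : IsFormMeasure P b ν μ) (h : IsParam I' ψ U) {A : Set X}
    (hA : MeasurableSet A) (hAU : A ⊆ ψ '' U) :
    μ A = ∫⁻ z in U ∩ ψ ⁻¹' A, ENNReal.ofReal |coordDensity P b ψ z| ∂ν := by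
  rw [← h.map_apply P b ν hA, ← hμ ψ U h, Measure.restrict_apply hA, inter_eq_left.2 hAU]

theorem IsFormMeasure.isOpenPosMeasure (hμ : IsFormMeasure P b ν μ) (hP : ContinuousOnParams P b)
    (h0 : ∀ x (u : Fin k → TangentSpace I' x), LinearIndependent ℝ u → P x u ≠ 0) :
    μ.IsOpenPosMeasure := by
  refine ⟨fun O hO hne h => ?_⟩
  obtain ⟨x, hx⟩ := hne
  have hp := isParam_chart (I' := I') x
  set U := (ϕ I' x).target ∩ (ϕ I' x).symm ⁻¹' O with hU
  have hUo : IsOpen U := (continuousOn_extChartAt_symm x).isOpen_inter_preimage hp.isOpen hO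
  have hp' := hp.mono hUo inter_subset_left
  have hz : ϕ I' x x ∈ U := ⟨mem_extChartAt_target x, by rw [mem_preimage, extChartAt_to_inv]; exact hx⟩
  have h1 : μ ((ϕ I' x).symm '' U) = 0 := measure_mono_null (by rintro _ ⟨z, hz, rfl⟩; exact hz.2) h
  rw [hμ.apply hp' (hp'.isOpen_image hUo subset_rfl).measurableSet subset_rfl,
    inter_eq_left.2 (subset_preimage_image _ _)] at h1
  have h2 : ∀ z ∈ U, coordDensity P b (ϕ I' x).symm z ≠ 0 := fun z hz => by
    exact h0 _ _ (b.linearIndependent.map' (mfderiv% (ϕ I' x).symm z).toLinearMap (LinearMap.ker_eq_bot.2 (hp'.imm z hz)))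
  have hm : AEMeasurable (fun z => ENNReal.ofReal |coordDensity P b (ϕ I' x).symm z|)
      (ν.restrict U) := (ENNReal.continuous_ofReal.comp_continuousOn (hP _ U hp').abs).aemeasurable
    hUo.measurableSet
  rw [lintegral_eq_zero_iff' hm] at h1
  have h3 : ν.restrict U = 0 := by
    have h5 : ∀ᵐ z ∂ν, z ∉ U := by
      filter_upwards [(ae_restrict_iff' hUo.measurableSet).1 h1] with z hz hzU
      have := hz hzU
      simp only [Pi.zero_apply, ENNReal.ofReal_eq_zero] at this
      exact h2 z hzU (abs_eq_zero.1 (le_antisymm this (abs_nonneg _)))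
    rw [Measure.restrict_eq_zero]
    exact measure_eq_zero_iff_ae_notMem.2 h5
  rw [Measure.restrict_eq_zero] at h3
  exact hUo.measure_ne_zero ν ⟨_, hz⟩ h3

theorem IsFormMeasure.isLocallyFiniteMeasure (hμ : IsFormMeasure P b ν μ)
    (hP : ContinuousOnParams P b) : IsLocallyFiniteMeasure μ := by
  refine ⟨fun x => ?_⟩
  have hp := isParam_chart (I' := I') x
  obtain ⟨r, hr, hrU⟩ := Metric.isOpen_iff.1 hp.isOpen _ (mem_extChartAt_target x)
  set z := ϕ I' x x
  have hsub : Metric.closedBall z (r / 2) ⊆ (ϕ I' x).target := (Metric.closedBall_subset_ball (by linarith)).trans hrU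
  have hp' := hp.mono Metric.isOpen_ball (Metric.ball_subset_closedBall.trans hsub)
  have ho := hp'.isOpen_image hp'.isOpen subset_rfl
  refine ⟨_, ho.mem_nhds ⟨z, Metric.mem_ball_self (half_pos hr), extChartAt_to_inv x⟩, ?_⟩
  rw [hμ.apply hp' ho.measurableSet subset_rfl, inter_eq_left.2 (subset_preimage_image _ _)]
  obtain ⟨C, hC⟩ := (isCompact_closedBall z (r / 2)).exists_bound_of_continuousOn ((hP _ _ hp).mono hsub)
  refine (setLIntegral_mono' Metric.isOpen_ball.measurableSet
    fun y hy => ENNReal.ofReal_le_ofReal (hC y (Metric.ball_subset_closedBall hy))).trans_lt ?_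
  rw [setLIntegral_const]
  exact ENNReal.mul_lt_top ENNReal.ofReal_lt_top measure_ball_lt_top

theorem IsFormMeasure.integrableOn_iff [SecondCountableTopology X] (hμ : IsFormMeasure P b ν μ) (hP : ContinuousOnParams P b)
    (h : IsParam I' ψ U) {q : X → ℝ} (hq : ContinuousOn q (ψ '' U)) :
    (IntegrableOn q (ψ '' U) μ ↔ IntegrableOn (fun z => |coordDensity P b ψ z| * q (ψ z)) U ν) ∧
    ∫ x in ψ '' U, q x ∂μ = ∫ z in U, |coordDensity P b ψ z| * q (ψ z) ∂ν := by
  have hm : AEStronglyMeasurable q (μ.restrict (ψ '' U)) :=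
    hq.aestronglyMeasurable (h.isOpen_image h.isOpen subset_rfl).measurableSet
  rw [hμ ψ U h] at hm
  have hd : AEMeasurable _ (ν.restrict U) :=
    (continuous_real_toNNReal.comp_continuousOn (hP ψ U h).abs).aemeasurable h.isOpen.measurableSet
  constructor
  · rw [IntegrableOn, hμ ψ U h, integrable_map_measure hm (h.aemeasurable P b ν), densityMeasure]
    refine (integrable_withDensity_iff_integrable_smul₀ hd).trans (integrable_congr (Eventually.of_forall fun z => ?_))
    simp [NNReal.smul_def]
  · rw [hμ ψ U h, integral_map (h.aemeasurable P b ν) hm, densityMeasure]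
    refine (integral_withDensity_eq_integral_smul₀ hd _).trans (integral_congr_ae (Eventually.of_forall fun z => ?_))
    simp [NNReal.smul_def]

end

section

variable {V : Type*} [NormedAddCommGroup V] [NormedSpace ℝ V] [FiniteDimensional ℝ V] [MeasurableSpace V]
  [BorelSpace V] {ν : Measure V} [ν.IsAddHaarMeasure] {U K : Set V}

theorem integrableOn_of_eq_zero_off_compact (hU : IsOpen U) (hK : IsCompact K) (hKU : K ⊆ U)
    {c : V → ℝ} (hc : ContinuousOn c U) (h0 : ∀ z ∈ U, z ∉ K → c z = 0) : IntegrableOn c U ν :=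
  ((hc.mono hKU).integrableOn_compact hK).of_forall_sdiff_eq_zero hU.measurableSet fun z hz => h0 z hz.1 hz.2

theorem integral_fderiv_eq_zero (hU : IsOpen U) (hK : IsCompact K) (hKU : K ⊆ U) {q : V → ℝ}
    (hq : ContDiffOn ℝ 1 q U) (h0 : ∀ z ∈ U, z ∉ K → q z = 0) (v : V) :
    ∫ z in U, fderiv ℝ q z v ∂ν = 0 := by
  set q' := U.indicator q with hq'
  have hU' : ∀ z ∈ U, q' =ᶠ[𝓝 z] q := fun z hz => by filter_upwards [hU.mem_nhds hz] with w hw using indicator_of_mem hw _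
  have hK' : ∀ z ∉ K, q' =ᶠ[𝓝 z] fun _ => 0 := fun z hz => by
    filter_upwards [hK.isClosed.isOpen_compl.mem_nhds hz] with w hw
    by_cases hwU : w ∈ U
    · exact (indicator_of_mem hwU _).trans (h0 w hwU hw)
    · exact indicator_of_notMem hwU _
  have hd := contDiff_iff_contDiffAt.2 fun z => by
    by_cases hz : z ∈ U
    · exact (hq.contDiffAt (hU.mem_nhds hz)).congr_of_eventuallyEq (hU' z hz)
    · exact contDiffAt_const.congr_of_eventuallyEq (hK' z fun h => hz (hKU h))
  have hf0 : ∀ z ∉ K, fderiv ℝ q' z v = 0 := fun z hz => by rw [(hK' z hz).fderiv_eq]; simp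
  have h1 := integral_mul_fderiv_eq_neg_fderiv_mul_of_integrable (μ := ν) (f := fun _ => (1 : ℝ))
    (by simp) (by simpa using ((hd.continuous_fderiv (by simp)).clm_apply continuous_const).integrable_of_hasCompactSupport (HasCompactSupport.intro hK hf0))
    (by simpa using hd.continuous.integrable_of_hasCompactSupport (HasCompactSupport.intro hK fun z hz => (hK' z hz).self_of_nhds))
    (fun _ _ => differentiableAt_const _) (fun z _ => (hd.differentiable (by simp)) z)
  simp only [one_mul, fderiv_fun_const, Pi.zero_apply, zero_apply, zero_mul, integral_zero, neg_zero] at h1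
  rw [← h1, setIntegral_congr_fun hU.measurableSet (g := fun z => fderiv ℝ q' z v)
    fun z hz => by simp only [(hU' z hz).fderiv_eq]]
  exact setIntegral_eq_integral_of_forall_compl_eq_zero fun z hz => hf0 z fun h => hz (hKU h)

end

section

variable {k : ℕ}

theorem alternating_mul_comm {W : Type*} [AddCommGroup W] [Module ℝ W]
    (b : Module.Basis (Fin k) ℝ W) (c d : W [⋀^Fin k]→ₗ[ℝ] ℝ) (u : Fin k → W) :
    c u * d b = c b * d u := by
  have h1 := (AlternatingMap.eq_smul_basis_det b c).app u
  have h2 := (AlternatingMap.eq_smul_basis_det b d).app u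
  simp only [AlternatingMap.smul_apply, smul_eq_mul] at h1 h2
  rw [h1, h2]; ring

/-- The quotient of two forms of top degree. -/
def formRatio (b : Module.Basis (Fin k) ℝ E') (A P : AltField I' X k) (x : X) : ℝ := A x (fun i => b i) / P x (fun i => b i)

variable {b : Module.Basis (Fin k) ℝ E'} {A P : AltField I' X k}

theorem formRatio_mul {x : X} (h : P x (fun i => b i) ≠ 0) (u : Fin k → TangentSpace I' x) :
    formRatio b A P x * P x u = A x u := by
  have := alternating_mul_comm b (A x) (P x) u
  rw [formRatio, div_mul_eq_mul_div, div_eq_iff h]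
  exact this.symm

variable {ψ : E' → X} {U : Set E'}

theorem formRatio_eq {x : X} (h : P x (fun i => b i) ≠ 0) (u : Fin k → TangentSpace I' x)
    (hu : P x u ≠ 0) : formRatio b A P x = A x u / P x u := by
  rw [eq_div_iff hu]; exact formRatio_mul h u

theorem coordDensity_ne_zero (h0 : ∀ x (u : Fin k → TangentSpace I' x), LinearIndependent ℝ u → P x u ≠ 0)
    (h : IsParam I' ψ U) {z : E'} (hz : z ∈ U) : coordDensity P b ψ z ≠ 0 :=
  h0 _ _ (b.linearIndependent.map' (mfderiv% ψ z).toLinearMap (LinearMap.ker_eq_bot.2 (h.imm z hz)))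

theorem basis_ne_zero (h0 : ∀ x (u : Fin k → TangentSpace I' x), LinearIndependent ℝ u → P x u ≠ 0) (x : X) :
    P x (fun i => b i) ≠ 0 := h0 x _ b.linearIndependent

theorem continuousOn_formRatio (h0 : ∀ x (u : Fin k → TangentSpace I' x), LinearIndependent ℝ u → P x u ≠ 0)
    (hP : ContinuousOnParams P b) (h : IsParam I' ψ U) (hA : ContinuousOn (coordDensity A b ψ) U) :
    ContinuousOn (formRatio b A P) (ψ '' U) := by
  exact h.continuousOn_image ((hA.div (hP ψ U h) fun z hz => coordDensity_ne_zero h0 h hz).congr fun z hz => formRatio_eq (basis_ne_zero h0 _) _ (coordDensity_ne_zero h0 h hz))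

theorem IsParam.isCompact_preimage (h : IsParam I' ψ U) {K : Set X} (hK : IsCompact K)
    (hKU : K ⊆ ψ '' U) : IsCompact (U ∩ ψ ⁻¹' K) := by
  have ho : IsOpenMap (U.domRestrict ψ) := fun O hO => by
    convert (h.isOpen_image (h.isOpen.isOpenMap_subtype_val O hO) (Subtype.coe_image_subset U O)) using 1
    ext x; simp
  have he := Topology.IsOpenEmbedding.of_continuous_injective_isOpenMap (continuousOn_iff_continuous_domRestrict.1 h.smooth.continuousOn) (fun z w hzw => Subtype.ext (h.inj z.2 w.2 hzw)) ho
  convert (((he.isInducing.isCompact_preimage_iff (by rwa [Set.range_domRestrict])).2 hK).image continuous_subtype_val) using 1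
  ext z; simp [and_comm]

variable [MeasurableSpace E'] [BorelSpace E'] {ν : Measure E'} [ν.IsAddHaarMeasure] [MeasurableSpace X]
  [BorelSpace X] {μ : Measure X} [SecondCountableTopology X] [T2Space X]

/-- Integrals of forms with compact support in the image of a parametrisation. -/
theorem integral_formRatio (h0 : ∀ x (u : Fin k → TangentSpace I' x), LinearIndependent ℝ u → P x u ≠ 0)
    (hP : ContinuousOnParams P b) (hμ : IsFormMeasure P b ν μ) (h : IsParam I' ψ U)
    {s : ℝ} (hs : ∀ z ∈ U, |coordDensity P b ψ z| = s * coordDensity P b ψ z)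
    (hA : ContinuousOn (coordDensity A b ψ) U) {K : Set X} (hK : IsCompact K) (hKU : K ⊆ ψ '' U)
    (hA0 : ∀ x ∉ K, ∀ u, A x u = 0) :
    Integrable (formRatio b A P) μ ∧ ∫ x, formRatio b A P x ∂μ = s * ∫ z in U, coordDensity A b ψ z ∂ν := by
  have h1 := hμ.integrableOn_iff hP h (continuousOn_formRatio h0 hP h hA)
  have h2 : ∀ z ∈ U, |coordDensity P b ψ z| * formRatio b A P (ψ z) = s * coordDensity A b ψ z := fun z hz => by
      rw [hs z hz, mul_assoc, mul_comm (coordDensity P b ψ z)]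
      exact congrArg (s * ·) (formRatio_mul (basis_ne_zero h0 _) _)
  have h3 : IntegrableOn _ U ν :=
    integrableOn_of_eq_zero_off_compact h.isOpen (h.isCompact_preimage hK hKU) inter_subset_left hA
      fun z hz hzK => hA0 _ (fun hx => hzK ⟨hz, hx⟩) _
  have h4 : ∀ x ∉ ψ '' U, formRatio b A P x = 0 := fun x hx => by
    exact (congrArg (· / _) (hA0 x (fun h => hx (hKU h)) _)).trans (zero_div _)
  constructor
  · refine (integrableOn_iff_integrable_of_support_subset fun x hx => ?_).1 (h1.1.2 ?_)
    · by_contra hx'; exact hx (h4 x hx')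
    · exact IntegrableOn.congr_fun (h3.const_mul s) (fun z hz => (h2 z hz).symm) h.isOpen.measurableSet
  · rw [← setIntegral_eq_integral_of_forall_compl_eq_zero h4, h1.2,
      setIntegral_congr_fun h.isOpen.measurableSet h2, integral_const_mul]

end

section

variable {T : AltField I M 4} {F : ℝ → X → M} {b : Module.Basis (Fin 4) ℝ E'}

/-- The product of a function and a form. -/
def AltField.smulFun {k : ℕ} (ζ : X → ℝ) (A : AltField I' X k) : AltField I' X k := fun x => ζ x • A x

/-- The differential of a function. -/
def dFun (ζ : X → ℝ) (x : X) : TangentSpace I' x →ₗ[ℝ] ℝ := (mfderiv% ζ x).toLinearMap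

/-- The form `dζ ∧ B`. -/
def dWedge (ζ : X → ℝ) (B : AltField I' X 3) : AltField I' X 4 := fun x => wedgeOneThree (dFun ζ x) (B x)

theorem dWedge_apply (ζ : X → ℝ) (B : AltField I' X 3) (x : X) (u : Fin 4 → TangentSpace I' x) :
    dWedge ζ B x u = ∑ i : Fin 4, (-1 : ℝ) ^ (i : ℕ) * dFun ζ x (u i) *
      B x (fun k => u (i.succAbove k)) := wedgeOneThree_apply _ _ _

variable {ψ : E' → X} {U : Set E'}

theorem coordDensity_dWedge {ζ : X → ℝ} (hζ : CMDiff ∞ ζ) (B : AltField I' X 3) (h : IsParam I' ψ U) {z : E'} (hz : z ∈ U) :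
    coordDensity (dWedge ζ B) b ψ z = ∑ i : Fin 4, (-1 : ℝ) ^ (i : ℕ) * fderiv ℝ (fun z => ζ (ψ z)) z (b i) *
        B (ψ z) (fun k => mfderiv% ψ z (b (i.succAbove k))) := by
  exact (dWedge_apply ζ B (ψ z) _).trans (Finset.sum_congr rfl fun i _ => congrArg (fun a => (-1 : ℝ) ^ (i : ℕ) * a * _) ((mfderiv_eq_fderiv.symm.trans (((hζ (ψ z)).mdiffAt).hasMFDerivAt.comp z ((h.contMDiffAt hz).mdiffAt).hasMFDerivAt).mfderiv).app (b i)).symm)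

theorem contDiffOn_comp_param {ζ : X → ℝ} (hζ : CMDiff ∞ ζ) (h : IsParam I' ψ U) : ContDiffOn ℝ ∞ (fun z => ζ (ψ z)) U :=
  contMDiffOn_iff_contDiffOn.1 (hζ.comp_contMDiffOn h.smooth)

theorem pull_contDiffOn (hT : SmoothOnMaps T.field) {f : X → M} (hf : CMDiff ∞ f)
    (h : IsParam I' ψ U) : ContDiffOn ℝ ∞ (coordDensity (T.pull (I' := I') f) b ψ) U := by
  refine fun z hz => ((hT E' _ z ((hf (ψ z)).comp z (h.contMDiffAt hz)) (fun i => b i)).congr_of_eventuallyEq ?_).contDiffWithinAt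
  filter_upwards [h.isOpen.mem_nhds hz] with w hw
  exact congrArg _ (funext fun i =>
    ((((hf (ψ w)).mdiffAt).hasMFDerivAt.comp w ((h.contMDiffAt hw).mdiffAt).hasMFDerivAt).mfderiv.symm.app (b i)))

variable [MeasurableSpace E'] [BorelSpace E'] {ν : Measure E'} [ν.IsAddHaarMeasure] [MeasurableSpace X]
  [BorelSpace X] {μ : Measure X} [SecondCountableTopology X] [T2Space X] {P : AltField I' X 4}

theorem stokes_param (hT : SmoothOnMaps T.field) (hTc : ClosedOnMaps T.field) (hF : CMDiff ∞ (fun z : ℝ × X => F z.1 z.2))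
    (hT0 : ∀ x u, T.pull (I' := I') (F 0) x u = 0)
    (h0 : ∀ x (u : Fin 4 → TangentSpace I' x), LinearIndependent ℝ u → P x u ≠ 0)
    (hP : ContinuousOnParams P b) (hμ : IsFormMeasure P b ν μ) (h : IsParam I' ψ U)
    {s : ℝ} (hs : ∀ z ∈ U, |coordDensity P b ψ z| = s * coordDensity P b ψ z)
    {ζ : X → ℝ} (hζ : CMDiff ∞ ζ) (hK : HasCompactSupport ζ)
    (hKU : tsupport ζ ⊆ ψ '' U) :
    Integrable (formRatio b ((T.pull (F 1)).smulFun ζ) P) μ ∧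
    Integrable (formRatio b (dWedge ζ (homotopyForm hT hF)) P) μ ∧
    ∫ x, formRatio b ((T.pull (I' := I') (F 1)).smulFun ζ) P x ∂μ =
      - ∫ x, formRatio b (dWedge ζ (homotopyForm hT hF)) P x ∂μ := by
  set κ : Fin 4 → E' → ℝ := fun i z => homotopyForm hT hF (ψ z) (fun k => mfderiv% ψ z (b (i.succAbove k))) with hκ
  have hκc : ∀ i, ContDiffOn ℝ 1 (κ i) U := fun i => homotopyForm_contDiffOn hT hF h.isOpen h.smooth _
  have hζc : ContDiffOn ℝ 1 _ U := (contDiffOn_comp_param hζ h).of_le (by exact_mod_cast le_top)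
  have hζ' : ∀ v, ContinuousOn (fun z => fderiv ℝ _ z v) U := fun v =>
    (hζc.continuousOn_fderiv_of_isOpen h.isOpen le_rfl).clm_apply continuousOn_const
  have hA1 : ContinuousOn (coordDensity ((T.pull (F 1)).smulFun ζ) b ψ) U :=
    hζc.continuousOn.mul (pull_contDiffOn hT (family_contMDiff_snd hF 1) h).continuousOn
  have hB1 : ContinuousOn (coordDensity (dWedge ζ (homotopyForm hT hF)) b ψ) U := by
    refine ContinuousOn.congr ?_ fun z hz => coordDensity_dWedge hζ _ h hz
    exact continuousOn_finsetSum _ fun i _ => (continuousOn_const.mul (hζ' (b i))).mul (hκc i).continuousOn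
  have hζ0 : ∀ x ∉ tsupport ζ, ∀ u, dFun ζ x u = 0 := fun x hx u => by
    have h2 : (mfderiv% ζ x) = 0 := (notMem_tsupport_iff_eventuallyEq.1 hx).mfderiv_eq.trans mfderiv_const
    exact h2.app u
  have hA2 := integral_formRatio h0 hP hμ h hs hA1 hK hKU fun x hx u => by
    simp [AltField.smulFun, image_eq_zero_of_notMem_tsupport hx]
  have hB2 := integral_formRatio h0 hP hμ h hs hB1 hK hKU fun x hx u => by
    rw [dWedge_apply]
    refine Finset.sum_eq_zero fun i _ => ?_
    rw [hζ0 x hx, mul_zero, zero_mul]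
  refine ⟨hA2.1, hB2.1, ?_⟩
  rw [hA2.2, hB2.2, ← mul_neg]
  congr 1
  have hK' := h.isCompact_preimage hK hKU
  have hz0 : ∀ z ∈ U, z ∉ U ∩ ψ ⁻¹' tsupport ζ → ζ (ψ z) = 0 := fun z hz hzK =>
    image_eq_zero_of_notMem_tsupport fun hx => hzK ⟨hz, hx⟩
  have hq : ∀ i, ∫ z in U, fderiv ℝ (fun z => ζ (ψ z) * κ i z) z (b i) ∂ν = 0 := fun i =>
    integral_fderiv_eq_zero h.isOpen hK' inter_subset_left (hζc.mul (hκc i))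
      (fun z hz hzK => by rw [hz0 z hz hzK, zero_mul]) (b i)
  have hd : ∀ i, ∀ z ∈ U, fderiv ℝ _ z (b i) =
      ζ (ψ z) * fderiv ℝ (κ i) z (b i) + fderiv ℝ (fun z => ζ (ψ z)) z (b i) * κ i z := fun i z hz => by
    rw [fderiv_fun_mul (((hζc.contDiffAt (h.isOpen.mem_nhds hz)).diffAt)) ((((hκc i).contDiffAt (h.isOpen.mem_nhds hz)).diffAt))]
    simp [mul_comm]
  have hqi : ∀ i, IntegrableOn (fun z => fderiv ℝ _ z (b i)) U ν := fun i => by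
    refine integrableOn_of_eq_zero_off_compact h.isOpen hK' inter_subset_left
      ((((hζc.mul (hκc i)).continuousOn_fderiv_of_isOpen h.isOpen le_rfl).clm_apply continuousOn_const)) fun z hz hzK => ?_
    have h1 : ∀ᶠ w in 𝓝 z, ζ (ψ w) = 0 := (h.contMDiffAt hz).continuousAt.eventually
        (notMem_tsupport_iff_eventuallyEq.1 (fun hx => hzK ⟨hz, hx⟩))
    have h2 : (fun z => ζ (ψ z) * κ i z) =ᶠ[𝓝 z] fun _ => 0 := by
      filter_upwards [h1] with w hw
      rw [hw, zero_mul]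
    rw [h2.fderiv_eq]; simp
  have key : ∀ z ∈ U, coordDensity _ b ψ z + coordDensity (dWedge ζ (homotopyForm hT hF)) b ψ z =
      ∑ i : Fin 4, (-1 : ℝ) ^ (i : ℕ) * fderiv ℝ _ z (b i) := fun z hz => by
    have h2 : coordDensity ((T.pull (I' := I') (F 1)).smulFun ζ) b ψ z =
        ζ (ψ z) * ∑ i : Fin 4, (-1 : ℝ) ^ (i : ℕ) * fderiv ℝ (κ i) z (b i) := by
      have h3 : (T.pull (F 1)) (ψ z) (fun i => mfderiv% ψ z (b i)) =
          ∑ i : Fin 4, (-1 : ℝ) ^ (i : ℕ) * fderiv ℝ (κ i) z (b i) := by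
        rw [← (homotopy_formula hT hTc hF h.isOpen h.smooth hz _), hT0, sub_zero]
      exact congrArg _ h3
    rw [h2, coordDensity_dWedge hζ _ h hz, Finset.mul_sum, ← Finset.sum_add_distrib]
    refine Finset.sum_congr rfl fun i _ => ?_
    rw [hd i z hz]; ring
  have hsum : ∫ z in U, (coordDensity ((T.pull (I' := I') (F 1)).smulFun ζ) b ψ z +
      coordDensity (dWedge ζ (homotopyForm hT hF)) b ψ z) ∂ν = 0 := by
    rw [setIntegral_congr_fun h.isOpen.measurableSet key, integral_finsetSum]
    · exact Finset.sum_eq_zero fun i _ => by rw [integral_const_mul, hq i, mul_zero]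
    · exact fun i _ => (hqi i).const_mul _
  have hAi : IntegrableOn _ U ν := integrableOn_of_eq_zero_off_compact h.isOpen hK' inter_subset_left hA1 fun z hz hzK => by
      exact (congrArg (· * _) (hz0 z hz hzK)).trans (zero_mul _)
  have hBi : IntegrableOn _ U ν := integrableOn_of_eq_zero_off_compact h.isOpen hK' inter_subset_left hB1 fun z hz hzK => by
      exact (dWedge_apply _ _ (ψ z) _).trans (Finset.sum_eq_zero fun i _ => (congrArg (fun a => (-1 : ℝ) ^ (i : ℕ) * a * _) (hζ0 _ (fun hx => hzK ⟨hz, hx⟩) _)).trans (by simp))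
  rw [integral_add hAi hBi] at hsum
  linarith

end

section

theorem exists_signed_param {k : ℕ} {P : AltField I' X k} {b : Module.Basis (Fin k) ℝ E'}
    (h0 : ∀ x (u : Fin k → TangentSpace I' x), LinearIndependent ℝ u → P x u ≠ 0)
    (hP : ContinuousOnParams P b) {ψ : E' → X} {U : Set E'} (h : IsParam I' ψ U) {z : E'}
    (hz : z ∈ U) : ∃ (s : ℝ) (O : Set E'), z ∈ O ∧ O ⊆ U ∧ IsParam I' ψ O ∧
      ∀ w ∈ O, |coordDensity P b ψ w| = s * coordDensity P b ψ w := by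
  have hc := hP ψ U h
  rcases lt_or_gt_of_ne (coordDensity_ne_zero h0 h hz) with hn | hp
  · exact ⟨-1, U ∩ coordDensity P b ψ ⁻¹' Iio 0, ⟨hz, hn⟩, inter_subset_left, h.mono (hc.isOpen_inter_preimage h.isOpen (isOpen_Iio)) inter_subset_left, fun w hw => by rw [abs_of_neg hw.2, neg_one_mul]⟩
  · exact ⟨1, U ∩ coordDensity P b ψ ⁻¹' Ioi 0, ⟨hz, hp⟩, inter_subset_left, h.mono (hc.isOpen_inter_preimage h.isOpen (isOpen_Ioi)) inter_subset_left, fun w hw => by rw [abs_of_pos hw.2, one_mul]⟩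

variable {T : AltField I M 4} {F : ℝ → X → M} {b : Module.Basis (Fin 4) ℝ E'}

theorem formRatio_smulFun {k : ℕ} {b : Module.Basis (Fin k) ℝ E'} (ζ : X → ℝ) (A P : AltField I' X k) (x : X) :
    formRatio b (A.smulFun ζ) P x = ζ x * formRatio b A P x := mul_div_assoc _ _ _

theorem dFun_sum {ι : Type*} (s : Finset ι) (ζ : ι → X → ℝ) (hζ : ∀ i ∈ s, CMDiff ∞ (ζ i)) (x : X) (u : TangentSpace I' x) :
    dFun (fun x => ∑ i ∈ s, ζ i x) x u = ∑ i ∈ s, dFun (ζ i) x u := by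
  classical
  induction s using Finset.induction_on with
  | empty =>
    simp only [Finset.sum_empty]
    exact mfderiv_const.app u
  | insert a s ha ih =>
    have h2 : MDiffAt (fun x => ∑ i ∈ s, ζ i x) x := (ContMDiffAt.sum fun i hi => hζ i (by simp [hi]) x).mdiffAt
    let D : (X → ℝ) → E' →L[ℝ] ℝ := fun η => mfderiv% η x
    have h3 := mfderiv_add ((hζ a (by simp) x).mdiffAt) h2
    simp only [Finset.sum_insert ha]
    rw [← ih fun i hi => hζ i (by simp [hi])]
    exact h3.app u

theorem formRatio_dWedge_sum {ι : Type*} (s : Finset ι) (ζ : ι → X → ℝ)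
    (hζ : ∀ i ∈ s, CMDiff ∞ (ζ i)) (B : AltField I' X 3) (P : AltField I' X 4) (x : X) :
    formRatio b (dWedge (fun x => ∑ i ∈ s, ζ i x) B) P x = ∑ i ∈ s, formRatio b (dWedge (ζ i) B) P x := by
  have h1 : dWedge (fun x => ∑ i ∈ s, ζ i x) B x (fun i => b i) = ∑ i ∈ s, dWedge (ζ i) B x (fun i => b i) := by
    refine (dWedge_apply _ _ _ _).trans ?_
    rw [Finset.sum_congr rfl fun i _ => dWedge_apply (ζ i) B x (fun i => b i), Finset.sum_comm]
    refine Finset.sum_congr rfl fun k _ => ?_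
    rw [← Finset.sum_mul, ← Finset.mul_sum]
    exact congrArg (fun a => (-1 : ℝ) ^ (k : ℕ) * a * _) (dFun_sum s ζ hζ x _)
  exact (congrArg (· / _) h1).trans (Finset.sum_div _ _ _)

variable [MeasurableSpace E'] [BorelSpace E'] {ν : Measure E'} [ν.IsAddHaarMeasure] [MeasurableSpace X]
  [BorelSpace X] {μ : Measure X} [SecondCountableTopology X] [T2Space X] [SigmaCompactSpace X]
  {P : AltField I' X 4}

theorem stokes (hT : SmoothOnMaps T.field) (hTc : ClosedOnMaps T.field) (hF : CMDiff ∞ (fun z : ℝ × X => F z.1 z.2))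
    (hT0 : ∀ x u, T.pull (I' := I') (F 0) x u = 0)
    (h0 : ∀ x (u : Fin 4 → TangentSpace I' x), LinearIndependent ℝ u → P x u ≠ 0)
    (hP : ContinuousOnParams P b) (hμ : IsFormMeasure P b ν μ)
    {ζ : X → ℝ} (hζ : CMDiff ∞ ζ) (hK : HasCompactSupport ζ) :
    Integrable (formRatio b ((T.pull (F 1)).smulFun ζ) P) μ ∧
    Integrable (formRatio b (dWedge ζ (homotopyForm hT hF)) P) μ ∧
    ∫ x, formRatio b ((T.pull (F 1)).smulFun ζ) P x ∂μ = - ∫ x, formRatio b (dWedge ζ (homotopyForm hT hF)) P x ∂μ := by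
  choose s O hpO hOU hO hs using fun p => exists_signed_param h0 hP (isParam_chart p) (mem_extChartAt_target p)
  obtain ⟨ρ, hρ⟩ := SmoothPartitionOfUnity.exists_isSubordinate I' (isClosed_tsupport ζ) (fun p => (ϕ I' p).symm '' O p)
    (fun p => (hO p).isOpen_image (hO p).isOpen subset_rfl)
    (fun x _ => mem_iUnion.2 ⟨x, _, hpO x, extChartAt_to_inv x⟩)
  set fs := (ρ.locallyFinite.finite_nonempty_inter_compact hK).toFinset with hfs
  have hsum : ζ = fun x => ∑ i ∈ fs, ρ i x * ζ x := by
    funext x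
    rw [← Finset.sum_mul]
    by_cases hx : x ∈ tsupport ζ
    · rw [← finsum_eq_sum_of_support_subset, ρ.sum_eq_one hx, one_mul]
      intro i hi
      simp only [hfs, Finite.coe_toFinset, mem_ofPred_eq]
      exact ⟨x, hi, hx⟩
    · rw [image_eq_zero_of_notMem_tsupport hx, mul_zero]
  have hsm : ∀ i, CMDiff ∞ (fun x => ρ i x * ζ x) := fun i => (ρ i).contMDiff.mul hζ
  have hi := fun i => stokes_param hT hTc hF hT0 h0 hP hμ (hO i) (hs i) (hsm i) hK.mul_left
    ((closure_mono (Function.support_mul_subset_left _ _)).trans (hρ i))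
  have e1 : formRatio b ((T.pull (F 1)).smulFun ζ) P =
      fun x => ∑ i ∈ fs, formRatio b ((T.pull (F 1)).smulFun fun x => ρ i x * ζ x) P x := by
    funext x
    simp only [formRatio_smulFun]
    rw [← Finset.sum_mul]
    exact congrArg (fun η => η x * _) hsum
  have e2 : formRatio b (dWedge ζ (homotopyForm hT hF)) P =
      fun x => ∑ i ∈ fs, formRatio b (dWedge (fun x => ρ i x * ζ x) (homotopyForm hT hF)) P x := by
    funext x
    rw [← formRatio_dWedge_sum fs _ (fun i _ => hsm i), ← hsum]
  rw [e1, e2]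
  refine ⟨integrable_finsetSum _ fun i _ => (hi i).1, integrable_finsetSum _ fun i _ => (hi i).2.1, ?_⟩
  rw [integral_finsetSum _ fun i _ => (hi i).1, integral_finsetSum _ fun i _ => (hi i).2.1, ← Finset.sum_neg_distrib]
  exact Finset.sum_congr rfl fun i _ => (hi i).2.2

end

section

/-- A smooth function that is `1` on `(-∞, 0]` and `0` on `[1, ∞)`. -/
def stepDown (s : ℝ) : ℝ := 1 - Real.smoothTransition s

theorem stepDown_contDiff : ContDiff ℝ ∞ stepDown := contDiff_const.sub Real.smoothTransition.contDiff

theorem stepDown_eq_one {s : ℝ} (hs : s ≤ 0) : stepDown s = 1 := by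
  rw [stepDown, Real.smoothTransition.zero_of_nonpos hs, sub_zero]

theorem stepDown_eq_zero {s : ℝ} (hs : 1 ≤ s) : stepDown s = 0 := by
  rw [stepDown, Real.smoothTransition.one_of_one_le hs, sub_self]

theorem stepDown_nonneg (s : ℝ) : 0 ≤ stepDown s := sub_nonneg.2 (Real.smoothTransition.le_one s)

theorem stepDown_anti {s t : ℝ} (h : s ≤ t) : stepDown t ≤ stepDown s := sub_le_sub_left (Real.smoothTransition.monotone h) 1

theorem exists_deriv_stepDown_le : ∃ c : ℝ, 0 ≤ c ∧ ∀ s ∈ Icc (-1 : ℝ) 2, |deriv stepDown s| ≤ c := by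
  obtain ⟨c, hc⟩ := (isCompact_Icc).exists_bound_of_continuousOn (stepDown_contDiff.continuous_deriv (by simp)).continuousOn
  exact ⟨c, (norm_nonneg _).trans (hc 0 (by norm_num)), hc⟩

end

section

/-- The map `α` parametrises the end of `X` by a half-cylinder over `Z`. -/
structure IsEnd (I' : ModelWithCorners ℝ E' H') (IZ : ModelWithCorners ℝ EZ HZ) (R : ℝ) (α : ℝ × Z → X) : Prop where
  diffeo : IsDiffeoOn I' (𝓘(ℝ).prod IZ) α (Ioi R ×ˢ univ) (α '' (Ioi R ×ˢ univ))
  compact : ∀ T : ℝ, R ≤ T → IsCompact (α '' (Ioi T ×ˢ univ))ᶜ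

variable {R : ℝ} {α : ℝ × Z → X}

theorem isOpen_halfCylinder (R : ℝ) : IsOpen (Ioi R ×ˢ (univ : Set Z)) := isOpen_Ioi.prod isOpen_univ

theorem IsEnd.isOpen_image (h : IsEnd I' IZ R α) {O : Set (ℝ × Z)} (hO : IsOpen O)
    (hOR : ∀ q ∈ O, R < q.1) : IsOpen (α '' O) :=
  IsDiffeoOn.isOpen_image (isOpen_halfCylinder R) h.diffeo hO fun q hq => ⟨hOR q hq, trivial⟩

theorem IsEnd.inj (h : IsEnd I' IZ R α) {q q' : ℝ × Z} (hq : R < q.1) (hq' : R < q'.1)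
    (e : α q = α q') : q = q' := h.diffeo.2.1.injOn ⟨hq, trivial⟩ ⟨hq', trivial⟩ e

theorem IsEnd.exists_cutoff [Nonempty Z] [T2Space X] (h : IsEnd I' IZ R α) {T : ℝ} (hT : R < T)
    (hcl : IsClosed (α '' (Ici T ×ˢ univ))) :
    ∃ χ : X → ℝ, CMDiff ∞ χ ∧ HasCompactSupport χ ∧ (∀ q : ℝ × Z, R < q.1 → χ (α q) = stepDown (q.1 - T)) ∧
      (∀ x ∉ α '' (Ioi R ×ˢ univ), χ x = 1) ∧
      ∀ x ∉ α '' (Ioo (T - 1) (T + 2) ×ˢ univ), ∃ c : ℝ, χ =ᶠ[𝓝 x] fun _ => c := by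
  classical
  obtain ⟨k, hk1, hk2, hk3, hk4⟩ := IsDiffeoOn.exists_inverse (isOpen_halfCylinder R) h.diffeo
  have hends := h.isOpen_image (isOpen_halfCylinder R) fun q hq => hq.1
  set χ : X → ℝ := fun x => if x ∈ α '' _ then stepDown ((k x).1 - T) else 1 with hχ
  have c1 : ∀ q, R < q.1 → χ (α q) = stepDown (q.1 - T) := fun q hq => by
    have hm : q ∈ Ioi R ×ˢ univ := ⟨hq, trivial⟩
    exact (if_pos (mem_image_of_mem α hm)).trans (by rw [hk1 q hm])
  have c2 : ∀ x ∉ α '' _, χ x = 1 := fun x hx => if_neg hx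
  have c3 : ∀ x ∉ α '' _, χ =ᶠ[𝓝 x] fun _ => 1 := fun x hx => by
    filter_upwards [hcl.isOpen_compl.mem_nhds hx] with y hy
    by_cases hyR : y ∈ α '' (Ioi R ×ˢ univ)
    · obtain ⟨q, hq, rfl⟩ := hyR
      rw [c1 q hq.1]
      refine stepDown_eq_one ?_
      by_contra hlt
      exact hy ⟨q, ⟨by simp only [mem_Ici]; linarith, trivial⟩, rfl⟩
    · exact c2 y hyR
  refine ⟨χ, ?_, ?_, c1, c2, ?_⟩
  · intro x
    by_cases hx : x ∈ α '' (Ioi R ×ˢ univ)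
    · have h1 : CMDiffAt ∞ (fun y => stepDown ((k y).1 - T)) x := by
        exact (stepDown_contDiff.comp (contDiff_id.sub contDiff_const)).contMDiff.contMDiffAt.comp x (contMDiffAt_fst.comp x ((hk4 x hx).contMDiffAt (hends.mem_nhds hx)))
      refine h1.congr_of_eventuallyEq ?_
      filter_upwards [hends.mem_nhds hx] with y hy using if_pos hy
    · exact contMDiffAt_const.congr_of_eventuallyEq (c3 x fun hx' => hx (image_mono (prod_mono (fun t (ht : T ≤ t) => hT.trans_le ht) subset_rfl) hx'))
  · refine HasCompactSupport.intro (h.compact (T + 1) (by linarith)) fun x hx => ?_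
    rw [notMem_compl_iff] at hx
    obtain ⟨q, hq, rfl⟩ := hx
    have hq1 : T + 1 < q.1 := hq.1
    rw [c1 q (by linarith)]
    exact stepDown_eq_zero (by linarith)
  · intro x hx
    by_cases hx' : x ∈ α '' (Ici T ×ˢ univ)
    · obtain ⟨q, hq, rfl⟩ := hx'
      have hq0 : T ≤ q.1 := hq.1
      have hq1 : T + 1 < q.1 := by
        by_contra hlt
        exact hx ⟨q, ⟨⟨by linarith, by linarith⟩, trivial⟩, rfl⟩
      refine ⟨0, ?_⟩
      have ho := h.isOpen_image (isOpen_halfCylinder _) fun q hq => by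
          have : T + 1 < q.1 := hq.1
          linarith
      filter_upwards [ho.mem_nhds ⟨q, ⟨hq1, trivial⟩, rfl⟩]
      rintro _ ⟨q', hq', rfl⟩
      have hq2 : T + 1 < q'.1 := hq'.1
      rw [c1 q' (by linarith)]
      exact stepDown_eq_zero (by linarith)
    · exact ⟨1, c3 x hx'⟩

/-- The coordinates on the end of `X` given by a chart of the cross-section. -/
def endParam (IZ : ModelWithCorners ℝ EZ HZ) (α : ℝ × Z → X) (A : E' ≃L[ℝ] ℝ × EZ) (y0 : Z)
    (z : E') : X := α ((A z).1, (ϕ IZ y0).symm (A z).2)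

theorem mfderiv_injective_of_left_inverse {F : Type*} [NormedAddCommGroup F] [NormedSpace ℝ F]
    {K : Type*} [TopologicalSpace K] {J : ModelWithCorners ℝ F K} {Y : Type*} [TopologicalSpace Y]
    [ChartedSpace K Y] {ψ : E' → Y} {L : Y → E'} {z : E'}
    (hL : MDiffAt L (ψ z)) (hψ : MDiffAt ψ z)
    (he : ∀ᶠ w in 𝓝 z, L (ψ w) = w) : Function.Injective (mfderiv% ψ z) := by
  intro u v huv
  have h3 := fun u =>
    ((mfderiv_comp z hL hψ).app u).symm.trans (((Filter.EventuallyEq.mfderiv_eq he).app u).trans (mfderiv_id.app u))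
  exact (h3 u).symm.trans ((congrArg _ huv).trans (h3 v))

theorem IsEnd.isParam (h : IsEnd I' IZ R α) (A : E' ≃L[ℝ] ℝ × EZ) (y0 : Z) :
    IsParam I' (endParam IZ α A y0) (A ⁻¹' (Ioi R ×ˢ (ϕ IZ y0).target)) := by
  have : Nonempty Z := ⟨y0⟩
  have hO : IsOpen (A ⁻¹' (Ioi R ×ˢ (ϕ IZ y0).target)) :=
    (isOpen_Ioi.prod (isOpen_extChartAt_target y0)).preimage A.continuous
  have hsm : ∀ z ∈ A ⁻¹' (Ioi R ×ˢ (ϕ IZ y0).target), CMDiffAt ∞ (endParam IZ α A y0) z := fun z hz => by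
    exact ((h.diffeo.1 _ ⟨hz.1, trivial⟩).contMDiffAt
      ((isOpen_halfCylinder R).mem_nhds ⟨hz.1, trivial⟩)).comp z (((contDiff_fst.comp A.contDiff).contMDiff.contMDiffAt).prodMk (ContMDiffAt.comp z (contMDiffAt_extChartAt_symm y0 hz.2) ((contDiff_snd.comp A.contDiff).contMDiff.contMDiffAt)))
  refine ⟨hO, fun z hz => (hsm z hz).contMDiffWithinAt, fun z hz w hw hzw => ?_, fun z hz => ?_⟩
  · have h1 := h.inj (q := ((A z).1, (ϕ IZ y0).symm (A z).2)) (q' := ((A w).1, (ϕ IZ y0).symm (A w).2)) hz.1 hw.1 hzw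
    exact A.injective (Prod.ext (Prod.ext_iff.1 h1).1 ((ϕ IZ y0).symm.injOn hz.2 hw.2 (Prod.ext_iff.1 h1).2))
  · obtain ⟨k, hk1, hk2, hk3, hk4⟩ := IsDiffeoOn.exists_inverse (isOpen_halfCylinder R) h.diffeo
    have hmem : ∀ w ∈ A ⁻¹' (Ioi R ×ˢ (ϕ IZ y0).target),
        ((A w).1, (ϕ IZ y0).symm (A w).2) ∈ Ioi R ×ˢ univ := fun w hw => ⟨hw.1, trivial⟩
    refine mfderiv_injective_of_left_inverse (L := fun x => A.symm ((k x).1, ϕ IZ y0 (k x).2)) ?_ ((hsm z hz).mdiffAt) ?_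
    · have hkz : k (endParam IZ α A y0 z) = ((A z).1, (ϕ IZ y0).symm (A z).2) := hk1 _ (hmem z hz)
      have h2 := (hk4 _ (mem_image_of_mem α (hmem z hz))).contMDiffAt ((h.isOpen_image (isOpen_halfCylinder R) fun q hq => hq.1).mem_nhds (mem_image_of_mem α (hmem z hz)))
      have h5 : CMDiffAt ∞ (fun x => ϕ IZ y0 (k x).2) (endParam IZ α A y0 z) := by
        refine ContMDiffAt.comp _ (contMDiffAt_extChartAt' ?_) (contMDiffAt_snd.comp _ h2)
        rw [hkz, ← extChartAt_source IZ]
        exact (ϕ IZ y0).map_target hz.2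
      exact (A.symm.contDiff.contMDiff.contMDiffAt.comp _ ((contMDiffAt_fst.comp _ h2).prodMk_space h5)).mdiffAt
    · filter_upwards [hO.mem_nhds hz] with w hw
      have hkw : k (endParam IZ α A y0 w) = ((A w).1, (ϕ IZ y0).symm (A w).2) := hk1 _ (hmem w hw)
      rw [hkw]
      simp only [(ϕ IZ y0).right_inv hw.2, Prod.mk.eta, ContinuousLinearEquiv.symm_apply_apply]

end

section

variable {g : MetricField I M} {T : AltField I M 4} {F : ℝ → X → M}

theorem VelocityC1Le.length_le (hg : g.IsRiem) (hF : CMDiff ∞ (fun z : ℝ × X => F z.1 z.2))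
    {r : ℝ} (hr : 0 ≤ r) {x : X} (h : ∀ τ ∈ Icc (0 : ℝ) 1, VelocityC1Le I' g (F 0) F τ x r)
    (u : TangentSpace I' x) {τ : ℝ} (hτ : τ ∈ Icc (0 : ℝ) 1) :
    g (F τ x) (mfderiv% (F τ) x u) (mfderiv% (F τ) x u) ≤
      (1 + r) ^ 2 * g (F 0 x) (mfderiv% (F 0) x u) (mfderiv% (F 0) x u) := by
  set n := g (F τ x) _ _
  set n0 := g (F 0 x) _ _
  calc n = √n ^ 2 := (Real.sq_sqrt (hg.nonneg (F τ x) _)).symm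
    _ ≤ ((1 + r) * √n0) ^ 2 := pow_le_pow_left₀ (Real.sqrt_nonneg _) (by linarith [(abs_le.1 (abs_sqrt_length_sub_le hg hF hr h u hτ)).2]) 2
    _ = _ := by rw [mul_pow, Real.sq_sqrt (hg.nonneg (F 0 x) _)]

theorem abs_homotopyForm_le (hg : g.IsRiem) (hT : SmoothOnMaps T.field) (hF : CMDiff ∞ (fun z : ℝ × X => F z.1 z.2))
    {C : ℝ} (hC : 0 ≤ C) (hTC : ∀ z u, T z u ^ 2 ≤ C * ∏ i, g z (u i) (u i))
    {ε r a : ℝ} (hε : 0 ≤ ε) (hr : 0 ≤ r) (ha : 0 ≤ a) {x : X}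
    (h : ∀ τ ∈ Icc (0 : ℝ) 1, VelocityC1Le I' g (F 0) F τ x ε)
    (h' : ∀ τ ∈ Icc (0 : ℝ) 1, VelocityC1Le I' g (F 0) F τ x r) (w : Fin 3 → TangentSpace I' x)
    (hw : ∀ i, g (F 0 x) (mfderiv% (F 0) x (w i)) (mfderiv% (F 0) x (w i)) ≤ a) :
    |homotopyForm hT hF x w| ≤ √(C * ((1 + ε) ^ 2 * a) ^ 3) * r := by
  rw [homotopyForm_apply]
  have h1 : ∀ τ ∈ uIoc 0 1, ‖AltField.velPull I' T F τ x w‖ ≤ √(C * ((1 + ε) ^ 2 * a) ^ 3) * r := by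
    intro τ hτ
    rw [uIoc_of_le zero_le_one] at hτ
    have hτ' := Ioc_subset_Icc_self hτ
    rw [Real.norm_eq_abs]
    refine abs_le_of_sq_le_sq ?_ (by positivity)
    rw [mul_pow, Real.sq_sqrt (by positivity), AltField.velPull_apply]
    refine (hTC _ _).trans ?_
    rw [mul_assoc]
    refine mul_le_mul_of_nonneg_left ?_ hC
    rw [Fin.prod_univ_succ, mul_comm]
    exact mul_le_mul ((Finset.prod_le_prod (g := fun _ => (1 + ε) ^ 2 * a) (fun i _ => hg.nonneg _ _) fun i _ => (VelocityC1Le.length_le hg hF hε h (w i) hτ').trans (mul_le_mul_of_nonneg_left (hw i) (by positivity))).trans_eq (by simp)) ((h' τ hτ').velocity_le hF) (hg.nonneg _ _) (by positivity)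
  simpa using intervalIntegral.norm_integral_le_of_norm_le_const h1

end

section

variable {g : MetricField I M} {T : AltField I M 4} {F : ℝ → X → M} {R : ℝ} {α : ℝ × Z → X}

theorem IsEnd.exists_cutoff' [T2Space X] (h : IsEnd I' IZ R α) {T : ℝ} (hT : R < T) (hcl : IsClosed (α '' (Ici T ×ˢ univ))) :
    ∃ χ : X → ℝ, CMDiff ∞ χ ∧ HasCompactSupport χ ∧ (∀ q : ℝ × Z, R < q.1 → χ (α q) = stepDown (q.1 - T)) ∧
      (∀ x ∉ α '' (Ioi R ×ˢ univ), χ x = 1) ∧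
      ∀ x ∉ α '' (Ioo (T - 1) (T + 2) ×ˢ univ), ∃ c : ℝ, χ =ᶠ[𝓝 x] fun _ => c := by
  rcases isEmpty_or_nonempty Z with hZ | hZ
  · have h1 : IsCompact (univ : Set X) := by
      have := h.compact R le_rfl
      rwa [univ_eq_empty_iff.2 hZ, prod_empty, image_empty, compl_empty] at this
    exact ⟨fun _ => 1, contMDiff_const, h1.of_isClosed_subset (isClosed_tsupport _) (subset_univ _),
      fun q => (IsEmpty.false q.2).elim, fun _ _ => rfl, fun _ _ => ⟨1, EventuallyEq.rfl⟩⟩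
  · exact h.exists_cutoff hT hcl

/-- The lengths of the vectors tangent to the cross-sections are bounded along the end. -/
def EndBounded (I : ModelWithCorners ℝ E H) (IZ : ModelWithCorners ℝ EZ HZ) (g : MetricField I M) (β : ℝ × Z → M) : Prop :=
  ∀ y0 : Z, ∃ (C : Set EZ) (c0 T0 : ℝ), IsCompact C ∧ C ∈ 𝓝 (ϕ IZ y0 y0) ∧
    C ⊆ (ϕ IZ y0).target ∧ 0 ≤ c0 ∧ ∀ t : ℝ, T0 < t → ∀ y ∈ C, ∀ v : EZ, g (β (t, (ϕ IZ y0).symm y))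
        (mfderiv 𝓘(ℝ, ℝ × EZ) I (fun q => β (q.1, (ϕ IZ y0).symm q.2)) (t, y) ((0 : ℝ), v))
        (mfderiv 𝓘(ℝ, ℝ × EZ) I (fun q => β (q.1, (ϕ IZ y0).symm q.2)) (t, y) ((0 : ℝ), v))
        ≤ c0 * ‖v‖ ^ 2

theorem exists_adapted_basis (hZ : Module.finrank ℝ EZ = 3) (A : E' ≃L[ℝ] ℝ × EZ) :
    ∃ b : Module.Basis (Fin 4) ℝ E', (A (b 0)).1 = 1 ∧ ∀ i : Fin 3, (A (b i.succ)).1 = 0 := by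
  let e : Module.Basis (Fin 3) ℝ EZ := Module.finBasisOfFinrankEq ℝ EZ hZ
  let p : Module.Basis _ ℝ (ℝ × EZ) := (Module.Basis.singleton (Fin 1) ℝ).prod e
  let b := (p.reindex (finSumFinEquiv)).map A.symm.toLinearEquiv
  have hb : ∀ i, A (b i) = p _ := fun i => by
    simp only [b, Module.Basis.map_apply, Module.Basis.reindex_apply]
    exact A.apply_symm_apply _
  refine ⟨b, ?_, fun i => ?_⟩
  · rw [hb, show (finSumFinEquiv).symm 0 = Sum.inl 0 from rfl]
    simp [p]
  · rw [hb, show (finSumFinEquiv (m := 1) (n := 3)).symm i.succ = Sum.inr i by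
      rw [Equiv.symm_apply_eq, finSumFinEquiv_apply_right]; ext; simp [add_comm]]
    simp [p]

theorem endParam_mfderiv (h : IsEnd I' IZ R α) {f : X → M} (hf : ContMDiff I' I ∞ f)
    (A : E' ≃L[ℝ] ℝ × EZ) (y0 : Z) {z : E'} (hz : z ∈ A ⁻¹' (Ioi R ×ˢ (ϕ IZ y0).target))
    (v : E') :
    (mfderiv I' I f (endParam IZ α A y0 z) (mfderiv 𝓘(ℝ, E') I' (endParam IZ α A y0) z v) : E) =
      mfderiv 𝓘(ℝ, ℝ × EZ) I (fun q => f (α (q.1, (ϕ IZ y0).symm q.2))) (A z) (A v) := by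
  have hp := h.isParam A y0
  have hG : MDifferentiableAt 𝓘(ℝ, ℝ × EZ) I (fun q => f (α (q.1, (ϕ IZ y0).symm q.2))) (A z) := by
    have h2 : MDiffAt (f ∘ endParam IZ α A y0) (A.symm (A z)) := by
      rw [A.symm_apply_apply]
      exact (((hf _).comp z (hp.contMDiffAt hz)).mdiffAt)
    exact (h2.comp (A z) A.symm.differentiableAt.mdifferentiableAt).congr_of_eventuallyEq (Eventually.of_forall fun q => by simp only [Function.comp_apply, endParam, A.apply_symm_apply])
  have h4 := mfderiv_comp z hG A.differentiableAt.mdifferentiableAt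
  have h6 := ((mfderiv_comp z ((hf _).mdiffAt) ((hp.contMDiffAt hz).mdiffAt)).symm.trans h4).app v
  exact h6.trans (congrArg (fun B => (mfderiv 𝓘(ℝ, ℝ × EZ) I
    (fun q => f (α (q.1, (ϕ IZ y0).symm q.2))) (A z) (B v) : E)) (mfderiv_eq_fderiv.trans A.fderiv))

theorem abs_coordDensity_dWedge_cutoff_le (hg : g.IsRiem) (hT : SmoothOnMaps T.field)
    (hF : ContMDiff (𝓘(ℝ).prod I') I ∞ (fun z : ℝ × X => F z.1 z.2))
    {C : ℝ} (hC : 0 ≤ C) (hTC : ∀ z u, T z u ^ 2 ≤ C * ∏ i, g z (u i) (u i))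
    {ε : ℝ} (hε : 0 ≤ ε)
    (hV : ∀ τ ∈ Icc (0 : ℝ) 1, ∀ x, VelocityC1Le I' g (F 0) F τ x ε)
    (h : IsEnd I' IZ R α) {lam K : ℝ} (hK : 0 ≤ K) (hlam : 0 ≤ lam)
    (hV' : ∀ τ ∈ Icc (0 : ℝ) 1, ∀ q : ℝ × Z, R < q.1 → VelocityC1Le I' g (F 0) F τ (α q) (K * Real.exp (-lam * q.1)))
    (hb : EndBounded I IZ g (fun q => F 0 (α q))) (A : E' ≃L[ℝ] ℝ × EZ)
    {b : Module.Basis (Fin 4) ℝ E'} (hb0 : (A (b 0)).1 = 1) (hb1 : ∀ i : Fin 3, (A (b i.succ)).1 = 0)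
    (y0 : Z) :
    ∃ (C' : Set EZ) (c T1 : ℝ), IsCompact C' ∧ C' ∈ 𝓝 (ϕ IZ y0 y0) ∧
      C' ⊆ (ϕ IZ y0).target ∧ 0 ≤ c ∧ R < T1 - 1 ∧ ∀ T2 : ℝ, T1 < T2 → ∀ χ : X → ℝ, ContMDiff I' 𝓘(ℝ) ∞ χ →
        (∀ q : ℝ × Z, R < q.1 → χ (α q) = stepDown (q.1 - T2)) →
        ∀ z : E', (A z).1 ∈ Ioo (T2 - 1) (T2 + 2) → (A z).2 ∈ C' →
          |coordDensity (dWedge χ (homotopyForm hT hF)) b (endParam IZ α A y0) z| ≤ c * Real.exp (-lam * T2) := by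
  obtain ⟨C', c0, T0, hC', hC'n, hC't, hc0, hbd⟩ := hb y0
  obtain ⟨c1, hc1, hst⟩ := exists_deriv_stepDown_le
  set m : ℝ := ∑ i : Fin 3, ‖(A (b i.succ)).2‖ ^ 2 with hm
  have hm0 : 0 ≤ m := Finset.sum_nonneg fun i _ => by positivity
  refine ⟨C', c1 * (√(C * ((1 + ε) ^ 2 * (c0 * m)) ^ 3) * (K * Real.exp lam)), max (R + 2) (T0 + 1),
    hC', hC'n, hC't, by positivity, by linarith [le_max_left (R + 2) (T0 + 1)], ?_⟩
  intro T2 hT2 χ hχ hχα z hz1 hz2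
  have hTR := (le_max_left _ _).trans_lt hT2
  have hTT := (le_max_right _ _).trans_lt hT2
  have hp := h.isParam A y0
  have hzU : z ∈ A ⁻¹' (Ioi R ×ˢ (ϕ IZ y0).target) := ⟨by have := hz1.1; simp only [mem_Ioi]; linarith, hC't hz2⟩
  have hd : ∀ v : E', fderiv ℝ _ z v = deriv stepDown ((A z).1 - T2) * (A v).1 := fun v => by
    have h1 : (fun w => χ (endParam IZ α A y0 w)) =ᶠ[𝓝 z] fun w => stepDown ((A w).1 - T2) := by
      filter_upwards [hp.isOpen.mem_nhds hzU] with w hw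
      exact hχα _ hw.1
    have h4 := ((stepDown_contDiff.differentiable (by simp) _).hasDerivAt).comp_hasFDerivAt z (((ContinuousLinearMap.fst ℝ ℝ EZ).comp (A : E' →L[ℝ] ℝ × EZ)).hasFDerivAt.sub_const T2)
    change HasFDerivAt (fun w => stepDown ((A w).1 - T2)) _ z at h4
    rw [h1.fderiv_eq, h4.fderiv]
    simp
  rw [coordDensity_dWedge hχ _ hp hzU, Fin.sum_univ_succ]
  rw [Finset.sum_eq_zero fun i _ => by rw [hd, hb1, mul_zero, mul_zero, zero_mul], add_zero, hd, hb0, Fin.val_zero, pow_zero, one_mul, mul_one, abs_mul]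
  have hB := abs_homotopyForm_le hg hT hF hC hTC hε (a := c0 * m)
    (by positivity) (by positivity) (x := endParam IZ α A y0 z) (fun τ hτ => hV τ hτ _)
    (fun τ hτ => hV' τ hτ _ hzU.1)
    (fun k => mfderiv 𝓘(ℝ, E') I' (endParam IZ α A y0) z (b k.succ)) (fun k => by
      have e2 : A (b k.succ) = ((0 : ℝ), (A (b k.succ)).2) := Prod.ext (hb1 k) rfl
      have e3 := (endParam_mfderiv h (family_contMDiff_snd hF 0) A y0 hzU (b k.succ)).trans (congrArg _ e2)
      refine ((congrArg (fun w => g _ w w) e3).trans_le (hbd (A z).1 (by linarith [hz1.1]) (A z).2 hz2 (A (b k.succ)).2)).trans (mul_le_mul_of_nonneg_left ?_ hc0)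
      exact Finset.single_le_sum (f := fun i => ‖(A (b i.succ)).2‖ ^ 2) (fun i _ => by positivity) (Finset.mem_univ k))
  have hexp : Real.exp (-lam * (A z).1) ≤ Real.exp lam * Real.exp (-lam * T2) := by
    rw [← Real.exp_add]
    refine Real.exp_le_exp.2 ?_
    nlinarith [hz1.1]
  calc |deriv stepDown _| * _ ≤ c1 * (√(C * ((1 + ε) ^ 2 * (c0 * m)) ^ 3) * (K * Real.exp (-lam * (A z).1))) :=
        mul_le_mul (hst _ ⟨by linarith [hz1.1], by linarith [hz1.2]⟩) hB (abs_nonneg _) hc1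
    _ ≤ c1 * (√(C * ((1 + ε) ^ 2 * (c0 * m)) ^ 3) * (K * (Real.exp lam * Real.exp (-lam * T2)))) := by gcongr
    _ = _ := by ring

end

section

variable [CompactSpace Z] {g : MetricField I M} {T Φ : AltField I M 4} {F : ℝ → X → M} {R : ℝ}
  {α : ℝ × Z → X}

theorem formRatio_dWedge_eq_zero {b : Module.Basis (Fin 4) ℝ E'} {χ : X → ℝ} {x : X} {c : ℝ}
    (h : χ =ᶠ[𝓝 x] fun _ => c) (B : AltField I' X 3) (P : AltField I' X 4) :
    formRatio b (dWedge χ B) P x = 0 := by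
  have h3 : ∀ u : TangentSpace I' x, dFun χ x u = 0 := fun u => (h.mfderiv_eq.trans mfderiv_const).app u
  have h4 : dWedge χ B x (fun i => b i) = 0 := (dWedge_apply _ _ _ _).trans (Finset.sum_eq_zero fun i _ => (congrArg (fun a => (-1 : ℝ) ^ (i : ℕ) * a * _) (h3 _)).trans (by simp))
  exact (congrArg (· / _) h4).trans (zero_div _)

variable [MeasurableSpace E'] [BorelSpace E'] {ν : Measure E'} [ν.IsAddHaarMeasure] [MeasurableSpace X]
  [BorelSpace X] {μ : Measure X} [SecondCountableTopology X] [T2Space X] [SigmaCompactSpace X]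
  {P : AltField I' X 4}

theorem integral_cutoff_le (hg : g.IsRiem) (hT : SmoothOnMaps T.field) (hTc : ClosedOnMaps T.field)
    (hF : CMDiff ∞ (fun z : ℝ × X => F z.1 z.2))
    (hT0 : ∀ x u, T.pull (I' := I') (F 0) x u = 0)
    {C : ℝ} (hC : 0 ≤ C) (hTC : ∀ z u, T z u ^ 2 ≤ C * ∏ i, g z (u i) (u i))
    {ε : ℝ} (hε : 0 ≤ ε)
    (hV : ∀ τ ∈ Icc (0 : ℝ) 1, ∀ x, VelocityC1Le I' g (F 0) F τ x ε)
    (h : IsEnd I' IZ R α) {lam K : ℝ} (hK : 0 ≤ K) (hlam : 0 ≤ lam)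
    (hV' : ∀ τ ∈ Icc (0 : ℝ) 1, ∀ q : ℝ × Z, R < q.1 → VelocityC1Le I' g (F 0) F τ (α q) (K * Real.exp (-lam * q.1)))
    (hbd : EndBounded I IZ g (fun q => F 0 (α q))) (A : E' ≃L[ℝ] ℝ × EZ)
    {b : Module.Basis (Fin 4) ℝ E'} (hb0 : (A (b 0)).1 = 1) (hb1 : ∀ i : Fin 3, (A (b i.succ)).1 = 0)
    (h0 : ∀ x (u : Fin 4 → TangentSpace I' x), LinearIndependent ℝ u → P x u ≠ 0)
    (hP : ContinuousOnParams P b) (hμ : IsFormMeasure P b ν μ) :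
    ∃ c T1 : ℝ, R < T1 - 1 ∧ ∀ T2 : ℝ, T1 < T2 → ∀ χ : X → ℝ, CMDiff ∞ χ → HasCompactSupport χ →
      (∀ q : ℝ × Z, R < q.1 → χ (α q) = stepDown (q.1 - T2)) →
      (∀ x ∉ α '' (Ioo (T2 - 1) (T2 + 2) ×ˢ univ), ∃ c : ℝ, χ =ᶠ[𝓝 x] fun _ => c) →
      Integrable (fun x => χ x * formRatio b (T.pull (F 1)) P x) μ ∧
      ∫ x, χ x * formRatio b (T.pull (F 1)) P x ∂μ ≤ c * Real.exp (-lam * T2) := by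
  choose C' c T1 hC' hC'n hC't hc hRT hest using fun y0 => abs_coordDensity_dWedge_cutoff_le hg hT hF hC hTC hε hV h hK hlam hV' hbd A hb0 hb1 y0
  obtain ⟨fs, hfs⟩ := CompactSpace.elim_nhds_subcover (fun y0 => (ϕ IZ y0).source ∩ ϕ IZ y0 ⁻¹' interior (C' y0)) (fun y0 =>
      inter_mem (extChartAt_source_mem_nhds y0)
        ((continuousAt_extChartAt y0).preimage_mem_nhds (interior_mem_nhds.2 (hC'n y0))))
  let O : Z → ℝ → Set E' := fun y0 T2 => A ⁻¹' (Ioo (T2 - 1) (T2 + 2) ×ˢ interior (C' y0))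
  have hOo : ∀ y0 T2, IsOpen (O y0 T2) := fun y0 T2 => (isOpen_Ioo.prod isOpen_interior).preimage A.continuous
  have hνO : ∀ y0 T2, ν (O y0 T2) = ν (O y0 0) := fun y0 T2 => by
    rw [← measure_preimage_add_right ν (A.symm (T2, 0)) (O y0 T2)]
    congr 1
    ext z
    simp only [O, mem_preimage, map_add, A.apply_symm_apply, mem_prod, mem_Ioo, Prod.fst_add, Prod.snd_add, add_zero]
    constructor <;> rintro ⟨⟨h1, h2⟩, h3⟩ <;> exact ⟨⟨by linarith, by linarith⟩, h3⟩
  have hνf : ∀ y0, ν (O y0 0) < ⊤ := fun y0 => by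
    exact (measure_mono (preimage_mono (Set.prod_mono Ioo_subset_Icc_self interior_subset))).trans_lt
      (A.toHomeomorph.isCompact_preimage.2 (isCompact_Icc.prod (hC' y0))).measure_lt_top
  refine ⟨∑ y0 ∈ fs, c y0 * ν.real (O y0 0), max (R + 2) _, by linarith [le_max_left (R + 2) (∑ y0 ∈ fs, |T1 y0|)], ?_⟩
  intro T2 hT2 χ hχ hχc hχα hχ0
  have hTR := (le_max_left _ _).trans_lt hT2
  have hTT : ∀ y0 ∈ fs, T1 y0 < T2 := fun y0 hy0 => by
    exact lt_of_le_of_lt ((le_abs_self _).trans (Finset.single_le_sum (f := fun y => |T1 y|) (fun i _ => abs_nonneg _) hy0)) ((le_max_right _ _).trans_lt hT2)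
  obtain ⟨s1, s2, s3⟩ := stokes hT hTc hF hT0 h0 hP hμ hχ hχc
  set D := formRatio b (dWedge χ _) P with hD
  have e1 : formRatio b ((T.pull (F 1)).smulFun χ) P = fun x => χ x * formRatio b (T.pull (F 1)) P x := by
    funext x; exact formRatio_smulFun _ _ _ _
  rw [e1] at s1 s3
  refine ⟨s1, ?_⟩
  rw [s3]
  have hOU : ∀ y0, O y0 T2 ⊆ A ⁻¹' (Ioi R ×ˢ (ϕ IZ y0).target) := fun y0 z hz =>
    ⟨by have := hz.1.1; simp only [mem_Ioi]; linarith, hC't y0 (interior_subset hz.2)⟩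
  have hp := fun y0 => (h.isParam A y0).mono (hOo y0 T2) (hOU y0)
  set S : Z → Set X := fun y0 => endParam IZ α A y0 '' O y0 T2 with hS
  have hSm := fun y0 => ((hp y0).isOpen_image (hOo y0 T2) subset_rfl).measurableSet
  have hcov : ∀ x, D x ≠ 0 → ∃ y0 ∈ fs, x ∈ S y0 := fun x hx => by
    have hx1 : x ∈ α '' (Ioo (T2 - 1) (T2 + 2) ×ˢ univ) := by
      by_contra hx'
      obtain ⟨c, hc⟩ := hχ0 x hx'
      exact hx (formRatio_dWedge_eq_zero hc _ _)
    obtain ⟨q, hq, rfl⟩ := hx1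
    have hq2 : q.2 ∈ ⋃ y0 ∈ fs, (ϕ IZ y0).source ∩ ϕ IZ y0 ⁻¹' interior (C' y0) := by rw [hfs]; trivial
    simp only [mem_iUnion] at hq2
    obtain ⟨y0, hy0, hy1, hy2⟩ := hq2
    refine ⟨y0, hy0, A.symm (q.1, ϕ IZ y0 q.2), ?_, ?_⟩
    · simp only [O, mem_preimage, A.apply_symm_apply]
      exact ⟨hq.1, hy2⟩
    · simp only [endParam, A.apply_symm_apply, (ϕ IZ y0).left_inv hy1]
  have hint : ∀ y0 ∈ fs, ∫ x in S y0, |D x| ∂μ ≤ c y0 * ν.real (O y0 0) * Real.exp (-lam * T2) := by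
    intro y0 hy0
    have hBc : ContinuousOn (coordDensity (dWedge χ _) b _)
        (O y0 T2) := ContinuousOn.congr (continuousOn_finsetSum _ fun i _ => (continuousOn_const.mul (((contDiffOn_comp_param hχ (hp y0)).continuousOn_fderiv_of_isOpen (hOo y0 T2) (by simp)).clm_apply continuousOn_const)).mul (homotopyForm_contDiffOn hT hF (hOo y0 T2) (hp y0).smooth _).continuousOn)
        fun z hz => coordDensity_dWedge hχ _ (hp y0) hz
    rw [(hμ.integrableOn_iff hP (hp y0) (continuousOn_formRatio h0 hP (hp y0) hBc).abs).2]
    have hpt : ∀ z ∈ O y0 T2, ‖|coordDensity P b (endParam IZ α A y0) z| *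
        |D _|‖ ≤ c y0 * Real.exp (-lam * T2) := fun z hz => by
      have h1 : D _ * coordDensity P b (endParam IZ α A y0) z = coordDensity _ b (endParam IZ α A y0) z :=
        formRatio_mul (basis_ne_zero h0 _) _
      rw [Real.norm_eq_abs, ← abs_mul, abs_abs, mul_comm, h1]
      exact hest y0 T2 (hTT y0 hy0) χ hχ hχα z hz.1 (interior_subset hz.2)
    have h2 := norm_setIntegral_le_of_norm_le_const (by rw [hνO]; exact hνf y0) hpt
    refine ((le_abs_self _).trans h2).trans_eq ?_
    rw [measureReal_def, hνO, ← measureReal_def]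
    ring
  have hi := fun y0 => s2.abs.indicator (hSm y0)
  calc -∫ x, D x ∂μ ≤ ∫ x, |D x| ∂μ := by
        rw [← integral_neg]
        exact integral_mono s2.neg s2.abs fun x => neg_le_abs _
    _ ≤ ∫ x, ∑ y0 ∈ fs, (S y0).indicator _ x ∂μ := by
        refine integral_mono s2.abs (integrable_finsetSum _ fun y0 _ => hi y0) fun x => ?_
        by_cases hx : D x = 0
        · simp only [hx, abs_zero]
          exact Finset.sum_nonneg fun y0 _ => indicator_nonneg (fun _ _ => abs_nonneg _) _
        · obtain ⟨y0, hy0, hxy⟩ := hcov x hx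
          have h3 := Finset.single_le_sum (f := fun y0 => (S y0).indicator (fun x => |D x|) x)
            (fun y _ => indicator_nonneg (fun _ _ => abs_nonneg _) _) hy0
          refine le_trans ?_ h3
          simp only
          rw [indicator_of_mem hxy]
    _ = ∑ y0 ∈ fs, ∫ x in S y0, |D x| ∂μ := by
        rw [integral_finsetSum _ fun y0 _ => hi y0]
        exact Finset.sum_congr rfl fun y0 _ => integral_indicator (hSm y0)
    _ ≤ ∑ y0 ∈ fs, c y0 * ν.real (O y0 0) * Real.exp (-lam * T2) := Finset.sum_le_sum hint
    _ = _ := (Finset.sum_mul _ _ _).symm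

theorem continuous_formRatio_pull {b : Module.Basis (Fin 4) ℝ E'} (hT : SmoothOnMaps T.field) {f : X → M} (hf : CMDiff ∞ f)
    (h0 : ∀ x (u : Fin 4 → TangentSpace I' x), LinearIndependent ℝ u → P x u ≠ 0)
    (hP : ContinuousOnParams P b) : Continuous (formRatio b (T.pull f) P) := by
  rw [continuous_iff_continuousAt]
  intro x
  have hp := isParam_chart (I' := I') x
  exact (continuousOn_formRatio h0 hP hp (pull_contDiffOn hT hf hp).continuousOn).continuousAt ((hp.isOpen_image hp.isOpen subset_rfl).mem_nhds
    ⟨_, mem_extChartAt_target x, extChartAt_to_inv x⟩)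

end

section

variable [CompactSpace Z] {g : MetricField I M} {T Φ : AltField I M 4} {F : ℝ → X → M} {R : ℝ}
  {α : ℝ × Z → X}

/-- A closed form that vanishes on `ι = F 0`, and whose restriction to `f = F 1` is a nonnegative
multiple of the orientation given by `Φ`, vanishes on `f`, if `F` decays exponentially. -/
theorem pull_eq_zero [T2Space X] [SigmaCompactSpace X] (hg : g.IsRiem)
    (hT : SmoothOnMaps T.field) (hTc : ClosedOnMaps T.field) (hΦ : SmoothOnMaps Φ.field)
    (hF : CMDiff ∞ (fun z : ℝ × X => F z.1 z.2))
    (hT0 : ∀ x u, T.pull (I' := I') (F 0) x u = 0)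
    {C : ℝ} (hC : 0 ≤ C) (hTC : ∀ z u, T z u ^ 2 ≤ C * ∏ i, g z (u i) (u i))
    {ε : ℝ} (hε : 0 ≤ ε)
    (hV : ∀ τ ∈ Icc (0 : ℝ) 1, ∀ x, VelocityC1Le I' g (F 0) F τ x ε)
    (h : IsEnd I' IZ R α) {lam K : ℝ} (hK : 0 ≤ K) (hlam : 0 < lam)
    (hV' : ∀ τ ∈ Icc (0 : ℝ) 1, ∀ q : ℝ × Z, R < q.1 → VelocityC1Le I' g (F 0) F τ (α q) (K * Real.exp (-lam * q.1)))
    (hbd : EndBounded I IZ g (fun q => F 0 (α q)))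
    (hcl : ∃ T0 : ℝ, ∀ T, T0 < T → IsClosed (α '' (Ici T ×ˢ univ)))
    (hZ : Module.finrank ℝ EZ = 3) (A : E' ≃L[ℝ] ℝ × EZ)
    (h0 : ∀ x (u : Fin 4 → TangentSpace I' x), LinearIndependent ℝ u → Φ.pull (F 1) x u ≠ 0)
    (hpos : ∀ x (u : Fin 4 → TangentSpace I' x), 0 ≤ T.pull (F 1) x u * Φ.pull (F 1) x u)
    (x0 : X) (u0 : Fin 4 → TangentSpace I' x0) : T.pull (F 1) x0 u0 = 0 := by
  let _ : MeasurableSpace E' := borel E'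
  have : BorelSpace E' := ⟨rfl⟩
  let _ : MeasurableSpace X := borel X
  have : BorelSpace X := ⟨rfl⟩
  have : SecondCountableTopology H' := I'.secondCountableTopology
  have : SecondCountableTopology X := ChartedSpace.secondCountable_of_sigmaCompact H' X
  have : Nonempty X := ⟨x0⟩
  obtain ⟨b, hb0, hb1⟩ := exists_adapted_basis hZ A
  have hF1 := family_contMDiff_snd hF 1
  set P : AltField I' X 4 := Φ.pull (F 1) with hPdef
  have hP : ContinuousOnParams P b := fun ψ U hp => (pull_contDiffOn hΦ hF1 hp).continuousOn
  obtain ⟨μ, hμ'⟩ := exists_form_measure P b Measure.addHaar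
  have hμ : IsFormMeasure P b Measure.addHaar μ := hμ'
  have := hμ.isOpenPosMeasure hP h0
  have := hμ.isLocallyFiniteMeasure hP
  obtain ⟨c, T1, hRT, hest⟩ := integral_cutoff_le hg hT hTc hF hT0 hC hTC hε hV h hK hlam.le hV' hbd A hb0 hb1 h0 hP hμ
  obtain ⟨T0, hT₀⟩ := hcl
  set q : X → ℝ := formRatio b _ P with hq
  have hqn : ∀ x, 0 ≤ q x := fun x => by
    rw [hq, formRatio]
    have h1 := hpos x (fun i => b i)
    rcases le_total 0 (P x (fun i => b i)) with h2 | h2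
    · rcases h2.eq_or_lt with h3 | h3
      · exact absurd h3.symm (basis_ne_zero h0 x)
      · exact div_nonneg (nonneg_of_mul_nonneg_left h1 h3) h2
    · rcases h2.eq_or_lt with h3 | h3
      · exact absurd h3 (basis_ne_zero h0 x)
      · refine div_nonneg_of_nonpos ?_ h2
        by_contra h4
        push Not at h4
        exact absurd h1 (not_le.2 (mul_neg_of_pos_of_neg h4 h3))
  have hq0 : q x0 = 0 := by
    by_contra hne
    have hcut : ∀ t : ℝ, ∃ χ : X → ℝ, max T1 T0 < t → (CMDiff ∞ χ ∧ HasCompactSupport χ ∧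
        (∀ q, R < q.1 → χ (α q) = stepDown (q.1 - t)) ∧
        (∀ x ∉ α '' _, χ x = 1) ∧
        ∀ x ∉ α '' _, ∃ c : ℝ, χ =ᶠ[𝓝 x] fun _ => c) := fun t => by
      by_cases ht : max T1 T0 < t
      · obtain ⟨χ, hχ⟩ := h.exists_cutoff'
          (by linarith [(le_max_left T1 T0).trans_lt ht]) (hT₀ t ((le_max_right T1 T0).trans_lt ht))
        exact ⟨χ, fun _ => hχ⟩
      · exact ⟨0, fun h => absurd h ht⟩
    choose χ hχ using hcut
    obtain ⟨t0, ht0⟩ : ∃ t0 : ℝ, ∀ q', R < q'.1 → α q' = x0 → q'.1 ≤ t0 := by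
      by_cases hx : x0 ∈ α '' (Ioi R ×ˢ univ)
      · obtain ⟨q', hq', rfl⟩ := hx
        exact ⟨q'.1, fun q'' hq'' e => (congrArg Prod.fst (h.inj hq'' hq'.1 e)).le⟩
      · exact ⟨0, fun q' hq' e => absurd ⟨q', ⟨hq', trivial⟩, e⟩ hx⟩
    set t1 : ℝ := max t0 _ with ht₁
    have ht1 : max T1 T0 < t1 := by linarith [le_max_right t0 (max T1 T0 + 1)]
    have hval : ∀ t, max T1 T0 < t → ∀ x, 0 ≤ χ t x := fun t ht x => by
      by_cases hx : x ∈ α '' (Ioi R ×ˢ univ)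
      · obtain ⟨q', hq', rfl⟩ := hx
        rw [(hχ t ht).2.2.1 q' hq'.1]
        exact stepDown_nonneg _
      · rw [(hχ t ht).2.2.2.1 x hx]; exact zero_le_one
    have hx0 : χ t1 x0 = 1 := by
      by_cases hx : x0 ∈ α '' (Ioi R ×ˢ univ)
      · obtain ⟨q', hq', e⟩ := hx
        rw [← e, (hχ t1 ht1).2.2.1 q' hq'.1]
        exact stepDown_eq_one (by linarith [ht0 q' hq'.1 e, le_max_left t0 (max T1 T0 + 1)])
      · exact (hχ t1 ht1).2.2.2.1 x0 hx
    have hposint : 0 < ∫ x, χ t1 x * q x ∂μ := by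
      refine Continuous.integral_pos_of_hasCompactSupport_nonneg_nonzero
        ((hχ t1 ht1).1.continuous.mul (continuous_formRatio_pull hT hF1 h0 hP)) (hχ t1 ht1).2.1.mul_right
        (fun x => mul_nonneg (hval t1 ht1 x) (hqn x)) (x := x0) ?_
      rw [hx0, one_mul]; exact hne
    have hle : ∀ t, t1 ≤ t → ∫ x, χ t1 x * q x ∂μ ≤ c * Real.exp (-lam * t) := fun t ht => by
      have ht2 := ht1.trans_le ht
      have i2 := hest t ((le_max_left _ _).trans_lt ht2) (χ t) (hχ t ht2).1 (hχ t ht2).2.1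
        (hχ t ht2).2.2.1 (hχ t ht2).2.2.2.2
      refine (integral_mono (hest t1 ((le_max_left _ _).trans_lt ht1) (χ t1) (hχ t1 ht1).1 (hχ t1 ht1).2.1 (hχ t1 ht1).2.2.1 (hχ t1 ht1).2.2.2.2).1 i2.1 fun x => mul_le_mul_of_nonneg_right ?_ (hqn x)).trans i2.2
      by_cases hx : x ∈ α '' (Ioi R ×ˢ univ)
      · obtain ⟨q', hq', rfl⟩ := hx
        rw [(hχ t ht2).2.2.1 q' hq'.1, (hχ t1 ht1).2.2.1 q' hq'.1]
        exact stepDown_anti (by linarith)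
      · rw [(hχ t ht2).2.2.2.1 x hx, (hχ t1 ht1).2.2.2.1 x hx]
    have := ge_of_tendsto (Tendsto.const_mul c (Real.tendsto_exp_atBot.comp (tendsto_id.const_mul_atTop_of_neg (neg_lt_zero.2 hlam)))) (eventually_atTop.2 ⟨t1, hle⟩)
    linarith
  exact (formRatio_mul (basis_ne_zero h0 x0) u0).symm.trans ((congrArg (· * _) hq0).trans (zero_mul _))

end

section

variable {V : Type*} [NormedAddCommGroup V] [NormedSpace ℝ V] [FiniteDimensional ℝ V] {g : MetricField I M}

/-- The pullback of the metric by a linear map to a tangent space. -/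
def MetricField.IsRiem.pullL (hg : g.IsRiem) (x : M) (D : V →L[ℝ] E) : V →L[ℝ] V →L[ℝ] ℝ :=
  LinearMap.toContinuousLinearMap ((LinearMap.toContinuousLinearMap : (V →ₗ[ℝ] ℝ) ≃ₗ[ℝ] V →L[ℝ] ℝ).toLinearMap.comp
    (LinearMap.mk₂ ℝ (fun v w => g x (D v : E) (D w : E))
    (fun _ _ _ => (congrArg (fun v => g x v _) (map_add _ _ _)).trans (hg.add_left _ _ _ _))
    (fun _ _ _ => (congrArg (fun v => g x v _) (map_smul _ _ _)).trans (hg.smul_left _ _ _ _))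
    (fun _ _ _ => (congrArg (fun v => g x _ v) (map_add _ _ _)).trans (hg.add_right _ _ _ _))
    (fun _ _ _ => (congrArg (fun v => g x _ v) (map_smul _ _ _)).trans (hg.smul_right _ _ _ _))))

theorem MetricField.IsRiem.inChart_pos (hg : g.IsRiem) (p : M) {z : E}
    (hz : z ∈ (ϕ I p).target) {v : E} (hv : v ≠ 0) : 0 < g.inChart p z v v := hg.pos _ _ fun h => hv ((mfderiv_mfderiv_symm_extChartAt p z hz v).symm.trans ((congrArg _ h).trans (map_zero _)))

theorem MetricField.IsRiem.exists_inChart_bounds (hg : g.IsRiem) (p : M) {C : Set E} (hC : IsCompact C)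
    (hCt : C ⊆ (ϕ I p).target) :
    ∃ c1 c2 : ℝ, 0 < c1 ∧ 0 < c2 ∧
      ∀ z ∈ C, ∀ v : E, c1 * ‖v‖ ^ 2 ≤ g.inChart p z v v ∧ g.inChart p z v v ≤ c2 * ‖v‖ ^ 2 := by
  have hcL : ContinuousOn (hg.chartL p) C := by
    have h : ContDiffOn ℝ ∞ (hg.chartL p) (ϕ I p).target := by
      rw [contDiffOn_clm_apply]
      intro v
      rw [contDiffOn_clm_apply]
      exact fun w z hz => (hg.inChart_contDiffAt p v w hz).contDiffWithinAt
    exact h.continuousOn.mono hCt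
  obtain ⟨c1, hc1, h1⟩ := (hC.prod (isCompact_sphere 0 1)).exists_forall_le' (((hcL.comp continuousOn_fst fun q hq => hq.1).clm_apply continuousOn_snd).clm_apply continuousOn_snd) fun q hq =>
    hg.inChart_pos p (hCt hq.1) (ne_zero_of_mem_unit_sphere (⟨q.2, hq.2⟩))
  obtain ⟨c2, h2⟩ := IsCompact.exists_bound_of_continuousOn (E := E →L[ℝ] E →L[ℝ] ℝ) hC hcL
  refine ⟨c1, max c2 1, hc1, by positivity, fun z hz v => ⟨?_, ?_⟩⟩
  · by_cases hv : v = 0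
    · subst hv
      have h3 : 0 ≤ g.inChart p z 0 0 := hg.nonneg _ _
      simpa using h3
    · have h3 := h1 (z, ‖v‖⁻¹ • v) ⟨hz, by simp [norm_smul, norm_ne_zero_iff.2 hv]⟩
      simp only [map_smul, smul_apply, smul_eq_mul] at h3
      have h4 : hg.chartL p z v v = ‖v‖ ^ 2 * (‖v‖⁻¹ * (‖v‖⁻¹ * hg.chartL p z v v)) := by field_simp
      rw [← hg.chartL_apply, h4, mul_comm]
      exact mul_le_mul_of_nonneg_left h3 (by positivity)
  · rw [← hg.chartL_apply]
    refine (le_abs_self _).trans (((hg.chartL p z).le_opNorm₂ v v).trans ?_)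
    rw [mul_assoc, ← sq]
    exact mul_le_mul_of_nonneg_right ((h2 z hz).trans (le_max_left _ _)) (by positivity)

end

section

variable {g : MetricField I M} {h : MetricField J N} {Ψ : ℝ × N → M}

theorem ExpDecayOn.eventually_le {EZ F : Type*} [NormedAddCommGroup EZ] [NormedSpace ℝ EZ]
    [NormedAddCommGroup F] [NormedSpace ℝ F] {D : ℝ × EZ → F} {C : Set EZ} {δ : ℝ} (hδ : 0 < δ)
    (hD : ExpDecayOn D C δ) (k : ℕ) {η : ℝ} (hη : 0 < η) :
    ∀ᶠ t : ℝ in atTop, ∀ y ∈ C, ‖iteratedFDeriv ℝ k D (t, y)‖ ≤ η := by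
  obtain ⟨c, hc⟩ := (hD k).bound
  have h1 := ((Real.tendsto_exp_atBot.comp (tendsto_id.const_mul_atTop_of_neg (neg_lt_zero.2 hδ))).norm).const_mul c
  rw [norm_zero, mul_zero] at h1
  rw [eventually_prod_principal_iff] at hc
  filter_upwards [hc, h1.eventually_le_const hη] with t h2 h3 y hy
  exact (h2 y hy).trans h3

theorem exists_pointwise_bounds (hg : g.IsRiem) (hh : h.IsRiem)
    (hasy : IsAsymptoticTo Ψ g.toTensor (cylMetric h)) (q : N) {C : Set EN} (hC : IsCompact C)
    (hCt : C ⊆ (ϕ J q).target) :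
    ∃ c : ℝ, 0 ≤ c ∧ ∀ᶠ t : ℝ in atTop, ∀ y ∈ C, ∀ w : ℝ × EN, w.1 ^ 2 ≤ 4 * pullbackComp J Ψ g.toTensor q ![w, w] (t, y) ∧
      pullbackComp J Ψ g.toTensor q ![w, w] (t, y) ≤ c * ‖w‖ ^ 2 := by
  obtain ⟨c1, c2, hc1, hc2, hbd⟩ := hh.exists_inChart_bounds q hC hCt
  obtain ⟨δ, hδ, hdec⟩ := hasy
  let e := Module.finBasis ℝ (ℝ × EN)
  obtain ⟨κ1, hκ1, hn1⟩ := e.exists_opNorm_le (F := ℝ)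
  obtain ⟨κ2, hκ2, hn2⟩ := e.exists_opNorm_le (F := ℝ × EN →L[ℝ] ℝ)
  set η : ℝ := min (1 / 2) c1 / (κ2 * κ1) with hη
  have hη0 : 0 < η := div_pos (lt_min (by norm_num) hc1) (mul_pos hκ2 hκ1)
  refine ⟨2 + c2, by positivity, ?_⟩
  have hev : ∀ᶠ t : ℝ in atTop, ∀ i j, ∀ y ∈ C, |pullbackComp J Ψ g.toTensor q ![e i, e j] (t, y) -
        (cylMetric h).comp q ![e i, e j] y| ≤ η := by
    rw [eventually_all]; intro i
    rw [eventually_all]; intro j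
    filter_upwards [(hdec q C hC hCt ![e i, e j]).eventually_le hδ 0 hη0] with t ht y hy
    simpa using ht y hy
  filter_upwards [hev] with t ht y hy w
  let D : ℝ × EN →L[ℝ] E := mfderiv 𝓘(ℝ, ℝ × EN) I (endInChart J Ψ q) (t, y)
  let B : (ℝ × EN) →L[ℝ] (ℝ × EN) →L[ℝ] ℝ := hg.pullL (endInChart J Ψ q (t, y)) D
  let fst := ContinuousLinearMap.fst ℝ ℝ EN
  let snd := ContinuousLinearMap.snd ℝ ℝ EN
  let B' : (ℝ × EN) →L[ℝ] (ℝ × EN) →L[ℝ] ℝ :=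
    (ContinuousLinearMap.mul ℝ ℝ).bilinearComp fst fst + (hh.chartL q y).bilinearComp snd snd
  have hB' : ∀ u v, B' u v = u.1 * v.1 + h.inChart q y u.2 v.2 := fun u v => rfl
  have h2 : |B w w - B' w w| ≤ min (1 / 2) c1 * ‖w‖ ^ 2 := by
    refine ((B - B').le_opNorm₂ w w).trans ?_
    rw [mul_assoc, ← sq]
    refine mul_le_mul_of_nonneg_right ((hn2 (by positivity) fun i => hn1 hη0.le fun j => (fun i j => ht i j y hy) i j).trans_eq ?_) (by positivity)
    rw [hη]; field_simp
  have hw : ‖w‖ ^ 2 ≤ w.1 ^ 2 + ‖w.2‖ ^ 2 := by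
    rcases le_total ‖w.1‖ ‖w.2‖ with h3 | h3
    · rw [Prod.norm_def, max_eq_right h3]; nlinarith [sq_nonneg w.1]
    · rw [Prod.norm_def, max_eq_left h3, Real.norm_eq_abs, sq_abs]; nlinarith [sq_nonneg ‖w.2‖]
  have hw1 : w.1 ^ 2 ≤ ‖w‖ ^ 2 := by rw [← sq_abs]; exact pow_le_pow_left₀ (abs_nonneg _) (norm_fst_le w) 2
  obtain ⟨h3, h4⟩ := hbd y hy w.2
  have h5 := abs_le.1 h2
  rw [hB'] at h5
  change w.1 ^ 2 ≤ 4 * B w w ∧ B w w ≤ (2 + c2) * ‖w‖ ^ 2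
  have h6 : min (1 / 2) c1 * ‖w‖ ^ 2 ≤ 1 / 2 * w.1 ^ 2 + c1 * ‖w.2‖ ^ 2 := by
    calc min (1 / 2) c1 * ‖w‖ ^ 2 ≤ min (1 / 2) c1 * (w.1 ^ 2 + ‖w.2‖ ^ 2) := mul_le_mul_of_nonneg_left hw (by positivity)
      _ ≤ _ := by
        rw [mul_add]
        exact add_le_add (mul_le_mul_of_nonneg_right (min_le_left _ _) (sq_nonneg _))
          (mul_le_mul_of_nonneg_right (min_le_right _ _) (by positivity))
  have h7 : min (1 / 2) c1 * ‖w‖ ^ 2 ≤ 1 * ‖w‖ ^ 2 :=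
    mul_le_mul_of_nonneg_right ((min_le_left _ _).trans (by norm_num)) (by positivity)
  have h8 := mul_le_mul_of_nonneg_left (pow_le_pow_left₀ (norm_nonneg _) (norm_snd_le w) 2) hc2.le
  constructor
  · nlinarith [sq_nonneg w.1]
  · nlinarith

theorem endInChart_mfderiv {t : ℝ} {q : N} {y : EN} (hΨ : CMDiffAt ∞ Ψ
      (t, (ϕ J q).symm y)) (hy : y ∈ (ϕ J q).target) (w : ℝ × EN) :
    (mfderiv 𝓘(ℝ, ℝ × EN) I (endInChart J Ψ q) (t, y) w : E) = mfderiv (𝓘(ℝ).prod J) I Ψ (t, (ϕ J q).symm y)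
        (w.1, mfderiv 𝓘(ℝ, EN) J (ϕ J q).symm y w.2) := by
  have h4 : HasMFDerivAt 𝓘(ℝ, ℝ × EN) 𝓘(ℝ, EN) Prod.snd (t, y)
      (ContinuousLinearMap.snd ℝ ℝ EN) := hasFDerivAt_snd.hasMFDerivAt
  have h5 := HasMFDerivAt.comp (t, y) ((contMDiffAt_extChartAt_symm q hy).mdiffAt).hasMFDerivAt h4
  exact (HasMFDerivAt.comp (t, y) hΨ.mdiffAt.hasMFDerivAt (hasFDerivAt_fst.hasMFDerivAt.prodMk h5)).mfderiv.app w

end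

section

variable [T2Space M] [CompactSpace N] {g : MetricField I M} {h : MetricField J N} {Ψ : ℝ × N → M} {S : Set M}

theorem mem_halfCylinder {Y : Type*} {R t : ℝ} (ht : R < t) (q : Y) : (t, q) ∈ Ioi R ×ˢ (univ : Set Y) := ⟨ht, trivial⟩

/-- The component along the axis of the cylinder is bounded by the length. -/
def AxisBound (I : ModelWithCorners ℝ E H) (J : ModelWithCorners ℝ EN HN) (g : MetricField I M)
    (Ψ : ℝ × N → M) (T0 : ℝ) : Prop :=
  ∀ t : ℝ, T0 < t → ∀ (q : N) (w : ℝ × EN), w.1 ^ 2 ≤ 4 * g (Ψ (t, q)) (mfderiv% Ψ (t, q) w) (mfderiv% Ψ (t, q) w)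

theorem exists_axisBound (hg : g.IsRiem) (hh : h.IsRiem) (hΨ : IsDiffeoOn I (𝓘(ℝ).prod J) Ψ (Ioi (0 : ℝ) ×ˢ univ) S)
    (hasy : IsAsymptoticTo Ψ g.toTensor (cylMetric h)) : ∃ T0, 0 < T0 ∧ AxisBound I J g Ψ T0 := by
  have hloc : ∀ q : N, ∃ C, IsCompact C ∧ C ⊆ (ϕ J q).target ∧ C ∈ 𝓝 (ϕ J q q) := fun q => by
    obtain ⟨r, hr, hrt⟩ := Metric.isOpen_iff.1 (isOpen_extChartAt_target (I := J) q) _ (mem_extChartAt_target q)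
    exact ⟨Metric.closedBall _ (r / 2), isCompact_closedBall _ _, (Metric.closedBall_subset_ball (by linarith)).trans hrt,
      Metric.closedBall_mem_nhds _ (by linarith)⟩
  choose C hC hCt hCn using hloc
  obtain ⟨fs, hfs⟩ := CompactSpace.elim_nhds_subcover (fun q => (ϕ J q).source ∩ ϕ J q ⁻¹' C q) (fun q =>
      inter_mem (extChartAt_source_mem_nhds q) ((continuousAt_extChartAt q).preimage_mem_nhds (hCn q)))
  have hev : ∀ q ∈ fs, ∀ᶠ t : ℝ in atTop, ∀ y ∈ C q, ∀ w,
      w.1 ^ 2 ≤ 4 * pullbackComp J Ψ g.toTensor q ![w, w] (t, y) := fun q _ => by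
    obtain ⟨c, -, hc⟩ := exists_pointwise_bounds hg hh hasy q (hC q) (hCt q)
    filter_upwards [hc] with t ht y hy w using (ht y hy w).1
  obtain ⟨T0, hT0⟩ := eventually_atTop.1 ((Finset.eventually_all fs).2 hev)
  refine ⟨max T0 1, by positivity, fun t ht q w => ?_⟩
  have hq : q ∈ ⋃ p ∈ fs, (ϕ J p).source ∩ ϕ J p ⁻¹' C p := by rw [hfs]; trivial
  simp only [mem_iUnion] at hq
  obtain ⟨p, hp, hq1, hq2⟩ := hq
  have ht0 := lt_trans (by positivity) ht
  let w' : ℝ × EN := (w.1, mfderiv% (ϕ J p) q w.2)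
  have h1 := hT0 t ((le_max_left _ _).trans ht.le) p hp _ hq2 w'
  have h2 := endInChart_mfderiv ((hΨ.1 _ (mem_halfCylinder ht0 _)).contMDiffAt ((isOpen_halfCylinder 0).mem_nhds (mem_halfCylinder ht0 _))) ((ϕ J p).map_source hq1) w'
  have h4 := h2.trans (congrArg (fun a => (mfderiv% Ψ
    (t, (ϕ J p).symm (ϕ J p q)) _ : E)) (mfderiv_symm_mfderiv_extChartAt p q hq1 w.2))
  have h5 : ∀ q' : N, q' = q → g (Ψ (t, q')) (mfderiv% Ψ (t, q') w) (mfderiv% Ψ (t, q') w) =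
      g (Ψ (t, q)) (mfderiv% Ψ (t, q) w) (mfderiv% Ψ (t, q) w) := by
    rintro q' rfl; rfl
  have h6 : pullbackComp J Ψ g.toTensor p ![w', w'] (t, ϕ J p q) = g _ (mfderiv% Ψ _ w) _ := congrArg (fun a => g _ a a) h4
  rw [h6, h5 _ ((ϕ J p).left_inv hq1)] at h1
  exact h1

/-- A smooth bump function around `0`. -/
def bump (s : ℝ) : ℝ := stepDown (2 * s ^ 2)

theorem bump_contDiff : ContDiff ℝ ∞ bump := stepDown_contDiff.comp (by fun_prop)

theorem bump_eq_zero {s : ℝ} (hs : 3 / 4 < |s|) : bump s = 0 := stepDown_eq_zero (by nlinarith [sq_abs s])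

theorem bump_zero : bump 0 = 1 := stepDown_eq_one (by simp)

theorem isClosed_image_end (hg : g.IsRiem)
    (hΨ : IsDiffeoOn I (𝓘(ℝ).prod J) Ψ (Ioi (0 : ℝ) ×ˢ univ) S) {T0 : ℝ} (hT0 : 0 < T0)
    (hax : AxisBound I J g Ψ T0) {T : ℝ} (hT : T0 + 1 < T) : IsClosed (Ψ '' (Ici T ×ˢ univ)) := by
  classical
  refine isClosed_of_closure_subset fun m hm => ?_
  have hN : Nonempty N := by
    by_contra hN
    rw [not_nonempty_iff] at hN
    rw [univ_eq_empty_iff.2 hN, prod_empty, image_empty, closure_empty] at hm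
    exact hm
  obtain ⟨k, hk1, hk2, hk3, hk4⟩ := IsDiffeoOn.exists_inverse (isOpen_halfCylinder 0) hΨ
  have hop : ∀ O, IsOpen O → O ⊆ Ioi 0 ×ˢ univ → IsOpen (Ψ '' O) := fun O hO h =>
    hΨ.isOpen_image (isOpen_halfCylinder 0) hO h
  have hS := hΨ.2.1.image_eq
  have hSo : IsOpen S := hS ▸ hop _ (isOpen_halfCylinder 0) subset_rfl
  obtain ⟨L, hL⟩ := (isCompact_Icc (a := (-1 : ℝ)) (b := 1)).exists_bound_of_continuousOn
    (bump_contDiff.continuous_deriv (by simp)).continuousOn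
  have hL0 : 0 ≤ L := (norm_nonneg _).trans (hL 0 (by norm_num))
  obtain ⟨r, hr, hrt⟩ := Metric.isOpen_iff.1 (isOpen_extChartAt_target (I := I) m) _ (mem_extChartAt_target m)
  set z0 := ϕ I m m with hz0
  obtain ⟨c1, c2, hc1, hc2, hbd⟩ := hg.exists_inChart_bounds m (isCompact_closedBall z0 (r / 2))
    ((Metric.closedBall_subset_ball (by linarith)).trans hrt)
  set L' : ℝ := L * (2 * √c2) with hL'
  have hL'0 : 0 ≤ L' := by positivity
  set r' : ℝ := min (r / 2) (1 / (L' + 1)) with hr'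
  have hr'0 : 0 < r' := lt_min (by linarith) (by positivity)
  have hbt : Metric.ball z0 r' ⊆ (ϕ I m).target := fun z hz => hrt
    (Metric.ball_subset_ball ((min_le_left _ _).trans (by linarith)) hz)
  have hW : (ϕ I m).source ∩ ϕ I m ⁻¹' Metric.ball z0 r' ∈ 𝓝 m := inter_mem (extChartAt_source_mem_nhds m)
      ((continuousAt_extChartAt m).preimage_mem_nhds (Metric.ball_mem_nhds _ hr'0))
  obtain ⟨_, ⟨hx1, hx2⟩, ⟨t, q⟩, ⟨ht, -⟩, rfl⟩ := mem_closure_iff_nhds.1 hm _ hW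
  have htT : T ≤ t := ht
  set ρ : M → ℝ := fun x => if x ∈ S then bump ((k x).1 - t) else 0 with hρ
  have hρ0 : ∀ x ∉ Ψ '' (Icc (t - 3 / 4) (t + 3 / 4) ×ˢ univ), ρ x = 0 := fun x hx => by
    by_cases hxS : x ∈ S
    · refine (if_pos hxS).trans (bump_eq_zero ?_)
      by_contra hle
      rw [not_lt, abs_le] at hle
      exact hx ⟨k x, ⟨⟨by linarith, by linarith⟩, trivial⟩, hk3 x hxS⟩
    · exact if_neg hxS
  have hcl : IsClosed (Ψ '' (Icc (t - 3 / 4) (t + 3 / 4) ×ˢ univ)) := by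
    refine ((isCompact_Icc.prod isCompact_univ).image_of_continuousOn (hΨ.1.continuousOn.mono (Set.prod_mono (fun s hs => ?_) subset_rfl))).isClosed
    have := hs.1; simp only [mem_Ioi]; linarith
  have hder : ∀ z ∈ Metric.ball z0 r', ∃ A : E →L[ℝ] ℝ, HasFDerivAt (fun z => ρ ((ϕ I m).symm z)) A z ∧ ‖A‖ ≤ L' := by
    intro z hz
    have hsymm := contMDiffAt_extChartAt_symm m (hbt hz)
    by_cases hx : (ϕ I m).symm z ∈ Ψ '' (Icc (t - 3 / 4) (t + 3 / 4) ×ˢ univ)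
    · obtain ⟨⟨t', q'⟩, ⟨ht', -⟩, hxe⟩ := hx
      have ht0 : 0 < t' := by have := ht'.1; simp only at this; linarith
      have hxS := hS ▸ hxe ▸ mem_image_of_mem Ψ (mem_halfCylinder ht0 _)
      have hkx : k ((ϕ I m).symm z) = (t', q') := by rw [← hxe]; exact hk1 _ (mem_halfCylinder ht0 _)
      have hκ := (((hk4 _ hxS).contMDiffAt (hSo.mem_nhds hxS)).comp z hsymm).mdiffAt
      let D : E →L[ℝ] ℝ × EN := mfderiv% (fun z => k ((ϕ I m).symm z)) z
      have hb' : HasDerivAt bump (deriv bump (t' - t)) ((k ((ϕ I m).symm z)).1 - t) := by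
        rw [hkx]; exact (bump_contDiff.differentiable (by simp) _).hasDerivAt
      refine ⟨_, (hb'.comp_hasFDerivAt z ((hasMFDerivAt_iff_hasFDerivAt.1 (HasMFDerivAt.comp z (hasMFDerivAt_fst _) hκ.hasMFDerivAt)).sub_const t)).congr_of_eventuallyEq ?_, ?_⟩
      · filter_upwards [hsymm.continuousAt.preimage_mem_nhds (hSo.mem_nhds hxS)] with y hy
        exact if_pos hy
      · have hΨκ : (fun z => Ψ (k ((ϕ I m).symm z))) =ᶠ[𝓝 z] (ϕ I m).symm := by
          filter_upwards [hsymm.continuousAt.preimage_mem_nhds (hSo.mem_nhds hxS)] with y hy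
          exact hk3 _ hy
        have hΨd : MDiffAt Ψ (k ((ϕ I m).symm z)) := by
          rw [hkx]
          exact ((hΨ.1 _ (mem_halfCylinder ht0 _)).contMDiffAt
            ((isOpen_halfCylinder 0).mem_nhds (mem_halfCylinder ht0 _))).mdiffAt
        have hv : ∀ v : E, |(D v).1| ≤ 2 * √c2 * ‖v‖ := fun v => by
          have e2 := hax (k _).1 (by rw [hkx]; have := ht'.1; simp only at this ⊢; linarith) (k ((ϕ I m).symm z)).2 (D v)
          have e3 := (congrArg (fun w => g _ w w) (((mfderiv_comp z hΨd hκ).symm.trans hΨκ.mfderiv_eq).app v)).trans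
              (tensor_congr_point g.toTensor (hk3 _ hxS) (fun _ => (mfderiv% (ϕ I m).symm z v : E)))
          have e4 := (hbd z (Metric.ball_subset_closedBall (Metric.ball_subset_ball (min_le_left _ _) hz)) v).2
          refine abs_le_of_sq_le_sq ?_ (by positivity)
          rw [mul_pow, mul_pow, Real.sq_sqrt hc2.le]
          have e5 : (D v).1 ^ 2 ≤ 4 * g.inChart m z v v := e2.trans_eq (congrArg (4 * ·) e3)
          linarith
        refine ContinuousLinearMap.opNorm_le_bound _ hL'0 fun v => ?_
        have e6 : |deriv bump (t' - t)| ≤ L := hL _ ⟨by have := ht'.1; simp only at this; linarith,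
          by have := ht'.2; simp only at this; linarith⟩
        change |deriv bump (t' - t) * (D v).1| ≤ L' * ‖v‖
        rw [abs_mul, hL', mul_assoc]
        exact mul_le_mul e6 (hv v) (abs_nonneg _) hL0
    · refine ⟨0, (hasFDerivAt_const (0 : ℝ) z).congr_of_eventuallyEq ?_, by simpa using hL'0⟩
      filter_upwards [hsymm.continuousAt.preimage_mem_nhds (hcl.isOpen_compl.mem_nhds hx)] with y hy
      exact hρ0 _ hy
  choose! A hA hAn using hder
  have hlip := (convex_ball z0 r').norm_image_sub_le_of_norm_hasFDerivWithin_le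
    (fun z hz => (hA z hz).hasFDerivWithinAt) hAn (Metric.mem_ball_self hr'0) hx2
  have hρx : ρ ((ϕ I m).symm (ϕ I m (Ψ (t, q)))) = 1 := by
    have ht0 : (0 : ℝ) < t := by linarith
    rw [(ϕ I m).left_inv hx1]
    refine (if_pos (hS ▸ mem_image_of_mem Ψ (mem_halfCylinder ht0 _))).trans ?_
    rw [hk1 _ (mem_halfCylinder ht0 _), sub_self, bump_zero]
  have hmS : m ∈ S := by
    by_contra hmS
    have hρm : ρ ((ϕ I m).symm z0) = 0 := by rw [hz0, extChartAt_to_inv]; exact if_neg hmS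
    rw [hρx, hρm, sub_zero, norm_one] at hlip
    have h1 : ‖ϕ I m (Ψ (t, q)) - z0‖ < 1 / (L' + 1) := by
      rw [← dist_eq_norm]; exact (Metric.mem_ball.1 hx2).trans_le (min_le_right _ _)
    have h2 := mul_le_mul_of_nonneg_left h1.le hL'0
    have h3 : L' * (1 / (L' + 1)) < 1 := by rw [mul_one_div, div_lt_one (by positivity)]; linarith
    linarith
  rw [← hS] at hmS
  obtain ⟨⟨t', q'⟩, ⟨ht', -⟩, rfl⟩ := hmS
  by_cases htt : T ≤ t'
  · exact ⟨(t', q'), ⟨htt, trivial⟩, rfl⟩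
  · exfalso
    obtain ⟨_, ⟨a, ha, rfl⟩, b, hb, hab⟩ := mem_closure_iff_nhds.1 hm _
      ((hop _ (isOpen_Ioo.prod isOpen_univ) (Set.prod_mono Ioo_subset_Ioi_self subset_rfl)).mem_nhds ⟨(t', q'), ⟨⟨ht', not_le.1 htt⟩, trivial⟩, rfl⟩)
    have hb1 : T ≤ b.1 := hb.1
    have := hΨ.2.1.injOn (mem_halfCylinder (show 0 < b.1 by linarith) b.2) ⟨ha.1.1, trivial⟩ hab
    have ha2 := ha.1.2
    rw [← this] at ha2
    linarith

end

section

variable [T2Space M] [CompactSpace N] {g : MetricField I M} {h : MetricField J N} {Ψ : ℝ × N → M} {S : Set M}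
  {R : ℝ} {α : ℝ × Z → X} {w : ℝ × Z → N} {j : Z → N}

theorem IsEnd.isClosed [T2Space X] [CompactSpace Z] (hα : IsEnd I' IZ R α)
    (hΨ : IsDiffeoOn I (𝓘(ℝ).prod J) Ψ (Ioi (0 : ℝ) ×ˢ univ) S) (hR : 0 ≤ R)
    {T : ℝ} (hT : R < T) (hcl : IsClosed (Ψ '' (Ici T ×ˢ univ))) {p : X → M} (hp : Continuous p)
    (hpα : ∀ q : ℝ × Z, R < q.1 → p (α q) = Ψ (q.1, w q)) : IsClosed (α '' (Ici T ×ˢ univ)) := by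
  refine isClosed_of_closure_subset fun x hx => ?_
  have h1 : p x ∈ Ψ '' (Ici T ×ˢ univ) := by
    rw [← hcl.closure_eq]
    refine map_mem_closure hp hx ?_
    rintro _ ⟨q, hq, rfl⟩
    have hq1 : T ≤ q.1 := hq.1
    exact ⟨(q.1, w q), ⟨hq1, trivial⟩, (hpα q (by linarith)).symm⟩
  obtain ⟨⟨t, n⟩, ⟨ht, -⟩, hpx⟩ := h1
  have htT : T ≤ t := ht
  have hn : p ⁻¹' (Ψ '' (Ioo 0 (t + 1) ×ˢ univ)) ∈ 𝓝 x :=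
    hp.continuousAt.preimage_mem_nhds ((hΨ.isOpen_image (isOpen_halfCylinder 0) (isOpen_Ioo.prod isOpen_univ) (Set.prod_mono Ioo_subset_Ioi_self subset_rfl)).mem_nhds
      ⟨(t, n), ⟨⟨by linarith, by linarith⟩, trivial⟩, hpx⟩)
  have hc : IsClosed (α '' (Icc T (t + 1) ×ˢ univ)) := by
    exact ((isCompact_Icc.prod isCompact_univ).image_of_continuousOn (hα.diffeo.1.continuousOn.mono (Set.prod_mono (fun s hs => hT.trans_le hs.1) subset_rfl))).isClosed
  have h2 : x ∈ closure (α '' (Icc T (t + 1) ×ˢ univ)) := by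
    rw [mem_closure_iff_nhds]
    intro O hO
    obtain ⟨_, ⟨hqO, a, ha, hab⟩, q, hq, rfl⟩ := mem_closure_iff_nhds.1 hx _ (inter_mem hO hn)
    have hq1 : T ≤ q.1 := hq.1
    rw [hpα q (by linarith)] at hab
    exact ⟨α q, hqO, q, ⟨⟨hq1, (congrArg Prod.fst (hΨ.2.1.injOn (mem_halfCylinder ha.1.1 a.2) (mem_halfCylinder (show 0 < q.1 by linarith) (w q)) hab)) ▸ ha.1.2.le⟩, trivial⟩, rfl⟩
  rw [hc.closure_eq] at h2
  exact image_mono (Set.prod_mono Icc_subset_Ici_self subset_rfl) h2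

theorem norm_fderiv_le_of_iteratedFDeriv {V F : Type*} [NormedAddCommGroup V] [NormedSpace ℝ V]
    [NormedAddCommGroup F] [NormedSpace ℝ F] {D : V → F} {z : V} {c : ℝ}
    (h : ‖iteratedFDeriv ℝ 1 D z‖ ≤ c) : ‖fderiv ℝ D z‖ ≤ c := by
  rwa [norm_iteratedFDeriv_one] at h

/-- In charts, maps that converge exponentially converge in `C^1` on small compact sets. -/
theorem ExpConverges.exists_chart (hw : ExpConverges J IZ w j) (hj : CMDiff ∞ j)
    (hws : ContMDiffOn (𝓘(ℝ).prod IZ) J ∞ w (Ioi R ×ˢ univ)) (y0 : Z) {O : Set EN}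
    (hO : O ∈ 𝓝 (ϕ J (j y0) (j y0))) {η : ℝ} (hη : 0 < η) :
    ∃ C : Set EZ, IsCompact C ∧ Convex ℝ C ∧ C ∈ 𝓝 (ϕ IZ y0 y0) ∧ C ⊆ (ϕ IZ y0).target ∧
      (∀ y ∈ C, j ((ϕ IZ y0).symm y) ∈ (ϕ J (j y0)).source ∧ ContDiffAt ℝ ∞ (fun y => ϕ J (j y0) (j ((ϕ IZ y0).symm y))) y) ∧
      ∀ᶠ t : ℝ in atTop, ∀ y ∈ C, w (t, (ϕ IZ y0).symm y) ∈ (ϕ J (j y0)).source ∧ ϕ J (j y0) (w (t, (ϕ IZ y0).symm y)) ∈ O ∧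
        ContDiffAt ℝ ∞ (fun z => ϕ J (j y0) (w (z.1, (ϕ IZ y0).symm z.2))) (t, y) ∧
        ∀ v : EZ, ‖fderiv ℝ (fun z => ϕ J (j y0) (w (z.1, (ϕ IZ y0).symm z.2))) (t, y) (0, v) -
          fderiv ℝ (fun y => ϕ J (j y0) (j ((ϕ IZ y0).symm y))) y v‖ ≤ η * ‖v‖ := by
  set q := j y0 with hq
  set e := ϕ J q
  set s := (ϕ IZ y0).symm
  have hs0 : s (ϕ IZ y0 y0) = y0 := extChartAt_to_inv y0
  have hjs := fun y hy => ContMDiffAt.comp y (hj _) (contMDiffAt_extChartAt_symm y0 hy)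
  have h0 : CMDiffAt ∞ (fun y => j (s y)) (ϕ IZ y0 y0) := hjs _ (mem_extChartAt_target y0)
  have hsrc : (fun y => j (s y)) ⁻¹' e.source ∈ 𝓝 (ϕ IZ y0 y0) :=
    h0.continuousAt.preimage_mem_nhds (by simp only [hs0]; exact extChartAt_source_mem_nhds q)
  have hWc := contDiffAt_chart_comp h0 (by simp only [hs0]; exact mem_extChartAt_source q)
  obtain ⟨ρ, hρ, hρO⟩ := Metric.mem_nhds_iff.1 hO
  have hball : (fun y => e (j (s y))) ⁻¹' Metric.ball (e q) (ρ / 2) ∈ 𝓝 (ϕ IZ y0 y0) :=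
    hWc.continuousAt.preimage_mem_nhds (by simp only [hs0]; exact Metric.ball_mem_nhds _ (by linarith))
  obtain ⟨r, hr, hrC⟩ := Metric.mem_nhds_iff.1 (inter_mem (inter_mem hsrc hball) (extChartAt_target_mem_nhds y0))
  have hC : Metric.closedBall (ϕ IZ y0 y0) (r / 2) ⊆ Metric.ball (ϕ IZ y0 y0) r :=
    Metric.closedBall_subset_ball (by linarith)
  have hCd := fun y hy => contDiffAt_chart_comp (hjs y (hrC (hC hy)).2) (hrC (hC hy)).1.1
  obtain ⟨δ, hδ, hconv⟩ := hw
  obtain ⟨hev, hdec⟩ := hconv y0 q _ (isCompact_closedBall _ (r / 2)) (fun y hy => (hrC (hC hy)).2)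
    (fun y hy => (hrC (hC hy)).1.1)
  refine ⟨_, isCompact_closedBall _ (r / 2), convex_closedBall _ _,
    Metric.closedBall_mem_nhds _ (by linarith), fun y hy => (hrC (hC hy)).2,
    fun y hy => ⟨(hrC (hC hy)).1.1, hCd y hy⟩, ?_⟩
  rw [eventually_prod_principal_iff] at hev
  filter_upwards [hev, hdec.eventually_le hδ 0 (half_pos hρ), hdec.eventually_le hδ 1 hη,
    eventually_gt_atTop R] with t h1 h2 h3 htR y hy
  have hsy := ContMDiffAt.prodMk contDiff_fst.contMDiff.contMDiffAt
      (ContMDiffAt.comp (t, y) (contMDiffAt_extChartAt_symm y0 (hrC (hC hy)).2) contDiff_snd.contMDiff.contMDiffAt)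
  have hwt := ContMDiffAt.comp (t, y) ((hws _ (mem_halfCylinder htR (s y))).contMDiffAt
      ((isOpen_halfCylinder R).mem_nhds (mem_halfCylinder htR (s y)))) hsy
  have hWt : ContDiffAt ℝ ∞ (fun z => e (w (z.1, s z.2))) (t, y) := contDiffAt_chart_comp hwt (h1 y hy)
  have hsnd : HasFDerivAt (fun z => e (j (s z.2))) ((fderiv ℝ (fun y => e (j (s y))) y).comp _) (t, y) :=
    HasFDerivAt.comp (t, y) (g := fun y => e (j (s y))) ((hCd y hy).diffAt).hasFDerivAt hasFDerivAt_snd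
  refine ⟨h1 y hy, hρO ?_, hWt, fun v => ?_⟩
  · have h5 := h2 y hy
    rw [norm_iteratedFDeriv_zero] at h5
    have h6 : dist (e (j (s y))) (e q) < ρ / 2 := (hrC (hC hy)).1.2
    have h7 : dist (e (w (t, s y))) (e (j (s y))) ≤ ρ / 2 := by rw [dist_eq_norm]; exact h5
    exact (dist_triangle _ _ _).trans_lt (by linarith)
  · have h6 : fderiv ℝ (fun z => e (w (z.1, s z.2)) - e (j (s z.2))) (t, y) (0, v) =
        fderiv ℝ (fun z => e (w (z.1, s z.2))) (t, y) (0, v) - fderiv ℝ (fun y => e (j (s y))) y v := by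
      rw [(hWt.diffAt.hasFDerivAt.fun_sub hsnd).fderiv]
      simp
    rw [← h6]
    refine (ContinuousLinearMap.le_of_opNorm_le _ (norm_fderiv_le_of_iteratedFDeriv (h3 y hy)) _).trans_eq ?_
    simp [Prod.norm_def]

theorem endBounded_of_expConverges (hg : g.IsRiem) (hh : h.IsRiem)
    (hΨ : IsDiffeoOn I (𝓘(ℝ).prod J) Ψ (Ioi (0 : ℝ) ×ˢ univ) S)
    (hasy : IsAsymptoticTo Ψ g.toTensor (cylMetric h)) (hj : CMDiff ∞ j)
    (hws : ContMDiffOn (𝓘(ℝ).prod IZ) J ∞ w (Ioi R ×ˢ univ)) (hw : ExpConverges J IZ w j)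
    {β : ℝ × Z → M} (hβ : ∀ q : ℝ × Z, R < q.1 → β q = Ψ (q.1, w q)) : EndBounded I IZ g β := by
  intro y0
  obtain ⟨r, hr, hrt⟩ := Metric.isOpen_iff.1 (isOpen_extChartAt_target (I := J) (j y0)) _ (mem_extChartAt_target (j y0))
  have hCN : Metric.closedBall _ (r / 2) ⊆ (ϕ J (j y0)).target := (Metric.closedBall_subset_ball (by linarith)).trans hrt
  obtain ⟨c, hc0, hc⟩ := exists_pointwise_bounds hg hh hasy (j y0) (isCompact_closedBall _ (r / 2)) hCN
  obtain ⟨C, hC, -, hCn, hCt, hCd, hev⟩ := hw.exists_chart hj hws y0 (Metric.closedBall_mem_nhds _ (half_pos hr)) one_pos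
  obtain ⟨d, hd⟩ := IsCompact.exists_bound_of_continuousOn hC fun y hy =>
    ((hCd y hy).2.continuousAt_fderiv (by simp)).continuousWithinAt
  obtain ⟨T0, hT0⟩ := eventually_atTop.1 ((hc.and hev).and (eventually_gt_atTop (max R 0)))
  refine ⟨C, c * (1 + |d|) ^ 2, T0, hC, hCn, hCt, by positivity, fun t ht y hy v => ?_⟩
  obtain ⟨⟨h1, h2⟩, htR⟩ := hT0 t ht.le
  obtain ⟨h3, h4, h5, h6⟩ := h2 y hy
  have hR : R < t := (le_max_left _ _).trans_lt htR
  have ht0 : 0 < t := (le_max_right _ _).trans_lt htR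
  set W : ℝ × EZ → EN := fun z => ϕ J (j y0) _ with hW
  have hWinv := (ϕ J (j y0)).left_inv h3
  have hdv : fderiv ℝ (fun z => (z.1, W z)) (t, y) (0, v) = (0, fderiv ℝ W (t, y) (0, v)) := by
    rw [(hasFDerivAt_fst.prodMk h5.diffAt.hasFDerivAt).fderiv]
    simp
  have hend := (ContMDiffAt.comp (t, W (t, y)) ((hΨ.1 _ (mem_halfCylinder ht0 _)).contMDiffAt ((isOpen_halfCylinder 0).mem_nhds (mem_halfCylinder ht0 _))) (contDiff_fst.contMDiff.contMDiffAt.prodMk (ContMDiffAt.comp (t, W (t, y)) (contMDiffAt_extChartAt_symm (j y0) (hCN h4)) contDiff_snd.contMDiff.contMDiffAt))).mdiffAt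
  have hloc : (fun q => β (q.1, (ϕ IZ y0).symm q.2)) =ᶠ[𝓝 (t, y)] fun z => endInChart J Ψ (j y0) (z.1, W z) := by
    have hcw : ContinuousAt (fun z => w (z.1, (ϕ IZ y0).symm z.2)) (t, y) := by
      have e1 : ContinuousAt _ (t, y) := continuousAt_fst.prodMk (ContinuousAt.comp
          ((continuousOn_extChartAt_symm y0).continuousAt
            ((isOpen_extChartAt_target y0).mem_nhds (hCt hy))) continuousAt_snd)
      exact ContinuousAt.comp (hws.continuousOn.continuousAt ((isOpen_halfCylinder R).mem_nhds (mem_halfCylinder hR _))) e1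
    filter_upwards [hcw.preimage_mem_nhds ((isOpen_extChartAt_source (j y0)).mem_nhds h3),
      continuousAt_fst.preimage_mem_nhds (isOpen_Ioi.mem_nhds hR)] with z hz hzR
    rw [hβ (z.1, (ϕ IZ y0).symm z.2) hzR]
    simp only [endInChart, hW]
    rw [(ϕ J (j y0)).left_inv hz]
  have e1 := mfderiv_comp (t, y) hend ((differentiableAt_fst.prodMk h5.diffAt).mdifferentiableAt)
  have e2 := ((hloc.mfderiv_eq.trans e1).app (0, v)).trans (congrArg (fun a => (mfderiv 𝓘(ℝ, ℝ × EN) I _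
      (t, W (t, y)) a : E)) ((mfderiv_eq_fderiv.app (0, v)).trans hdv))
  have e5 := (congrArg (fun a => g _ a a) e2).trans (tensor_congr_point g.toTensor hloc.self_of_nhds (fun _ =>
        (mfderiv 𝓘(ℝ, ℝ × EN) I (endInChart J Ψ (j y0)) (t, W (t, y)) ((0 : ℝ), fderiv ℝ W (t, y) (0, v)) : E)))
  refine (e5.trans_le ((h1 _ h4 _).2)).trans ?_
  rw [mul_assoc]
  refine mul_le_mul_of_nonneg_left ?_ hc0
  rw [← mul_pow]
  refine pow_le_pow_left₀ (norm_nonneg _) ?_ 2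
  have h7 : ‖fderiv ℝ W (t, y) (0, v)‖ ≤ (1 + |d|) * ‖v‖ := by
    have h8 := h6 v
    have h9 := ContinuousLinearMap.le_of_opNorm_le _ ((hd y hy).trans (le_abs_self d)) v
    have h10 := norm_le_norm_add_norm_sub' (fderiv ℝ W (t, y) (0, v))
      (fderiv ℝ (fun y => ϕ J (j y0) (j ((ϕ IZ y0).symm y))) y v)
    linarith
  simpa [Prod.norm_def] using h7

end

section

variable [T2Space M] [CompactSpace N] {g : MetricField I M} {h : MetricField J N} {Ψ : ℝ × N → M} {S : Set M}
  {R : ℝ} {α : ℝ × Z → X} {w : ℝ × Z → N} {j : Z → N} {f ι : X → M} {ε : ℝ} {T Φ : AltField I M 4}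

theorem MetricField.IsRiem.gramAt_pos (hg : g.IsRiem) {k : ℕ} {x : M} {u : Fin k → TangentSpace I x}
    (hu : LinearIndependent ℝ u) : 0 < g.gramAt x u := by
  refine Matrix.PosDef.det_pos (Matrix.PosDef.of_dotProduct_mulVec_pos ?_ fun c hc => ?_)
  · ext i k
    exact hg.symm _ _ _
  · have hs : ∀ v, g x v (∑ i, c i • u i) = ∑ i, c i * g x v (u i) := fun v => by
      classical
      induction (Finset.univ : Finset (Fin k)) using Finset.induction_on with
      | empty => simpa using hg.smul_right x 0 v 0
      | insert a s ha ih => rw [Finset.sum_insert ha, Finset.sum_insert ha, hg.add_right, hg.smul_right, ih]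
    have h1 := hg.pos x _ fun h0 => hc (funext fun i => Fintype.linearIndependent_iff.1 hu c h0 i)
    rw [hs] at h1
    refine h1.trans_eq (Finset.sum_congr rfl fun i _ => ?_)
    simp only [Matrix.mulVec, dotProduct, Matrix.of_apply, star_trivial]
    rw [hg.symm, hs]
    exact congrArg _ (Finset.sum_congr rfl fun k _ => mul_comm _ _)

theorem IsSmoothEmb.linearIndependent (hf : IsSmoothEmb I I' f) {k : ℕ} {x : X}
    {u : Fin k → TangentSpace I' x} (hu : LinearIndependent ℝ u) :
    LinearIndependent ℝ fun i => mfderiv% f x (u i) :=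
  hu.map' (mfderiv% f x).toLinearMap (LinearMap.ker_eq_bot.2 (hf.immersion x))

theorem IsEnd.sigmaCompactSpace [CompactSpace Z] (h : IsEnd I' IZ R α) : SigmaCompactSpace X := by
  have h1 : IsSigmaCompact (Ioi R ×ˢ (univ : Set Z)) := by
    have : Ioi R ×ˢ (univ : Set Z) = ⋃ n : ℕ, Icc (R + 1 / (n + 1)) (R + n) ×ˢ univ := by
      ext ⟨t, y⟩
      simp only [mem_prod, mem_Ioi, mem_univ, and_true, mem_iUnion, mem_Icc]
      constructor
      · intro ht
        obtain ⟨m, hm⟩ := exists_nat_one_div_lt (sub_pos.2 ht)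
        obtain ⟨n, hn⟩ := exists_nat_ge (t - R)
        refine ⟨max m n, ?_, ?_⟩
        · have h2 : 1 / (((max m n : ℕ) : ℝ) + 1) ≤ 1 / (m + 1) := by
            gcongr
            exact le_max_left _ _
          linarith
        · have h2 : (n : ℝ) ≤ ((max m n : ℕ) : ℝ) := by exact_mod_cast le_max_right _ _
          linarith
      · rintro ⟨n, hn, -⟩
        have h2 : 0 < 1 / ((n : ℝ) + 1) := by positivity
        linarith
    rw [this]
    exact isSigmaCompact_iUnion_of_isCompact _ fun n => isCompact_Icc.prod isCompact_univ
  rw [← isSigmaCompact_univ_iff, ← compl_union_self _, union_comm]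
  have h4 := isSigmaCompact_iUnion (fun b => cond b _ _ᶜ)
    (by rintro (_ | _); exacts [(h.compact R le_rfl).isSigmaCompact, h1.image_of_continuousOn h.diffeo.1.continuousOn])
  rwa [← union_eq_iUnion] at h4

theorem IsACylSubmanifold.exists_end (hf : IsACylSubmanifold I' IZ J g Ψ j f) :
    ∃ (R : ℝ) (α : ℝ × Z → X) (w : ℝ × Z → N), 0 ≤ R ∧ IsEnd I' IZ R α ∧ ContMDiffOn (𝓘(ℝ).prod IZ) J ∞ w (Ioi R ×ˢ univ) ∧
      (∀ q : ℝ × Z, R < q.1 → f (α q) = Ψ (q.1, w q)) ∧ ExpConverges J IZ w j := by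
  obtain ⟨R, α, w, h1, h2, h3, h4, h5, h6⟩ := hf.end_param
  exact ⟨R, α, w, h1, ⟨h2, h3⟩, h4, fun q => h5 q.1 q.2, h6⟩

theorem IsLocalDeformation.pull_eq_zero [CompactSpace Z] (hg : g.IsRiem)
    (hT : SmoothOnMaps T.field) (hTc : ClosedOnMaps T.field) (hΦ : SmoothOnMaps Φ.field)
    (hgram : ∀ z u, g.gramAt z u ≤ 24 * ∏ i : Fin 4, g z (u i) (u i))
    (hTg : ∀ z u, T z u ^ 2 ≤ g.gramAt z u)
    (hpos : ∀ z u, Φ z u ^ 2 = g.gramAt z u → 0 ≤ T z u * Φ z u)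
    (hf : IsLocalDeformation I' IZ J g Ψ j ι ε f) (hε : 0 ≤ ε) (hα : IsEnd I' IZ R α) (hR : 0 ≤ R)
    (hαw : ∀ q : ℝ × Z, R < q.1 → ι (α q) = Ψ (q.1, w q))
    (hbd : EndBounded I IZ g (fun q => ι (α q)))
    (hcl : ∃ T0 : ℝ, ∀ T, T0 < T → IsClosed (α '' (Ici T ×ˢ univ)))
    (hZ : Module.finrank ℝ EZ = 3) (hE' : Module.finrank ℝ E' = 4)
    (hι : ∀ x (u : Fin 4 → TangentSpace I' x), T (ι x) (fun i => mfderiv% ι x (u i)) = 0)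
    (hcal : IsCalibratedBy I' g Φ.field f) (x : X) (u : Fin 4 → TangentSpace I' x) :
    T (f x) (fun i => mfderiv% f x (u i)) = 0 := by
  have : T2Space X := hf.acyl.embedding.embedding.t2Space
  have := hα.sigmaCompactSpace
  obtain ⟨F, hF, rfl, rfl, hV, lam, A, hlam, hA, hV'⟩ := hf.family
  refine ACyl.pull_eq_zero hg hT hTc hΦ hF hι (by norm_num) (fun z u => (hTg z u).trans (hgram z u)) hε hV hα hA hlam
    (fun τ hτ q hq => hV' τ hτ _ q.1 (w q) (hR.trans_lt hq) (hαw q hq)) hbd hcl hZ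
    (ContinuousLinearEquiv.ofFinrankEq (by simp [hZ, hE'])) (fun x u hu h0 => ?_) (fun x u => hpos _ _ (hcal x u)) x u
  have h2 := hcal x u
  rw [show Φ.field (F 1 x) (fun i => mfderiv% (F 1) x (u i)) = 0 from h0] at h2
  exact (hg.gramAt_pos (hf.acyl.embedding.linearIndependent hu)).ne ((zero_pow two_ne_zero).symm.trans h2)

theorem IsACylManifold.isClosed_end {g : SmoothMetric I M} {h : SmoothMetric J N}
    (hM : IsACylManifold g h Ψ) [CompactSpace Z] [T2Space X] (hα : IsEnd I' IZ R α) (hR : 0 ≤ R)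
    {p : X → M} (hp : Continuous p) (hpα : ∀ q : ℝ × Z, R < q.1 → p (α q) = Ψ (q.1, w q)) :
    ∃ T0 : ℝ, ∀ T, T0 < T → IsClosed (α '' (Ici T ×ˢ univ)) := by
  obtain ⟨K, -, hΨ⟩ := hM.diffeo
  obtain ⟨T0, hT0, hax⟩ := exists_axisBound g.isRiem h.isRiem hΨ hM.metric
  refine ⟨max R (T0 + 1), fun T hT => hα.isClosed hΨ hR ((le_max_left _ _).trans_lt hT)
    (isClosed_image_end g.isRiem hΨ hT0 hax ((le_max_right _ _).trans_lt hT)) hp hpα⟩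

theorem IsACylManifold.endBounded {g : SmoothMetric I M} {h : SmoothMetric J N}
    (hM : IsACylManifold g h Ψ) [CompactSpace Z] (hj : CMDiff ∞ j)
    (hws : ContMDiffOn (𝓘(ℝ).prod IZ) J ∞ w (Ioi R ×ˢ univ)) (hw : ExpConverges J IZ w j)
    {β : ℝ × Z → M} (hβ : ∀ q : ℝ × Z, R < q.1 → β q = Ψ (q.1, w q)) :
    EndBounded I IZ g.field β := by
  obtain ⟨K, -, hΨ⟩ := hM.diffeo
  exact endBounded_of_expConverges g.isRiem h.isRiem hΨ hM.metric hj hws hw hβ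

end

section

variable {M : Type*} [TopologicalSpace M] [T2Space M] [ChartedSpace (𝔼 8) M]
  [IsManifold (𝓡 8) ∞ M] {N : Type*} [TopologicalSpace N] [CompactSpace N]
  [ChartedSpace (𝔼 7) N] [IsManifold (𝓡 7) ∞ N] {S : CalabiYau4 M}
  {h : SmoothMetric (𝓡 7) N} {Ψ : ℝ × N → M} {X : Type*} [TopologicalSpace X]
  [ChartedSpace (𝔼 4) X] [IsManifold (𝓡 4) ∞ X] {Z : Type*} [TopologicalSpace Z]
  [CompactSpace Z] [ChartedSpace (𝔼 3) Z] [IsManifold (𝓡 3) ∞ Z] {j : Z → N}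
  {ι f : X → M} {ε : ℝ}

theorem CalabiYau4.pull_eq_zero {T : AltField (𝓡 8) M 4} (hM : IsACylManifold S.g h Ψ)
    (hι : IsACylSubmanifold (𝓡 4) (𝓡 3) (𝓡 7) S.g.field Ψ j ι) (hε : 0 ≤ ε)
    (hT : SmoothOnMaps T.field) (hTc : ClosedOnMaps T.field)
    (hTg : ∀ z u, T z u ^ 2 ≤ S.g.field.gramAt z u)
    (hpos : ∀ z u, S.cayley z u ^ 2 = S.g.field.gramAt z u → 0 ≤ T z u * S.cayley z u)
    (hT0 : ∀ x (u : Fin 4 → TangentSpace (𝓡 4) x), T (ι x) (fun i => mfderiv (𝓡 4) (𝓡 8) ι x (u i)) = 0)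
    (hf : IsLocalDeformation (𝓡 4) (𝓡 3) (𝓡 7) S.g.field Ψ j ι ε f) (hc : S.IsCayley (𝓡 4) f)
    (x : X) (u : Fin 4 → TangentSpace (𝓡 4) x) :
    T (f x) (fun i => mfderiv (𝓡 4) (𝓡 8) f x (u i)) = 0 := by
  obtain ⟨R, α, w, hR, hα, hws, hαw, hw⟩ := hι.exists_end
  have : T2Space X := hι.embedding.embedding.t2Space
  exact hf.pull_eq_zero S.g.isRiem hT hTc S.cayley_smooth S.gramAt_le hTg hpos hε hα hR hαw
    (hM.endBounded hι.cross_section.smooth hws hw hαw)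
    (hM.isClosed_end hα hR hι.embedding.smooth.continuous hαw) (by simp) (by simp) hT0 hc x u

theorem CalabiYau4.isCayley_iff_isSpecialLagrangian (hM : IsACylManifold S.g h Ψ)
    (hι : IsACylSubmanifold (𝓡 4) (𝓡 3) (𝓡 7) S.g.field Ψ j ι) (hε : 0 ≤ ε)
    (hs : S.IsSpecialLagrangian (𝓡 4) ι)
    (hf : IsLocalDeformation (𝓡 4) (𝓡 3) (𝓡 7) S.g.field Ψ j ι ε f) :
    S.IsCayley (𝓡 4) f ↔ S.IsSpecialLagrangian (𝓡 4) f := by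
  have hzero : ∀ {z : M} {u : Fin 4 → TangentSpace (𝓡 8) z},
      S.reHvol z u ^ 2 = S.g.field.gramAt z u → S.halfSq z u = 0 := fun {z u} h1 => by
    have h2 := S.comass z u
    rw [← h1, add_sq, sq_abs, sq_abs] at h2
    have h3 := mul_nonneg (abs_nonneg (S.halfSq z u)) (abs_nonneg (S.reHvol z u))
    exact pow_eq_zero_iff two_ne_zero |>.1 (le_antisymm (by linarith) (sq_nonneg _))
  have hadd : ∀ z u, S.cayley z u = -S.halfSq z u + S.reHvol z u := fun z u => rfl
  constructor
  · intro hc x u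
    have h0 := CalabiYau4.pull_eq_zero (T := fun x => -S.halfSq x) hM hι hε
      (fun V _ _ G z0 hG u => (S.halfSq_smooth V G z0 hG u).neg)
      (fun V _ _ G z0 hG v => ?_) (fun z u => ?_) (fun z u h1 => ?_)
      (fun x u => (neg_eq_zero.2 (hzero (hs x u)) :)) hf hc x u
    · have h1 : S.halfSq (f x) _ = 0 := neg_eq_zero.1 h0
      refine Eq.trans (congrArg (· ^ 2) (Eq.symm ((hadd (f x) fun i => mfderiv (𝓡 4) (𝓡 8) f x (u i)).trans ?_))) (hc x u)
      rw [h1, neg_zero, zero_add]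
      rfl
    · have h1 := S.halfSq_closed V G z0 hG v
      rw [← neg_eq_zero, ← Finset.sum_neg_distrib] at h1
      rw [← h1]
      refine Finset.sum_congr rfl fun i _ => ?_
      rw [← smul_neg]
      congr 1
      exact (fderiv_fun_neg).app (v i)
    · have h3 : (-S.halfSq z u) ^ 2 ≤ _ := (S.comass z u).trans' (by
        rw [neg_sq, ← sq_abs]
        gcongr
        linarith [abs_nonneg (S.reHvol z u)])
      exact h3
    · have h2 := S.comass z u
      rw [← h1, hadd] at h2
      have h3 : 0 ≤ -S.halfSq z u * (-S.halfSq z u + S.reHvol z u) := by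
        nlinarith [abs_nonneg (S.halfSq z u * S.reHvol z u), abs_mul (S.halfSq z u) (S.reHvol z u),
          sq_abs (S.halfSq z u), sq_abs (S.reHvol z u), sq_nonneg (S.halfSq z u)]
      exact h3
  · intro hc x u
    refine Eq.trans (congrArg (· ^ 2) ((hadd (f x) fun i => mfderiv (𝓡 4) (𝓡 8) f x (u i)).trans ?_)) (hc x u)
    rw [hzero (hc x u), neg_zero, zero_add]
    rfl

theorem CalabiYau4.isCayley_iff_isComplex (hM : IsACylManifold S.g h Ψ)
    (hι : IsACylSubmanifold (𝓡 4) (𝓡 3) (𝓡 7) S.g.field Ψ j ι) (hε : 0 ≤ ε)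
    (hs : S.IsComplex (𝓡 4) ι)
    (hf : IsLocalDeformation (𝓡 4) (𝓡 3) (𝓡 7) S.g.field Ψ j ι ε f) :
    S.IsCayley (𝓡 4) f ↔ S.IsComplex (𝓡 4) f := by
  have hadd : ∀ z u, S.cayley z u = -S.halfSq z u + S.reHvol z u := fun z u => rfl
  have hzero : ∀ {z : M} {u : Fin 4 → TangentSpace (𝓡 8) z},
      S.halfSq z u ^ 2 = S.g.field.gramAt z u → S.reHvol z u = 0 := fun {z u} h1 => by
    have h2 := S.comass z u
    rw [← h1, add_sq, sq_abs, sq_abs] at h2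
    have h3 := mul_nonneg (abs_nonneg (S.halfSq z u)) (abs_nonneg (S.reHvol z u))
    exact pow_eq_zero_iff two_ne_zero |>.1 (le_antisymm (by linarith) (sq_nonneg _))
  have hcx : ∀ {f : X → M}, IsSmoothEmb (𝓡 8) (𝓡 4) f → S.IsComplex (𝓡 4) f → ∀ x (u : Fin 4 → TangentSpace (𝓡 4) x),
      S.halfSq (f x) _ ^ 2 = S.g.field.gramAt (f x) _ := fun {f} hfe hfc x u => by
    by_cases hu : LinearIndependent ℝ u
    · refine S.halfSq_sq_eq fun i => ?_
      obtain ⟨v, hv⟩ := hfc x (u i)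
      rw [← hv]
      have : FiniteDimensional ℝ (TangentSpace (𝓡 4) x) := inferInstanceAs (FiniteDimensional ℝ (𝔼 4))
      have h1 : v ∈ Submodule.span ℝ (range u) := by
        have h2 := hu.span_eq_top_of_card_eq_finrank' (by
          rw [show Module.finrank ℝ (TangentSpace (𝓡 4) x) = Module.finrank ℝ (𝔼 4) from rfl]
          simp)
        rw [h2]; trivial
      have h3 := Submodule.mem_map_of_mem (f := (mfderiv (𝓡 4) (𝓡 8) f x).toLinearMap) h1
      rw [Submodule.map_span, ← range_comp] at h3
      exact h3
    · have h1 : ¬ LinearIndependent ℝ fun i => mfderiv (𝓡 4) (𝓡 8) f x (u i) := fun h2 =>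
        hu (LinearIndependent.of_comp (mfderiv (𝓡 4) (𝓡 8) f x).toLinearMap h2)
      obtain ⟨L, -, -, hL, -⟩ := S.exists_frame (f x)
      rw [(S.halfSq (f x)).map_linearDependent _ h1, CalabiYau4.gramAt_eq hL, gram_eq_zero_of_not_linearIndependent]
      · simp
      · exact fun h3 => h1 (LinearIndependent.of_comp L.toLinearMap h3)
  constructor
  · intro hc x u
    have h0 := CalabiYau4.pull_eq_zero hM hι hε S.reHvol_smooth S.reHvol_closed (fun z u => (S.comass z u).trans' (by
          rw [← sq_abs]
          gcongr
          linarith [abs_nonneg (S.halfSq z u)])) (fun z u h1 => by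
          have h2 := S.comass z u
          rw [← h1, hadd] at h2
          rw [hadd]
          nlinarith [abs_nonneg (S.halfSq z u * S.reHvol z u), abs_mul (S.halfSq z u) (S.reHvol z u),
            sq_abs (S.halfSq z u), sq_abs (S.reHvol z u), sq_nonneg (S.reHvol z u)])
        (fun x u => hzero (hcx hι.embedding hs x u)) hf hc x
    let b : Module.Basis (Fin 4) ℝ (TangentSpace (𝓡 4) x) := (EuclideanSpace.basisFun (Fin 4) ℝ).toBasis
    have h1 : ∀ i, S.J (f x) (mfderiv (𝓡 4) (𝓡 8) f x (b i)) ∈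
        Submodule.span ℝ (range fun i => mfderiv (𝓡 4) (𝓡 8) f x (b i)) := by
      refine S.J_mem_span (S.g.isRiem.gramAt_pos
        (hf.acyl.embedding.linearIndependent b.linearIndependent)).ne' (Eq.trans ?_ (hc x b))
      have h2 : S.cayleyForm (f x) _ = -_ := (hadd _ _).trans (by rw [h0 b, add_zero])
      rw [h2, neg_sq]
    obtain ⟨L, -, -, -, hJ, -⟩ := S.exists_frame (f x)
    have hJl : ∀ v, S.J (f x) v = L.symm (Complex.I • L v) := fun v => by rw [← hJ, L.symm_apply_apply]
    let Jl : TangentSpace (𝓡 8) (f x) →ₗ[ℝ] TangentSpace (𝓡 8) (f x) := L.symm.toLinearMap ∘ₗ (Complex.I • L.toLinearMap)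
    have h2 : ∀ v ∈ Submodule.span ℝ (range b), Jl (mfderiv (𝓡 4) (𝓡 8) f x v) ∈
        LinearMap.range (mfderiv (𝓡 4) (𝓡 8) f x).toLinearMap := by
      intro v hv
      induction hv using Submodule.span_induction with
      | mem v hv =>
        obtain ⟨i, rfl⟩ := hv
        have h3 := h1 i
        rw [hJl] at h3
        refine (Submodule.span_le.2 ?_) h3
        rintro _ ⟨k, rfl⟩
        exact ⟨b k, rfl⟩
      | zero => rw [map_zero, map_zero]; exact Submodule.zero_mem _
      | add v w _ _ hv hw => rw [map_add, map_add]; exact Submodule.add_mem _ hv hw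
      | smul a v _ hv => rw [map_smul, map_smul]; exact Submodule.smul_mem _ _ hv
    obtain ⟨v, hv⟩ := h2 u (b.mem_span u)
    exact ⟨v, hv.trans (hJl _).symm⟩
  · intro hc x u
    have h1 := hcx hf.acyl.embedding hc x u
    refine Eq.trans (Eq.trans (congrArg (· ^ 2) ((hadd (f x) fun i => mfderiv (𝓡 4) (𝓡 8) f x (u i)).trans ?_)) (neg_sq _)) h1
    rw [hzero h1, add_zero]

end

theorem moduliSpace_congr {E H M EN HN N EX HX X EZ HZ Z : Type*} [NormedAddCommGroup E]
    [NormedSpace ℝ E] [TopologicalSpace H] {I : ModelWithCorners ℝ E H}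
    [TopologicalSpace M] [ChartedSpace H M] [NormedAddCommGroup EN] [NormedSpace ℝ EN]
    [TopologicalSpace HN] {J : ModelWithCorners ℝ EN HN} [TopologicalSpace N] [ChartedSpace HN N]
    [NormedAddCommGroup EX] [NormedSpace ℝ EX] [TopologicalSpace HX]
    {IX : ModelWithCorners ℝ EX HX} [TopologicalSpace X] [ChartedSpace HX X]
    [NormedAddCommGroup EZ] [NormedSpace ℝ EZ] [TopologicalSpace HZ]
    {IZ : ModelWithCorners ℝ EZ HZ} [TopologicalSpace Z] [ChartedSpace HZ Z]
    {g : MetricField I M} {Ψ : ℝ × N → M} {j : Z → N} {ι : X → M} {ε : ℝ} {P Q : (X → M) → Prop}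
    (h : ∀ f, IsLocalDeformation IX IZ J g Ψ j ι ε f → (P f ↔ Q f)) :
    moduliSpace IX IZ J g Ψ j ι ε P = moduliSpace IX IZ J g Ψ j ι ε Q :=
  ext fun _ => exists_congr fun f => and_congr_right fun hf => and_congr_left fun _ => h f hf

/-- The model of the circle. -/
abbrev E1 : Type := 𝔼 1

/-- The model of a 7-manifold. -/
abbrev E7 : Type := 𝔼 7

/-- The model of the product of the circle with a 7-manifold. -/
abbrev E17 : Type := E1 × E7

section

variable {V : Type*} [NormedAddCommGroup V] [NormedSpace ℝ V] {W : Type*} [NormedAddCommGroup W]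
  [NormedSpace ℝ W]

/-- The scalar product of `w` with the covariant derivative of a velocity field `a` in direction
`b`, whose derivative is `c`, in terms of the metric coefficients `G`. -/
def velForm (G : V → V → V → ℝ) (z a b c w : V) : ℝ := G z c w + (1 / 2) * (fderiv ℝ (fun z => G z a w) z b
        + fderiv ℝ (fun z => G z b w) z a - fderiv ℝ (fun z => G z a b) z w)

theorem velForm_prod {G : V × W → V × W → V × W → ℝ} {G1 : V → V → V → ℝ} {G2 : W → W → W → ℝ}
    {z : V × W} (hG : ∀ a b, ∀ᶠ y in 𝓝 z, G y a b = G1 y.1 a.1 b.1 + G2 y.2 a.2 b.2)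
    (h1 : ∀ a b, DifferentiableAt ℝ (fun y => G1 y a b) z.1)
    (h2 : ∀ a b, DifferentiableAt ℝ (fun y => G2 y a b) z.2) (a b c w : V × W) :
    velForm G z a b c w = velForm G1 z.1 a.1 b.1 c.1 w.1 + velForm G2 z.2 a.2 b.2 c.2 w.2 := by
  have key : ∀ a b v, fderiv ℝ (fun y => G y a b) z v = fderiv ℝ _ z.1 v.1 + fderiv ℝ _ z.2 v.2 := fun a b v => by
      rw [((((h1 a.1 b.1).hasFDerivAt.comp z (hasFDerivAt_fst)).add ((h2 a.2 b.2).hasFDerivAt.comp z (hasFDerivAt_snd))).congr_of_eventuallyEq (hG a b)).fderiv]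
      rfl
  simp only [velForm, key, (hG c w).self_of_nhds]
  ring

theorem velForm_zero_right {G : V → V → V → ℝ} (hG : ∀ z a, G z a 0 = 0) (z a b c : V) : velForm G z a b c 0 = 0 := by
  simp [velForm, hG]

theorem velForm_zero_velocity {G : V → V → V → ℝ} (hG : ∀ z a, G z 0 a = 0) (z b w : V) : velForm G z 0 b 0 w = 0 := by
  simp [velForm, hG]

end

section

variable {M : Type*} [TopologicalSpace M] [ChartedSpace (𝔼 7) M] [IsManifold (𝓡 7) ∞ M]
  {S : TorsionFreeG2 M} {ι : X → M} {τ r : ℝ}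

/-- The metric `dθ^2` of the circle. -/
def circleMetric : MetricField (𝓡 1) Circle := fun p u v => dtheta p u * dtheta p v

theorem circleMetric_isRiem : circleMetric.IsRiem where
  add_left x u v w := (congrArg (· * dtheta x w) (map_add (dthetaL x) u v)).trans (add_mul _ _ _)
  smul_left x r u w := (congrArg (· * dtheta x w) (map_smul (dthetaL x) r u)).trans (mul_assoc _ _ _)
  symm _ _ _ := mul_comm _ _
  pos x u hu := mul_self_pos.2 fun h => hu (dtheta_eq_zero x h)
  smooth V _ _ _ _ hG u := (dtheta_smooth hG (u 0)).mul (dtheta_smooth hG (u 1))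

theorem TorsionFreeG2.prodMetric_inChart {P : Circle × M} {z : E17} (hz : z ∈ (ϕ 𝓒(𝓡 7) P).target) (a b : E17) :
    S.prodMetric.inChart P z a b = circleMetric.inChart P.1 z.1 a.1 b.1 + S.g.field.inChart P.2 z.2 a.2 b.2 := by
  have hd := (contMDiffAt_extChartAt_symm P hz).mdiffAt
  have hz' := hz
  rw [extChartAt_prod] at hz'
  have e1 : ∀ v : E17, circlePart _ _ = dtheta _ (mfderiv% (ϕ (𝓡 1) P.1).symm z.1 v.1) := fun v => by
    refine (circlePart_mfderiv hd v).trans (congrArg (dtheta _) ?_)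
    exact ((mfderiv_comp z ((contMDiffAt_extChartAt_symm P.1 hz'.1).mdiffAt) (hasFDerivAt_fst).differentiableAt.mdifferentiableAt).app v).trans (congrArg (mfderiv% (ϕ (𝓡 1) P.1).symm z.1) (congrArg (fun A : E17 →L[ℝ] E1 => A v) (mfderiv_eq_fderiv.trans fderiv_fst)))
  have e2 : ∀ v : E17, basePart _ _ = (mfderiv 𝓘(ℝ, E7) (𝓡 7) (ϕ (𝓡 7) P.2).symm z.2 v.2) := fun v => by
    refine (basePart_mfderiv hd v).trans ?_
    exact ((mfderiv_comp z ((contMDiffAt_extChartAt_symm P.2 hz'.2).mdiffAt) (hasFDerivAt_snd).differentiableAt.mdifferentiableAt).app v).trans (congrArg (mfderiv 𝓘(ℝ, E7) (𝓡 7) (ϕ (𝓡 7) P.2).symm z.2) (congrArg (fun A : E17 →L[ℝ] E7 => A v) (mfderiv_eq_fderiv.trans fderiv_snd)))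
  exact congrArg₂ (· + ·) (congrArg₂ (· * ·) (e1 a) (e1 b)) (congrArg₂ (S.g.field _) (e2 a) (e2 b))

theorem velForm_prodMetric (P : Circle × M) (a b c w : E17) : velForm (S.prodMetric.inChart P) (ϕ 𝓒(𝓡 7) P P) a b c w =
      velForm (circleMetric.inChart P.1) (ϕ (𝓡 1) P.1 P.1) a.1 b.1 c.1 w.1 +
      velForm (S.g.field.inChart P.2) (ϕ (𝓡 7) P.2 P.2) a.2 b.2 c.2 w.2 :=
  velForm_prod (fun a b => by
      filter_upwards [extChartAt_target_mem_nhds P] with y hy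
      exact TorsionFreeG2.prodMetric_inChart hy a b)
    (fun a b => (circleMetric_isRiem.inChart_contDiffAt P.1 a b (mem_extChartAt_target P.1)).diffAt)
    (fun a b => (S.g.isRiem.inChart_contDiffAt P.2 a b (mem_extChartAt_target P.2)).diffAt) a b c w

theorem inChart_zero_right {E : Type} [NormedAddCommGroup E] [NormedSpace ℝ E]
    [FiniteDimensional ℝ E] {H : Type*} [TopologicalSpace H] {I : ModelWithCorners ℝ E H}
    [I.Boundaryless] {N : Type*} [TopologicalSpace N] [ChartedSpace H N] [IsManifold I ∞ N]
    {g : MetricField I N} (hg : g.IsRiem) (p : N) (z a : E) : g.inChart p z a 0 = 0 :=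
  map_zero (hg.chartL p z a)

theorem inChart_zero_left {E : Type} [NormedAddCommGroup E] [NormedSpace ℝ E]
    [FiniteDimensional ℝ E] {H : Type*} [TopologicalSpace H] {I : ModelWithCorners ℝ E H}
    [I.Boundaryless] {N : Type*} [TopologicalSpace N] [ChartedSpace H N] [IsManifold I ∞ N]
    {g : MetricField I N} (hg : g.IsRiem) (p : N) (z a : E) : g.inChart p z 0 a = 0 :=
  (map_zero (hg.chartL p z)).app a

theorem mfderiv_clm_comp {V W : Type*} [NormedAddCommGroup V] [NormedSpace ℝ V]
    [NormedAddCommGroup W] [NormedSpace ℝ W] (L : V →L[ℝ] W) {y : Z} {G : Z → V}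
    (hG : MDiffAt G y) (u : TangentSpace IZ y) :
    (mfderiv% (fun y => L (G y)) y u : W) = L (mfderiv% G y u : V) := ((mfderiv_comp y L.hasFDerivAt.differentiableAt.mdifferentiableAt hG).app u).trans ((mfderiv_eq_fderiv.trans L.fderiv).app _)

theorem mfderiv_comp_apply_eq {c : X → Z} {x : X} {G : Z → V} (hc : MDiffAt c x) (hG : MDiffAt G (c x))
    (u : TangentSpace I' x) : (mfderiv% (fun y => G (c y)) x u : V) = mfderiv% G (c x) (mfderiv% c x u) :=
  (mfderiv_comp x hG hc).app u

theorem mfderiv_snd_comp {V W : Type*} [NormedAddCommGroup V] [NormedSpace ℝ V]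
    [NormedAddCommGroup W] [NormedSpace ℝ W] {c : X → Z} {x : X} {G : Z → V × W}
    (hc : MDifferentiableAt I' IZ c x) (hG : MDifferentiableAt IZ 𝓘(ℝ, V × W) G (c x))
    (u : TangentSpace I' x) : (mfderiv I' 𝓘(ℝ, W) (fun y => (G (c y)).2) x u : W) =
      (mfderiv IZ 𝓘(ℝ, V × W) G (c x) (mfderiv I' IZ c x u) : V × W).2 :=
  (mfderiv_clm_comp (ContinuousLinearMap.snd ℝ V W) (hG.comp x hc) u).trans
    (congrArg Prod.snd (mfderiv_comp_apply_eq hc hG u))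

theorem eventually_hasDerivAt_chart {E : Type} [NormedAddCommGroup E] [NormedSpace ℝ E]
    [FiniteDimensional ℝ E] {H : Type*} [TopologicalSpace H] {I : ModelWithCorners ℝ E H} [I.Boundaryless]
    {N : Type*} [TopologicalSpace N] [ChartedSpace H N] [IsManifold I ∞ N] {F : ℝ → Z → N}
    (hF : CMDiff ∞ (fun z : ℝ × Z => F z.1 z.2)) (τ : ℝ) (y : Z) :
    ∀ᶠ y' in 𝓝 y, DifferentiableAt ℝ (fun σ => ϕ I (F τ y) (F σ y')) τ := by
  filter_upwards [(family_contMDiff_snd hF τ).continuous.continuousAt.eventually_mem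
    (extChartAt_source_mem_nhds (I := I) (F τ y))] with y' hy'
  exact (contDiffAt_chart_comp (family_contMDiff_fst hF y' τ) hy').diffAt

theorem VelocityC1Le.snd_comp {F : ℝ → Z → Circle × M} {κ : Z → Circle × M} {c : X → Z} {x : X}
    (hF : ContMDiff (𝓘(ℝ).prod IZ) 𝓒(𝓡 7) ∞ (fun z : ℝ × Z => F z.1 z.2))
    (hc : ContMDiff I' IZ ∞ c) (hr : 0 ≤ r)
    (hι : ∀ u, S.prodMetric (κ (c x)) (mfderiv IZ 𝓒(𝓡 7) κ (c x) (mfderiv I' IZ c x u))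
      (mfderiv IZ 𝓒(𝓡 7) κ (c x) (mfderiv I' IZ c x u)) ≤ S.g.field (ι x) (mfderiv I' (𝓡 7) ι x u) (mfderiv I' (𝓡 7) ι x u))
    (h : VelocityC1Le IZ S.prodMetric κ F τ (c x) r) :
    VelocityC1Le I' S.g.field ι (fun σ y => (F σ (c y)).2) τ x r := by
  set P := F τ (c x) with hP
  have hcd : MDiffAt c x := hc.mdiffAt
  have hd := eventually_hasDerivAt_chart hF τ (c x)
  have hv : ∀ y, DifferentiableAt ℝ (fun σ => ϕ 𝓒(𝓡 7) P (F σ y)) τ → deriv _ τ =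
        (deriv (fun σ => ϕ 𝓒(𝓡 7) P (F σ y)) τ).2 := fun y hy =>
    (hy.hasDerivAt.hasFDerivAt.snd.hasDerivAt.congr_deriv (by simp)).deriv
  have ha := hv (c x) hd.self_of_nhds
  have hm := TorsionFreeG2.prodMetric_inChart (S := S) (mem_extChartAt_target P)
  refine ⟨?_, fun u w => ?_⟩
  · refine le_trans (le_trans (le_add_of_nonneg_of_le (mul_self_nonneg _) (le_of_eq ?_)) (hm _ _).ge) h.1
    exact congrArg (fun a => S.g.field.inChart P.2 _ a a) ha
  · have hcc : (mfderiv% (fun y => deriv (fun σ => ϕ (𝓡 7) P.2 (F σ (c y)).2) τ) x u : E7) =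
        (mfderiv IZ 𝓘(ℝ, E17) (fun y => deriv (fun σ => ϕ 𝓒(𝓡 7) P (F σ y)) τ) (c x) (mfderiv I' IZ c x u) : E17).2 := by
      have e : (fun y => deriv (fun σ => ϕ (𝓡 7) P.2 (F σ (c y)).2) τ) =ᶠ[𝓝 x] fun y =>
          (deriv (fun σ => ϕ 𝓒(𝓡 7) P (F σ (c y))) τ).2 := by
        filter_upwards [hc.continuous.continuousAt.eventually hd] with y hy using hv _ hy
      exact (e.mfderiv_eq.app u).trans (mfderiv_snd_comp hcd (velocity_mdifferentiableAt hF τ (c x)) u)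
    have h3 := velForm_prodMetric (S := S) P (deriv (fun σ => ϕ 𝓒(𝓡 7) P (F σ (c x))) τ) (mfderiv IZ 𝓘(ℝ, E17)
        (fun y => ϕ 𝓒(𝓡 7) P (F τ y)) (c x) (mfderiv I' IZ c x u))
      (mfderiv IZ 𝓘(ℝ, E17) (fun y => deriv (fun σ => ϕ 𝓒(𝓡 7) P (F σ y)) τ) (c x) (mfderiv I' IZ c x u))
      (0, w)
    rw [velForm_zero_right (inChart_zero_right circleMetric_isRiem P.1), zero_add] at h3
    refine (congrArg abs ((congrFun (congr (congr (congrArg (velForm _ _) ha) (mfderiv_snd_comp hcd ((contMDiffAt_extChartAt.comp (c x) (family_contMDiff_snd hF τ (c x))).mdifferentiableAt (by simp)) u)) hcc) _).trans h3.symm)).trans_le ((h.2 _ _).trans (mul_le_mul (mul_le_mul_of_nonneg_left (Real.sqrt_le_sqrt (hι u)) hr) (Real.sqrt_le_sqrt ?_) (Real.sqrt_nonneg _) (by positivity)))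
    refine (hm _ _).trans_le ?_
    rw [inChart_zero_right circleMetric_isRiem, zero_add]
    exact le_rfl

theorem VelocityC1Le.prodMk {F : ℝ → X → M} {κ : Z → Circle × M} {p : Z → X} {k : Z → Circle} {y : Z}
    (hF : ContMDiff (𝓘(ℝ).prod I') (𝓡 7) ∞ (fun z : ℝ × X => F z.1 z.2))
    (hp : ContMDiff IZ I' ∞ p) (hk : ContMDiff IZ (𝓡 1) ∞ k) (hr : 0 ≤ r)
    (hι : ∀ u, S.g.field (ι (p y)) (mfderiv I' (𝓡 7) ι (p y) (mfderiv IZ I' p y u))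
        (mfderiv I' (𝓡 7) ι (p y) (mfderiv IZ I' p y u)) ≤
      S.prodMetric (κ y) (mfderiv IZ 𝓒(𝓡 7) κ y u) (mfderiv IZ 𝓒(𝓡 7) κ y u))
    (h : VelocityC1Le I' S.g.field ι F τ (p y) r) :
    VelocityC1Le IZ S.prodMetric κ (fun σ y => (k y, F σ (p y))) τ y r := by
  set P : Circle × M := (k y, F τ (p y)) with hP
  have hF' := (hk.comp contMDiff_snd).prodMk (hF.comp (contMDiff_fst.prodMk (hp.comp contMDiff_snd)))
  have hpd : MDiffAt p y := hp.mdiffAt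
  have hd := hp.continuous.continuousAt.eventually (eventually_hasDerivAt_chart hF τ (p y))
  have hv : ∀ y', DifferentiableAt ℝ (fun σ => ϕ (𝓡 7) P.2 (F σ (p y'))) τ →
      (deriv (fun σ => ϕ 𝓒(𝓡 7) P (k y', F σ (p y'))) τ : E17) =
        (0, deriv (fun σ => ϕ (𝓡 7) P.2 (F σ (p y'))) τ) := fun y' hy =>
    ((hasDerivAt_const τ (ϕ (𝓡 1) P.1 (k y'))).prodMk hy.hasDerivAt).deriv
  have hm := TorsionFreeG2.prodMetric_inChart (S := S) (mem_extChartAt_target P)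
  have hvel := velocity_mdifferentiableAt (F := fun σ y => (k y, F σ (p y))) hF' τ y
  refine ⟨?_, fun u w => ?_⟩
  · refine le_trans (le_of_eq ((congrArg (fun a => S.prodMetric.inChart P _ a a) (hv y hd.self_of_nhds)).trans ((hm _ _).trans ?_))) h.1
    rw [inChart_zero_right circleMetric_isRiem, zero_add]
    rfl
  · have hb := (mfderiv_clm_comp (ContinuousLinearMap.snd ℝ E1 E7)
     
      ((contMDiffAt_extChartAt.comp y (family_contMDiff_snd (F := fun σ y => (k y, F σ (p y))) hF' τ y)).mdifferentiableAt
          (by simp)) u).symm.trans (mfderiv_comp_apply_eq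
      hpd
      ((contMDiffAt_extChartAt.comp (p y) (family_contMDiff_snd hF τ (p y))).mdifferentiableAt (by simp)) u)
    have e : (fun y' => deriv (fun σ => ϕ 𝓒(𝓡 7) P (k y', F σ (p y'))) τ) =ᶠ[𝓝 y]
        fun y' => ((0, deriv (fun σ => ϕ (𝓡 7) P.2 (F σ (p y'))) τ) : E17) := by
      filter_upwards [hd] with y' hy using hv _ hy
    have hc1 := (mfderiv_clm_comp (ContinuousLinearMap.fst ℝ E1 E7) hvel u).symm.trans (congrArg (fun A : EZ →L[ℝ] E1 => A u)
        ((e.fun_comp (ContinuousLinearMap.fst ℝ E1 E7)).mfderiv_eq.trans mfderiv_const))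
    have hc2 := ((mfderiv_clm_comp (ContinuousLinearMap.snd ℝ E1 E7) hvel u).symm.trans
      (congrArg (fun A : EZ →L[ℝ] E7 => A u)
        (e.fun_comp (ContinuousLinearMap.snd ℝ E1 E7)).mfderiv_eq)).trans (mfderiv_comp_apply_eq
      hpd
      (velocity_mdifferentiableAt hF τ (p y)) u)
    have h3 := velForm_prodMetric (S := S) P (deriv (fun σ => ϕ 𝓒(𝓡 7) P (k y, F σ (p y))) τ)
      (mfderiv IZ 𝓘(ℝ, E17) (fun y' => ϕ 𝓒(𝓡 7) P (k y', F τ (p y'))) y u)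
      (mfderiv IZ 𝓘(ℝ, E17) (fun y' => deriv (fun σ => ϕ 𝓒(𝓡 7) P (k y', F σ (p y'))) τ) y u) w
    have h4 : velForm (circleMetric.inChart P.1) _ (deriv (fun σ => ϕ 𝓒(𝓡 7) P _) τ : E17).1
        (mfderiv IZ 𝓘(ℝ, E17) (fun y' => ϕ 𝓒(𝓡 7) P (k y', F τ (p y'))) y u : E17).1
        (mfderiv IZ 𝓘(ℝ, E17) (fun y' => deriv (fun σ => ϕ 𝓒(𝓡 7) P (k y', F σ (p y'))) τ) y u : E17).1
        w.1 = 0 :=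
      (congrFun (congr (congrFun (congrArg (velForm (circleMetric.inChart P.1)
        (ϕ (𝓡 1) P.1 P.1)) (congrArg Prod.fst (hv y hd.self_of_nhds))) _) hc1) _).trans
        (velForm_zero_velocity (inChart_zero_left circleMetric_isRiem P.1) _ _ _)
    rw [h4, zero_add] at h3
    have h5 := h3.trans (congrFun (congr (congr (congrArg (velForm (S.g.field.inChart P.2)
      (ϕ (𝓡 7) P.2 P.2)) (congrArg Prod.snd (hv y hd.self_of_nhds))) hb) hc2) _ :
      _ = velForm (S.g.field.inChart P.2) _ (deriv (fun σ => ϕ (𝓡 7) P.2 (F σ (p y))) τ)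
        (mfderiv% (fun x => ϕ (𝓡 7) P.2 (F τ x)) (p y) _)
        (mfderiv% (fun x => deriv (fun σ => ϕ (𝓡 7) P.2 (F σ x)) τ) (p y) _) w.2)
    exact (congrArg abs h5).trans_le ((h.2 _ w.2).trans (mul_le_mul (mul_le_mul_of_nonneg_left (Real.sqrt_le_sqrt (hι u)) hr) (Real.sqrt_le_sqrt (le_trans (le_add_of_nonneg_left (mul_self_nonneg _)) (hm _ _).ge)) (Real.sqrt_nonneg _) (by positivity)))

end

section

variable {V V' F F' : Type*} [NormedAddCommGroup V] [NormedSpace ℝ V] [NormedAddCommGroup V']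
  [NormedSpace ℝ V'] [NormedAddCommGroup F] [NormedSpace ℝ F] [NormedAddCommGroup F'] [NormedSpace ℝ F']

theorem ExpDecayOn.comp {D : ℝ × V → F} {C : Set V} {C' : Set V'} {δ : ℝ} (hD : ExpDecayOn D C δ)
    (hs : ∀ᶠ z in atTop ×ˢ 𝓟 C, ContDiffAt ℝ ∞ D z) (L : F →L[ℝ] F') (p : V' →L[ℝ] V) (b : V)
    (hC : ∀ y ∈ C', p y + b ∈ C) : ExpDecayOn (fun z => L (D (z.1, p z.2 + b))) C' δ := by
  intro k
  have ht : Tendsto (fun z : ℝ × V' => (z.1, p z.2 + b)) (atTop ×ˢ 𝓟 C') (atTop ×ˢ 𝓟 C) :=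
    tendsto_id.prodMap (tendsto_principal_principal.2 hC)
  let P : ℝ × V' →L[ℝ] ℝ × V := (ContinuousLinearMap.id ℝ ℝ).prodMap p
  refine IsBigO.trans (IsBigO.of_bound (‖L‖ * ‖P‖ ^ k) ?_) ((hD k).comp_tendsto ht)
  filter_upwards [ht.eventually hs] with z hz
  have hP : ∀ z, P z + ((0 : ℝ), b) = (z.1, p z.2 + b) := fun z => by ext <;> simp [P]
  have e : (fun z => L (D (z.1, p z.2 + b))) = (L ∘ (fun z => D (z + ((0 : ℝ), b)))) ∘ P := by
    funext z
    simp only [Function.comp, hP]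
  have hz' : ContDiffAt ℝ ∞ (fun z => D (z + ((0 : ℝ), b))) (P z) := by
    rw [← hP] at hz
    exact hz.comp (P z) (contDiffAt_id.add contDiffAt_const)
  obtain ⟨W, hW, hWo⟩ := ContDiffAt.contDiffOn (L.contDiff.contDiffAt.comp _ hz') (m := k)
    (by exact_mod_cast le_top) (by simp)
  obtain ⟨U, hUW, hU, hzU⟩ := mem_nhds_iff.1 hW
  have h2 := P.iteratedFDerivWithin_comp_right (hWo.mono hUW) hU.uniqueDiffOn (hU.preimage P.continuous).uniqueDiffOn
    hzU le_rfl
  rw [iteratedFDerivWithin_of_isOpen k (hU.preimage P.continuous) hzU, iteratedFDerivWithin_of_isOpen k hU hzU] at h2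
  rw [e]
  refine (congrArg norm h2).trans_le ((ContinuousMultilinearMap.norm_compContinuousLinearMap_le _ _).trans ?_)
  rw [Finset.prod_const, Finset.card_univ, Fintype.card_fin]
  have h3 := L.norm_iteratedFDeriv_comp_left hz' (n := k) (by exact_mod_cast le_top)
  rw [iteratedFDeriv_comp_add_right, hP] at h3
  calc _ ≤ (‖L‖ * ‖iteratedFDeriv ℝ k D (z.1, p z.2 + b)‖) * ‖P‖ ^ k := mul_le_mul_of_nonneg_right h3 (by positivity)
    _ = _ := by simp only [Function.comp]; ring

end

section

variable {R : ℝ} {w : ℝ × Z → N} {j : Z → N}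

theorem ExpConverges.of_chart {EN' HN' N' EZ' HZ' Z' : Type*} [NormedAddCommGroup EN']
    [NormedSpace ℝ EN'] [TopologicalSpace HN'] {J' : ModelWithCorners ℝ EN' HN'}
    [TopologicalSpace N'] [ChartedSpace HN' N'] [NormedAddCommGroup EZ'] [NormedSpace ℝ EZ']
    [TopologicalSpace HZ'] {IZ' : ModelWithCorners ℝ EZ' HZ'} [TopologicalSpace Z']
    [ChartedSpace HZ' Z'] {w' : ℝ × Z' → N'} {j' : Z' → N'} (hw : ExpConverges J IZ w j)
    (hj : CMDiff ∞ j) (hws : ContMDiffOn (𝓘(ℝ).prod IZ) J ∞ w (Ioi R ×ˢ univ))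
    (H : ∀ (z' : Z') (q' : N'), ∃ (z : Z) (q : N) (L : EN →L[ℝ] EN') (p : EZ' →L[ℝ] EZ) (b : EZ),
      (∀ y : ℝ × EZ', ϕ J' q' (w' (y.1, (ϕ IZ' z').symm y.2)) - ϕ J' q' (j' ((ϕ IZ' z').symm y.2)) =
        L (ϕ J q (w (y.1, (ϕ IZ z).symm (p y.2 + b))) - ϕ J q (j ((ϕ IZ z).symm (p y.2 + b))))) ∧
      (∀ y ∈ (ϕ IZ' z').target, p y + b ∈ (ϕ IZ z).target ∧ (j' ((ϕ IZ' z').symm y) ∈ (ϕ J' q').source →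
          j ((ϕ IZ z).symm (p y + b)) ∈ (ϕ J q).source ∧
          ∀ t, w (t, (ϕ IZ z).symm (p y + b)) ∈ (ϕ J q).source → w' (t, (ϕ IZ' z').symm y) ∈ (ϕ J' q').source))) :
    ExpConverges J' IZ' w' j' := by
  obtain ⟨δ, hδ, h⟩ := hw
  refine ⟨δ, hδ, fun z' q' C hC hCt hCj => ?_⟩
  obtain ⟨z, q, L, p, b, h1, h2⟩ := H z' q'
  have hCt' : (fun y => p y + b) '' C ⊆ (ϕ IZ z).target := by
    rintro _ ⟨y, hy, rfl⟩
    exact (h2 y (hCt hy)).1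
  have hCj' : ∀ y ∈ (fun y => p y + b) '' C, j ((ϕ IZ z).symm y) ∈ (ϕ J q).source := by
    rintro _ ⟨y, hy, rfl⟩
    exact ((h2 y (hCt hy)).2 (hCj y hy)).1
  obtain ⟨h3, h4⟩ := h z q _ (hC.image (by fun_prop)) hCt' hCj'
  refine ⟨?_, ?_⟩
  · filter_upwards [(tendsto_id.prodMap (tendsto_principal_principal.2 fun y hy => mem_image_of_mem _ hy)).eventually h3, (eventually_principal.2 fun y hy => hy : ∀ᶠ y in 𝓟 C, y ∈ C).prod_inr atTop]
      with y hy hyC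
    exact ((h2 y.2 (hCt hyC)).2 (hCj y.2 hyC)).2 y.1 hy
  · rw [funext h1]
    refine h4.comp ?_ L p b fun y hy => mem_image_of_mem _ hy
    filter_upwards [h3, (eventually_principal.2 fun y hy => hy : ∀ᶠ y in 𝓟 _, y ∈ (fun y => p y + b) '' C).prod_inr atTop,
      (eventually_gt_atTop R).prod_inl _] with y hy hyC hyR
    have hs := contMDiffAt_extChartAt_symm z (hCt' hyC)
    have h6 := ContMDiffAt.comp y (hws.contMDiffAt ((isOpen_halfCylinder R).mem_nhds (mem_halfCylinder hyR _)))
        (ContMDiffAt.prodMk contDiff_fst.contMDiff.contMDiffAt (ContMDiffAt.comp y hs contDiff_snd.contMDiff.contMDiffAt))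
    exact (contDiffAt_chart_comp h6 hy).sub ((contDiffAt_chart_comp ((hj _).comp y.2 hs) (hCj' _ hyC)).comp y contDiffAt_snd)

theorem ExpConverges.eventually_mem_nhds [CompactSpace N] (hw : ExpConverges J IZ w j)
    (hj : CMDiff ∞ j) (hws : ContMDiffOn (𝓘(ℝ).prod IZ) J ∞ w (Ioi R ×ˢ univ))
    {U : Set N} (y0 : Z) (hU : U ∈ 𝓝 (j y0)) : ∃ V ∈ 𝓝 y0, ∀ᶠ t : ℝ in atTop, ∀ y ∈ V, w (t, y) ∈ U := by
  have hO : (ϕ J (j y0)).target ∩ (ϕ J (j y0)).symm ⁻¹' U ∈ 𝓝 (ϕ J (j y0) (j y0)) := by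
    refine inter_mem (extChartAt_target_mem_nhds (j y0)) ((continuousAt_extChartAt_symm (j y0)).preimage_mem_nhds ?_)
    rwa [extChartAt_to_inv]
  obtain ⟨C, -, -, hCn, hCt, -, h1⟩ := hw.exists_chart hj hws y0 hO one_pos
  refine ⟨(ϕ IZ y0).source ∩ ϕ IZ y0 ⁻¹' C, inter_mem (extChartAt_source_mem_nhds y0)
    ((continuousAt_extChartAt y0).preimage_mem_nhds hCn), ?_⟩
  filter_upwards [h1] with t ht y hy
  obtain ⟨h2, h3, -⟩ := ht _ hy.2
  rw [(ϕ IZ y0).left_inv hy.1] at h2 h3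
  have h4 : (ϕ J (j y0)).symm _ ∈ U := h3.2
  rwa [(ϕ J (j y0)).left_inv h2] at h4

theorem eventually_forall_of_local [CompactSpace Z] {P : ℝ → Z → Prop}
    (h : ∀ y0 : Z, ∃ V ∈ 𝓝 y0, ∀ᶠ t : ℝ in atTop, ∀ y ∈ V, P t y) : ∀ᶠ t : ℝ in atTop, ∀ y, P t y := by
  choose V hV hVw using h
  obtain ⟨s, hs⟩ := CompactSpace.elim_nhds_subcover V hV
  filter_upwards [s.eventually_all.2 fun y0 _ => hVw y0] with t ht y
  have hy : y ∈ ⋃ x ∈ s, V x := hs ▸ mem_univ y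
  obtain ⟨y0, hy0, hy1⟩ := mem_iUnion₂.1 hy
  exact ht y0 hy0 y hy1

theorem ExpConverges.eventually_mem [CompactSpace N] [CompactSpace Z] (hw : ExpConverges J IZ w j)
    (hj : CMDiff ∞ j) (hws : ContMDiffOn (𝓘(ℝ).prod IZ) J ∞ w (Ioi R ×ˢ univ))
    {U : Set N} (hU : IsOpen U) (hjU : ∀ y, j y ∈ U) : ∀ᶠ t : ℝ in atTop, ∀ y, w (t, y) ∈ U :=
  eventually_forall_of_local fun y0 => hw.eventually_mem_nhds hj hws y0 (hU.mem_nhds (hjU y0))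

end

section

variable {f : X → M}

theorem isSmoothEmb_oneMk_iff : IsSmoothEmb 𝓒(I) I' (fun x => ((1 : Circle), f x)) ↔ IsSmoothEmb I I' f := by
  have hd : CMDiff ∞ f → ∀ x, mfderiv I' 𝓒(I) (fun x => ((1 : Circle), f x)) x = (0 : E' →L[ℝ] E1).prod _ := fun hs x =>
    (mfderiv_prodMk mdifferentiableAt_const hs.mdiffAt).trans (congrArg (fun A : E' →L[ℝ] E1 => A.prod _) mfderiv_const)
  constructor
  · intro h
    have hs := contMDiff_snd.comp h.smooth
    exact ⟨hs, fun x u v huv => h.immersion x (((hd hs x).app u).trans ((congrArg (Prod.mk 0) huv).trans ((hd hs x).app v).symm)), .of_comp hs.continuous (by fun_prop) h.embedding⟩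
  · refine fun h => ⟨contMDiff_const.prodMk h.smooth, fun x u v huv => h.immersion x ?_,
      (isEmbedding_prodMkRight 1).comp h.embedding⟩
    have := (((hd h.smooth x).app u).symm.trans huv).trans ((hd h.smooth x).app v)
    exact congrArg Prod.snd this

theorem IsCompleteAlong.congr {EM HM M' : Type*} [NormedAddCommGroup EM] [NormedSpace ℝ EM]
    [TopologicalSpace HM] {I2 : ModelWithCorners ℝ EM HM} [TopologicalSpace M'] [ChartedSpace HM M']
    {f' : X → M'} {g : MetricField I M} {g' : MetricField I2 M'} (h : IsCompleteAlong I' g f)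
    (hg : ∀ x u, g (f x) (mfderiv I' I f x u) (mfderiv I' I f x u) =
      g' (f' x) (mfderiv I' I2 f' x u) (mfderiv I' I2 f' x u)) : IsCompleteAlong I' g' f' := by
  refine fun u hu => h u fun ε hε => ?_
  obtain ⟨n0, hn0⟩ := hu ε hε
  refine ⟨n0, fun m n hm hn => ?_⟩
  obtain ⟨γ, h1, h2, h3, h4⟩ := hn0 m n hm hn
  refine ⟨γ, h1, h2, h3, ?_⟩
  simp only [hg]
  exact h4

theorem isLocallyConstant_of_mfderiv_eq_zero [I'.Boundaryless] [IsManifold I' ∞ X] {c : X → E}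
    (hc : ContMDiff I' 𝓘(ℝ, E) ∞ c) (h : ∀ x u, (mfderiv I' 𝓘(ℝ, E) c x u : E) = 0) :
    IsLocallyConstant c := by
  refine (IsLocallyConstant.iff_eventually_eq c).2 fun x => ?_
  obtain ⟨r, hr, hrt⟩ := Metric.isOpen_iff.1 (isOpen_extChartAt_target (I := I') x) _ (mem_extChartAt_target x)
  have hs : ∀ z ∈ Metric.ball (ϕ I' x x) r, HasFDerivAt (fun z => c ((ϕ I' x).symm z)) (0 : E' →L[ℝ] E) z := fun z hz => by
    have h1 := ((contMDiffOn_extChartAt_symm x).contMDiffAt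
      ((isOpen_extChartAt_target x).mem_nhds (hrt hz))).mdifferentiableAt (n := ∞) (by simp)
    have h2 := hc.mdiffAt (x := (ϕ I' x).symm z)
    have h3 := (h2.comp z h1).differentiableAt.hasFDerivAt
    rw [← mfderiv_eq_fderiv] at h3
    have h4 : mfderiv 𝓘(ℝ, E') 𝓘(ℝ, E) (c ∘ (ϕ I' x).symm) z = (0 : E' →L[ℝ] E) :=
      (mfderiv_comp z h2 h1).trans (ContinuousLinearMap.ext fun v => h _ _)
    rw [h4] at h3
    exact h3
  filter_upwards [(continuousAt_extChartAt (I := I') x).preimage_mem_nhds (Metric.ball_mem_nhds _ hr),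
    extChartAt_source_mem_nhds (I := I') x] with y hy hys
  have h5 := Metric.isOpen_ball.is_const_of_fderiv_eq_zero (convex_ball _ _).isPreconnected
    (fun z hz => (hs z hz).differentiableAt.differentiableWithinAt) (fun z hz => (hs z hz).fderiv)
    hy (Metric.mem_ball_self hr)
  simp only [(ϕ I' x).left_inv hys, extChartAt_to_inv] at h5
  exact h5

end

section

variable {M : Type*} [TopologicalSpace M] [ChartedSpace (𝔼 7) M] [IsManifold (𝓡 7) ∞ M]
  {S : TorsionFreeG2 M} {N : Type*} [TopologicalSpace N] [ChartedSpace (𝔼 6) N]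
  [IsManifold (𝓡 6) ∞ N] {Ψ : ℝ × N → M} {j : Z → N} {ι f : X → M} {ε : ℝ} {F : X → Circle × M} {x : X}

theorem TorsionFreeG2.prodMetric_mfderiv (hF : MDifferentiableAt I' 𝓒(𝓡 7) F x) (u v : TangentSpace I' x) :
    S.prodMetric (F x) (mfderiv I' 𝓒(𝓡 7) F x u) (mfderiv I' 𝓒(𝓡 7) F x v) =
      circleMetric (F x).1 (mfderiv I' (𝓡 1) (fun x => (F x).1) x u) (mfderiv I' (𝓡 1) (fun x => (F x).1) x v) +
      S.g.field (F x).2 (mfderiv I' (𝓡 7) (fun x => (F x).2) x u) (mfderiv I' (𝓡 7) (fun x => (F x).2) x v) :=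
  congrArg₂ (· + ·) (congrArg₂ (· * ·) (circlePart_mfderiv hF u) (circlePart_mfderiv hF v))
    (congrArg₂ (S.g.field (F x).2) (basePart_mfderiv hF u) (basePart_mfderiv hF v))

theorem circleMetric_mfderiv_const (p : Circle) (u v : TangentSpace I' x) :
    circleMetric p (mfderiv I' (𝓡 1) (fun _ => p) x u) (mfderiv I' (𝓡 1) (fun _ => p) x v) = 0 := by
  refine (congrArg (· * _) ((congrArg (dtheta p) (mfderiv_const.app u)).trans (map_zero (dthetaL p)))).trans (zero_mul _)

theorem TorsionFreeG2.prodMetric_oneMk (hf : MDifferentiableAt I' (𝓡 7) f x) (u v : TangentSpace I' x) :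
    S.prodMetric ((1 : Circle), f x) (mfderiv I' 𝓒(𝓡 7) (fun x => ((1 : Circle), f x)) x u)
      (mfderiv I' 𝓒(𝓡 7) (fun x => ((1 : Circle), f x)) x v) =
    S.g.field (f x) (mfderiv I' (𝓡 7) f x u) (mfderiv I' (𝓡 7) f x v) :=
  (TorsionFreeG2.prodMetric_mfderiv (mdifferentiableAt_const.prodMk hf) u v).trans
    ((congrArg (· + _) (circleMetric_mfderiv_const 1 u v)).trans (zero_add _))

theorem isACylSubmanifold_oneMk_iff : IsACylSubmanifold I' IZ 𝓒(𝓡 6) S.prodMetric (prodEnd Ψ) (fun y => ((1 : Circle), j y))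
      (fun x => ((1 : Circle), f x)) ↔ IsACylSubmanifold I' IZ (𝓡 6) S.g.field Ψ j f := by
  constructor
  · intro h
    have he := isSmoothEmb_oneMk_iff.1 h.embedding
    refine ⟨he, isSmoothEmb_oneMk_iff.1 h.cross_section, h.complete.congr fun x u =>
      TorsionFreeG2.prodMetric_oneMk he.smooth.mdiffAt u u, ?_⟩
    obtain ⟨R, α, w, hR, h1, h2, h3, h4, h5⟩ := h.end_param
    refine ⟨R, α, fun q => (w q).2, hR, h1, h2, contMDiff_snd.comp_contMDiffOn h3,
      fun t y ht => congrArg Prod.snd (h4 t y ht), h5.of_chart h.cross_section.smooth h3 fun z q => ⟨z, (1, q), ContinuousLinearMap.snd ℝ E1 _, ContinuousLinearMap.id ℝ EZ, 0, fun y => ?_, fun y hy => ?_⟩⟩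
    · simp only [ContinuousLinearMap.id_apply, add_zero]
      rfl
    · simp only [ContinuousLinearMap.id_apply, add_zero, extChartAt_prod]
      exact ⟨hy, fun h => ⟨⟨mem_extChartAt_source 1, h⟩, fun t h => h.2⟩⟩
  · refine fun h => ⟨isSmoothEmb_oneMk_iff.2 h.embedding, isSmoothEmb_oneMk_iff.2 h.cross_section,
      h.complete.congr fun x u => (TorsionFreeG2.prodMetric_oneMk h.embedding.smooth.mdiffAt u u).symm, ?_⟩
    obtain ⟨R, α, w, hR, h1, h2, h3, h4, h5⟩ := h.end_param
    refine ⟨R, α, fun q => (1, w q), hR, h1, h2, contMDiffOn_const.prodMk h3,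
      fun t y ht => Prod.ext rfl (h4 t y ht), h5.of_chart h.cross_section.smooth h3 fun z q => ⟨z, q.2, ContinuousLinearMap.inr ℝ E1 _, ContinuousLinearMap.id ℝ EZ, 0, fun y => ?_, fun y hy => ?_⟩⟩
    · simp only [ContinuousLinearMap.id_apply, add_zero]
      exact Prod.ext (sub_self _) rfl
    · simp only [ContinuousLinearMap.id_apply, add_zero, extChartAt_prod]
      exact ⟨hy, fun h => ⟨h.2, fun t h' => ⟨h.1, h'⟩⟩⟩

theorem isLocalDeformation_oneMk_iff (hι : ContMDiff I' (𝓡 7) ∞ ι) (hε : 0 ≤ ε) :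
    IsLocalDeformation I' IZ 𝓒(𝓡 6) S.prodMetric (prodEnd Ψ) (fun y => ((1 : Circle), j y))
      (fun x => ((1 : Circle), ι x)) ε (fun x => ((1 : Circle), f x)) ↔
      IsLocalDeformation I' IZ (𝓡 6) S.g.field Ψ j ι ε f := by
  have hid : ∀ (x : X) (u : TangentSpace I' x), (mfderiv I' I' (fun x => x) x u : E') = u := fun x u => mfderiv_id.app u
  have hm := fun x u => TorsionFreeG2.prodMetric_oneMk (S := S) (hι.mdiffAt (x := x)) u u
  constructor
  · rintro ⟨hc, F, hF, h0, h1, hV, lam, A, hlam, hA, hV'⟩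
    refine ⟨isACylSubmanifold_oneMk_iff.1 hc, fun τ x => (F τ x).2, contMDiff_snd.comp hF,
      funext fun x => congrArg Prod.snd (congrFun h0 x), funext fun x => congrArg Prod.snd (congrFun h1 x),
      fun τ hτ x => (hV τ hτ x).snd_comp hF contMDiff_id hε ?_, lam, A, hlam, hA,
      fun τ hτ x t y ht hx => (hV' τ hτ x t (1, y) ht (Prod.ext rfl hx)).snd_comp hF contMDiff_id (by positivity) ?_⟩
    all_goals
      intro u
      exact le_trans (le_of_eq (congrArg (fun u => S.prodMetric (1, ι x) (mfderiv I' 𝓒(𝓡 7) _ x u) (mfderiv I' 𝓒(𝓡 7) _ x u)) (hid x u))) (hm x u).le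
  · rintro ⟨hc, F, hF, rfl, rfl, hV, lam, A, hlam, hA, hV'⟩
    refine ⟨isACylSubmanifold_oneMk_iff.2 hc, fun τ x => (1, F τ x), contMDiff_const.prodMk hF, rfl, rfl,
      fun τ hτ x => (hV τ hτ x).prodMk hF contMDiff_id contMDiff_const hε ?_, lam, A, hlam, hA,
      fun τ hτ x t y ht hx => (hV' τ hτ x t y.2 ht (congrArg Prod.snd hx)).prodMk hF contMDiff_id
        contMDiff_const (by positivity) ?_⟩
    all_goals
      intro u
      exact le_trans (le_of_eq (congrArg (fun u => S.g.field (F 0 x) _ (mfderiv I' (𝓡 7) (F 0) x u)) (hid x u))) (hm x u).ge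

theorem isCayley_oneMk_iff (hf : ContMDiff I' (𝓡 7) ∞ f) :
    S.IsCayley I' (fun x => ((1 : Circle), f x)) ↔ S.IsCoassociative I' f := by
  refine forall_congr' fun x => forall_congr' fun u => ?_
  have hd : MDifferentiableAt I' 𝓒(𝓡 7) (fun x => ((1 : Circle), f x)) x := mdifferentiableAt_const.prodMk hf.mdiffAt
  have h1 : S.cayleyForm _ (fun i => mfderiv I' 𝓒(𝓡 7) (fun x => ((1 : Circle), f x)) x (u i)) =
      S.ψ.field (f x) (fun i => mfderiv I' (𝓡 7) f x (u i)) := by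
    refine (congrArg₂ (· + ·) (Finset.sum_eq_zero fun i _ => ?_)
      (congrArg (S.ψ (f x)) (funext fun i => basePart_mfderiv hd (u i)))).trans (zero_add _)
    rw [(circlePart_mfderiv hd (u i)).trans (mul_self_eq_zero.1 (circleMetric_mfderiv_const 1 (u i) (u i)))]
    simp
  exact iff_of_eq (congrArg₂ (fun a b : ℝ => a ^ 2 = b) h1 (congrArg Matrix.det (Matrix.ext fun i k => TorsionFreeG2.prodMetric_oneMk hf.mdiffAt (u i) (u k))))

end

section

variable {M : Type*} [TopologicalSpace M] [T2Space M] [ChartedSpace (𝔼 7) M]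
  [IsManifold (𝓡 7) ∞ M] {S : TorsionFreeG2 M} {N : Type*} [TopologicalSpace N] [CompactSpace N]
  [ChartedSpace (𝔼 6) N] [IsManifold (𝓡 6) ∞ N] {h : SmoothMetric (𝓡 6) N} {X : Type*}
  [TopologicalSpace X] [ChartedSpace (𝔼 4) X] [IsManifold (𝓡 4) ∞ X] {Z : Type*}
  [TopologicalSpace Z] [CompactSpace Z] [ChartedSpace (𝔼 3) Z] [IsManifold (𝓡 3) ∞ Z]
  {Ψ : ℝ × N → M} {j : Z → N} {ι : X → M} {ε : ℝ} {f : X → Circle × M}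

theorem fst_eq_one (hf : IsACylSubmanifold (𝓡 4) (𝓡 3) 𝓒(𝓡 6) S.prodMetric (prodEnd Ψ)
      (fun y => ((1 : Circle), j y)) f) (hX : ∀ x : X, ¬ IsCompact (connectedComponent x))
    (hc : ∀ x u, circlePart (f x) (mfderiv (𝓡 4) 𝓒(𝓡 7) f x u) = 0) (x : X) : (f x).1 = 1 := by
  have hs := contMDiff_fst.comp hf.embedding.smooth
  have hl : IsLocallyConstant fun x => ((f x).1 : ℂ) :=
    isLocallyConstant_of_mfderiv_eq_zero (contMDiff_circle_coe.comp hs) fun x u => by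
      exact (coe_circle_mfderiv hs.mdiffAt u).trans
        ((congrArg (fun r : ℝ => (r : ℂ) * Complex.I * ((f x).1 : ℂ)) ((circlePart_mfderiv hf.embedding.smooth.mdiffAt u).symm.trans (hc x u))).trans (by simp : ((0 : ℝ) : ℂ) * Complex.I * ((f x).1 : ℂ) = 0))
  obtain ⟨R, α, w, hR, hα, hws, hαw, hw⟩ := hf.exists_end
  by_contra hne
  obtain ⟨T, hT⟩ := ((hw.eventually_mem hf.cross_section.smooth hws (isOpen_compl_singleton.preimage continuous_fst) fun y h1 => hne h1.symm).and
    (eventually_ge_atTop R)).exists_forall_of_atTop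
  have hRT := (hT T le_rfl).2
  refine hX x ((hα.compact T hRT).of_isClosed_subset isClosed_connectedComponent ?_)
  rintro y hy ⟨⟨t, z⟩, ⟨ht, -⟩, rfl⟩
  have ht' : T < t := ht
  have h1 := hl.apply_eq_of_isPreconnected isPreconnected_connectedComponent hy mem_connectedComponent
  rw [hαw (t, z) (hRT.trans_lt ht')] at h1
  exact (hT t ht'.le).1 z (Circle.ext h1)

theorem TorsionFreeG2.endBounded_oneMk {β : ℝ × Z → M} {R : ℝ} (hβ : ContMDiffOn (𝓘(ℝ).prod (𝓡 3)) (𝓡 7) ∞ β (Ioi R ×ˢ univ))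
    (h : EndBounded (𝓡 7) (𝓡 3) S.g.field β) :
    EndBounded 𝓒(𝓡 7) (𝓡 3) S.prodMetric (fun q => ((1 : Circle), β q)) := by
  intro y0
  obtain ⟨C, c0, T0, hC, hCn, hCt, hc0, hb⟩ := h y0
  refine ⟨C, c0, max T0 R, hC, hCn, hCt, hc0, fun t ht y hy v => ?_⟩
  have h2 := ContMDiffAt.comp (t, y) (hβ.contMDiffAt ((isOpen_halfCylinder R).mem_nhds (mem_halfCylinder ((le_max_right _ _).trans_lt ht) ((ϕ (𝓡 3) y0).symm y)))) (ContMDiffAt.prodMk contDiff_fst.contMDiff.contMDiffAt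
      (ContMDiffAt.comp (t, y) (contMDiffAt_extChartAt_symm y0 (hCt hy)) contDiff_snd.contMDiff.contMDiffAt))
  exact (TorsionFreeG2.prodMetric_oneMk h2.mdiffAt _ _).trans_le (hb t ((le_max_left _ _).trans_lt ht) y hy v)

theorem fst_eq_one_of_isCayley (hM : IsACylManifold S.g h Ψ)
    (hι : IsACylSubmanifold (𝓡 4) (𝓡 3) (𝓡 6) S.g.field Ψ j ι) (hε : 0 ≤ ε)
    (hX : ∀ x : X, ¬ IsCompact (connectedComponent x))
    (hf : IsLocalDeformation (𝓡 4) (𝓡 3) 𝓒(𝓡 6) S.prodMetric (prodEnd Ψ)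
      (fun y => ((1 : Circle), j y)) (fun x => ((1 : Circle), ι x)) ε f)
    (hcf : S.IsCayley (𝓡 4) f) (x : X) : (f x).1 = 1 := by
  refine fst_eq_one hf.acyl hX (fun x u => ?_) x
  obtain ⟨R, α, w, hR, hα, hws, hαw, hw⟩ := hι.exists_end
  have : T2Space X := hι.embedding.embedding.t2Space
  have hadd : ∀ z u, S.cayley z u = S.thetaPhi z u + S.psiP z u := fun z u => rfl
  have h0 := hf.pull_eq_zero S.prodMetric_isRiem S.thetaPhi_smooth S.thetaPhi_closed S.cayley_smooth S.gramAt_le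
      (fun z u => (le_add_of_nonneg_right (sq_nonneg _)).trans (S.comass z u))
      (fun z u h1 => by
        have h2 := S.comass z u
        rw [← h1, hadd] at h2
        rw [hadd]
        nlinarith [sq_nonneg (S.thetaPhi z u)]) hε hα hR
      (w := fun q => (1, w q)) (fun q hq => Prod.ext rfl (hαw q hq))
      (TorsionFreeG2.endBounded_oneMk (hι.embedding.smooth.comp_contMDiffOn hα.diffeo.1)
        (hM.endBounded hι.cross_section.smooth hws hw hαw))
      (hM.isClosed_end hα hR hι.embedding.smooth.continuous hαw) (by simp) (by simp)
      (fun x u => (S.thetaPhi_apply _ _).trans (Finset.sum_eq_zero fun i _ => by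
        rw [(circlePart_mfderiv ((isACylSubmanifold_oneMk_iff.2 hι).embedding.smooth.mdiffAt) (u i)).trans (mul_self_eq_zero.1 (circleMetric_mfderiv_const 1 (u i) (u i)))]
        simp)) (S.cayleyForm_eq ▸ hcf) x
  let b : Module.Basis (Fin 4) ℝ _ := (EuclideanSpace.basisFun (Fin 4) ℝ).toBasis
  have h1 := TorsionFreeG2.circlePart_eq_zero (S := S) (S.prodMetric_isRiem.gramAt_pos
    (hf.acyl.embedding.linearIndependent b.linearIndependent)).ne' (by
      refine Eq.trans (congrArg (· ^ 2) (Eq.symm ?_)) (hcf x b)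
      rw [TorsionFreeG2.cayleyForm_eq]
      exact (hadd _ _).trans (by rw [h0 b, zero_add]))
  have h2 : (circlePartL (f x)) ∘ₗ (mfderiv (𝓡 4) 𝓒(𝓡 7) f x).toLinearMap = 0 := b.ext fun i => h1 i
  exact LinearMap.congr_fun h2 u

theorem coassociative_deformations (hM : IsACylManifold S.g h Ψ)
    (hι : IsACylSubmanifold (𝓡 4) (𝓡 3) (𝓡 6) S.g.field Ψ j ι) (hε : 0 ≤ ε)
    (hX : ∀ x : X, ¬ IsCompact (connectedComponent x)) :
    (∀ f : X → Circle × M, IsLocalDeformation (𝓡 4) (𝓡 3) 𝓒(𝓡 6) S.prodMetric (prodEnd Ψ)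
        (fun y => ((1 : Circle), j y)) (fun x => ((1 : Circle), ι x)) ε f → S.IsCayley (𝓡 4) f →
      ∃ f' : X → M, IsACylSubmanifold (𝓡 4) (𝓡 3) (𝓡 6) S.g.field Ψ j f' ∧
        S.IsCoassociative (𝓡 4) f' ∧ range f = {(1 : Circle)} ×ˢ range f') ∧
    moduliSpace (𝓡 4) (𝓡 3) 𝓒(𝓡 6) S.prodMetric (prodEnd Ψ)
        (fun y => ((1 : Circle), j y)) (fun x => ((1 : Circle), ι x)) ε (S.IsCayley (𝓡 4)) =
      (fun Y => {(1 : Circle)} ×ˢ Y) '' moduliSpace (𝓡 4) (𝓡 3) (𝓡 6) S.g.field Ψ j ι ε (S.IsCoassociative (𝓡 4)) := by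
  have key : ∀ f, IsLocalDeformation (𝓡 4) (𝓡 3) 𝓒(𝓡 6) S.prodMetric (prodEnd Ψ)
        (fun y => (1, j y)) _ ε f → S.IsCayley (𝓡 4) f →
      ∃ f', IsLocalDeformation (𝓡 4) (𝓡 3) (𝓡 6) S.g.field Ψ j ι ε f' ∧
        S.IsCoassociative (𝓡 4) f' ∧ f = fun x => (1, f' x) := fun f hf hcf => by
    have e : f = fun x => (1, (f x).2) :=
      funext fun x => Prod.ext (fst_eq_one_of_isCayley hM hι hε hX hf hcf x) rfl
    rw [e] at hf hcf
    exact ⟨_, (isLocalDeformation_oneMk_iff hι.embedding.smooth hε).1 hf, (isCayley_oneMk_iff (contMDiff_snd.comp hf.acyl.embedding.smooth)).1 hcf, e⟩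
  have hr : ∀ f' : X → M, range (fun x => ((1 : Circle), f' x)) = {1} ×ˢ range f' := fun f' => by
    rw [singleton_prod, ← range_comp]
    rfl
  refine ⟨fun f hf hcf => ?_, ext fun Y => ⟨?_, ?_⟩⟩
  · obtain ⟨f', h1, h2, rfl⟩ := key f hf hcf
    exact ⟨f', h1.acyl, h2, hr f'⟩
  · rintro ⟨f, hf, hcf, rfl⟩
    obtain ⟨f', h1, h2, rfl⟩ := key f hf hcf
    exact ⟨_, ⟨f', h1, h2, rfl⟩, (hr f').symm⟩
  · rintro ⟨_, ⟨f', h1, h2, rfl⟩, rfl⟩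
    exact ⟨_, (isLocalDeformation_oneMk_iff hι.embedding.smooth hε).2 h1,
      (isCayley_oneMk_iff h1.acyl.embedding.smooth).2 h2, (hr f').symm⟩

end

/-- The model of the product of the circle with a 3-manifold. -/
abbrev E13 : Type := E1 × 𝔼 3

section

theorem MetricField.IsRiem.sq_eq_gramAt_of_basis {g : MetricField I M} (hg : g.IsRiem) {k : ℕ} {z : M}
    (T : TangentSpace I z [⋀^Fin k]→ₗ[ℝ] ℝ) {V : Type*} [AddCommGroup V] [Module ℝ V]
    (L : V →ₗ[ℝ] TangentSpace I z) (b : Module.Basis (Fin k) ℝ V)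
    (h : T (fun i => L (b i)) ^ 2 = g.gramAt z (fun i => L (b i))) (u : Fin k → V) :
    T (fun i => L (u i)) ^ 2 = g.gramAt z (fun i => L (u i)) := by
  have h1 : T _ = T _ * b.det u := ((T.compLinearMap L).eq_smul_basis_det b).app u
  let B : V →ₗ[ℝ] V →ₗ[ℝ] ℝ := LinearMap.mk₂ ℝ (fun u v => g z (L u) (L v))
    (fun u v w => by simp only [map_add, hg.add_left]) (fun c u v => by simp only [map_smul, hg.smul_left, smul_eq_mul])
    (fun u v w => by simp only [map_add, hg.add_right]) (fun c u v => by simp only [map_smul, hg.smul_right, smul_eq_mul])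
  have h2 : (Matrix.of fun i j => g z (L (u i)) (L (u j))) =
      (b.toMatrix u).transpose * (Matrix.of fun i j => g z (L (b i)) (L (b j))) * b.toMatrix u := by
    ext i j
    have e : B (u i) (u j) = _ := (LinearMap.sum_repr_mul_repr_mul b b (u i) (u j)).symm
    refine e.trans ((Finsupp.sum_fintype _ _ (by simp)).trans
      ((Finset.sum_congr rfl fun k _ => Finsupp.sum_fintype _ _ (by simp)).trans ?_))
    simp only [smul_eq_mul, Matrix.mul_apply, Matrix.transpose_apply,
      Matrix.of_apply, Finset.sum_mul, Module.Basis.toMatrix_apply, B, LinearMap.mk₂_apply]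
    rw [Finset.sum_comm]
    exact Finset.sum_congr rfl fun _ _ => Finset.sum_congr rfl fun _ _ => by ring
  rw [h1, mul_pow, h, MetricField.gramAt, MetricField.gramAt, h2, Matrix.det_mul, Matrix.det_mul,
    Matrix.det_transpose, Module.Basis.det_apply]
  ring

end

section

variable {M : Type*} [TopologicalSpace M] [ChartedSpace (𝔼 7) M] [IsManifold (𝓡 7) ∞ M]
  {S : TorsionFreeG2 M} {f : X → M}

theorem TorsionFreeG2.frame_eq {z : Circle × M} {v : Fin 4 → TangentSpace 𝓒(𝓡 7) z}
    (h0 : basePart z (v 0) = 0) (h : ∀ i : Fin 3, circlePart z (v i.succ) = 0) :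
    S.thetaPhi z v = circlePart z (v 0) * S.φ z.2 (fun i => basePart z (v i.succ)) ∧
    S.psiP z v = 0 ∧ S.prodMetric.gramAt z v =
      circlePart z (v 0) ^ 2 * S.g.field.gramAt z.2 (fun i => basePart z (v i.succ)) := by
  have hz : ∀ u, S.prodMetric z (v 0) u = circlePart z (v 0) * circlePart z u := fun u => by
    simp only [TorsionFreeG2.prodMetric, h0, map_zero, zero_apply, add_zero]
  refine ⟨?_, (S.ψ z.2).map_coord_zero 0 h0, ?_⟩
  · rw [TorsionFreeG2.thetaPhi_apply, Fin.sum_univ_succ]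
    simp [h]
  · rw [MetricField.gramAt, Matrix.det_succ_row_zero, Fin.sum_univ_succ]
    simp only [Matrix.of_apply, hz, h, mul_zero, zero_mul, Finset.sum_const_zero, add_zero, Fin.val_zero, pow_zero, one_mul, ← pow_two]
    congr 1
    refine congrArg Matrix.det (Matrix.ext fun i j => ?_)
    simp only [Matrix.submatrix_apply, Matrix.of_apply, Fin.zero_succAbove, TorsionFreeG2.prodMetric, h, mul_zero, zero_add]
    rfl

theorem circlePart_prodMap {a : Circle × X} (hf : MDifferentiableAt I' (𝓡 7) f a.2) (v : E1 × E') :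
    circlePart (a.1, f a.2) (mfderiv 𝓒(I') 𝓒(𝓡 7) (Prod.map id f) a v) = dtheta a.1 v.1 :=
  (circlePart_mfderiv (mdifferentiableAt_fst.prodMk
    (hf.comp a mdifferentiableAt_snd)) v).trans (congrArg (fun A : E1 × E' →L[ℝ] E1 => dtheta a.1 (A v)) mfderiv_fst)

theorem basePart_prodMap {a : Circle × X} (hf : MDifferentiableAt I' (𝓡 7) f a.2) (v : E1 × E') :
    basePart (a.1, f a.2) (mfderiv 𝓒(I') 𝓒(𝓡 7) (Prod.map id f) a v) = mfderiv I' (𝓡 7) f a.2 v.2 :=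
  (basePart_mfderiv (mdifferentiableAt_fst.prodMk
    (hf.comp a mdifferentiableAt_snd)) v).trans (((mfderiv_comp a hf mdifferentiableAt_snd).app v).trans
      (congrArg (fun A : E1 × E' →L[ℝ] E' => mfderiv I' (𝓡 7) f a.2 (A v)) mfderiv_snd))

end

section

variable {M : Type*} [TopologicalSpace M] [T2Space M] [ChartedSpace (𝔼 7) M]
  [IsManifold (𝓡 7) ∞ M] {S : TorsionFreeG2 M} {X : Type*} [TopologicalSpace X]
  [ChartedSpace (𝔼 3) X] [IsManifold (𝓡 3) ∞ X] {f : X → M}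

theorem TorsionFreeG2.psiP_prodMap (hf : ContMDiff (𝓡 3) (𝓡 7) ∞ f) (a : Circle × X) (u : Fin 4 → E13) :
    S.psiP (Prod.map id f a) (fun i => mfderiv 𝓒(𝓡 3) 𝓒(𝓡 7) (Prod.map id f) a (u i)) = 0 := by
  refine (congrArg _ (funext fun i =>
    basePart_prodMap hf.mdiffAt (u i))).trans (((S.ψ (f a.2)).toAlternatingMap.compLinearMap (mfderiv (𝓡 3) (𝓡 7) f a.2).toLinearMap).map_linearDependent _ fun h => ?_)
  have : FiniteDimensional ℝ (TangentSpace (𝓡 3) a.2) := inferInstanceAs (FiniteDimensional ℝ (𝔼 3))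
  have h1 := h.fintype_card_le_finrank
  have h2 : Module.finrank ℝ (TangentSpace (𝓡 3) a.2) = 3 := finrank_euclideanSpace_fin
  rw [h2] at h1
  simp at h1

theorem TorsionFreeG2.IsAssociative.isCayley_prodMap (hf : ContMDiff (𝓡 3) (𝓡 7) ∞ f)
    (h : S.IsAssociative (𝓡 3) f) : S.IsCayley 𝓒(𝓡 3) (Prod.map id f) := fun a u => by
  have hd : MDifferentiableAt (𝓡 3) (𝓡 7) f a.2 := hf.mdiffAt
  rw [TorsionFreeG2.cayleyForm_eq]
  let b : Module.Basis (Fin 4) ℝ E13 := ((EuclideanSpace.basisFun (Fin 1) ℝ).toBasis.prod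
    (EuclideanSpace.basisFun (Fin 3) ℝ).toBasis).reindex (finSumFinEquiv)
  refine S.prodMetric_isRiem.sq_eq_gramAt_of_basis _ (mfderiv 𝓒(𝓡 3) 𝓒(𝓡 7) _ a).toLinearMap b ?_ u
  have hb0 : (b 0).2 = 0 := by
    simp only [b, Module.Basis.reindex_apply, show (finSumFinEquiv (m := 1) (n := 3)).symm 0 = Sum.inl 0 from rfl]
    simp
  have hb : ∀ i : Fin 3, (b i.succ).1 = 0 := fun i => by
    simp only [b, Module.Basis.reindex_apply, show (finSumFinEquiv (m := 1) (n := 3)).symm i.succ = Sum.inr i by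
      rw [Equiv.symm_apply_eq]; rw [finSumFinEquiv_apply_right]; ext; simp [add_comm]]
    simp
  obtain ⟨h1, h2, h3⟩ := TorsionFreeG2.frame_eq (v := fun i => mfderiv 𝓒(𝓡 3) 𝓒(𝓡 7) (Prod.map id f) a (b i))
    ((basePart_prodMap hd _).trans ((congrArg _ hb0).trans (map_zero _)))
    (fun i => (circlePart_prodMap hd _).trans ((congrArg (dtheta a.1) (hb i)).trans (map_zero (dthetaL a.1))))
  refine Eq.trans (congrArg (· ^ 2) ((congrArg₂ (· + ·) h1 h2).trans (add_zero _))) (Eq.trans ((mul_pow _ _ _).trans (congrArg (_ * ·) ?_)) h3.symm)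
  have e := funext fun i : Fin 3 => basePart_prodMap hd (b i.succ)
  exact (congrArg (fun y => (S.φ (f a.2) y) ^ 2) e).trans ((h a.2 _).trans ((congrArg (S.g.field.gramAt (f a.2)) e).symm))

end

section

variable {g : MetricField I M} {f : X → M} {R : ℝ} {α : ℝ × Z → X}

theorem MetricField.IsRiem.continuous_speed (hg : g.IsRiem) {δ : ℝ → M}
    (hδ : CMDiff 1 δ) : Continuous fun s => g (δ s) (mfderiv% δ s (1 : ℝ))
      (mfderiv% δ s (1 : ℝ)) := continuous_iff_continuousAt.2 fun s0 => by
  set e := ϕ I (δ s0) with he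
  have h1 := contDiffAt_chart_comp (hδ s0) (mem_extChartAt_source _)
  have h2 : ContinuousAt (fun s => (fderiv ℝ _ s 1 : E)) s0 :=
    (h1.fderiv_right (m := 0) (by norm_num)).continuousAt.clm_apply continuousAt_const
  refine (((ContinuousAt.comp (f := fun s => e (δ s)) (hg.chartL_hasFDerivAt (δ s0)).continuousAt h1.continuousAt).clm_apply h2).clm_apply h2).congr ?_
  filter_upwards [(hδ s0).continuousAt.preimage_mem_nhds (extChartAt_source_mem_nhds (I := I) (δ s0))] with s hs
  exact Eq.trans (congrArg (fun w => g.inChart (δ s0) (e (δ s)) w w) (mfderiv_chart_comp ((hδ s).mdiffAt) hs 1)) (metric_eq_chart (δ s) (δ s0) hs _ _).symm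

theorem norm_coe_circle_sub_le {c : ℝ → Circle} (hc : CMDiff 1 c) :
    ‖(c 1 : ℂ) - c 0‖ ≤ ∫ s in (0 : ℝ)..1, √(circleMetric (c s) (mfderiv% c s (1 : ℝ)) (mfderiv% c s (1 : ℝ))) := by
  have h1 := contDiff_iff_contDiffAt.2 fun s => contDiffAt_coe_circle (hc s)
  have h2 : ∀ s, deriv _ s = (dtheta (c s) _ : ℂ) * Complex.I * (c s : ℂ) := fun s =>
    (mfderiv_eq_fderiv.symm.app 1).trans (coe_circle_mfderiv ((hc s).mdiffAt) (1 : ℝ))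
  rw [← intervalIntegral.integral_eq_sub_of_hasDerivAt
    (fun s _ => (h1.differentiable (by simp) s).hasDerivAt) ((h1.continuous_deriv le_rfl).intervalIntegrable _ _)]
  refine (intervalIntegral.norm_integral_le_integral_norm zero_le_one).trans_eq (intervalIntegral.integral_congr fun s _ => ?_)
  simp only [h2, circleMetric, Real.sqrt_mul_self_eq_abs, norm_mul, Circle.norm_coe]
  simp

theorem IsSmoothEmb.prodMap (hf : IsSmoothEmb I I' f) : IsSmoothEmb 𝓒(I) 𝓒(I') (Prod.map (id : Circle → Circle) f) := by
  refine ⟨contMDiff_id.prodMap hf.smooth, fun a u v huv => ?_, IsEmbedding.id.prodMap hf.embedding⟩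
  have e : ∀ u, (mfderiv% (Prod.map (id : Circle → Circle) f) a u) = ((u.1 : E1), (mfderiv% f a.2 u.2 : E)) := fun u =>
    ((mfderiv_prodMap mdifferentiableAt_id hf.smooth.mdiffAt).app u).trans (Prod.ext (mfderiv_id.app u.1) rfl)
  have h := (e u).symm.trans (huv.trans (e v))
  exact Prod.ext (congrArg Prod.fst h :) (hf.immersion _ (congrArg Prod.snd h))

theorem IsEnd.prodMap (h : IsEnd I' IZ R α) : IsEnd 𝓒(I') 𝓒(IZ) R (fun q : ℝ × (Circle × Z) => (q.2.1, α (q.1, q.2.2))) := by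
  have him : ∀ T, (fun q : ℝ × (Circle × Z) => (q.2.1, α (q.1, q.2.2))) '' (Ioi T ×ˢ univ) =
      univ ×ˢ (α '' (Ioi T ×ˢ univ)) := fun T => by
    ext ⟨θ, x⟩
    constructor
    · rintro ⟨⟨t, θ', z⟩, ht, e⟩
      cases e
      exact ⟨trivial, (t, z), ⟨ht.1, trivial⟩, rfl⟩
    · rintro ⟨-, ⟨t, z⟩, ht, rfl⟩
      exact ⟨(t, θ, z), ⟨ht.1, trivial⟩, rfl⟩
  have hs : CMDiff ∞ (fun q : ℝ × (Circle × Z) => (q.1, q.2.2)) := contMDiff_fst.prodMk (contMDiff_snd.comp contMDiff_snd)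
  have hc : CMDiff ∞ (fun q : ℝ × (Circle × Z) => q.2.1) := contMDiff_fst.comp contMDiff_snd
  refine ⟨⟨hc.contMDiffOn.prodMk (h.diffeo.1.comp hs.contMDiffOn fun q hq => mem_halfCylinder hq.1 _),
    ⟨mapsTo_image _ _, ?_, surjOn_image _ _⟩, fun q hq => ?_⟩, fun T hT => ?_⟩
  · rintro ⟨t, θ, z⟩ ht ⟨t', θ', z'⟩ ht' e
    have e1 := h.inj (q := (t, z)) (q' := (t', z')) ht.1 ht'.1 (congrArg Prod.snd e)
    cases e1
    cases (congrArg Prod.fst e)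
    rfl
  · have hd := (h.diffeo.1.contMDiffAt ((isOpen_halfCylinder R).mem_nhds (mem_halfCylinder hq.1 q.2.2))).mdiffAt
    have hsd := hs.mdiffAt (x := q)
    have e3 := (mfderiv_prodMk mdifferentiableAt_fst ((contMDiff_snd.comp contMDiff_snd :
        CMDiff ∞ (fun q : ℝ × (Circle × Z) => q.2.2)).mdiffAt)).trans (congrArg₂ _ mfderiv_fst ((mfderiv_comp q mdifferentiableAt_snd mdifferentiableAt_snd).trans (congrArg₂ _ mfderiv_snd mfderiv_snd)))
    have e : ∀ v, (mfderiv% (fun q : ℝ × (Circle × Z) => (q.2.1, α (q.1, q.2.2))) q v : E1 × E') =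
        (v.2.1, (mfderiv% α (q.1, q.2.2) _ : E')) := fun v =>
      ((mfderiv_prodMk hc.mdiffAt
        (hd.comp q hsd)).app v).trans (Prod.ext (((mfderiv_comp q mdifferentiableAt_fst mdifferentiableAt_snd).trans (congrArg₂ _ mfderiv_fst mfderiv_snd)).app v)
        (((mfderiv_comp q hd hsd).app v).trans (congrArg (fun A => mfderiv% α (q.1, q.2.2) (A v)) e3)))
    obtain ⟨h1, h2⟩ := h.diffeo.2.2 (q.1, q.2.2) (mem_halfCylinder hq.1 _)
    constructor
    · intro u v huv
      have huv' := (e u).symm.trans (huv.trans (e v))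
      have h3 := h1 (congrArg Prod.snd huv')
      exact Prod.ext (congrArg Prod.fst h3 :) (Prod.ext (congrArg Prod.fst huv' :) (congrArg Prod.snd h3 :))
    · rintro ⟨a, b⟩
      obtain ⟨v, hv⟩ := h2 b
      exact ⟨(v.1, (a, v.2)), (e _).trans (Prod.ext rfl hv)⟩
  · rw [him, compl_prod_eq_union, compl_univ, empty_prod, empty_union]
    exact isCompact_univ.prod (h.compact T hT)

end

section

variable {M : Type*} [TopologicalSpace M] [ChartedSpace (𝔼 7) M] [IsManifold (𝓡 7) ∞ M]
  {S : TorsionFreeG2 M} {N : Type*} [TopologicalSpace N] [ChartedSpace (𝔼 6) N]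
  [IsManifold (𝓡 6) ∞ N] {Ψ : ℝ × N → M} {j : Z → N} {ι f : X → M} {ε : ℝ}

theorem TorsionFreeG2.prodMetric_prodMap (hf : ContMDiff I' (𝓡 7) ∞ f) (a : Circle × X) (u : E1 × E') :
    S.prodMetric (Prod.map id f a) (mfderiv 𝓒(I') 𝓒(𝓡 7) (Prod.map id f) a u) (mfderiv 𝓒(I') 𝓒(𝓡 7) (Prod.map id f) a u) =
    circleMetric a.1 u.1 u.1 + S.g.field (f a.2) (mfderiv I' (𝓡 7) f a.2 u.2) (mfderiv I' (𝓡 7) f a.2 u.2) := by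
  have hd : MDifferentiableAt I' (𝓡 7) f a.2 := hf.mdiffAt
  exact congrArg₂ (· + ·) (congrArg (fun r => r * r) (circlePart_prodMap hd u))
    (congrArg (fun w => S.g.field (f a.2) w w) (basePart_prodMap hd u))

theorem IsCompleteAlong.prodMap (hf : ContMDiff I' (𝓡 7) ∞ f) (h : IsCompleteAlong I' S.g.field f) :
    IsCompleteAlong 𝓒(I') S.prodMetric (Prod.map id f) := by
  intro u hu
  have key : ∀ γ, ContMDiff 𝓘(ℝ) 𝓒(I') 1 γ →
      ‖((γ 1).1 : ℂ) - (γ 0).1‖ ≤ (∫ s in (0 : ℝ)..1, √(S.prodMetric (Prod.map id f (γ s)) (mfderiv 𝓒(I') 𝓒(𝓡 7) _ (γ s) _)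
        (mfderiv 𝓒(I') 𝓒(𝓡 7) _ (γ s) _))) ∧
      (∫ s in (0 : ℝ)..1, √(S.g.field (f (γ s).2) (mfderiv I' (𝓡 7) f (γ s).2 _) (mfderiv I' (𝓡 7) f (γ s).2 _))) ≤
      (∫ s in (0 : ℝ)..1, √(S.prodMetric _ (mfderiv 𝓒(I') 𝓒(𝓡 7) _ (γ s) _) (mfderiv 𝓒(I') 𝓒(𝓡 7) _ (γ s) _))) :=
      fun γ hγ => by
    have hc := contMDiff_fst.comp hγ
    have hx := contMDiff_snd.comp hγ
    have hd := fun s => (hγ s).mdiffAt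
    have e1 := fun s =>
      (((mfderiv_comp s mdifferentiableAt_fst (hd s)).app 1).trans
        (congrArg (fun A => A (mfderiv 𝓘(ℝ) 𝓒(I') γ s (1 : ℝ))) mfderiv_fst)).symm
    have e2 := fun s =>
      (((mfderiv_comp s mdifferentiableAt_snd (hd s)).app 1).trans
        (congrArg (fun A => A (mfderiv 𝓘(ℝ) 𝓒(I') γ s (1 : ℝ))) mfderiv_snd)).symm
    have e := fun s => (TorsionFreeG2.prodMetric_prodMap hf (γ s)
      (mfderiv 𝓘(ℝ) 𝓒(I') γ s (1 : ℝ))).trans (congrArg₂ (fun v w =>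
        circleMetric (γ s).1 v v + S.g.field (f (γ s).2) (mfderiv I' (𝓡 7) f (γ s).2 w) (mfderiv I' (𝓡 7) f (γ s).2 w))
        (e1 s) (e2 s))
    have hA := circleMetric_isRiem.continuous_speed hc
    have e3 := fun s => (mfderiv_comp s hf.mdiffAt ((hx s).mdiffAt)).app 1
    have hB' := (S.g.isRiem.continuous_speed ((hf.of_le (by simp)).comp hx)).congr fun s => congrArg (fun w => S.g.field (f (γ s).2) w w) (e3 s)
    have hC := (hA.add hB').congr fun s => (e s).symm
    refine ⟨(norm_coe_circle_sub_le hc).trans ?_, ?_⟩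
    · exact intervalIntegral.integral_mono_on zero_le_one (hA.sqrt.intervalIntegrable _ _)
        (hC.sqrt.intervalIntegrable _ _) fun s _ => Real.sqrt_le_sqrt ((le_add_of_nonneg_right (S.g.isRiem.nonneg _ _)).trans_eq (e s).symm)
    · exact intervalIntegral.integral_mono_on zero_le_one (hB'.sqrt.intervalIntegrable _ _)
        (hC.sqrt.intervalIntegrable _ _) fun s _ => Real.sqrt_le_sqrt ((le_add_of_nonneg_left ((fun s => mul_self_nonneg _) s)).trans_eq (e s).symm)
  obtain ⟨x, hx⟩ := h _ fun ε hε => by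
    obtain ⟨n0, hn0⟩ := hu ε hε
    refine ⟨n0, fun m n hm hn => ?_⟩
    obtain ⟨γ, h1, h2, h3, h4⟩ := hn0 m n hm hn
    exact ⟨fun s => (γ s).2, contMDiff_snd.comp h1, congrArg Prod.snd h2, congrArg Prod.snd h3, (key γ h1).2.trans_lt h4⟩
  obtain ⟨θ, hθ⟩ := cauchySeq_tendsto_of_complete (u := fun n => (u n).1) (Metric.cauchySeq_iff.2 fun ε hε => by
    obtain ⟨n0, hn0⟩ := hu ε hε
    refine ⟨n0, fun m hm n hn => ?_⟩
    obtain ⟨γ, h1, h2, h3, h4⟩ := hn0 n m hn hm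
    have h5 := (key γ h1).1.trans_lt h4
    rwa [h2, h3, ← dist_eq_norm] at h5)
  exact ⟨(θ, x), hθ.prodMk_nhds hx⟩

theorem IsACylSubmanifold.prodMap (hf : IsACylSubmanifold I' IZ (𝓡 6) S.g.field Ψ j f) :
    IsACylSubmanifold 𝓒(I') 𝓒(IZ) 𝓒(𝓡 6) S.prodMetric (prodEnd Ψ) (Prod.map id j) (Prod.map id f) := by
  refine ⟨hf.embedding.prodMap, hf.cross_section.prodMap, hf.complete.prodMap hf.embedding.smooth, ?_⟩
  obtain ⟨R, α, w, hR, h1, h2, hws, hαw, hw⟩ := hf.end_param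
  have hα : IsEnd I' IZ R α := ⟨h1, h2⟩
  refine ⟨R, _, fun q => (q.2.1, w (q.1, q.2.2)), hR, hα.prodMap.diffeo, hα.prodMap.compact, ?_,
    fun t y ht => Prod.ext rfl (hαw t y.2 ht), ?_⟩
  · exact (contMDiff_fst.comp contMDiff_snd).contMDiffOn.prodMk (hws.comp (contMDiff_fst.prodMk
      (contMDiff_snd.comp contMDiff_snd)).contMDiffOn fun q hq => mem_halfCylinder hq.1 _)
  · refine hw.of_chart hf.cross_section.smooth hws fun z q => ⟨z.2, q.2, ContinuousLinearMap.inr ℝ E1 _,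
      ContinuousLinearMap.snd ℝ E1 EZ, 0, fun y => ?_, fun y hy => ?_⟩
    · simp only [ContinuousLinearMap.coe_snd', add_zero]
      exact Prod.ext (sub_self _) rfl
    · simp only [ContinuousLinearMap.coe_snd', add_zero, extChartAt_prod] at hy ⊢
      exact ⟨hy.2, fun h => ⟨h.2, fun t h' => ⟨h.1, h'⟩⟩⟩

theorem IsLocalDeformation.prodMap (hε : 0 ≤ ε) (h : IsLocalDeformation I' IZ (𝓡 6) S.g.field Ψ j ι ε f) :
    IsLocalDeformation 𝓒(I') 𝓒(IZ) 𝓒(𝓡 6) S.prodMetric (prodEnd Ψ) (Prod.map id j) (Prod.map id ι) ε (Prod.map id f) := by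
  obtain ⟨hc, F, hF, rfl, rfl, hV, lam, A, hlam, hA, hV'⟩ := h
  have hm : ∀ a u, S.g.field (F 0 a.2) (mfderiv I' (𝓡 7) (F 0) a.2 _)
      (mfderiv I' (𝓡 7) (F 0) a.2 (mfderiv 𝓒(I') I' Prod.snd a u)) ≤
      S.prodMetric _ (mfderiv 𝓒(I') 𝓒(𝓡 7) _ a u) (mfderiv 𝓒(I') 𝓒(𝓡 7) _ a u) := fun a u => by
    exact le_trans (le_of_eq (congrArg (fun A => S.g.field (F 0 a.2) (mfderiv I' (𝓡 7) (F 0) a.2 (A u)) (mfderiv I' (𝓡 7) (F 0) a.2 (A u))) mfderiv_snd)) ((le_add_of_nonneg_left (mul_self_nonneg _)).trans_eq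
      (TorsionFreeG2.prodMetric_prodMap (family_contMDiff_snd hF 0) a u).symm)
  exact ⟨hc.prodMap, fun τ => Prod.map id (F τ), (contMDiff_fst.comp contMDiff_snd).prodMk
    (hF.comp (contMDiff_fst.prodMk (contMDiff_snd.comp contMDiff_snd))), rfl, rfl,
    fun τ hτ a => (hV τ hτ a.2).prodMk hF contMDiff_snd contMDiff_fst hε (hm a),
    lam, A, hlam, hA, fun τ hτ a t y ht hx => (hV' τ hτ a.2 t y.2 ht (congrArg Prod.snd hx)).prodMk
      hF contMDiff_snd contMDiff_fst (by positivity) (hm a)⟩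

theorem EndBounded.prodMap {R : ℝ} {β : ℝ × Z → M}
    (hβ : ContMDiffOn (𝓘(ℝ).prod IZ) (𝓡 7) ∞ β (Ioi R ×ˢ univ)) (h : EndBounded (𝓡 7) IZ S.g.field β) :
    EndBounded 𝓒(𝓡 7) 𝓒(IZ) S.prodMetric (fun q : ℝ × (Circle × Z) => (q.2.1, β (q.1, q.2.2))) := by
  intro a
  obtain ⟨C, c0, T0, hC, hCn, hCt, hc0, hb⟩ := h a.2
  obtain ⟨K, hKn, hKt, hK⟩ := local_compact_nhds (extChartAt_target_mem_nhds (I := 𝓡 1) a.1)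
  obtain ⟨c1, c2, -, hc2, hbd⟩ := circleMetric_isRiem.exists_inChart_bounds a.1 hK hKt
  refine ⟨K ×ˢ C, c2 + c0, max T0 R, hK.prod hC, ?_, ?_, by positivity, fun t ht y hy v => ?_⟩
  · exact prod_mem_nhds hKn hCn
  · rw [extChartAt_prod]
    exact prod_mono hKt hCt
  · have h2 := ContMDiffAt.comp (t, y.2) (hβ.contMDiffAt ((isOpen_halfCylinder R).mem_nhds (mem_halfCylinder ((le_max_right _ _).trans_lt ht) _))) (ContMDiffAt.prodMk contDiff_fst.contMDiff.contMDiffAt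
        (ContMDiffAt.comp (t, y.2) (contMDiffAt_extChartAt_symm a.2 (hCt hy.2)) contDiff_snd.contMDiff.contMDiffAt))
    have h3 := contMDiffAt_extChartAt_symm a.1 (hKt hy.1)
    let P : ℝ × (E1 × EZ) →L[ℝ] ℝ × EZ := (ContinuousLinearMap.fst ℝ ℝ (E1 × EZ)).prod
      ((ContinuousLinearMap.snd ℝ E1 EZ).comp (ContinuousLinearMap.snd ℝ ℝ (E1 × EZ)))
    let Q : ℝ × (E1 × EZ) →L[ℝ] E1 := (ContinuousLinearMap.fst ℝ E1 EZ).comp (ContinuousLinearMap.snd ℝ ℝ (E1 × EZ))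
    have hP := (P.hasFDerivAt (x := (t, y))).differentiableAt.mdifferentiableAt
    have hQ := (Q.hasFDerivAt (x := (t, y))).differentiableAt.mdifferentiableAt
    have e := TorsionFreeG2.prodMetric_mfderiv (S := S) ((h3.mdiffAt.comp (t, y) hQ).prodMk (h2.mdiffAt.comp (t, y) hP)) (0, v) (0, v)
    refine e.trans_le ?_
    have e3 := congrArg (fun A => circleMetric ((ϕ (𝓡 1) a.1).symm y.1)
      (A ((0 : ℝ), v)) (A ((0 : ℝ), v))) ((mfderiv_comp (t, y) h3.mdiffAt hQ).trans (congrArg (fun A =>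
        (mfderiv% (ϕ (𝓡 1) a.1).symm y.1).comp A) (mfderiv_eq_fderiv.trans Q.fderiv)))
    have e4 := congrArg (fun A : ℝ × (E1 × EZ) →L[ℝ] E7 => S.g.field (β (t, (ϕ IZ a.2).symm y.2))
      (A ((0 : ℝ), v)) (A ((0 : ℝ), v))) ((mfderiv_comp (t, y) h2.mdiffAt hP).trans (congrArg (fun A =>
        (mfderiv 𝓘(ℝ, ℝ × EZ) (𝓡 7) (fun q => β _) (t, y.2) : ℝ × EZ →L[ℝ] E7).comp A) (mfderiv_eq_fderiv.trans P.fderiv)))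
    rw [add_mul]
    refine add_le_add (e3.trans_le ((hbd _ hy.1 v.1).2.trans ?_)) (e4.trans_le
      ((hb t ((le_max_left _ _).trans_lt ht) y.2 hy.2 v.2).trans ?_))
    · exact mul_le_mul_of_nonneg_left (pow_le_pow_left₀ (norm_nonneg _) (norm_fst_le v) 2) hc2.le
    · exact mul_le_mul_of_nonneg_left (pow_le_pow_left₀ (norm_nonneg _) (norm_snd_le v) 2) hc0

end

section

theorem existsUnique_eq_one {C : Circle → Circle} {k : ℝ → ℝ}
    (hC : ∀ s, HasDerivAt (fun s => (C (Circle.exp s) : ℂ)) (k s * Complex.I * C (Circle.exp s)) s)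
    (hk : ∀ s, k s ≠ 0) (hclose : ∀ θ, ‖(C θ : ℂ) - θ‖ < 2) : ∃! θ, C θ = 1 := by
  have hu : ∀ s, (C _ : ℂ) * Circle.exp (-s) ∈ Complex.slitPlane := fun s => by
    by_contra h
    have h1 : ‖(C (Circle.exp s) : ℂ) * Circle.exp (-s)‖ = 1 := by rw [norm_mul, Circle.norm_coe, Circle.norm_coe, one_mul]
    rw [Complex.mem_slitPlane_iff, not_or, not_lt, not_not] at h
    have h2 : (C (Circle.exp s) : ℂ) * Circle.exp (-s) = -1 := by
      refine Complex.ext ?_ (by simpa using h.2)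
      rw [← Complex.abs_re_eq_norm.2 h.2, abs_of_nonpos h.1] at h1
      simp only [Complex.neg_re, Complex.one_re]
      linarith
    have h3 : (Circle.exp (-s) : ℂ) * Circle.exp s = 1 := by rw [← Circle.coe_mul, ← Circle.exp_add]; simp
    have h4 := hclose (Circle.exp s)
    rw [show (C _ : ℂ) = -Circle.exp s by
      rw [← mul_one (C _ : ℂ), ← h3, ← mul_assoc, h2, neg_one_mul], ← neg_add', norm_neg, ← two_mul] at h4
    simp at h4
  set κ : ℝ → ℝ := fun s => s + (Complex.log _).im with hκ
  have hexp : ∀ s, (C (Circle.exp s)) = Circle.exp (κ s) := fun s => by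
    have h1 : Circle.exp (Complex.log ((C (Circle.exp s) : ℂ) * Circle.exp (-s))).im = C (Circle.exp s) * Circle.exp (-s) := by
      rw [Complex.log_im, ← Circle.coe_mul, Circle.exp_arg]
    rw [hκ, Circle.exp_add, h1, mul_left_comm, ← Circle.exp_add]
    simp
  have hd : ∀ s, HasDerivAt κ (k s) s := fun s => by
    have h1 : HasDerivAt (fun s => (Circle.exp (-s) : ℂ)) (-Complex.I * Circle.exp (-s)) s := by
      refine ((((hasDerivAt_neg s).ofReal_comp).mul_const Complex.I).cexp).congr_deriv ?_
      rw [Circle.coe_exp]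
      push_cast
      ring
    refine ((hasDerivAt_id s).add (Complex.imCLM.hasFDerivAt.comp_hasDerivAt s (((hC s).mul h1).clog_real (hu s)))).congr_deriv ?_
    have h5 : (C (Circle.exp s) : ℂ) ≠ 0 := Circle.coe_ne_zero _
    have h6 : (Circle.exp (-s) : ℂ) ≠ 0 := Circle.coe_ne_zero _
    have h7 : ((k s : ℂ) * Complex.I * C (Circle.exp s) * Circle.exp (-s) + C (Circle.exp s) * (-Complex.I * Circle.exp (-s))) /
      ((C (Circle.exp s) : ℂ) * Circle.exp (-s)) = ((k s - 1 : ℝ) : ℂ) * Complex.I := by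
      push_cast
      field_simp
      ring
    exact (congrArg (fun w : ℂ => 1 + w.im) h7).trans (by simp)
  have hcont := continuous_iff_continuousAt.2 fun s => (hd s).continuousAt
  have hinj : ∀ s t, κ s = κ t → s = t := by
    have h1 : ∀ s t, s < t → κ s ≠ κ t := fun s t hst he => by
      obtain ⟨r, -, hr⟩ := exists_hasDerivAt_eq_zero hst hcont.continuousOn he fun x _ => hd x
      exact hk r hr
    intro s t he
    rcases lt_trichotomy s t with h | h | h
    · exact (h1 s t h he).elim
    · exact h
    · exact (h1 t s h he.symm).elim
  have hper : ∀ s (n : ℤ), κ (s + n * (2 * Real.pi)) = κ s + n * (2 * Real.pi) := fun s n => by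
    have h1 : Circle.exp _ = Circle.exp s := Circle.exp_eq_exp.2 ⟨n, rfl⟩
    have h2 : Circle.exp (-(s + n * (2 * Real.pi))) = Circle.exp (-s) := by rw [Circle.exp_neg, h1, Circle.exp_neg]
    simp only [hκ, h1, h2]
    ring
  have hle : ∀ s, |κ s - s| ≤ Real.pi := fun s => by
    simp only [hκ, add_sub_cancel_left, Complex.log_im]
    exact Complex.abs_arg_le_pi _
  obtain ⟨s0, -, hs0⟩ := intermediate_value_Icc (by linarith [Real.pi_pos]) hcont.continuousOn
    (show (0 : ℝ) ∈ Icc (κ (-Real.pi)) (κ Real.pi) by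
      constructor
      · linarith [(abs_le.1 (hle (-Real.pi))).2]
      · linarith [(abs_le.1 (hle Real.pi)).1])
  refine ⟨Circle.exp s0, (hexp s0).trans (by rw [hs0, Circle.exp_zero]), fun θ hθ => ?_⟩
  set s := Complex.arg θ
  rw [← (Circle.exp_arg θ)] at hθ ⊢
  have h1 : Circle.exp (κ s) = Circle.exp 0 := by rw [← hexp, hθ, Circle.exp_zero]
  obtain ⟨n, hn⟩ := Circle.exp_eq_exp.1 h1
  have h2 := hper s0 n
  rw [hs0, ← hn] at h2
  exact Circle.exp_eq_exp.2 ⟨n, (hinj _ _ h2).symm⟩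

theorem contMDiff_rotation (θ : Circle) : CMDiff ∞ (fun s => θ * Circle.exp s) := (contMDiff_const).mul contMDiff_circleExp

theorem dtheta_rotation (θ : Circle) (s : ℝ) : dtheta (θ * Circle.exp s)
    (mfderiv% (fun s => θ * Circle.exp s) s (1 : ℝ)) = 1 := by
  refine (dtheta_mfderiv ((contMDiff_rotation θ s).mdiffAt) (1 : ℝ)).trans ?_
  have h2 : HasDerivAt (fun s : ℝ => (θ : ℂ) * Complex.exp _)
      ((θ : ℂ) * (Complex.exp ((s : ℂ) * Complex.I) * (1 * Complex.I))) s :=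
    ((((hasDerivAt_id s).ofReal_comp).mul_const Complex.I).cexp).const_mul _
  have h3 : (mfderiv 𝓘(ℝ) 𝓘(ℝ, ℂ) (fun s : ℝ => ((θ * Circle.exp s) : ℂ)) s (1 : ℝ) : ℂ) =
      ((θ * Circle.exp s : Circle) : ℂ) * Complex.I := by
    refine (mfderiv_eq_fderiv.app 1).trans (h2.deriv.trans ?_)
    rw [Circle.coe_mul, Circle.coe_exp]
    ring
  refine (congrArg (fun w => ((starRingEnd ℂ _) * w).im) h3).trans ?_
  rw [← mul_assoc, circle_conj_mul]
  simp

end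

section

variable {M : Type*} [TopologicalSpace M] [ChartedSpace (𝔼 7) M] [IsManifold (𝓡 7) ∞ M]
  {EA : Type} [NormedAddCommGroup EA] [NormedSpace ℝ EA] [FiniteDimensional ℝ EA] {HA : Type*}
  [TopologicalSpace HA] {IA : ModelWithCorners ℝ EA HA} [IA.Boundaryless] {A : Type*} [TopologicalSpace A]
  [ChartedSpace HA A] [IsManifold IA ∞ A] {f : A → Circle × M}

theorem IsSmoothEmb.existsUnique_eq_one (hf : IsSmoothEmb 𝓒(𝓡 7) IA f) {m : M} {c : A → Circle}
    {γ : Circle → A} (hγ : ∀ θ, f (γ θ) = (θ, m)) (hc : ∀ θ, CMDiffAt ∞ c (γ θ))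
    (hclose : ∀ θ, ‖(c (γ θ) : ℂ) - θ‖ < 2)
    (hker : ∀ θ (v : EA), dtheta (c (γ θ)) (mfderiv% c (γ θ) v) = 0 →
      basePart (f (γ θ)) (mfderiv IA 𝓒(𝓡 7) f (γ θ) v) = 0 → v = 0) :
    ∃! θ, c (γ θ) = 1 := by
  have hγc : Continuous γ := by
    rw [hf.embedding.isInducing.continuous_iff, show f ∘ γ = fun θ => (θ, m) from funext hγ]
    fun_prop
  have hr := contMDiff_rotation 1
  simp only [one_mul] at hr
  have hσ : ∀ s, CMDiffAt ∞ (fun s => γ (Circle.exp s)) s := fun s => by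
    obtain ⟨h, h1, h2, h3, -⟩ := exists_left_inverse (hf.smooth _) (hf.immersion _)
    rw [hγ] at h1
    refine (ContMDiffAt.comp s h1 ((hr s).prodMk contMDiffAt_const)).congr_of_eventuallyEq ?_
    filter_upwards [(hγc.comp Circle.exp.continuous).continuousAt.eventually h3] with t ht
    exact ht.symm.trans (congrArg h (hγ _))
  refine ACyl.existsUnique_eq_one (k := fun s => dtheta _ (mfderiv% (fun s => c (γ (Circle.exp s))) s (1 : ℝ)))
    (fun s => ?_) (fun s h0 => ?_) hclose
  · have h1 := ContMDiffAt.comp s (hc _) (hσ s)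
    exact ((contDiffAt_coe_circle h1).diffAt).hasDerivAt.congr_deriv ((mfderiv_eq_fderiv.symm.app 1).trans (coe_circle_mfderiv h1.mdiffAt (1 : ℝ)))
  · have hd := (hσ s).mdiffAt
    have hfd := hf.smooth.mdiffAt (x := γ (Circle.exp s))
    have hF : ∀ s, f _ = (1 * Circle.exp s, m) := fun s => by rw [one_mul, hγ]
    have h2 := ((mfderiv_comp s hfd hd).app 1).symm
    have hcd := hfd.comp s hd
    have h3 := (basePart_mfderiv hcd (1 : ℝ)).trans ((congrArg (fun c => (mfderiv 𝓘(ℝ) (𝓡 7) c s (1 : ℝ) : E7)) (funext fun s => congrArg Prod.snd (hF s))).trans <| mfderiv_const.app 1)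
    have h5 := (circlePart_mfderiv hcd (1 : ℝ)).trans (((congrArg (fun c => dtheta (c s) (mfderiv% c s (1 : ℝ))) (funext fun s => congrArg Prod.fst (hF s))) : _ = _).trans (dtheta_rotation 1 s))
    have h7 := (congrArg _ (h2.symm.trans ((congrArg (mfderiv IA 𝓒(𝓡 7) f _) (hker _ _ ((congrArg _ ((mfderiv_comp s ((hc _).mdiffAt) hd).app 1).symm).trans h0) ((congrArg _ h2).trans h3))).trans (map_zero _)))).symm.trans h5
    exact zero_ne_one ((map_zero (circlePartL _)).symm.trans h7)

end

section

variable {M : Type*} [TopologicalSpace M] [ChartedSpace (𝔼 7) M] [IsManifold (𝓡 7) ∞ M]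
  {S : TorsionFreeG2 M} {N : Type*} [TopologicalSpace N] [ChartedSpace (𝔼 6) N]
  [IsManifold (𝓡 6) ∞ N] {Ψ : ℝ × N → M} {j : Z → N} {ι : X → M} {ε : ℝ} {f : Circle × X → Circle × M}

theorem mfderiv_sliceMk (θ : Circle) (x : X) (v : E') : (mfderiv I' 𝓒(I') (fun x => (θ, x)) x v : E1 × E') = (0, v) :=
  ((mfderiv_prodMk mdifferentiableAt_const mdifferentiableAt_id).app v).trans (Prod.ext (mfderiv_const.app v)
      (mfderiv_id.app v))

theorem contMDiff_sliceMk (θ : Circle) : CMDiff ∞ (fun x : X => (θ, x)) := contMDiff_const.prodMk contMDiff_id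

theorem mfderiv_slice (hf : ContMDiff 𝓒(I') 𝓒(𝓡 7) ∞ f) (θ : Circle) (x : X) (v : E') :
    (mfderiv I' (𝓡 7) (fun x => (f (θ, x)).2) x v : E7) =
      basePart (f (θ, x)) (mfderiv 𝓒(I') 𝓒(𝓡 7) f (θ, x) ((0, v) : E1 × E')) := by
  have h1 := hf.mdiffAt (x := (θ, x))
  have h2 := (contMDiff_sliceMk (I' := I') θ).mdiffAt (x := x)
  exact (basePart_mfderiv (h1.comp x h2) v).symm.trans (congrArg _ (((mfderiv_comp x h1 h2).app v).trans (congrArg _ (mfderiv_sliceMk θ x v))))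

theorem VelocityC1Le.slice {F : ℝ → Circle × X → Circle × M} (hι : ContMDiff I' (𝓡 7) ∞ ι)
    (hF : ContMDiff (𝓘(ℝ).prod 𝓒(I')) 𝓒(𝓡 7) ∞ (fun z : ℝ × (Circle × X) => F z.1 z.2))
    {r τ : ℝ} (hr : 0 ≤ r) {θ : Circle} {x : X}
    (h : VelocityC1Le 𝓒(I') S.prodMetric (Prod.map id ι) F τ (θ, x) r) :
    VelocityC1Le I' S.g.field ι (fun σ y => (F σ (θ, y)).2) τ x r := by
  exact h.snd_comp hF (contMDiff_sliceMk θ) hr fun u => le_of_eq ((congrArg (fun w => S.prodMetric (θ, ι x) (mfderiv 𝓒(I') 𝓒(𝓡 7) _ (θ, x) w) (mfderiv 𝓒(I') 𝓒(𝓡 7) _ (θ, x) w)) (mfderiv_sliceMk (E' := E') θ x u)).trans ((TorsionFreeG2.prodMetric_prodMap hι (θ, x) ((0, u))).trans ((congrArg (· + _) ((congrArg (fun r => r * r) (map_zero (dthetaL θ))).trans (zero_mul _))).trans (zero_add _))))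

theorem IsLocalDeformation.basePart_injective (hι : IsSmoothEmb (𝓡 7) I' ι) (hε : 0 ≤ ε) (hε1 : ε < 1)
    (hf : IsLocalDeformation 𝓒(I') 𝓒(IZ) 𝓒(𝓡 6) S.prodMetric (prodEnd Ψ)
      (Prod.map id j) (Prod.map id ι) ε f) (a : Circle × X) {v : E'}
    (hv : basePart (f a) (mfderiv 𝓒(I') 𝓒(𝓡 7) f a ((0, v) : E1 × E')) = 0) : v = 0 := by
  obtain ⟨hc, F, hF, h0, h1, hV, -⟩ := hf
  have e0 : ι = fun x => (F 0 (a.1, x)).2 := by rw [h0]; rfl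
  have h2 := abs_sqrt_length_sub_le (F := fun σ x => (F σ (a.1, x)).2) S.g.isRiem (contMDiff_snd.comp (hF.comp (contMDiff_fst.prodMk (contMDiff_const.prodMk contMDiff_snd)))) hε
    (fun τ hτ => e0 ▸ (hV τ hτ (a.1, a.2)).slice hι.smooth hF hε) v (right_mem_Icc.2 zero_le_one)
  set L := √(S.g.field (F 0 (a.1, a.2)).2 (mfderiv I' (𝓡 7) (fun x => (F 0 (a.1, x)).2) a.2 v)
    (mfderiv I' (𝓡 7) (fun x => (F 0 (a.1, x)).2) a.2 v)) with hL
  have h5 : |0 - L| ≤ ε * L := by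
    refine le_trans (le_of_eq (congrArg (fun r => |r - L|) (Real.sqrt_zero.symm.trans (congrArg Real.sqrt ?_)))) h2
    exact ((congrArg (fun w => S.g.field (F 1 (a.1, a.2)).2 w w) ((congrArg (fun c => (mfderiv I' (𝓡 7) c a.2 v)) (by rw [h1])).trans ((mfderiv_slice hc.embedding.smooth a.1 a.2 v).trans hv))).trans ((fun y => map_zero _) _)).symm
  have hL0 : 0 ≤ L := Real.sqrt_nonneg _
  rw [zero_sub, abs_neg, abs_of_nonneg hL0] at h5
  by_contra hne
  have h7 := S.g.isRiem.pos (ι a.2) (mfderiv I' (𝓡 7) ι a.2 v) fun h => hne (hι.immersion a.2 (h.trans (map_zero _).symm))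
  exact (Real.sqrt_pos.2 h7).ne' (Eq.trans (congrArg (fun c => √(S.g.field (c a.2) (mfderiv I' (𝓡 7) c a.2 v) (mfderiv I' (𝓡 7) c a.2 v))) e0) (by nlinarith))

theorem IsLocalDeformation.norm_fst_sub_le (hε : 0 ≤ ε) (hf : IsLocalDeformation 𝓒(I') 𝓒(IZ) 𝓒(𝓡 6) S.prodMetric (prodEnd Ψ)
      (Prod.map id j) (Prod.map id ι) ε f) (a : Circle × X) : ‖((f a).1 : ℂ) - a.1‖ ≤ ε := by
  obtain ⟨hc, F, hF, h0, rfl, hV, -⟩ := hf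
  have hs := family_contMDiff_fst hF a
  have hc : CMDiff 1 (fun τ => (F τ a).1) := (contMDiff_fst.comp hs).of_le (by simp)
  have h1 := norm_coe_circle_sub_le hc
  have e0 : (F 0 a).1 = a.1 := by rw [h0]; rfl
  simp only [e0] at h1
  refine h1.trans ?_
  have h2 := intervalIntegral.integral_mono_on zero_le_one
    ((circleMetric_isRiem.continuous_speed hc).sqrt.intervalIntegrable 0 1)
    (continuous_const (y := ε).intervalIntegrable (μ := MeasureTheory.volume) 0 1) fun τ hτ => ?_
  · refine h2.trans_eq ?_
    simp
  · exact Real.sqrt_le_iff.2 ⟨hε, le_trans (le_add_of_nonneg_right (S.g.isRiem.nonneg _ _)) (((TorsionFreeG2.prodMetric_mfderiv ((hs τ).mdiffAt) 1 1).symm.le).trans ((hV τ hτ a).velocity_le hF))⟩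

end

section

variable [T2Space M] [CompactSpace N] {g : SmoothMetric I M} {h : SmoothMetric J N} {Ψ : ℝ × N → M} {R : ℝ}
  {α : ℝ × Z → X} {w : ℝ × Z → N}

theorem IsACylManifold.exists_disjoint_end (hM : IsACylManifold g h Ψ) {K : Set M} (hK : IsCompact K) :
    ∃ T0 : ℝ, 0 < T0 ∧ (∀ T, T0 ≤ T → IsClosed (Ψ '' (Ici T ×ˢ univ))) ∧
      ∀ T, T0 ≤ T → Disjoint K (Ψ '' (Ici T ×ˢ univ)) := by
  obtain ⟨K', -, hΨ⟩ := hM.diffeo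
  obtain ⟨T0, hT0, hax⟩ := exists_axisBound g.isRiem h.isRiem hΨ hM.metric
  have hcl : ∀ T, T0 + 2 ≤ T → IsClosed _ := fun T hT => isClosed_image_end g.isRiem hΨ hT0 hax (by linarith)
  obtain ⟨i, hi⟩ := hK.elim_directed_family_closed
    (fun i : ℕ => Ψ '' (Ici (T0 + 2 + i) ×ˢ univ)) (fun i => hcl _ (by linarith [(Nat.cast_nonneg i : (0 : ℝ) ≤ i)])) (by
      refine eq_empty_of_forall_notMem fun m hm => ?_
      obtain ⟨q, hq, rfl⟩ := mem_iInter.1 hm.2 0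
      obtain ⟨n, hn⟩ := exists_nat_gt q.1
      obtain ⟨q', hq', e⟩ := mem_iInter.1 hm.2 n
      have h1 : T0 + 2 + (0 : ℕ) ≤ q.1 := hq.1
      have h2 : T0 + 2 + n ≤ q'.1 := hq'.1
      rw [Nat.cast_zero] at h1
      have e' : q' = q := hΨ.2.1.injOn (mem_halfCylinder (by linarith [(Nat.cast_nonneg n : (0 : ℝ) ≤ n)]) q'.2)
        (mem_halfCylinder (by linarith) q.2) e
      rw [e'] at h2
      linarith) (directed_of_isDirected_le fun i k hik => image_mono (prod_mono_left (Ici_subset_Ici.2 (by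
        have : (i : ℝ) ≤ k := by exact_mod_cast hik
        linarith))))
  exact ⟨T0 + 2 + i, by positivity, fun T hT => hcl T (by linarith [(Nat.cast_nonneg i : (0 : ℝ) ≤ i)]), fun T hT => (disjoint_iff_inter_eq_empty.2 hi).mono_right (image_mono (prod_mono_left (Ici_subset_Ici.2 hT)))⟩

theorem IsACylManifold.isClosed_range (hM : IsACylManifold g h Ψ) (hα : IsEnd I' IZ R α)
    {P : Type*} [TopologicalSpace P] [T2Space P] {f : X → P} (hf : Continuous f) {p : P → M} (hp : Continuous p)
    (hpα : ∀ q : ℝ × Z, R < q.1 → p (f (α q)) = Ψ (q.1, w q)) : IsClosed (range f) := by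
  refine isClosed_of_closure_subset fun y hy => ?_
  obtain ⟨T0, hT0, hcl, hd⟩ := hM.exists_disjoint_end (isCompact_singleton)
  have h1 : range f ⊆ f '' (α '' (Ioi (max R T0) ×ˢ univ))ᶜ ∪ p ⁻¹' (Ψ '' (Ici T0 ×ˢ univ)) := by
    rintro _ ⟨x, rfl⟩
    by_cases hx : x ∈ α '' (Ioi (max R T0) ×ˢ univ)
    · obtain ⟨q, hq, rfl⟩ := hx
      have hq' : max R T0 < q.1 := hq.1
      exact Or.inr ⟨(q.1, w q), ⟨((le_max_right _ _).trans_lt hq').le, trivial⟩,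
        (hpα q ((le_max_left _ _).trans_lt hq')).symm⟩
    · exact Or.inl (mem_image_of_mem f hx)
  rcases closure_minimal h1 (((hα.compact (max R T0) (le_max_left _ _)).image hf).isClosed.union ((hcl T0 le_rfl).preimage hp)) hy with h2 | h2
  · exact image_subset_range _ _ h2
  · exact (disjoint_left.1 (hd T0 le_rfl) rfl h2).elim

end

section

variable {M : Type*} [TopologicalSpace M] [ChartedSpace (𝔼 7) M] [IsManifold (𝓡 7) ∞ M]
  {f : Circle × X → Circle × M}

/-- The circle component of the differential of a map. -/
def circleDiff (I' : ModelWithCorners ℝ E' H') (f : Circle × X → Circle × M) (a : Circle × X) : E1 × E' →ₗ[ℝ] ℝ :=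
  (circlePartL (f a)) ∘ₗ (mfderiv 𝓒(I') 𝓒(𝓡 7) f a).toLinearMap

/-- The base component of the differential of a map. -/
def baseDiff (I' : ModelWithCorners ℝ E' H') (f : Circle × X → Circle × M) (a : Circle × X) : E1 × E' →ₗ[ℝ] E7 :=
  (basePartL (f a)) ∘ₗ (mfderiv 𝓒(I') 𝓒(𝓡 7) f a).toLinearMap

theorem eq_zero_of_diff {a : Circle × X} (hker : ∀ v : E', baseDiff I' f a (0, v) = 0 → v = 0) {W : E1 × E'}
    (hW1 : circleDiff I' f a W = 1) (hW2 : baseDiff I' f a W = 0) {u : E1 × E'}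
    (hu1 : circleDiff I' f a u = 0) {k : E7 →ₗ[ℝ] E'} (hk : ∀ v, k (baseDiff I' f a (0, v)) = v)
    (hu2 : k (baseDiff I' f a u) = 0) : u = 0 := by
  have hWn := fun h0 => by
    have h2 : W = (0, W.2) := Prod.ext (dtheta_eq_zero a.1 h0) rfl
    rw [h2] at hW2
    rw [h2, hker _ hW2, Prod.mk_zero_zero, map_zero] at hW1
    exact zero_ne_one hW1
  set r := dthetaL a.1 u.1 / dthetaL a.1 W.1 with hr
  have h1 := dtheta_eq_zero a.1 (by
    exact (map_sub (dthetaL a.1) _ _).trans (sub_eq_zero.2 (((map_smul (dthetaL a.1) r W.1).trans (div_mul_cancel₀ _ hWn)).symm)))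
  have h2 : u - r • W = (0, u.2 - r • W.2) := Prod.ext h1 rfl
  have h3 : baseDiff I' f a (u - r • W) = baseDiff I' f a u := by rw [map_sub, map_smul, hW2, smul_zero, sub_zero]
  rw [← h3, h2, hk] at hu2
  rw [hu2, Prod.mk_zero_zero, sub_eq_zero] at h2
  rw [h2, map_smul, hW1, smul_eq_mul, mul_one] at hu1
  rw [h2, hu1, zero_smul]

theorem eventually_rotation_mem_range (hf : ContMDiff 𝓒(I') 𝓒(𝓡 7) ∞ f)
    (hker : ∀ a v, baseDiff I' f a ((0, v) : E1 × E') = 0 → v = 0)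
    (hW : ∀ a, ∃ W : E1 × E', circleDiff I' f a W = 1 ∧ baseDiff I' f a W = 0) (a : Circle × X) :
    ∀ᶠ s : ℝ in 𝓝 0, ((f a).1 * Circle.exp s, (f a).2) ∈ range f := by
  have m1 : IsManifold 𝓒(I') 1 (Circle × X) := isManifold_one
  have m2 := isManifold_one (I := 𝓡 7) (M := M)
  have m3 := isManifold_one (I := I') (M := X)
  have hg := contMDiff_snd.comp (hf.comp (contMDiff_sliceMk a.1))
  obtain ⟨k, k1, k2, k3, -⟩ := exists_left_inverse (hg a.2) ((injective_iff_map_eq_zero _).2 fun v hv => hker a v ((mfderiv_slice hf a.1 a.2 v).symm.trans hv))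
  have hf1 := contMDiff_fst.comp hf
  have hf2 := contMDiff_snd.comp hf
  set P : Circle × X → Circle × X := fun b => ((f b).1, k (f b).2) with hP
  have hPs : ContMDiffAt 𝓒(I') 𝓒(I') ∞ P a := (hf1 a).prodMk (ContMDiffAt.comp a k1 (hf2 a))
  have hPa : P a = ((f a).1, a.2) := Prod.ext rfl k2
  have hPd : ∀ b, MDifferentiableAt (𝓡 7) I' k (f b).2 → ∀ u, (mfderiv 𝓒(I') 𝓒(I') P b u) =
        ((mfderiv 𝓒(I') (𝓡 1) _ b u : E1), (mfderiv (𝓡 7) I' k (f b).2 _ : E')) := fun b hb u => by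
    have hd2 := hf2.mdiffAt (x := b)
    exact ((mfderiv_prodMk hf1.mdiffAt
      (hb.comp b hd2)).app u).trans (Prod.ext rfl (((mfderiv_comp b hb hd2).app u).trans (congrArg (mfderiv (𝓡 7) I' k (f b).2) (basePart_mfderiv hf.mdiffAt u).symm)))
  have hcd : ∀ b (u : E1 × E'), circleDiff I' f b u = dtheta (f b).1 _ := fun b u => circlePart_mfderiv hf.mdiffAt u
  have hkd := k1.mdiffAt
  have hPi := (injective_iff_map_eq_zero _).2 fun u hu => by
      have h0 := (hPd a hkd u).symm.trans hu
      obtain ⟨W, hW1, hW2⟩ := hW a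
      refine eq_zero_of_diff (hker a) hW1 hW2 ((hcd a u).trans ((congrArg _ (congrArg Prod.fst h0)).trans
        (map_zero (dthetaL (f a).1)))) (fun v => ?_) (congrArg Prod.snd h0)
      have e1 : mfderiv I' I' _ a.2 = ContinuousLinearMap.id ℝ E' :=
        (EventuallyEq.mfderiv_eq (show (fun x => k (f (a.1, x)).2) =ᶠ[𝓝 a.2] id from k3)).trans mfderiv_id
      exact Eq.trans (congrArg _ (mfderiv_slice hf a.1 a.2 v).symm) (((mfderiv_comp a.2 hkd hg.mdiffAt).app v).symm.trans (e1.app v))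
  let A : E1 × E' →L[ℝ] E1 × E' := mfderiv 𝓒(I') 𝓒(I') P a
  obtain ⟨K, K1, K2, K3, K4⟩ := exists_left_inverse hPs hPi
  have K4 := K4 ((LinearMap.injective_iff_surjective (f := A.toLinearMap)).1 hPi)
  set ρ : ℝ → Circle × X := fun s => ((f a).1 * Circle.exp s, a.2) with hρ
  have hρs : ContMDiff 𝓘(ℝ) 𝓒(I') ∞ ρ := (contMDiff_rotation _).prodMk contMDiff_const
  have hρ0 : ρ 0 = P a := by simp [hPa, hρ]
  rw [← hρ0] at K1 K2 K4
  have hσ : ContMDiffAt 𝓘(ℝ) 𝓒(I') ∞ (fun s => K (ρ s)) 0 := ContMDiffAt.comp 0 K1 (hρs 0)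
  have hσa : Tendsto (fun s => K (ρ s)) (𝓝 0) (𝓝 a) := by
    have := hσ.continuousAt.tendsto
    rwa [K2] at this
  have hK1 : ∀ᶠ b in 𝓝 (ρ 0), ContMDiffAt 𝓒(I') 𝓒(I') 1 K b :=
    (contMDiffAt_iff_contMDiffAt_nhds (by simp)).1 (K1.of_le (by simp))
  have hk1 : ∀ᶠ m in 𝓝 (f a).2, ContMDiffAt (𝓡 7) I' 1 k m :=
    (contMDiffAt_iff_contMDiffAt_nhds (by simp)).1 (k1.of_le (by simp))
  have hev : ∀ᶠ s in 𝓝 (0 : ℝ), P (K (ρ s)) = ρ s ∧ (f (K (ρ s))).2 ∈ (ϕ (𝓡 7) (f a).2).source ∧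
      MDifferentiableAt 𝓘(ℝ) 𝓒(I') (fun s => K (ρ s)) s ∧
      (mfderiv 𝓘(ℝ) (𝓡 7) (fun s => (f (K (ρ s))).2) s (1 : ℝ) : E7) = 0 := by
    filter_upwards [(hρs 0).continuousAt.eventually K4, (hρs 0).continuousAt.eventually hK1,
      hσa.eventually (eventually_eventually_nhds.2 K3), hσa.eventually ((hf2 a).continuousAt.eventually hk1),
      hσa.eventually ((hf2 a).continuousAt.eventually (extChartAt_source_mem_nhds (I := 𝓡 7) (f a).2))]
      with s s1 s2 s3 s4 s5
    have hKd := s2.mdiffAt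
    have hρd := (hρs s).mdiffAt
    have hd := hKd.comp s hρd
    refine ⟨s1, s5, hd, ?_⟩
    have s4' := s4.mdiffAt
    obtain ⟨W, hW1, hW2⟩ := hW (K (ρ s))
    have e1 : (mfderiv 𝓘(ℝ) 𝓒(I') ρ s (1 : ℝ)) = ((mfderiv 𝓘(ℝ) (𝓡 1) _ s (1 : ℝ) : E1), 0) :=
      ((mfderiv_prodMk ((contMDiff_rotation _ s).mdiffAt) mdifferentiableAt_const).app 1).trans (Prod.ext rfl (mfderiv_const.app 1))
    have e2 : (mfderiv 𝓒(I') 𝓒(I') P (K (ρ s)) W) = mfderiv 𝓘(ℝ) 𝓒(I') ρ s (1 : ℝ) := by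
      refine (hPd _ s4' W).trans (Eq.trans (Prod.ext ?_ ?_) e1.symm)
      · exact sub_eq_zero.1 (dtheta_eq_zero (f (K (ρ s))).1 ((map_sub (dthetaL (f (K (ρ s))).1) _ _).trans
          (sub_eq_zero.2 (((hcd _ W).symm.trans hW1).trans ((dtheta_rotation (f a).1 s).symm.trans (congrArg (fun p => dtheta p _) (congrArg Prod.fst s1).symm))))))
      · exact (congrArg (mfderiv (𝓡 7) I' k _) hW2).trans (map_zero _)
    have e3 : W = mfderiv 𝓘(ℝ) 𝓒(I') (fun s => K (ρ s)) s (1 : ℝ) := by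
      have h1 : mfderiv 𝓒(I') 𝓒(I') _ (K (ρ s)) = ContinuousLinearMap.id ℝ (E1 × E') :=
        (EventuallyEq.mfderiv_eq (show (fun b => K (P b)) =ᶠ[𝓝 (K (ρ s))] id from s3)).trans mfderiv_id
      have h3 := h1.app W
      refine h3.symm.trans ((congrArg (fun A => A W) (mfderiv_comp (K (ρ s)) (s1 ▸ hKd) (hf1.mdiffAt.prodMk (s4'.comp (K (ρ s)) hf2.mdiffAt)))).trans ((congrArg _ e2).trans (Eq.trans ?_ ((mfderiv_comp s hKd hρd).app 1).symm)))
      exact congrArg (fun b => (mfderiv 𝓒(I') 𝓒(I') K b _)) s1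
    exact ((mfderiv_comp s (hf2.mdiffAt) hd).app 1).trans ((basePart_mfderiv (hf.mdiffAt) _).symm.trans ((congrArg _ e3).symm.trans hW2))
  obtain ⟨r, hr, hball⟩ := Metric.eventually_nhds_iff_ball.1 hev
  filter_upwards [Metric.ball_mem_nhds (0 : ℝ) hr] with s hs
  have hd := fun t ht => hf2.mdiffAt.comp t (hball t ht).2.2.1
  have hc : ∀ t ∈ Metric.ball (0 : ℝ) r, HasDerivAt (fun s => ϕ (𝓡 7) (f a).2 (f (K (ρ s))).2) 0 t := fun t ht => by
    have hsrc := (hball t ht).2.1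
    have h1 : DifferentiableAt ℝ (fun s => ϕ (𝓡 7) (f a).2 (f (K (ρ s))).2) t := by
      rw [← mdifferentiableAt_iff_differentiableAt]
      rw [extChartAt_source] at hsrc
      exact (mdifferentiableAt_extChartAt hsrc).comp t (hd t ht)
    exact h1.hasDerivAt.congr_deriv ((mfderiv_chart_comp (hd t ht) hsrc (1 : ℝ)).trans ((congrArg _ (hball t ht).2.2.2).trans (map_zero _)))
  have h0 := Metric.mem_ball_self (x := (0 : ℝ)) hr
  have h5 := Metric.isOpen_ball.is_const_of_deriv_eq_zero (convex_ball (0 : ℝ) r).isPreconnected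
    (fun t ht => (hc t ht).differentiableAt.differentiableWithinAt) (fun t ht => (hc t ht).deriv) hs h0
  refine ⟨K (ρ s), Prod.ext (congrArg Prod.fst (hball s hs).1 :) (((ϕ (𝓡 7) (f a).2).injOn (hball s hs).2.1 (hball 0 h0).2.1 h5).trans ?_)⟩
  simp only [K2]

theorem rotation_mem_range (hf : ContMDiff 𝓒(I') 𝓒(𝓡 7) ∞ f) (hcl : IsClosed (range f))
    (hker : ∀ a v, baseDiff I' f a ((0, v) : E1 × E') = 0 → v = 0)
    (hW : ∀ a, ∃ W : E1 × E', circleDiff I' f a W = 1 ∧ baseDiff I' f a W = 0) {θ : Circle} {m : M}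
    (h : (θ, m) ∈ range f) (θ' : Circle) : (θ', m) ∈ range f := by
  have h1 : IsClopen {s : ℝ | (θ * Circle.exp s, m) ∈ range f} := by
    refine ⟨hcl.preimage (by fun_prop), isOpen_iff_mem_nhds.2 ?_⟩
    rintro s0 ⟨b, hb⟩
    have h2 := eventually_rotation_mem_range hf hker hW b
    rw [hb] at h2
    have h3 : Tendsto (fun s => s - s0) (𝓝 s0) (𝓝 0) := by
      have := (continuous_sub_right s0).tendsto s0
      rwa [sub_self] at this
    filter_upwards [h3.eventually h2] with s hs
    rwa [mul_assoc, ← Circle.exp_add, add_sub_cancel] at hs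
  have h3 : Complex.arg ((θ⁻¹ * θ' : Circle)) ∈ {s : ℝ | (θ * Circle.exp s, m) ∈ range f} := (h1.eq_univ ⟨0, by simpa using h⟩) ▸ mem_univ _
  rwa [mem_ofPred_eq, Circle.exp_arg, mul_inv_cancel_left] at h3

end

section

variable {M : Type*} [TopologicalSpace M] [ChartedSpace (𝔼 7) M] [IsManifold (𝓡 7) ∞ M]
  {f : Circle × X → Circle × M}

theorem exists_lift (hrot : ∀ θ m, (θ, m) ∈ range f → ∀ θ', (θ', m) ∈ range f) {θ : Circle} {m : M}
    (hm : (θ, m) ∈ range f) : ∃ γ : Circle → Circle × X, ∀ θ, f (γ θ) = (θ, m) := by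
  choose γ hγ using hrot θ m hm
  exact ⟨γ, hγ⟩

theorem existsUnique_slice (hf : IsSmoothEmb 𝓒(𝓡 7) 𝓒(I') f)
    (hclose : ∀ a, ‖((f a).1 : ℂ) - a.1‖ < 2) (hker : ∀ a v, baseDiff I' f a ((0, v) : E1 × E') = 0 → v = 0)
    (hrot : ∀ θ m, (θ, m) ∈ range f → ∀ θ', (θ', m) ∈ range f) {θ : Circle} {m : M}
    (hm : (θ, m) ∈ range f) : ∃! x, (f (1, x)).2 = m := by
  obtain ⟨γ, hγ⟩ := exists_lift hrot hm
  obtain ⟨θ, hθ, hθu⟩ := hf.existsUnique_eq_one hγ (fun θ => contMDiffAt_fst) (fun θ => by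
      have := hclose (γ θ)
      rwa [hγ, norm_sub_rev] at this)
    (fun θ v h1 h2 => by
      have h4 : v = ((0 : E1), v.2) := Prod.ext (dtheta_eq_zero (γ θ).1 ((congrArg (fun A : E1 × E' →L[ℝ] E1 => dtheta (γ θ).1 (A v)) mfderiv_fst).symm.trans h1)) rfl
      rw [h4] at h2 ⊢
      rw [hker (γ θ) v.2 h2, Prod.mk_zero_zero])
  refine ⟨(γ θ).2, ?_, fun x hx => ?_⟩
  · have e : (1, (γ θ).2) = γ θ := Prod.ext hθ.symm rfl
    simp only [e, hγ]
  · have h1 : (1, x) = γ (f (1, x)).1 := hf.embedding.injective (by rw [hγ, ← hx])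
    rw [hθu (f (1, x)).1 (congrArg Prod.fst h1.symm)] at h1
    exact congrArg Prod.snd h1

theorem range_eq_univ_prod (hf : IsSmoothEmb 𝓒(𝓡 7) 𝓒(I') f)
    (hclose : ∀ a, ‖((f a).1 : ℂ) - a.1‖ < 2) (hker : ∀ a v, baseDiff I' f a ((0, v) : E1 × E') = 0 → v = 0)
    (hrot : ∀ θ m, (θ, m) ∈ range f → ∀ θ', (θ', m) ∈ range f) :
    range f = univ ×ˢ range (fun x => (f (1, x)).2) := by
  ext ⟨θ, m⟩
  constructor
  · exact fun h => ⟨trivial, (existsUnique_slice hf hclose hker hrot h).exists⟩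
  · rintro ⟨-, x, hx⟩
    exact hrot (f (1, x)).1 m ⟨(1, x), Prod.ext rfl hx⟩ θ

theorem slice_isClosedEmbedding (hf : IsSmoothEmb 𝓒(𝓡 7) 𝓒(I') f)
    (hclose : ∀ a, ‖((f a).1 : ℂ) - a.1‖ < 2) (hker : ∀ a v, baseDiff I' f a ((0, v) : E1 × E') = 0 → v = 0)
    (hrot : ∀ θ m, (θ, m) ∈ range f → ∀ θ', (θ', m) ∈ range f) (hcl : IsClosed (range f)) :
    IsClosedEmbedding (fun x => (f (1, x)).2) := by
  refine .of_continuous_injective_isClosedMap (continuous_snd.comp (hf.embedding.continuous.comp (by fun_prop)))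
    (fun x y hxy => ?_) ?_
  · exact (existsUnique_slice hf hclose hker hrot ⟨(1, x), rfl⟩).unique rfl hxy.symm
  · have h1 : IsClosedEmbedding (fun x : X => ((1 : Circle), x)) := by
      refine ⟨isEmbedding_prodMkRight 1, ?_⟩
      have : range (fun x : X => ((1 : Circle), x)) = Prod.fst ⁻¹' {1} := by
        ext ⟨θ, x⟩
        simp [eq_comm]
      rw [this]
      exact isClosed_singleton.preimage continuous_fst
    exact isClosedMap_snd_of_compactSpace.comp ((IsClosedEmbedding.mk hf.embedding hcl).isClosedMap.comp h1.isClosedMap)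

theorem IsCompleteAlong.of_isClosedEmbedding {E H M : Type*} [NormedAddCommGroup E] [NormedSpace ℝ E]
    [TopologicalSpace H] {I : ModelWithCorners ℝ E H} [TopologicalSpace M] [ChartedSpace H M]
    {g : MetricField I M} {f : X → M} (hf : CMDiff ∞ f) (hcl : IsClosedEmbedding f)
    (h : IsCompleteAlong I g (id : M → M)) : IsCompleteAlong I' g f := by
  intro u hu
  obtain ⟨y, hy⟩ := h _ fun ε hε => by
    obtain ⟨n0, hn0⟩ := hu ε hε
    refine ⟨n0, fun m n hm hn => ?_⟩
    obtain ⟨γ, h1, h2, h3, h4⟩ := hn0 m n hm hn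
    refine ⟨fun s => f (γ s), (hf.of_le (by simp)).comp h1, congrArg f h2, congrArg f h3, lt_of_eq_of_lt (congrArg (fun F => ∫ s in (0 : ℝ)..1, F s) (funext fun s => ?_)) h4⟩
    have e := (congrArg (fun A => A (mfderiv% (fun s => f (γ s)) s (1 : ℝ))) mfderiv_id).trans
        ((mfderiv_comp s hf.mdiffAt ((h1 s).mdiffAt)).app 1)
    exact congrArg (fun w => √(g (f (γ s)) w w)) e
  obtain ⟨x, rfl⟩ := hcl.isClosed_range.mem_of_tendsto hy (Eventually.of_forall fun n => mem_range_self _)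
  exact ⟨x, hcl.isInducing.tendsto_nhds_iff.2 hy⟩

end

section

variable {M : Type*} [TopologicalSpace M] [T2Space M] [ChartedSpace (𝔼 7) M]
  [IsManifold (𝓡 7) ∞ M] {S : TorsionFreeG2 M} {N : Type*} [TopologicalSpace N] [CompactSpace N]
  [ChartedSpace (𝔼 6) N] [IsManifold (𝓡 6) ∞ N] {h : SmoothMetric (𝓡 6) N} {X : Type*}
  [TopologicalSpace X] [ChartedSpace (𝔼 3) X] [IsManifold (𝓡 3) ∞ X] {Z : Type*}
  [TopologicalSpace Z] [CompactSpace Z] [ChartedSpace (𝔼 2) Z] [IsManifold (𝓡 2) ∞ Z]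
  {Ψ : ℝ × N → M} {j : Z → N} {ι : X → M} {ε : ℝ} {f : Circle × X → Circle × M}

theorem TorsionFreeG2.IsCayley.psiP_eq_zero (hM : IsACylManifold S.g h Ψ)
    (hι : IsACylSubmanifold (𝓡 3) (𝓡 2) (𝓡 6) S.g.field Ψ j ι) (hε : 0 ≤ ε)
    (hf : IsLocalDeformation 𝓒(𝓡 3) 𝓒(𝓡 2) 𝓒(𝓡 6) S.prodMetric (prodEnd Ψ) (Prod.map id j) (Prod.map id ι) ε f)
    (hcf : S.IsCayley 𝓒(𝓡 3) f) (a : Circle × X) :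
    ∀ v : Fin 4 → E13, S.psiP (f a) (fun i => mfderiv 𝓒(𝓡 3) 𝓒(𝓡 7) f a (v i)) = 0 := by
  obtain ⟨R, α, w, hR, hα, hws, hαw, hw⟩ := hι.exists_end
  have : T2Space X := hι.embedding.embedding.t2Space
  have hadd : ∀ z u, S.cayley z u = S.thetaPhi z u + S.psiP z u := fun z u => rfl
  have hαw' : ∀ q : ℝ × (Circle × Z), R < q.1 → Prod.map id ι (q.2.1, α (q.1, q.2.2)) =
      prodEnd Ψ (q.1, (q.2.1, w (q.1, q.2.2))) := fun q hq => Prod.ext rfl (hαw (q.1, q.2.2) hq)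
  have hbd := EndBounded.prodMap
    (hι.embedding.smooth.comp_contMDiffOn hα.diffeo.1) (hM.endBounded hι.cross_section.smooth hws hw hαw)
  exact hf.pull_eq_zero S.prodMetric_isRiem S.psiP_smooth S.psiP_closed S.cayley_smooth S.gramAt_le
      (fun z u => (le_add_of_nonneg_left (sq_nonneg _)).trans (S.comass z u))
      (fun z u h1 => by
        have h2 := S.comass z u
        rw [← h1, hadd] at h2
        rw [hadd]
        nlinarith [sq_nonneg (S.psiP z u)]) hε hα.prodMap hR
      hαw' hbd (hM.isClosed_end hα.prodMap hR (hι.embedding.smooth.continuous.comp continuous_snd) fun q hq => hαw (q.1, q.2.2) hq)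
      (by simp) (by simp)
      (fun x u => TorsionFreeG2.psiP_prodMap hι.embedding.smooth x u) (S.cayleyForm_eq ▸ hcf) a

theorem TorsionFreeG2.IsCayley.exists_circleDiff_eq_one (hf : IsSmoothEmb 𝓒(𝓡 7) 𝓒(𝓡 3) f)
    (hcf : S.IsCayley 𝓒(𝓡 3) f) (a : Circle × X) (h0 : ∀ v : Fin 4 → E13, S.psiP (f a)
      (fun i => mfderiv 𝓒(𝓡 3) 𝓒(𝓡 7) f a (v i)) = 0) :
    ∃ W : E13, circleDiff (𝓡 3) f a W = 1 ∧ baseDiff (𝓡 3) f a W = 0 := by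
  let b : Module.Basis (Fin 4) ℝ E13 := Module.finBasisOfFinrankEq ℝ E13 (by simp)
  obtain ⟨W', hW', h1, h2⟩ := TorsionFreeG2.exists_theta_mem_span (S := S) (S.prodMetric_isRiem.gramAt_pos
    (hf.linearIndependent b.linearIndependent)).ne' (by
      refine Eq.trans (congrArg (· ^ 2) (Eq.symm ?_)) (hcf a b)
      rw [TorsionFreeG2.cayleyForm_eq]
      exact (show S.cayley _ _ = S.thetaPhi _ _ + S.psiP _ _ from rfl).trans (by rw [h0 b, add_zero]))
  have h3 : W' ∈ LinearMap.range (mfderiv 𝓒(𝓡 3) 𝓒(𝓡 7) f a).toLinearMap :=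
    Submodule.span_le.2 (by rintro _ ⟨i, rfl⟩; exact ⟨b i, rfl⟩) hW'
  obtain ⟨W, rfl⟩ := h3
  exact ⟨W, h1, h2⟩

theorem TorsionFreeG2.IsCayley.isAssociative_slice (hf : ContMDiff 𝓒(𝓡 3) 𝓒(𝓡 7) ∞ f) (hcf : S.IsCayley 𝓒(𝓡 3) f)
    (hW : ∀ a, ∃ W : E13, circleDiff (𝓡 3) f a W = 1 ∧ baseDiff (𝓡 3) f a W = 0) :
    S.IsAssociative (𝓡 3) (fun x => (f (1, x)).2) := fun x u => by
  obtain ⟨W, hW1, hW2⟩ := hW (1, x)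
  let u' : Fin 3 → 𝔼 3 := u
  let v : Fin 4 → E13 := Fin.cons W fun i => ((0 : E1), u' i) - circleDiff (𝓡 3) f (1, x) ((0 : E1), u' i) • W
  have hc : ∀ i : Fin 3, circleDiff (𝓡 3) f (1, x) (v i.succ) = 0 := fun i => by
    simp only [v, Fin.cons_succ, map_sub, map_smul, hW1, smul_eq_mul, mul_one, sub_self]
  have hb : ∀ i : Fin 3, baseDiff (𝓡 3) f (1, x) (v i.succ) = mfderiv (𝓡 3) (𝓡 7) (fun x => (f (1, x)).2) x (u i) := fun i => by
    refine Eq.trans ?_ (mfderiv_slice hf 1 x (u' i)).symm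
    simp only [v, Fin.cons_succ, map_sub, map_smul, hW2, smul_zero, sub_zero]
    rfl
  obtain ⟨h1, h2, h3⟩ := TorsionFreeG2.frame_eq (v := fun i => mfderiv 𝓒(𝓡 3) 𝓒(𝓡 7) f (1, x) (v i)) hW2 hc
  have h4 := hcf (1, x) v
  rw [TorsionFreeG2.cayleyForm_eq] at h4
  have hb' := funext hb
  have h5 : circlePart (f (1, x)) (mfderiv 𝓒(𝓡 3) 𝓒(𝓡 7) f (1, x) (v 0)) = 1 := hW1
  have h6 : S.cayley (f (1, x)) (fun i => mfderiv 𝓒(𝓡 3) 𝓒(𝓡 7) f (1, x) (v i)) =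
      S.φ (f (1, x)).2 (fun i => mfderiv (𝓡 3) (𝓡 7) (fun x => (f (1, x)).2) x (u i)) := by
    refine (congrArg₂ (· + ·) h1 h2).trans ((add_zero _).trans ?_)
    rw [h5, one_mul]
    exact congrArg _ hb'
  refine (congrArg (· ^ 2) h6).symm.trans (h4.trans (h3.trans ?_))
  rw [h5, one_pow, one_mul]
  exact congrArg _ hb'

end

section

variable [CompactSpace N] {R : ℝ} {w : ℝ × (Circle × Z) → Circle × N} {j : Z → N}

theorem ExpConverges.slice (hw : ExpConverges 𝓒(J) 𝓒(IZ) w (Prod.map id j)) (hj : CMDiff ∞ j)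
    (hws : ContMDiffOn (𝓘(ℝ).prod 𝓒(IZ)) 𝓒(J) ∞ w (Ioi R ×ˢ univ)) (θ : Circle) :
    ExpConverges J IZ (fun q => (w (q.1, (θ, q.2))).2) j := by
  have hs : (ϕ (𝓡 1) θ).symm _ = θ := extChartAt_to_inv θ
  refine hw.of_chart (contMDiff_id.prodMap hj) hws fun z q => ⟨(θ, z), (θ, q), ContinuousLinearMap.snd ℝ E1 EN,
    ContinuousLinearMap.inr ℝ E1 EZ, (ϕ (𝓡 1) θ θ, 0), fun y => ?_, fun y hy => ?_⟩
  · simp only [extChartAt_prod, ContinuousLinearMap.inr_apply, Prod.mk_add_mk, zero_add, add_zero,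
      PartialEquiv.prod_coe_symm, PartialEquiv.prod_coe, hs]
    rfl
  · simp only [extChartAt_prod, ContinuousLinearMap.inr_apply, Prod.mk_add_mk, zero_add, add_zero,
      PartialEquiv.prod_coe_symm, hs]
    exact ⟨⟨mem_extChartAt_target θ, hy⟩, fun h => ⟨⟨mem_extChartAt_source θ, h⟩, fun t h => h.2⟩⟩

theorem ExpConverges.eventually_norm_fst_sub_lt [CompactSpace Z]
    (hw : ExpConverges 𝓒(J) 𝓒(IZ) w (Prod.map id j)) (hj : CMDiff ∞ j)
    (hws : ContMDiffOn (𝓘(ℝ).prod 𝓒(IZ)) 𝓒(J) ∞ w (Ioi R ×ˢ univ)) :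
    ∀ᶠ t : ℝ in atTop, ∀ a : Circle × Z, ‖((w (t, a)).1 : ℂ) - a.1‖ < 2 := by
  refine eventually_forall_of_local fun a0 => ?_
  obtain ⟨V, hV, h⟩ := hw.eventually_mem_nhds (contMDiff_id.prodMap hj) hws
    a0 (continuous_fst.continuousAt.preimage_mem_nhds (Metric.ball_mem_nhds _ one_pos))
  refine ⟨V ∩ Prod.fst ⁻¹' Metric.ball a0.1 1, inter_mem hV
    (continuous_fst.continuousAt.preimage_mem_nhds (Metric.ball_mem_nhds _ one_pos)), ?_⟩
  filter_upwards [h] with t ht a ha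
  have h1 : dist (w (t, a)).1 a0.1 < 1 := ht a ha.1
  have h2 : dist a.1 a0.1 < 1 := ha.2
  have h3 : dist (w (t, a)).1 a.1 < 2 := by linarith [dist_triangle_right (w (t, a)).1 a.1 a0.1]
  rw [← dist_eq_norm]
  exact h3

theorem ExpConverges.eventually_slice_immersion [CompactSpace Z]
    (hw : ExpConverges 𝓒(J) 𝓒(IZ) w (Prod.map id j)) (hj : IsSmoothEmb J IZ j)
    (hws : ContMDiffOn (𝓘(ℝ).prod 𝓒(IZ)) 𝓒(J) ∞ w (Ioi R ×ˢ univ)) :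
    ∀ᶠ t : ℝ in atTop, ∀ a : Circle × Z, Function.Injective (mfderiv% (fun z => (w (t, (a.1, z))).2) a.2) := by
  refine eventually_forall_of_local fun a0 => ?_
  have m1 := isManifold_one (I := J) (M := N)
  have m1' := isManifold_one (I := IZ) (M := Z)
  let B : EZ →L[ℝ] EN := mfderiv% j a0.2
  have hB : {L : EZ →L[ℝ] EN | Function.Injective L} ∈ 𝓝 B :=
    ContinuousLinearMap.isOpen_injective.mem_nhds (hj.immersion a0.2)
  obtain ⟨η, hη, hηB⟩ := Metric.mem_nhds_iff.1 hB
  obtain ⟨C, -, -, hCn, hCt, hC, h⟩ := hw.exists_chart (contMDiff_id.prodMap hj.smooth) hws a0 univ_mem (half_pos hη)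
  set Φ : ℝ × (E1 × EZ) → E1 × EN := fun z => ϕ 𝓒(J) _ (w _) with hΦ
  set Φ' : E1 × EZ → E1 × EN := fun y => ϕ 𝓒(J) (Prod.map id j a0) _ with hΦ'
  set y0 := ϕ 𝓒(IZ) a0 a0 with hy0
  let π : (E1 × EZ →L[ℝ] E1 × EN) →L[ℝ] (EZ →L[ℝ] EN) :=
    (ContinuousLinearMap.compL ℝ EZ (E1 × EN) EN (ContinuousLinearMap.snd ℝ E1 EN)) ∘L
      ((ContinuousLinearMap.compL ℝ EZ (E1 × EZ) (E1 × EN)).flip (ContinuousLinearMap.inr ℝ E1 EZ))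
  have hπ : π (fderiv ℝ Φ' y0) = B := by
    refine ((((hC y0 (mem_of_mem_nhds hCn)).2.diffAt).hasFDerivAt.comp y0.2 (hasFDerivAt_prodMk_right y0.1 y0.2)).snd).fderiv.symm.trans ?_
    have h2 : B = fderivWithin ℝ _ (range IZ) _ := hj.smooth.mdiffAt.mfderiv
    rw [h2, IZ.range_eq_univ, fderivWithin_univ]
    rfl
  have hnear : ∀ᶠ y in 𝓝 y0, ‖π (fderiv ℝ Φ' y) - B‖ < η / 2 := by
    have h1 : ContinuousAt (fun y => π _) y0 := π.continuous.continuousAt.comp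
      (((hC y0 (mem_of_mem_nhds hCn)).2.fderiv_right (m := 0) (by simp)).continuousAt)
    have h2 := Metric.tendsto_nhds.1 h1 _ (half_pos hη)
    simp only [hπ] at h2
    simpa only [dist_eq_norm] using h2
  refine ⟨(ϕ 𝓒(IZ) a0).source ∩ ϕ 𝓒(IZ) a0 ⁻¹' (C ∩ {y | ‖π _ - B‖ < η / 2}), inter_mem (extChartAt_source_mem_nhds a0)
    ((continuousAt_extChartAt a0).preimage_mem_nhds (inter_mem hCn hnear)), ?_⟩
  filter_upwards [h, eventually_gt_atTop R] with t ht htR a ⟨ha, haC, haη⟩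
  obtain ⟨h1, -, h2, h3⟩ := ht _ haC
  set y := ϕ 𝓒(IZ) a0 a with hy
  let D : EZ →L[ℝ] EN := π ((fderiv ℝ Φ (t, y)) ∘L ContinuousLinearMap.inr ℝ ℝ (E1 × EZ))
  have hD : Function.Injective D := by
    refine hηB (mem_ball_iff_norm.2 ?_)
    have h4 : ‖D - π (fderiv ℝ Φ' y)‖ ≤ η / 2 := by
      refine ContinuousLinearMap.opNorm_le_bound _ (half_pos hη).le fun v => le_trans ?_ ((h3 (0, v)).trans_eq ?_)
      · exact norm_snd_le (fderiv ℝ Φ (t, y) (0, (0, v)) - fderiv ℝ Φ' y (0, v))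
      · rw [Prod.norm_mk, norm_zero, max_eq_right (norm_nonneg v)]
    calc ‖D - B‖ = ‖(D - π _) + (π _ - B)‖ := by rw [sub_add_sub_cancel]
      _ ≤ _ := norm_add_le _ _
      _ < η := by linarith [show ‖π _ - B‖ < η / 2 from haη]
  have hDd := (h2.diffAt.hasFDerivAt.comp y.2 ((hasFDerivAt_prodMk_right t (y.1, y.2)).comp y.2
      (hasFDerivAt_prodMk_right y.1 y.2))).snd
  rw [(ϕ 𝓒(IZ) a0).left_inv ha, extChartAt_prod] at h1
  rw [extChartAt_prod] at ha
  have hsrc := ha.2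
  have hwz : MDiffAt (fun z => (w (t, (a.1, z))).2) a.2 := (contMDiffAt_snd.comp a.2 ((hws.contMDiffAt ((isOpen_halfCylinder R).mem_nhds (mem_halfCylinder htR _))).comp a.2 (contMDiffAt_const.prodMk
      (contMDiffAt_const.prodMk contMDiffAt_id)))).mdiffAt
  have hcn : MDiffAt (ϕ J (j a0.2)) (w _).2 :=
    mdifferentiableAt_extChartAt (by have := h1.2; rwa [extChartAt_source] at this)
  have he : (ϕ J (j a0.2)) ∘ (fun z => (w (t, (a.1, z))).2) =ᶠ[𝓝 a.2] (fun ζ => (Φ (t, (y.1, ζ))).2) ∘ ϕ IZ a0.2 := by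
    filter_upwards [extChartAt_source_mem_nhds' hsrc] with z hz
    have h5 : (ϕ 𝓒(IZ) a0).symm (y.1, ϕ IZ a0.2 z) = (a.1, z) := by
      rw [extChartAt_prod]
      exact Prod.ext ((ϕ (𝓡 1) a0.1).left_inv ha.1) ((ϕ IZ a0.2).left_inv hz)
    simp only [hΦ, Function.comp_apply, h5]
    rfl
  refine (injective_iff_map_eq_zero _).2 fun u hu => ?_
  have h6 : D (mfderiv% (ϕ IZ a0.2) a.2 u) = 0 := by
    exact Eq.trans (Eq.trans (congrArg (fun A => A (mfderiv% (ϕ IZ a0.2) a.2 u)) (mfderiv_eq_fderiv.trans hDd.fderiv).symm) (((mfderiv_comp a.2 hDd.differentiableAt.mdifferentiableAt (mdifferentiableAt_extChartAt (by rwa [extChartAt_source] at hsrc))).symm.trans ((he.mfderiv_eq).symm.trans (mfderiv_comp a.2 hcn hwz))).app u)) ((congrArg (mfderiv% (ϕ J (j a0.2)) (w _).2) hu).trans (map_zero _))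
  exact (isInvertible_mfderiv_extChartAt hsrc).injective ((hD (h6.trans (map_zero D).symm)).trans (map_zero _).symm)

end

section

variable {M : Type*} [TopologicalSpace M] [ChartedSpace (𝔼 7) M] [IsManifold (𝓡 7) ∞ M]
  [CompactSpace N] {Ψ : ℝ × N → M} {S : Set M} {R : ℝ} {α : ℝ × (Circle × Z) → Circle × X}
  {w : ℝ × (Circle × Z) → Circle × N} {f : Circle × X → Circle × M}

theorem IsDiffeoOn.eq_zero_of_mfderiv (hΨ : IsDiffeoOn (𝓡 7) (𝓘(ℝ).prod J) Ψ (Ioi (0 : ℝ) ×ˢ univ) S)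
    {EA HA A : Type*} [NormedAddCommGroup EA] [NormedSpace ℝ EA] [TopologicalSpace HA]
    {IA : ModelWithCorners ℝ EA HA} [TopologicalSpace A] [ChartedSpace HA A] {g : A → ℝ} {n : A → N} {a : A}
    (hg : MDiffAt g a) (hn : MDiffAt n a) (ha : 0 < g a) {v : EA}
    (hv : (mfderiv IA (𝓡 7) (fun a => Ψ (g a, n a)) a v : E7) = 0) :
    (mfderiv IA 𝓘(ℝ) g a v : ℝ) = 0 ∧ (mfderiv IA J n a v : EN) = 0 := by
  have hm := mem_halfCylinder ha (n a)
  exact Prod.ext_iff.1 (((mfderiv_prodMk hg hn).app v).symm.trans ((hΨ.2.2 _ hm).1 ((((mfderiv_comp a ((hΨ.1.contMDiffAt ((isOpen_halfCylinder 0).mem_nhds hm)).mdiffAt) (hg.prodMk hn)).app v).symm.trans hv).trans (map_zero _).symm)))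

theorem mfderiv_slice_snd (hw : MDiffAt w q0) (v : EZ) :
    (mfderiv% (fun q => (w q).2) q0 ((0, (0, v)) : ℝ × (E1 × EZ)) : EN) =
      mfderiv% (fun z => (w (q0.1, (q0.2.1, z))).2) q0.2.2 v := by
  have h2 : (mfderiv IZ (𝓘(ℝ).prod 𝓒(IZ)) (fun z => (q0.1, (q0.2.1, z))) q0.2.2 v : ℝ × (E1 × EZ)) = (0, (0, v)) :=
    ((mfderiv_prodMk mdifferentiableAt_const (mdifferentiableAt_const.prodMk mdifferentiableAt_id)).app v).trans
    (Prod.ext (mfderiv_const.app v) (mfderiv_sliceMk q0.2.1 q0.2.2 v))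
  have h3 := mfderiv_comp q0.2.2 (mdifferentiableAt_snd.comp q0 hw) (mdifferentiableAt_const.prodMk (mdifferentiableAt_const.prodMk mdifferentiableAt_id))
  exact ((h3.app v).trans (congrArg (mfderiv% (fun q => (w q).2) q0) h2)).symm

theorem existsUnique_slice_end (hΨ : IsDiffeoOn (𝓡 7) (𝓘(ℝ).prod J) Ψ (Ioi (0 : ℝ) ×ˢ univ) S)
    (hf : IsSmoothEmb 𝓒(𝓡 7) 𝓒(I') f)
    (hrot : ∀ θ m, (θ, m) ∈ range f → ∀ θ', (θ', m) ∈ range f)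
    (hα : IsEnd 𝓒(I') 𝓒(IZ) R α) (hR : 0 ≤ R)
    (hws : ContMDiffOn (𝓘(ℝ).prod 𝓒(IZ)) 𝓒(J) ∞ w (Ioi R ×ˢ univ))
    (hαw : ∀ q, R < q.1 → f (α q) = prodEnd Ψ (q.1, w q)) {t : ℝ} (ht : R < t)
    (hclose : ∀ a : Circle × Z, ‖((w (t, a)).1 : ℂ) - a.1‖ < 2)
    (himm : ∀ a : Circle × Z, Function.Injective (mfderiv% (fun z => (w (t, (a.1, z))).2) a.2))
    {n : N} (hin : ∀ a, (f a).2 = Ψ (t, n) → a ∈ α '' (Ioi R ×ˢ univ)) {θ : Circle}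
    (hm : (θ, Ψ (t, n)) ∈ range f) : ∃! z, (w (t, (1, z))).2 = n := by
  obtain ⟨γ, hγ⟩ := exists_lift hrot hm
  have ht0 := hR.trans_lt ht
  have hpt : ∀ θ, ∃ b, α (t, b) = γ θ ∧ w (t, b) = (θ, n) := fun θ => by
    obtain ⟨⟨s, b⟩, ⟨hs, -⟩, e⟩ := hin (γ θ) (congrArg Prod.snd (hγ θ))
    have hs' := hs
    have h1 := (hαw (s, b) hs').symm.trans ((congrArg f e).trans (hγ θ))
    have h2 := hΨ.2.1.injOn (mem_halfCylinder (hR.trans_lt hs') (w (s, b)).2) (mem_halfCylinder ht0 n) (congrArg Prod.snd h1)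
    have h3 := congrArg Prod.fst h2
    subst h3
    have h4 := congrArg Prod.fst h1
    have h5 := congrArg Prod.snd h2
    exact ⟨b, e, Prod.ext h4 h5⟩
  choose b hb hbw using hpt
  have : Nonempty Z := ⟨(b 1).2⟩
  obtain ⟨k, hk1, hk2, hk3, hk4⟩ := hα.diffeo.exists_inverse (isOpen_halfCylinder R)
  have hkγ : ∀ θ, k (γ θ) = (t, b θ) := fun θ => by
    rw [← hb θ]
    exact hk1 _ (mem_halfCylinder ht _)
  have hmem := fun θ =>
    (hα.isOpen_image (isOpen_halfCylinder R) fun q hq => hq.1).mem_nhds ⟨(t, b θ), mem_halfCylinder ht _, hb θ⟩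
  have hks := fun θ => hk4.contMDiffAt (hmem θ)
  obtain ⟨θ, hθ, hθu⟩ := hf.existsUnique_eq_one hγ (c := fun a => (k a).2.1)
    (fun θ => contMDiffAt_fst.comp _ (contMDiffAt_snd.comp _ (hks θ)))
    (fun θ => by
      rw [hkγ, norm_sub_rev]
      simpa only [hbw] using hclose (b θ))
    (fun θ v h1 h2 => by
      have hkd := (hks θ).mdiffAt
      have hwd : MDiffAt w (k (γ θ)) := by
        rw [hkγ]
        exact (hws.contMDiffAt ((isOpen_halfCylinder R).mem_nhds (mem_halfCylinder ht _))).mdiffAt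
      let u : ℝ × (E1 × EZ) := mfderiv% k (γ θ) v
      have hc : (mfderiv% (fun a => (k a).2.1) (γ θ) v : E1) = u.2.1 := by
        exact ((mfderiv_comp (γ θ) mdifferentiableAt_fst (mdifferentiableAt_snd.comp _ hkd)).app v).trans ((congrArg (fun A => A (mfderiv% (fun a => (k a).2) (γ θ) v)) mfderiv_fst).trans ((congrArg (fun A => (A v).1) (mfderiv_comp (γ θ) mdifferentiableAt_snd hkd)).trans (congrArg (fun A : ℝ × (E1 × EZ) →L[ℝ] E1 × EZ => (A u).1) mfderiv_snd)))
      have he : (fun a => (f a).2) =ᶠ[𝓝 (γ θ)] fun a => Ψ ((k a).1, (w (k a)).2) := by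
        filter_upwards [hmem θ] with a ha
        have h3 := hαw (k a) (hk2 ha).1
        rw [hk3 a ha] at h3
        exact congrArg Prod.snd h3
      obtain ⟨h5, h6⟩ := hΨ.eq_zero_of_mfderiv (mdifferentiableAt_fst.comp _ hkd)
        (mdifferentiableAt_snd.comp _ (hwd.comp _ hkd)) ((congrArg Prod.fst (hkγ θ)).symm ▸ ht0 : 0 < (k (γ θ)).1) (((he.mfderiv_eq).app v).symm.trans ((basePart_mfderiv hf.smooth.mdiffAt v).symm.trans h2))
      have hu : u = (0, (0, u.2.2)) := Prod.ext ((((mfderiv_comp (γ θ) mdifferentiableAt_fst hkd).app v).trans (mfderiv_fst.app u)).symm.trans h5)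
        (Prod.ext (hc.symm.trans (dtheta_eq_zero _ h1)) rfl)
      have h7 := (mfderiv_slice_snd hwd u.2.2).symm.trans ((congrArg _ hu).symm.trans (((mfderiv_comp (γ θ) (mdifferentiableAt_snd.comp _ hwd) hkd).app v).symm.trans h6))
      rw [hkγ] at h7
      have hu0 : u = 0 := by rw [hu, himm (b θ) (h7.trans (map_zero _).symm)]; rfl
      have hαd : MDiffAt α (k (γ θ)) := by
        rw [hkγ]
        exact (hα.diffeo.1.contMDiffAt ((isOpen_halfCylinder R).mem_nhds (mem_halfCylinder ht _))).mdiffAt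
      have h9 : (mfderiv% (fun a => α (k a)) (γ θ) v : E1 × E') = v := by
        have h10 : (fun a => α (k a)) =ᶠ[𝓝 (γ θ)] id := by filter_upwards [hmem θ] with a ha using hk3 a ha
        exact ((h10.mfderiv_eq).trans mfderiv_id).app v
      exact h9.symm.trans (((mfderiv_comp (γ θ) hαd hkd).app v).trans ((congrArg (mfderiv% α (k (γ θ))) hu0).trans (map_zero _))))
  have hθ' : (b θ).1 = 1 := by simpa only [hkγ] using hθ
  refine ⟨(b θ).2, ?_, fun z hz => ?_⟩
  · have e : (1, (b θ).2) = b θ := Prod.ext hθ'.symm rfl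
    simp only [e, hbw]
  · have h1 : α (t, (1, z)) = γ (w (t, (1, z))).1 := by
      refine hf.embedding.injective ?_
      rw [hγ, hαw (t, (1, z)) ht, ← hz]
      rfl
    have h2 := hk1 (t, (1, z)) (mem_halfCylinder ht _)
    rw [h1, hkγ] at h2
    have h3 := hθu (w (t, (1, z))).1 (by simp only [hkγ]; exact congrArg (fun q => q.2.1) h2)
    rw [h3] at h2
    exact congrArg (fun q => q.2.2) h2.symm

theorem exists_slice_end [T2Space M] [CompactSpace Z] {g : SmoothMetric (𝓡 7) M} {h : SmoothMetric J N} {j : Z → N}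
    (hM : IsACylManifold g h Ψ) (hf : IsSmoothEmb 𝓒(𝓡 7) 𝓒(I') f)
    (hf' : IsSmoothEmb (𝓡 7) I' (fun x => (f (1, x)).2))
    (hr : range f = univ ×ˢ range (fun x => (f (1, x)).2))
    (hα : IsEnd 𝓒(I') 𝓒(IZ) R α) (hR : 0 ≤ R)
    (hws : ContMDiffOn (𝓘(ℝ).prod 𝓒(IZ)) 𝓒(J) ∞ w (Ioi R ×ˢ univ))
    (hαw : ∀ q, R < q.1 → f (α q) = prodEnd Ψ (q.1, w q))
    (hw : ExpConverges 𝓒(J) 𝓒(IZ) w (Prod.map id j)) (hj : IsSmoothEmb J IZ j)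
    (hd : Module.finrank ℝ (ℝ × EZ) = Module.finrank ℝ E') :
    ∃ (T : ℝ) (β : ℝ × Z → X), R ≤ T ∧ IsEnd I' IZ T β ∧ ∀ q, T < q.1 → (f (1, β q)).2 = Ψ (q.1, (w (q.1, (1, q.2))).2) := by
  obtain ⟨K', -, hΨ⟩ := hM.diffeo
  have hrot : ∀ θ m, (θ, m) ∈ range f → ∀ θ', (θ', m) ∈ range f := fun θ m hm θ' => by
    rw [hr] at hm ⊢
    exact ⟨trivial, hm.2⟩
  obtain ⟨T0, hT0, -, hdisj⟩ := hM.exists_disjoint_end ((hα.compact R le_rfl).image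
    (continuous_snd.comp hf.embedding.continuous))
  obtain ⟨T1, hT1⟩ := ((hw.eventually_norm_fst_sub_lt hj.smooth hws).and
    (hw.eventually_slice_immersion hj hws)).exists_forall_of_atTop
  set T := max (max R T0) T1 with hT
  have hRT : R ≤ T := (le_max_left _ _).trans (le_max_left _ _)
  have huniq : ∀ t n, T < t → (∃ θ, (θ, Ψ (t, n)) ∈ range f) → ∃! z, (w (t, (1, z))).2 = n := by
    rintro t n ht ⟨θ, hm⟩
    obtain ⟨h1, h2⟩ := hT1 t ((le_max_right _ _).trans ht.le)
    refine existsUnique_slice_end hΨ hf hrot hα hR hws hαw (hRT.trans_lt ht) h1 h2 (fun a ha => ?_) hm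
    by_contra hna
    exact disjoint_left.1 (hdisj T0 le_rfl) (mem_image_of_mem _ hna) ⟨(t, n), ⟨((le_max_right _ _).trans (le_max_left _ _)).trans ht.le, trivial⟩, ha.symm⟩
  have hmem : ∀ q : ℝ × Z, T < q.1 → ((w _).1, Ψ _) ∈ range f := fun q hq => ⟨_, hαw (q.1, (1, q.2)) (hRT.trans_lt hq)⟩
  have hex : ∀ q : ℝ × Z, ∃ x, T < q.1 → (f (1, x)).2 = Ψ _ := fun q => by
    by_cases hq : T < q.1
    · have h1 := hmem q hq
      rw [hr] at h1
      obtain ⟨x, hx⟩ := h1.2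
      exact ⟨x, fun _ => hx⟩
    · exact ⟨(α (q.1, (1, q.2))).2, fun h => absurd h hq⟩
  choose β hβ using hex
  have hO := isOpen_halfCylinder (Z := Z) T
  have hw's : ContMDiffOn _ J ∞ (fun q => (w (q.1, (1, q.2))).2) (Ioi T ×ˢ univ) :=
    contMDiff_snd.comp_contMDiffOn (hws.comp (contMDiff_fst.prodMk
      (contMDiff_const.prodMk contMDiff_snd)).contMDiffOn fun q hq => mem_halfCylinder (hRT.trans_lt hq.1) _)
  have hGs := hΨ.1.comp (contMDiffOn_fst.prodMk hw's) fun q hq => mem_halfCylinder (hR.trans_lt (hRT.trans_lt hq.1)) _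
  have hβs : ContMDiffOn _ I' ∞ β (Ioi T ×ˢ univ) := fun q hq => by
    obtain ⟨k, hk1, hk2, hk3, -⟩ := exists_left_inverse (hf'.smooth (β q)) (hf'.immersion (β q))
    rw [hβ q hq.1] at hk1
    refine ((ContMDiffAt.comp q hk1 (hGs.contMDiffAt (hO.mem_nhds hq))).congr_of_eventuallyEq ?_).contMDiffWithinAt
    filter_upwards [((hf'.embedding.isInducing.continuousOn_iff.2 (hGs.continuousOn.congr fun q hq => hβ q hq.1)).continuousAt (hO.mem_nhds hq)).eventually hk3, hO.mem_nhds hq] with q' h2 h3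
    exact h2.symm.trans (congrArg k (hβ q' h3.1))
  have himg : ∀ T', T ≤ T' → β '' (Ioi T' ×ˢ univ) = (fun x => (f (1, x)).2) ⁻¹' (Ψ '' (Ioi T' ×ˢ univ)) := by
    intro T' hT'
    ext x
    constructor
    · rintro ⟨q, hq, rfl⟩
      exact ⟨_, mem_halfCylinder hq.1 _, (hβ q (hT'.trans_lt hq.1)).symm⟩
    · rintro ⟨⟨t, n⟩, ⟨ht, -⟩, hx⟩
      have ht' : T' < t := ht
      obtain ⟨z, hz, -⟩ := huniq t n (hT'.trans_lt ht') ⟨(f (1, x)).1, (1, x), Prod.ext rfl hx.symm⟩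
      exact ⟨(t, z), mem_halfCylinder ht' z, hf'.embedding.injective ((hβ (t, z) (hT'.trans_lt ht')).trans ((congrArg (fun n => Ψ (t, n)) hz).trans hx))⟩
  refine ⟨T, β, hRT, ⟨⟨hβs, ⟨mapsTo_image _ _, fun q hq q' hq' e => ?_, surjOn_image _ _⟩, fun q hq => ?_⟩,
    fun T' hT' => ?_⟩, hβ⟩
  · have h2 := hΨ.2.1.injOn (mem_halfCylinder (hR.trans_lt (hRT.trans_lt hq.1)) _)
      (mem_halfCylinder (hR.trans_lt (hRT.trans_lt hq'.1)) _) ((hβ q hq.1).symm.trans ((congrArg (fun x => (f (1, x)).2) e).trans (hβ q' hq'.1)))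
    have h3 := (Prod.ext_iff.1 h2).1
    have h4 := (Prod.ext_iff.1 h2).2
    rw [← h3] at h4
    exact Prod.ext h3 ((huniq q.1 _ hq.1 ⟨_, hmem q hq.1⟩).unique rfl h4.symm)
  · let A : ℝ × EZ →L[ℝ] E' := mfderiv% β q
    have hA : Function.Injective A := by
      refine (injective_iff_map_eq_zero A).2 fun v hv => ?_
      have hq1 : T < q.1 := hq.1
      have hw'd := (hw's.contMDiffAt (hO.mem_nhds hq)).mdiffAt
      have he : (fun x => (f (1, x)).2) ∘ β =ᶠ[𝓝 q] fun q => Ψ (q.1, (w (q.1, (1, q.2))).2) := by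
        filter_upwards [hO.mem_nhds hq] with q' h1 using hβ q' h1.1
      have h2 := ((he.mfderiv_eq.symm.trans (mfderiv_comp q hf'.smooth.mdiffAt ((hβs.contMDiffAt (hO.mem_nhds hq)).mdiffAt))).app v).trans ((congrArg (mfderiv I' (𝓡 7) _ (β q)) hv).trans (map_zero _))
      obtain ⟨h3, h4⟩ := hΨ.eq_zero_of_mfderiv mdifferentiableAt_fst hw'd (hR.trans_lt (hRT.trans_lt hq1)) h2
      have hv' : v = (0, v.2) := Prod.ext ((mfderiv_fst.app v).symm.trans h3) rfl
      have h6 : (mfderiv IZ (𝓘(ℝ).prod IZ) (fun z => (q.1, z)) q.2 v.2 : ℝ × EZ) = (0, v.2) :=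
        ((mfderiv_prodMk mdifferentiableAt_const mdifferentiableAt_id).app v.2).trans (Prod.ext (mfderiv_const.app v.2)
            (mfderiv_id.app v.2))
      have h8 := ((mfderiv_comp q.2 hw'd (mdifferentiableAt_const.prodMk mdifferentiableAt_id)).app v.2).trans
          ((congrArg _ (h6.trans hv'.symm)).trans h4)
      have h9 : v.2 = 0 := (hT1 q.1 ((le_max_right _ _).trans hq1.le)).2 (1, q.2) (h8.trans (map_zero _).symm)
      rw [hv', h9, Prod.mk_zero_zero]
    exact ⟨hA, (LinearMap.injective_iff_surjective_of_finrank_eq_finrank hd).1 hA⟩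
  · rw [himg T' hT']
    have hop := hΨ.isOpen_image (isOpen_halfCylinder 0)
      (isOpen_Ioi.prod isOpen_univ) fun q hq => mem_halfCylinder (hR.trans_lt (hRT.trans_lt (hT'.trans_lt hq.1))) _
    refine ((hα.compact T' (hRT.trans hT')).image continuous_snd).of_isClosed_subset
      (hop.preimage hf'.embedding.continuous).isClosed_compl fun x hx => ⟨(1, x), fun hx' => hx ?_, rfl⟩
    obtain ⟨q, hq, e⟩ := hx'
    have hq1 : T' < q.1 := hq.1
    have h1 := hαw q (hRT.trans_lt (hT'.trans_lt hq1))
    rw [e] at h1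
    exact ⟨(q.1, (w q).2), mem_halfCylinder hq1 _, (congrArg Prod.snd h1).symm⟩

end

section

variable {M : Type*} [TopologicalSpace M] [T2Space M] [ChartedSpace (𝔼 7) M]
  [IsManifold (𝓡 7) ∞ M] {S : TorsionFreeG2 M} {N : Type*} [TopologicalSpace N] [CompactSpace N]
  [ChartedSpace (𝔼 6) N] [IsManifold (𝓡 6) ∞ N] {h : SmoothMetric (𝓡 6) N} {X : Type*}
  [TopologicalSpace X] [ChartedSpace (𝔼 3) X] [IsManifold (𝓡 3) ∞ X] {Z : Type*}
  [TopologicalSpace Z] [CompactSpace Z] [ChartedSpace (𝔼 2) Z] [IsManifold (𝓡 2) ∞ Z]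
  {Ψ : ℝ × N → M} {j : Z → N} {ι : X → M} {ε : ℝ} {f : Circle × X → Circle × M}

theorem TorsionFreeG2.IsCayley.isLocalDeformation_slice (hM : IsACylManifold S.g h Ψ)
    (hι : IsACylSubmanifold (𝓡 3) (𝓡 2) (𝓡 6) S.g.field Ψ j ι) (hε : 0 ≤ ε) (hε1 : ε < 1)
    (hf : IsLocalDeformation 𝓒(𝓡 3) 𝓒(𝓡 2) 𝓒(𝓡 6) S.prodMetric (prodEnd Ψ) (Prod.map id j) (Prod.map id ι) ε f)
    (hcf : S.IsCayley 𝓒(𝓡 3) f) :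
    IsLocalDeformation (𝓡 3) (𝓡 2) (𝓡 6) S.g.field Ψ j ι ε (fun x => (f (1, x)).2) ∧
      S.IsAssociative (𝓡 3) (fun x => (f (1, x)).2) ∧ range f = univ ×ˢ range (fun x => (f (1, x)).2) := by
  have he := hf.acyl.embedding
  have hs := contMDiff_snd.comp (he.smooth.comp (contMDiff_sliceMk 1))
  obtain ⟨R, α, w, hR, hα, hws, hαw, hw⟩ := hf.acyl.exists_end
  have hcl := hM.isClosed_range hα he.embedding.continuous continuous_snd fun q hq => congrArg Prod.snd (hαw q hq)
  have hker : ∀ a v, baseDiff (𝓡 3) f a ((0, v) : E13) = 0 → v = 0 := fun a v => hf.basePart_injective hι.embedding hε hε1 a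
  have hW := fun a => TorsionFreeG2.IsCayley.exists_circleDiff_eq_one he hcf a
    (TorsionFreeG2.IsCayley.psiP_eq_zero hM hι hε hf hcf a)
  have hrot : ∀ θ m, (θ, m) ∈ range f → ∀ θ', (θ', m) ∈ range f := fun θ m => rotation_mem_range he.smooth hcl hker hW
  have hclose : ∀ a, ‖((f a).1 : ℂ) - a.1‖ < 2 := fun a => (hf.norm_fst_sub_le hε a).trans_lt (by linarith)
  have hce := slice_isClosedEmbedding he hclose hker hrot hcl
  have hr := range_eq_univ_prod he hclose hker hrot
  have he' : IsSmoothEmb (𝓡 7) (𝓡 3) (fun x => (f (1, x)).2) := ⟨hs, fun x => (injective_iff_map_eq_zero _).2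
      fun v hv => hker (1, x) v ((mfderiv_slice he.smooth 1 x v).symm.trans hv), hce.isEmbedding⟩
  have hfr : Module.finrank ℝ (ℝ × 𝔼 2) = Module.finrank ℝ (𝔼 3) := by simp
  obtain ⟨T, β, hRT, hβ, hβw⟩ := exists_slice_end hM he he' hr hα hR hws hαw hw hι.cross_section hfr
  refine ⟨⟨⟨he', hι.cross_section, hM.complete.of_isClosedEmbedding hs hce, T, β,
    fun q => (w _).2, hR.trans hRT, hβ.diffeo, hβ.compact, ?_, fun t y ht => hβw (t, y) ht,
    hw.slice hι.cross_section.smooth hws 1⟩, ?_⟩,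
    TorsionFreeG2.IsCayley.isAssociative_slice he.smooth hcf hW, hr⟩
  · exact contMDiff_snd.comp_contMDiffOn (hws.comp (contMDiff_fst.prodMk
      (contMDiff_const.prodMk contMDiff_snd)).contMDiffOn fun q hq => mem_halfCylinder (hRT.trans_lt hq.1) _)
  · obtain ⟨-, F, hF, h0, h1, hV, lam, A, hlam, hA, hV'⟩ := hf
    refine ⟨fun τ x => (F τ (1, x)).2, contMDiff_snd.comp (hF.comp (contMDiff_fst.prodMk
      (contMDiff_const.prodMk contMDiff_snd))), funext fun x => congrArg Prod.snd (congrFun h0 (1, x)),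
      funext fun x => congrArg Prod.snd (congrFun h1 (1, x)),
      fun τ hτ x => (hV τ hτ (1, x)).slice hι.embedding.smooth hF hε, lam, A, hlam, hA,
      fun τ hτ x t y ht hx => (hV' τ hτ (1, x) t (1, y) ht (Prod.ext rfl hx)).slice hι.embedding.smooth hF (by positivity)⟩

theorem associative_deformations (hM : IsACylManifold S.g h Ψ)
    (hι : IsACylSubmanifold (𝓡 3) (𝓡 2) (𝓡 6) S.g.field Ψ j ι) (hε : 0 ≤ ε) (hε1 : ε < 1) :
    (∀ f : Circle × X → Circle × M, IsLocalDeformation 𝓒(𝓡 3) 𝓒(𝓡 2) 𝓒(𝓡 6)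
        S.prodMetric (prodEnd Ψ) (Prod.map id j) (Prod.map id ι) ε f → S.IsCayley 𝓒(𝓡 3) f →
      ∃ f' : X → M, IsACylSubmanifold (𝓡 3) (𝓡 2) (𝓡 6) S.g.field Ψ j f' ∧
        S.IsAssociative (𝓡 3) f' ∧ range f = (univ : Set Circle) ×ˢ range f') ∧
    moduliSpace 𝓒(𝓡 3) 𝓒(𝓡 2) 𝓒(𝓡 6) S.prodMetric (prodEnd Ψ) (Prod.map id j) (Prod.map id ι) ε (S.IsCayley 𝓒(𝓡 3)) =
      (fun Y => (univ : Set Circle) ×ˢ Y) '' moduliSpace (𝓡 3) (𝓡 2) (𝓡 6) S.g.field Ψ j ι ε (S.IsAssociative (𝓡 3)) := by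
  refine ⟨fun f hf hcf => ?_, ext fun Y => ⟨?_, ?_⟩⟩
  · obtain ⟨h1, h2, h3⟩ := TorsionFreeG2.IsCayley.isLocalDeformation_slice hM hι hε hε1 hf hcf
    exact ⟨_, h1.acyl, h2, h3⟩
  · rintro ⟨f, hf, hcf, rfl⟩
    obtain ⟨h1, h2, h3⟩ := TorsionFreeG2.IsCayley.isLocalDeformation_slice hM hι hε hε1 hf hcf
    exact ⟨_, ⟨_, h1, h2, rfl⟩, h3.symm⟩
  · rintro ⟨_, ⟨f', h1, h2, rfl⟩, rfl⟩
    exact ⟨_, h1.prodMap hε, h2.isCayley_prodMap h1.acyl.embedding.smooth, by rw [range_prodMap, range_id]⟩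

end

end Manifolds

end

end ACyl

theorem mainTheorem12 :
    -- deformations of special Lagrangian submanifolds and of complex surfaces in an
    -- asymptotically cylindrical Calabi–Yau 4-fold
    (∀ (M : Type*) [TopologicalSpace M] [T2Space M] [ChartedSpace (EuclideanSpace ℝ (Fin 8)) M]
        [IsManifold (𝓡 8) ∞ M]
        (N : Type*) [TopologicalSpace N] [T2Space N] [CompactSpace N]
        [ChartedSpace (EuclideanSpace ℝ (Fin 7)) N] [IsManifold (𝓡 7) ∞ N]
        (S : CalabiYau4 M) (h : SmoothMetric (𝓡 7) N) (Ψ : ℝ × N → M),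
        S.IsACyl h Ψ →
      ∀ (X : Type*) [TopologicalSpace X] [ChartedSpace (EuclideanSpace ℝ (Fin 4)) X]
        [IsManifold (𝓡 4) ∞ X]
        (Z : Type*) [TopologicalSpace Z] [CompactSpace Z]
        [ChartedSpace (EuclideanSpace ℝ (Fin 3)) Z] [IsManifold (𝓡 3) ∞ Z]
        (j : Z → N) (ι : X → M),
        IsACylSubmanifold (𝓡 4) (𝓡 3) (𝓡 7) S.g.field Ψ j ι →
        (S.IsSpecialLagrangian (𝓡 4) ι →
          ∃ ε₀ : ℝ, 0 < ε₀ ∧ ∀ ε : ℝ, 0 < ε → ε ≤ ε₀ →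
            (∀ f : X → M, IsLocalDeformation (𝓡 4) (𝓡 3) (𝓡 7) S.g.field Ψ j ι ε f →
              S.IsCayley (𝓡 4) f → S.IsSpecialLagrangian (𝓡 4) f) ∧
            moduliSpace (𝓡 4) (𝓡 3) (𝓡 7) S.g.field Ψ j ι ε (S.IsCayley (𝓡 4)) =
              moduliSpace (𝓡 4) (𝓡 3) (𝓡 7) S.g.field Ψ j ι ε
                (S.IsSpecialLagrangian (𝓡 4))) ∧
        (S.IsComplex (𝓡 4) ι →
          ∃ ε₀ : ℝ, 0 < ε₀ ∧ ∀ ε : ℝ, 0 < ε → ε ≤ ε₀ →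
            (∀ f : X → M, IsLocalDeformation (𝓡 4) (𝓡 3) (𝓡 7) S.g.field Ψ j ι ε f →
              S.IsCayley (𝓡 4) f → S.IsComplex (𝓡 4) f) ∧
            moduliSpace (𝓡 4) (𝓡 3) (𝓡 7) S.g.field Ψ j ι ε (S.IsCayley (𝓡 4)) =
              moduliSpace (𝓡 4) (𝓡 3) (𝓡 7) S.g.field Ψ j ι ε (S.IsComplex (𝓡 4)))) ∧
    -- deformations of `{1} × X` for a coassociative submanifold `X`, and of `S^1 × X` for an
    -- associative submanifold `X`, of an asymptotically cylindrical `G₂`-manifold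
    (∀ (M : Type*) [TopologicalSpace M] [T2Space M] [ChartedSpace (EuclideanSpace ℝ (Fin 7)) M]
        [IsManifold (𝓡 7) ∞ M]
        (N : Type*) [TopologicalSpace N] [T2Space N] [CompactSpace N]
        [ChartedSpace (EuclideanSpace ℝ (Fin 6)) N] [IsManifold (𝓡 6) ∞ N]
        (S : TorsionFreeG2 M) (h : SmoothMetric (𝓡 6) N) (Ψ : ℝ × N → M),
        S.IsACyl h Ψ →
      (∀ (X : Type*) [TopologicalSpace X] [ChartedSpace (EuclideanSpace ℝ (Fin 4)) X]
          [IsManifold (𝓡 4) ∞ X]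
          (Z : Type*) [TopologicalSpace Z] [CompactSpace Z]
          [ChartedSpace (EuclideanSpace ℝ (Fin 3)) Z] [IsManifold (𝓡 3) ∞ Z]
          (j : Z → N) (ι : X → M),
          IsACylSubmanifold (𝓡 4) (𝓡 3) (𝓡 6) S.g.field Ψ j ι →
          S.IsCoassociative (𝓡 4) ι →
          -- `X` has no closed connected component
          (∀ x : X, ¬ IsCompact (connectedComponent x)) →
          ∃ ε₀ : ℝ, 0 < ε₀ ∧ ∀ ε : ℝ, 0 < ε → ε ≤ ε₀ →
            (∀ f : X → Circle × M,
              IsLocalDeformation (𝓡 4) (𝓡 3) ((𝓡 1).prod (𝓡 6)) S.prodMetric (prodEnd Ψ)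
                (fun y => ((1 : Circle), j y)) (fun x => ((1 : Circle), ι x)) ε f →
              S.IsCayley (𝓡 4) f →
              ∃ f' : X → M, IsACylSubmanifold (𝓡 4) (𝓡 3) (𝓡 6) S.g.field Ψ j f' ∧
                S.IsCoassociative (𝓡 4) f' ∧ range f = {(1 : Circle)} ×ˢ range f') ∧
            moduliSpace (𝓡 4) (𝓡 3) ((𝓡 1).prod (𝓡 6)) S.prodMetric (prodEnd Ψ)
                (fun y => ((1 : Circle), j y)) (fun x => ((1 : Circle), ι x)) ε
                (S.IsCayley (𝓡 4)) =
              (fun Y : Set M => {(1 : Circle)} ×ˢ Y) ''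
                moduliSpace (𝓡 4) (𝓡 3) (𝓡 6) S.g.field Ψ j ι ε
                  (S.IsCoassociative (𝓡 4))) ∧
      (∀ (X : Type*) [TopologicalSpace X] [ChartedSpace (EuclideanSpace ℝ (Fin 3)) X]
          [IsManifold (𝓡 3) ∞ X]
          (Z : Type*) [TopologicalSpace Z] [CompactSpace Z]
          [ChartedSpace (EuclideanSpace ℝ (Fin 2)) Z] [IsManifold (𝓡 2) ∞ Z]
          (j : Z → N) (ι : X → M),
          IsACylSubmanifold (𝓡 3) (𝓡 2) (𝓡 6) S.g.field Ψ j ι →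
          S.IsAssociative (𝓡 3) ι →
          ∃ ε₀ : ℝ, 0 < ε₀ ∧ ∀ ε : ℝ, 0 < ε → ε ≤ ε₀ →
            (∀ f : Circle × X → Circle × M,
              IsLocalDeformation ((𝓡 1).prod (𝓡 3)) ((𝓡 1).prod (𝓡 2)) ((𝓡 1).prod (𝓡 6))
                S.prodMetric (prodEnd Ψ) (Prod.map id j) (Prod.map id ι) ε f →
              S.IsCayley ((𝓡 1).prod (𝓡 3)) f →
              ∃ f' : X → M, IsACylSubmanifold (𝓡 3) (𝓡 2) (𝓡 6) S.g.field Ψ j f' ∧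
                S.IsAssociative (𝓡 3) f' ∧ range f = (univ : Set Circle) ×ˢ range f') ∧
            moduliSpace ((𝓡 1).prod (𝓡 3)) ((𝓡 1).prod (𝓡 2)) ((𝓡 1).prod (𝓡 6))
                S.prodMetric (prodEnd Ψ) (Prod.map id j) (Prod.map id ι) ε
                (S.IsCayley ((𝓡 1).prod (𝓡 3))) =
              (fun Y : Set M => (univ : Set Circle) ×ˢ Y) ''
                moduliSpace (𝓡 3) (𝓡 2) (𝓡 6) S.g.field Ψ j ι ε
                  (S.IsAssociative (𝓡 3)))) := by
  refine ⟨fun M _ _ _ _ N _ _ _ _ _ S h Ψ hM X _ _ _ Z _ _ _ _ j ι hι => ⟨fun hs => ⟨1, one_pos, fun ε hε _ => ?_⟩,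
    fun hs => ⟨1, one_pos, fun ε hε _ => ?_⟩⟩, fun M _ _ _ _ N _ _ _ _ _ S h Ψ hM =>
    ⟨fun X _ _ _ Z _ _ _ _ j ι hι _ hX => ⟨1, one_pos, fun ε hε _ => ?_⟩,
    fun X _ _ _ Z _ _ _ _ j ι hι _ => ⟨1 / 2, by norm_num, fun ε hε hε1 => ?_⟩⟩⟩
  · have key := fun f => CalabiYau4.isCayley_iff_isSpecialLagrangian (f := f) hM.manifold hι hε.le hs
    exact ⟨fun f hf => (key f hf).1, moduliSpace_congr key⟩
  · have key := fun f => CalabiYau4.isCayley_iff_isComplex (f := f) hM.manifold hι hε.le hs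
    exact ⟨fun f hf => (key f hf).1, moduliSpace_congr key⟩
  · exact coassociative_deformations hM.manifold hι hε.le hX
  · exact associative_deformations hM.manifold hι hε.le (by linarith)
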